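/- **Setting.** Let $\Theta\in(0,2\pi)$, $\mu_0,\rho_0>0$ and $\omega\in\mathbb C\setminus\mathbb R$. Let $(r,\theta)$, $\theta\in[0,2\pi)$, be polar coordinates in $\mathbb R^2\cong\mathbb C$, and let $$\Omega=\{re^{i\theta}: r>0,\ 0<\theta<\Theta\},\quad \Gamma=(0,\infty)\times\{0\},\quad \Sigma_\Omega=\{re^{i\Theta}: r>0\}.$$ Put $\alpha=e^{-i\Theta}$ and, for $z=re^{i\theta}$, $(\alpha z)^q:=r^qe^{iq(\theta-\Theta)}$, $\overline{\alpha z}^{\,k}:=r^ke^{-ik(\theta-\Theta)}$, $\log(\alpha z):=\ln r+i(\theta-\Theta)$. All function spaces are complex. * For $d\in\mathbb R$, $\mathcal A_d(\Omega)$ is the complex span of the functions $\operatorname{Im}[(\alpha z)^q\,\overline{\alpha z}^{\,k}P(\log(\alpha z))]$ with $q\in\mathbb R$, $k\in\mathbb N$, $q+k=d$, $P\in\mathbb R[T]$, and $\mathcal A_d(\Gamma)=\{x\mapsto x^dQ(\ln x): Q\in\mathbb C[T]\}$. Let $\mathcal A(D)=\sum_{d\in\mathbb R}\mathcal A_d(D)$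 (finite sums) for $D\in\{\Omega,\Gamma\}$. * Let $\chi_0$ be a radial $C^\infty$ function on $\mathbb R^2$ that is equal to $1$ near $0$ and to $0$ near infinity. * $H^{1/2}_{00}(\Gamma)$ is the set of functions of $H^{1/2}(\Gamma)$ whose extension by $0$ to $\partial\Omega$ is in $H^{1/2}(\partial\Omega)$. * For $d\in-\frac\pi\Theta\mathbb N^*$, $\sigma_d:\mathcal A(\Omega)\to\mathbb C$ is the linear form such that, for all $(q,k,P)$ as above with $q\notin\mathbb N$ or $q>k$ or $P(0)=0$, its value on $\operatorname{Im}[(\alpha z)^q\,\overline{\alpha z}^{\,k}P(\log(\alpha z))]$ is $P(0)$ if $q=d$ and $k=0$, and $0$ otherwise. For $u\in H^1(\Omega)+\chi_0\mathcal A(\Omega)$, put $\sigma_d(u):=\sigma_d(\psi)$ for any $\psi\in\mathcal A(\Omega)$ such that $u-\chi_0\psi\in H^1(\Omega)$ (the choice of $\psi$ does not matter). **Theorem.** Let $f\in(H^1(\Omega))'$, let $g\in H^{1/2}_{00}(\Gamma)+\chi_0\mathcal A(\Gamma)$, and let $(s_d)_{d\in-\frac\pi\Theta\mathbb N^*}$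 be complex numbers, all but finitely many of them zero. Then there is exactly one $u\in H^1(\Omega)+\chi_0\mathcal A(\Omega)$ such that $$\begin{cases}\mu_0\Delta u+\omega^2\rho_0u=f&\text{in }\Omega,\\ u=g&\text{on }\Gamma,\\ u=0&\text{on }\Sigma_\Omega,\\ \sigma_d(u)=s_d&\text{for all }d\in-\frac\pi\Theta\mathbb N^*.\end{cases}$$ The equation holds in the sense of distributions in $\Omega$. The boundary values of $u=w+\chi_0\psi$, with $w\in H^1(\Omega)$ and $\psi\in\mathcal A(\Omega)$, are the trace of $w$ plus the pointwise restriction of $\chi_0\psi$. -/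

import Mathlib

open MeasureTheory Set Filter Topology Polynomial
open scoped ENNReal

noncomputable section

namespace FarField

/-! ### The sector -/

/-- The sector `Ω = {r e^{iθ} | r > 0, 0 < θ < Θ}`; the plane `ℝ²` is identified with `ℂ`. -/
def sector (Θ : ℝ) : Set ℂ :=
  {z | ∃ r θ : ℝ, 0 < r ∧ 0 < θ ∧ θ < Θ ∧ z = r * Complex.exp (θ * Complex.I)}

/-- Lebesgue measure on the sector. -/
abbrev sectorMeasure (Θ : ℝ) : Measure ℂ := volume.restrict (sector Θ)

/-- The point at distance `r` from the vertex on the half-line of direction `θ`. The direction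
`θ = 0` gives `Γ` and the direction `θ = Θ` gives `Σ`. -/
def rayPoint (θ r : ℝ) : ℂ := r * Complex.exp (θ * Complex.I)

/-- The half-line `(0, ∞)` with Lebesgue measure: the arc length measure of `Γ` and of `Σ`. -/
abbrev rayMeasure : Measure ℝ := volume.restrict (Ioi 0)

/-- The polar angle of `z`, in `[0, 2π)`. -/
def polarAngle (z : ℂ) : ℝ := if 0 ≤ z.arg then z.arg else z.arg + 2 * Real.pi

/-! ### Test functions and the Sobolev space `H¹(Ω)` -/

/-- `C_c^∞(ℝ²; ℂ)`. -/
def IsSmoothCompact (v : ℂ → ℂ) : Prop := ContDiff ℝ (⊤ : ℕ∞) v ∧ HasCompactSupport v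

/-- `𝒟(Ω)`: smooth functions with compact support contained in the sector. -/
def IsTest (Θ : ℝ) (v : ℂ → ℂ) : Prop := IsSmoothCompact v ∧ tsupport v ⊆ sector Θ

/-- The derivative of `v` in the direction `e` (`e = 1` for `∂ₓ`, `e = I` for `∂_y`). -/
def dirDeriv (e : ℂ) (v : ℂ → ℂ) (z : ℂ) : ℂ := fderiv ℝ v z e

/-- `w` is the weak derivative of `u` in the direction `e` on the sector. -/
def IsWeakDeriv (Θ : ℝ) (e : ℂ) (u w : ℂ → ℂ) : Prop :=
  ∀ v : ℂ → ℂ, IsTest Θ v →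
    ∫ z, u z * dirDeriv e v z ∂(sectorMeasure Θ) = -∫ z, w z * v z ∂(sectorMeasure Θ)

lemma IsSmoothCompact.continuous {v : ℂ → ℂ} (hv : IsSmoothCompact v) : Continuous v :=
  hv.1.continuous

lemma IsSmoothCompact.dirDeriv_continuous {v : ℂ → ℂ} (hv : IsSmoothCompact v) (e : ℂ) :
    Continuous (dirDeriv e v) :=
  (hv.1.continuous_fderiv (by simp)).clm_apply continuous_const

lemma IsSmoothCompact.dirDeriv_compact {v : ℂ → ℂ} (hv : IsSmoothCompact v) (e : ℂ) :
    HasCompactSupport (dirDeriv e v) :=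
  hv.2.fderiv_apply ℝ e

lemma IsSmoothCompact.memLp {v : ℂ → ℂ} (hv : IsSmoothCompact v) (Θ : ℝ) (p : ℝ≥0∞) :
    MemLp v p (sectorMeasure Θ) :=
  (hv.continuous.memLp_of_hasCompactSupport hv.2).restrict _

lemma IsSmoothCompact.memLp_dirDeriv {v : ℂ → ℂ} (hv : IsSmoothCompact v) (Θ : ℝ) (p : ℝ≥0∞)
    (e : ℂ) : MemLp (dirDeriv e v) p (sectorMeasure Θ) :=
  ((hv.dirDeriv_continuous e).memLp_of_hasCompactSupport (hv.dirDeriv_compact e)).restrict _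

lemma IsWeakDeriv.congr {Θ : ℝ} {e : ℂ} {u w u' w' : ℂ → ℂ} (h : IsWeakDeriv Θ e u w)
    (hu : u' =ᵐ[sectorMeasure Θ] u) (hw : w' =ᵐ[sectorMeasure Θ] w) :
    IsWeakDeriv Θ e u' w' := by
  intro v hv
  rw [integral_congr_ae (g := fun z => u z * dirDeriv e v z)
      (by filter_upwards [hu] with z hz; rw [hz]),
    integral_congr_ae (f := fun z => w' z * v z) (g := fun z => w z * v z)
      (by filter_upwards [hw] with z hz; rw [hz])]
  exact h v hv

lemma IsWeakDeriv.add {Θ : ℝ} {e : ℂ} {u w u' w' : ℂ → ℂ} (h : IsWeakDeriv Θ e u w)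
    (h' : IsWeakDeriv Θ e u' w') (hu : MemLp u 2 (sectorMeasure Θ))
    (hw : MemLp w 2 (sectorMeasure Θ)) (hu' : MemLp u' 2 (sectorMeasure Θ))
    (hw' : MemLp w' 2 (sectorMeasure Θ)) :
    IsWeakDeriv Θ e (u + u') (w + w') := by
  intro v hv
  have hd := hv.1.memLp_dirDeriv Θ 2 e
  have hv2 := hv.1.memLp Θ 2
  simp only [Pi.add_apply, add_mul]
  have i1 : Integrable (fun z => u z * dirDeriv e v z) (sectorMeasure Θ) := hu.integrable_mul hd
  have i2 : Integrable (fun z => u' z * dirDeriv e v z) (sectorMeasure Θ) := hu'.integrable_mul hd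
  have i3 : Integrable (fun z => w z * v z) (sectorMeasure Θ) := hw.integrable_mul hv2
  have i4 : Integrable (fun z => w' z * v z) (sectorMeasure Θ) := hw'.integrable_mul hv2
  rw [integral_add i1 i2, integral_add i3 i4, h v hv, h' v hv]
  ring

lemma IsWeakDeriv.smul {Θ : ℝ} {e : ℂ} {u w : ℂ → ℂ} (a : ℂ) (h : IsWeakDeriv Θ e u w) :
    IsWeakDeriv Θ e (a • u) (a • w) := by
  intro v hv
  simp only [Pi.smul_apply, smul_eq_mul, mul_assoc]
  rw [integral_const_mul, integral_const_mul, h v hv]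
  ring

/-- The Sobolev space `H¹(Ω)`, as the space of triples `(u, ∂ₓu, ∂_y u)` in `L²(Ω)³`. The norm
inherited from `L²(Ω)³` is the usual norm `(‖u‖² + ‖∂ₓu‖² + ‖∂_y u‖²)^{1/2}`. -/
def H1 (Θ : ℝ) : Submodule ℂ (PiLp 2 fun _ : Fin 3 => Lp ℂ 2 (sectorMeasure Θ)) where
  carrier := {w | IsWeakDeriv Θ 1 (w 0) (w 1) ∧ IsWeakDeriv Θ Complex.I (w 0) (w 2)}
  add_mem' := by
    rintro a b ⟨ha1, ha2⟩ ⟨hb1, hb2⟩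
    exact ⟨(ha1.add hb1 (Lp.memLp _) (Lp.memLp _) (Lp.memLp _) (Lp.memLp _)).congr
        (Lp.coeFn_add _ _) (Lp.coeFn_add _ _),
      (ha2.add hb2 (Lp.memLp _) (Lp.memLp _) (Lp.memLp _) (Lp.memLp _)).congr
        (Lp.coeFn_add _ _) (Lp.coeFn_add _ _)⟩
  zero_mem' := by
    have h0 : IsWeakDeriv Θ 1 0 0 := by intro v _; simp
    have h1 : IsWeakDeriv Θ Complex.I 0 0 := by intro v _; simp
    exact ⟨h0.congr (Lp.coeFn_zero ..) (Lp.coeFn_zero ..),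
      h1.congr (Lp.coeFn_zero ..) (Lp.coeFn_zero ..)⟩
  smul_mem' := by
    rintro c a ⟨ha1, ha2⟩
    exact ⟨(ha1.smul c).congr (Lp.coeFn_smul _ _) (Lp.coeFn_smul _ _),
      (ha2.smul c).congr (Lp.coeFn_smul _ _) (Lp.coeFn_smul _ _)⟩

/-- The function underlying an element of `H¹(Ω)`. -/
def fnOf {Θ : ℝ} (w : H1 Θ) : ℂ → ℂ := (w : PiLp 2 fun _ : Fin 3 => Lp ℂ 2 (sectorMeasure Θ)) 0

lemma IsSmoothCompact.isWeakDeriv {v : ℂ → ℂ} (hv : IsSmoothCompact v) (Θ : ℝ) (e : ℂ) :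
    IsWeakDeriv Θ e v (dirDeriv e v) := by
  intro w hw
  have hsub : Function.support w ⊆ sector Θ := (subset_tsupport w).trans hw.2
  have hsub' : Function.support (dirDeriv e w) ⊆ sector Θ :=
    (subset_tsupport _).trans ((tsupport_fderiv_apply_subset ℝ e).trans hw.2)
  rw [setIntegral_eq_integral_of_forall_compl_eq_zero (fun z hz => ?_),
    setIntegral_eq_integral_of_forall_compl_eq_zero (fun z hz => ?_)]
  · have hint : ∀ a b : ℂ → ℂ, Continuous a → Continuous b → HasCompactSupport b →
        Integrable (fun z => a z * b z) := fun a b ha hb hc =>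
      (ha.mul hb).integrable_of_hasCompactSupport hc.mul_left
    exact integral_mul_fderiv_eq_neg_fderiv_mul_of_integrable
      (hint _ _ (hv.dirDeriv_continuous e) hw.1.continuous hw.1.2)
      (hint _ _ hv.continuous (hw.1.dirDeriv_continuous e) (hw.1.dirDeriv_compact e))
      (hint _ _ hv.continuous hw.1.continuous hw.1.2)
      (fun z _ => hv.1.differentiable (by simp) z)
      (fun z _ => hw.1.1.differentiable (by simp) z)
  · have : w z = 0 := by by_contra h; exact hz (hsub h)
    simp [this]
  · have : dirDeriv e w z = 0 := by by_contra h; exact hz (hsub' h)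
    simp [this]

/-- The restriction to `Ω` of a function of `C_c^∞(ℝ²)`, as an element of `H¹(Ω)`. -/
def toH1 (Θ : ℝ) (v : ℂ → ℂ) (hv : IsSmoothCompact v) : H1 Θ :=
  ⟨WithLp.toLp 2 ![(hv.memLp Θ 2).toLp v, (hv.memLp_dirDeriv Θ 2 1).toLp _,
      (hv.memLp_dirDeriv Θ 2 Complex.I).toLp _],
    (hv.isWeakDeriv Θ 1).congr (MemLp.coeFn_toLp (hv.memLp Θ 2))
      (MemLp.coeFn_toLp (hv.memLp_dirDeriv Θ 2 1)),
    (hv.isWeakDeriv Θ Complex.I).congr (MemLp.coeFn_toLp (hv.memLp Θ 2))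
      (MemLp.coeFn_toLp (hv.memLp_dirDeriv Θ 2 Complex.I))⟩

/-- `t ∈ L²` is the trace of `w ∈ H¹(Ω)` on the side of direction `θ` (`θ = 0` or `θ = Θ`): the
pair `(w, t)` is a limit in `H¹(Ω) × L²` of pairs `(v|_Ω, v|_side)` with `v ∈ C_c^∞(ℝ²)`. Thus
`w ↦ t` is the continuous extension of the restriction to the side. -/
def IsTrace (Θ θ : ℝ) (w : H1 Θ) (t : ℝ → ℂ) : Prop :=
  MemLp t 2 rayMeasure ∧
  ∃ (v : ℕ → ℂ → ℂ) (hv : ∀ n, IsSmoothCompact (v n)),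
    Tendsto (fun n => toH1 Θ (v n) (hv n)) atTop (𝓝 w) ∧
    Tendsto (fun n => eLpNorm (fun r => v n (rayPoint θ r) - t r) 2 rayMeasure) atTop (𝓝 0)

/-! ### The boundary space `H^{1/2}_{00}(Γ)` -/

/-- The space `H^{1/2}` of the curve `p(I)` parametrised by arc length by `p` on `I`:
`L²` functions with finite Sobolev–Slobodeckij seminorm (the distance is that of the plane). -/
def MemHHalf (p : ℝ → ℂ) (I : Set ℝ) (g : ℝ → ℂ) : Prop :=
  MemLp g 2 (volume.restrict I) ∧
  ∫⁻ a in I, ∫⁻ b in I, ENNReal.ofReal (‖g a - g b‖ ^ 2 / ‖p a - p b‖ ^ 2) < ⊤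

/-- Arc length parametrisation of `∂Ω` by `ℝ`: positive parameters run along `Γ`, negative ones
along `Σ`, and `0` is the vertex. -/
def bdryParam (Θ a : ℝ) : ℂ := if 0 ≤ a then rayPoint 0 a else rayPoint Θ (-a)

/-- `H^{1/2}_{00}(Γ)`: functions of `H^{1/2}(Γ)` whose extension by `0` to `∂Ω` is in
`H^{1/2}(∂Ω)`. -/
def MemH00 (Θ : ℝ) (g : ℝ → ℂ) : Prop :=
  MemHHalf (bdryParam Θ) (Ioi 0) g ∧ MemHHalf (bdryParam Θ) univ ((Ioi 0).indicator g)

/-! ### The spaces of singular functions -/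

/-- `Im[(αz)^q (conj (αz))^k P(log (αz))]` with `α = e^{-iΘ}`, where for `z = r e^{iθ}`,
`θ ∈ [0, 2π)`, one sets `(αz)^q = r^q e^{iq(θ-Θ)}`, `(conj (αz))^k = r^k e^{-ik(θ-Θ)}` and
`log (αz) = ln r + i(θ-Θ)`. Only its values on the closed sector without its vertex matter; there
the formula gives the continuous extension to `Γ` and `Σ` of the function on `Ω`. -/
def sing (Θ q : ℝ) (k : ℕ) (P : ℝ[X]) (z : ℂ) : ℂ :=
  (((‖z‖ ^ q : ℝ) * Complex.exp (q * (polarAngle z - Θ) * Complex.I) *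
    ((‖z‖ ^ k : ℝ) * Complex.exp (-k * (polarAngle z - Θ) * Complex.I)) *
    aeval (Real.log ‖z‖ + (polarAngle z - Θ) * Complex.I : ℂ) P).im : ℂ)

/-- `𝒜_d(Ω)`. -/
def singDeg (Θ d : ℝ) : Submodule ℂ (ℂ → ℂ) :=
  Submodule.span ℂ {φ | ∃ (q : ℝ) (k : ℕ) (P : ℝ[X]), q + k = d ∧ φ = sing Θ q k P}

/-- `𝒜(Ω) = ∑_d 𝒜_d(Ω)`. -/
def singSpace (Θ : ℝ) : Submodule ℂ (ℂ → ℂ) := ⨆ d : ℝ, singDeg Θ d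

/-- `𝒜_d(Γ)`: the functions `x ↦ x^d Q(ln x)`, `Q ∈ ℂ[T]` (they form a subspace). -/
def bdrySingDeg (d : ℝ) : Submodule ℂ (ℝ → ℂ) :=
  Submodule.span ℂ {φ | ∃ Q : ℂ[X], φ = fun x => ((x ^ d : ℝ) : ℂ) * Q.eval (Real.log x : ℂ)}

/-- `𝒜(Γ) = ∑_d 𝒜_d(Γ)`. -/
def bdrySingSpace : Submodule ℂ (ℝ → ℂ) := ⨆ d : ℝ, bdrySingDeg d

/-- The normalisation `q ∉ ℕ` or `q > k` or `P(0) = 0`, which removes the redundancy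
`Im[(αz)^q (conj (αz))^k] = -Im[(αz)^k (conj (αz))^q]` for `q ∈ ℕ`. -/
def IsNormalized (q : ℝ) (k : ℕ) (P : ℝ[X]) : Prop :=
  (¬∃ n : ℕ, q = n) ∨ (k : ℝ) < q ∨ P.eval 0 = 0

/-- `φ = ∑ c(q,k,P) Im[(αz)^q (conj (αz))^k P(log (αz))]`, a finite sum over normalized
triples `(q,k,P)`. -/
def IsExpansion (Θ : ℝ) (c : (ℝ × ℕ × ℝ[X]) →₀ ℂ) (φ : ℂ → ℂ) : Prop :=
  (∀ i ∈ c.support, IsNormalized i.1 i.2.1 i.2.2) ∧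
  φ = c.sum fun i a => a • sing Θ i.1 i.2.1 i.2.2

open Classical in
/-- The linear form `σ_d` on `𝒜(Ω)`: for a normalized triple `(q,k,P)` its value on
`Im[(αz)^q (conj (αz))^k P(log (αz))]` is `P(0)` if `q = d` and `k = 0`, and `0` otherwise; it is
extended by linearity. -/
def sigma (Θ d : ℝ) (φ : ℂ → ℂ) : ℂ :=
  if h : ∃ c, IsExpansion Θ c φ then
    h.choose.sum fun i a => a * (if i.1 = d ∧ i.2.1 = 0 then ((i.2.2.eval 0 : ℝ) : ℂ) else 0)
  else 0

/-! ### The space `H¹(Ω) + χ₀𝒜(Ω)` and the boundary value problem -/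

/-- `χ₀`: a smooth radial function equal to `1` near `0` and to `0` near infinity. -/
structure IsCutoff (χ : ℂ → ℂ) : Prop where
  smooth : ContDiff ℝ (⊤ : ℕ∞) χ
  radial : ∀ z w : ℂ, ‖z‖ = ‖w‖ → χ z = χ w
  one_near_zero : ∀ᶠ z in 𝓝 0, χ z = 1
  zero_near_infty : ∀ᶠ z in cocompact ℂ, χ z = 0

/-- Measurable functions on `Ω` modulo equality almost everywhere. -/
abbrev FunOn (Θ : ℝ) : Type := ℂ →ₘ[sectorMeasure Θ] ℂ

/-- `u = w + χ₀ψ` on `Ω`, with `w ∈ H¹(Ω)` and `ψ ∈ 𝒜(Ω)`. -/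
def IsDecomp (Θ : ℝ) (χ : ℂ → ℂ) (u : FunOn Θ) (w : H1 Θ) (ψ : ℂ → ℂ) : Prop :=
  ψ ∈ singSpace Θ ∧ ∀ᵐ z ∂(sectorMeasure Θ), u z = fnOf w z + χ z * ψ z

/-- The space `H¹(Ω) + χ₀𝒜(Ω)`. -/
def farSpace (Θ : ℝ) (χ : ℂ → ℂ) : Set (FunOn Θ) := {u | ∃ w ψ, IsDecomp Θ χ u w ψ}

/-- The space `H^{1/2}_{00}(Γ) + χ₀𝒜(Γ)`. -/
def bdryDataSpace (Θ : ℝ) (χ : ℂ → ℂ) : Set (ℝ → ℂ) :=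
  {g | ∃ g₀ φ : ℝ → ℂ, MemH00 Θ g₀ ∧ φ ∈ bdrySingSpace ∧
    ∀ᵐ x ∂rayMeasure, g x = g₀ x + χ (rayPoint 0 x) * φ x}

/-- `u = g` on the side of direction `θ`, for `u = w + χ₀ψ ∈ H¹(Ω) + χ₀𝒜(Ω)`: the trace of `w`
plus the pointwise restriction of `χ₀ψ` is `g`. -/
def HasBdryValue (Θ : ℝ) (χ : ℂ → ℂ) (θ : ℝ) (u : FunOn Θ) (g : ℝ → ℂ) : Prop :=
  ∃ w ψ t, IsDecomp Θ χ u w ψ ∧ IsTrace Θ θ w t ∧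
    ∀ᵐ r ∂rayMeasure, t r + χ (rayPoint θ r) * ψ (rayPoint θ r) = g r

open Classical in
/-- `σ_d(u) = σ_d(ψ)` where `ψ ∈ 𝒜(Ω)` is such that `u - χ₀ψ ∈ H¹(Ω)` (to be used for
`d ∈ -(π/Θ)ℕ*`). -/
def farSigma (Θ : ℝ) (χ : ℂ → ℂ) (d : ℝ) (u : FunOn Θ) : ℂ :=
  if h : ∃ ψ w, IsDecomp Θ χ u w ψ then sigma Θ d h.choose else 0

/-- `μ₀ Δu + ω² ρ₀ u = f` (with `om` for `ω`) in `Ω`, in the sense of distributions. -/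
def SolvesHelmholtz (Θ μ₀ ρ₀ : ℝ) (om : ℂ) (f : StrongDual ℂ (H1 Θ)) (u : FunOn Θ) : Prop :=
  ∀ (v : ℂ → ℂ) (hv : IsTest Θ v),
    ∫ z, u z * (μ₀ * Laplacian.laplacian v z + om ^ 2 * ρ₀ * v z) ∂(sectorMeasure Θ) =
      f (toH1 Θ v hv.1)

end FarField

end

noncomputable section

namespace FarField

/-! ### Exponential polynomials with real exponents -/

/-- The exponential polynomial `∑ exp (l x) P_l(x)`. -/
def expPoly (p : ℝ →₀ ℂ[X]) (x : ℝ) : ℂ :=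
  p.sum fun l P => (Real.exp (l * x) : ℂ) * P.eval (x : ℂ)

lemma expPoly_add (p q : ℝ →₀ ℂ[X]) (x : ℝ) : expPoly (p + q) x = expPoly p x + expPoly q x :=
  Finsupp.sum_add_index' (by simp) (by intros; simp [mul_add])

lemma expPoly_single (l : ℝ) (P : ℂ[X]) (x : ℝ) :
    expPoly (Finsupp.single l P) x = (Real.exp (l * x) : ℂ) * P.eval (x : ℂ) :=
  Finsupp.sum_single_index (by simp)

lemma expPoly_finset_sum {ι : Type*} (s : Finset ι) (p : ι → ℝ →₀ ℂ[X]) (x : ℝ) :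
    expPoly (∑ i ∈ s, p i) x = ∑ i ∈ s, expPoly (p i) x := by
  classical
  induction s using Finset.induction_on with
  | empty => simp [expPoly]
  | insert a s ha ih => rw [Finset.sum_insert ha, Finset.sum_insert ha, expPoly_add, ih]

lemma tendsto_exp_mul_eval_atBot {a : ℝ} (ha : 0 < a) (P : ℂ[X]) :
    Tendsto (fun x : ℝ => (Real.exp (a * x) : ℂ) * P.eval (x : ℂ)) atBot (𝓝 0) := by
  have key : ∀ n : ℕ, Tendsto (fun x : ℝ => Real.exp (a * x) * x ^ n) atBot (𝓝 0) := by
    intro n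
    have h := (isLittleO_pow_exp_pos_mul_atTop n ha).tendsto_div_nhds_zero
    have h2 := (h.const_mul ((-1 : ℝ) ^ n)).comp tendsto_neg_atBot_atTop
    simp only [mul_zero] at h2
    refine h2.congr fun x => ?_
    simp only [Function.comp]
    rw [neg_pow x, mul_neg, Real.exp_neg]
    rw [div_inv_eq_mul, ← mul_assoc, ← mul_assoc, ← mul_pow]
    simp [mul_comm]
  have : ∀ x : ℝ, (Real.exp (a * x) : ℂ) * P.eval (x : ℂ) =
      ∑ n ∈ Finset.range (P.natDegree + 1),
        P.coeff n * ((Real.exp (a * x) * x ^ n : ℝ) : ℂ) := by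
    intro x
    rw [Polynomial.eval_eq_sum_range, Finset.mul_sum]
    refine Finset.sum_congr rfl fun n _ => ?_
    push_cast
    ring
  simp_rw [this]
  rw [show (0 : ℂ) = ∑ n ∈ Finset.range (P.natDegree + 1), P.coeff n * ((0 : ℝ) : ℂ) by simp]
  refine tendsto_finsetSum _ fun n _ => Tendsto.const_mul _ ?_
  exact (Complex.continuous_ofReal.tendsto 0).comp (key n)

lemma eventually_le_norm_eval_atBot {P : ℂ[X]} (hP : P ≠ 0) :
    ∃ c : ℝ, 0 < c ∧ ∀ᶠ x : ℝ in atBot, c ≤ ‖P.eval (x : ℂ)‖ := by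
  by_cases hd : 0 < P.degree
  · refine ⟨1, one_pos, ?_⟩
    have h : Tendsto (fun x : ℝ => ‖((x : ℝ) : ℂ)‖) atBot atTop := by
      simp only [Complex.norm_real, Real.norm_eq_abs]
      exact tendsto_abs_atBot_atTop
    exact (P.tendsto_norm_atTop hd h).eventually_ge_atTop 1
  · have h := Polynomial.eq_C_of_degree_le_zero (not_lt.mp hd)
    have h0 : P.coeff 0 ≠ 0 := by
      intro h0; rw [h0, map_zero] at h; exact hP h
    refine ⟨‖P.coeff 0‖, norm_pos_iff.mpr h0, Eventually.of_forall fun x => ?_⟩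
    rw [h]; simp

/-- A nonzero exponential polynomial is bounded below at `-∞` by the exponential of its least
exponent. -/
lemma expPoly_lower_bound {p : ℝ →₀ ℂ[X]} (hp : p ≠ 0) :
    ∃ d ∈ p.support, (∀ l ∈ p.support, d ≤ l) ∧ ∃ c : ℝ, 0 < c ∧
      ∀ᶠ x : ℝ in atBot, c * Real.exp (d * x) ≤ ‖expPoly p x‖ := by
  have hne : p.support.Nonempty := Finsupp.support_nonempty_iff.mpr hp
  refine ⟨p.support.min' hne, p.support.min'_mem hne, fun l hl => p.support.min'_le l hl, ?_⟩
  set d := p.support.min' hne with hd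
  have hdm : d ∈ p.support := p.support.min'_mem hne
  obtain ⟨c, hc, hev⟩ := eventually_le_norm_eval_atBot (Finsupp.mem_support_iff.mp hdm)
  refine ⟨c / 2, by positivity, ?_⟩
  have hrest : Tendsto (fun x : ℝ => ∑ l ∈ p.support.erase d,
      (Real.exp ((l - d) * x) : ℂ) * (p l).eval (x : ℂ)) atBot (𝓝 0) := by
    rw [show (0 : ℂ) = ∑ l ∈ p.support.erase d, 0 by simp]
    refine tendsto_finsetSum _ fun l hl => tendsto_exp_mul_eval_atBot ?_ _
    have h1 := p.support.min'_le l (Finset.mem_of_mem_erase hl)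
    exact sub_pos.mpr (lt_of_le_of_ne h1 (Ne.symm (Finset.ne_of_mem_erase hl)))
  have hsmall := (hrest.norm).eventually (gt_mem_nhds (show ‖(0 : ℂ)‖ < c / 2 by simpa using half_pos hc))
  filter_upwards [hev, hsmall] with x hx1 hx2
  have heq : expPoly p x = (Real.exp (d * x) : ℂ) * ((p d).eval (x : ℂ) +
      ∑ l ∈ p.support.erase d, (Real.exp ((l - d) * x) : ℂ) * (p l).eval (x : ℂ)) := by
    rw [expPoly, Finsupp.sum, ← Finset.add_sum_erase _ _ hdm, mul_add, Finset.mul_sum]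
    congr 1
    refine Finset.sum_congr rfl fun l _ => ?_
    rw [← mul_assoc, ← Complex.ofReal_mul, ← Real.exp_add]
    ring_nf
  rw [heq, norm_mul, Complex.norm_real, Real.norm_eq_abs, Real.abs_exp, mul_comm]
  refine mul_le_mul_of_nonneg_left ?_ (Real.exp_pos _).le
  have := norm_sub_le_norm_add ((p d).eval (x : ℂ))
    (∑ l ∈ p.support.erase d, (Real.exp ((l - d) * x) : ℂ) * (p l).eval (x : ℂ))
  linarith

lemma expPoly_eq_zero_of_frequently {p : ℝ →₀ ℂ[X]} (h : ∃ᶠ x in atBot, expPoly p x = 0) :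
    p = 0 := by
  by_contra hp
  obtain ⟨d, -, -, c, hc, hev⟩ := expPoly_lower_bound hp
  obtain ⟨x, hx, hx2⟩ := (h.and_eventually hev).exists
  rw [hx, norm_zero] at hx2
  exact absurd hx2 (not_le.mpr (by positivity))

lemma expPoly_eq_zero_of_forall {p : ℝ →₀ ℂ[X]} (h : ∀ x, expPoly p x = 0) : p = 0 :=
  expPoly_eq_zero_of_frequently (Eventually.of_forall h).frequently

/-- If an exponential polynomial tends to `0` at `-∞`, its exponents are positive. -/
lemma expPoly_apply_eq_zero_of_tendsto {p : ℝ →₀ ℂ[X]} (h : Tendsto (expPoly p) atBot (𝓝 0))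
    {l : ℝ} (hl : l ≤ 0) : p l = 0 := by
  by_contra hpl
  have hp : p ≠ 0 := fun h0 => hpl (by simp [h0])
  obtain ⟨d, -, hmin, c, hc, hev⟩ := expPoly_lower_bound hp
  have hd : d ≤ 0 := (hmin l (Finsupp.mem_support_iff.mpr hpl)).trans hl
  have hsm := h.norm.eventually (gt_mem_nhds (show ‖(0 : ℂ)‖ < c by simpa using hc))
  obtain ⟨x, hx1, hx2, hx3⟩ := (hev.and (hsm.and (eventually_le_atBot 0))).exists
  have : 1 ≤ Real.exp (d * x) := Real.one_le_exp (mul_nonneg_of_nonpos_of_nonpos hd hx3)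
  nlinarith

/-- If an exponential polynomial is square integrable at `-∞`, its exponents are positive. -/
lemma expPoly_apply_eq_zero_of_lintegral {p : ℝ →₀ ℂ[X]} {b : ℝ}
    (h : ∫⁻ x in Iio b, ‖expPoly p x‖ₑ ^ 2 < ⊤) {l : ℝ} (hl : l ≤ 0) : p l = 0 := by
  by_contra hpl
  have hp : p ≠ 0 := fun h0 => hpl (by simp [h0])
  obtain ⟨d, -, hmin, c, hc, hev⟩ := expPoly_lower_bound hp
  have hd : d ≤ 0 := (hmin l (Finsupp.mem_support_iff.mpr hpl)).trans hl
  obtain ⟨B, hB⟩ := eventually_atBot.mp hev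
  set M := min (min b B) 0
  have : ∫⁻ x in Iio M, ENNReal.ofReal c ^ 2 ≤ ∫⁻ x in Iio b, ‖expPoly p x‖ₑ ^ 2 := by
    refine le_trans (setLIntegral_mono' measurableSet_Iio fun x hx => ?_)
      (lintegral_mono_set (Iio_subset_Iio ((min_le_left _ _).trans (min_le_left _ _))))
    gcongr
    rw [← ofReal_norm]
    refine ENNReal.ofReal_le_ofReal (le_trans ?_ (hB x ?_))
    · have hx0 : x ≤ 0 := (le_of_lt hx).trans (min_le_right _ _)
      have : 1 ≤ Real.exp (d * x) := Real.one_le_exp (mul_nonneg_of_nonpos_of_nonpos hd hx0)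
      nlinarith
    · exact (le_of_lt hx).trans ((min_le_left _ _).trans (min_le_right _ _))
  rw [setLIntegral_const, Real.volume_Iio, ENNReal.mul_top] at this
  · exact absurd (this.trans_lt h) (lt_irrefl _)
  · simpa using hc

/-! ### Logarithmic polar coordinates -/

/-- The plane slit along the half-line opposite to the bisector of the sector. -/
def slit (Θ : ℝ) : Set ℂ := {z | z * Complex.exp (-((Θ / 2 : ℝ) * Complex.I)) ∈ Complex.slitPlane}

/-- The branch of the logarithm on `slit Θ` whose imaginary part is the polar angle on the
sector. -/
def lg (Θ : ℝ) (z : ℂ) : ℂ :=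
  Complex.log (z * Complex.exp (-((Θ / 2 : ℝ) * Complex.I))) + (Θ / 2 : ℝ) * Complex.I

lemma isOpen_slit (Θ : ℝ) : IsOpen (slit Θ) :=
  Complex.isOpen_slitPlane.preimage (continuous_id.mul continuous_const)

lemma ne_zero_of_mem_slit {Θ : ℝ} {z : ℂ} (hz : z ∈ slit Θ) : z ≠ 0 := by
  rintro rfl
  exact Complex.slitPlane_ne_zero hz (by simp)

lemma exp_lg (Θ : ℝ) {z : ℂ} (hz : z ≠ 0) : Complex.exp (lg Θ z) = z := by
  rw [lg, Complex.exp_add, Complex.exp_log (mul_ne_zero hz (Complex.exp_ne_zero _)), mul_assoc,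
    ← Complex.exp_add]
  simp

lemma lg_re (Θ : ℝ) (z : ℂ) : (lg Θ z).re = Real.log ‖z‖ := by
  have : (-((Θ / 2 : ℝ) * Complex.I)) = ((-(Θ / 2) : ℝ) : ℂ) * Complex.I := by push_cast; ring
  rw [lg, Complex.add_re, Complex.log_re, norm_mul, this, Complex.norm_exp_ofReal_mul_I]
  simp

lemma lg_exp {Θ : ℝ} {ζ : ℂ} (h : |ζ.im - Θ / 2| < Real.pi) : lg Θ (Complex.exp ζ) = ζ := by
  rw [abs_lt] at h
  rw [lg, ← Complex.exp_add, Complex.log_exp] <;> simp <;> linarith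

lemma exp_mem_slit {Θ : ℝ} {ζ : ℂ} (h : |ζ.im - Θ / 2| < Real.pi) : Complex.exp ζ ∈ slit Θ := by
  rw [abs_lt] at h
  rw [slit, mem_ofPred_eq, ← Complex.exp_add, Complex.exp_mem_slitPlane]
  rw [toIocMod_eq_self Real.two_pi_pos |>.mpr]
  · simp; linarith
  · simp; constructor <;> linarith

lemma hasDerivAt_lg {Θ : ℝ} {z : ℂ} (hz : z ∈ slit Θ) : HasDerivAt (lg Θ) z⁻¹ z := by
  have h := ((hasDerivAt_id z).mul_const (Complex.exp (-((Θ / 2 : ℝ) * Complex.I)))).clog hz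
  have h2 := h.add_const (((Θ / 2 : ℝ) : ℂ) * Complex.I)
  convert! h2 using 1
  have := Complex.exp_ne_zero (-((Θ / 2 : ℝ) * Complex.I))
  have := ne_zero_of_mem_slit hz
  simp only [id]
  field_simp

lemma contDiffAt_lg {Θ : ℝ} {z : ℂ} (hz : z ∈ slit Θ) : ContDiffAt ℝ (⊤ : ℕ∞) (lg Θ) z := by
  have : ContDiffAt ℂ (⊤ : ℕ∞) (lg Θ) z := by
    unfold lg
    exact ((Complex.contDiffAt_log hz).comp z
      (f := fun z => z * Complex.exp (-((Θ / 2 : ℝ) * Complex.I)))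
      (contDiffAt_id.mul contDiffAt_const)).add contDiffAt_const
  exact this.restrict_scalars ℝ

lemma continuousOn_lg (Θ : ℝ) : ContinuousOn (lg Θ) (slit Θ) := fun _ hz =>
  (hasDerivAt_lg hz).continuousAt.continuousWithinAt

lemma measurable_lg (Θ : ℝ) : Measurable (lg Θ) := by
  unfold lg
  fun_prop

/-- The strip `0 < Im ζ < Θ`. -/
def strip (Θ : ℝ) : Set ℂ := {ζ | 0 < ζ.im ∧ ζ.im < Θ}

lemma isOpen_strip (Θ : ℝ) : IsOpen (strip Θ) :=
  (isOpen_lt continuous_const Complex.continuous_im).inter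
    (isOpen_lt Complex.continuous_im continuous_const)

lemma sector_eq_image (Θ : ℝ) : sector Θ = Complex.exp '' strip Θ := by
  ext z
  constructor
  · rintro ⟨r, θ, hr, h0, h1, rfl⟩
    refine ⟨Real.log r + θ * Complex.I, ⟨by simpa using h0, by simpa using h1⟩, ?_⟩
    rw [Complex.exp_add, ← Complex.ofReal_exp, Real.exp_log hr]
  · rintro ⟨ζ, ⟨h0, h1⟩, rfl⟩
    refine ⟨Real.exp ζ.re, ζ.im, Real.exp_pos _, h0, h1, ?_⟩
    rw [Complex.ofReal_exp, ← Complex.exp_add, Complex.re_add_im]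

lemma isOpen_sector (Θ : ℝ) : IsOpen (sector Θ) := by
  rw [sector_eq_image]; exact Complex.isOpenMap_exp _ (isOpen_strip Θ)

lemma abs_sub_half_lt {Θ t : ℝ} (hΘ : Θ < 2 * Real.pi) (h0 : 0 ≤ t) (h1 : t ≤ Θ) :
    |t - Θ / 2| < Real.pi := by
  rw [abs_lt]; constructor <;> linarith

lemma lg_mem_strip {Θ : ℝ} (hΘ : Θ < 2 * Real.pi) {z : ℂ} (hz : z ∈ sector Θ) :
    lg Θ z ∈ strip Θ := by
  rw [sector_eq_image] at hz
  obtain ⟨ζ, hζ, rfl⟩ := hz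
  rwa [lg_exp (abs_sub_half_lt hΘ hζ.1.le hζ.2.le)]

lemma exp_mem_sector {Θ : ℝ} {ζ : ℂ} (h : ζ ∈ strip Θ) : Complex.exp ζ ∈ sector Θ := by
  rw [sector_eq_image]; exact mem_image_of_mem _ h

lemma sector_subset_slit {Θ : ℝ} (hΘ : Θ < 2 * Real.pi) : sector Θ ⊆ slit Θ := by
  rw [sector_eq_image]
  rintro _ ⟨ζ, hζ, rfl⟩
  exact exp_mem_slit (abs_sub_half_lt hΘ hζ.1.le hζ.2.le)

lemma measurableSet_sector (Θ : ℝ) : MeasurableSet (sector Θ) := (isOpen_sector Θ).measurableSet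

lemma ae_mem_sector (Θ : ℝ) : ∀ᵐ z ∂(sectorMeasure Θ), z ∈ sector Θ :=
  ae_restrict_mem (measurableSet_sector Θ)

lemma injOn_exp_strip {Θ : ℝ} (hΘ : Θ < 2 * Real.pi) : InjOn Complex.exp (strip Θ) := by
  intro a ha b hb hab
  rw [← lg_exp (abs_sub_half_lt hΘ ha.1.le ha.2.le), hab,
    lg_exp (abs_sub_half_lt hΘ hb.1.le hb.2.le)]

lemma rayPoint_eq_exp (θ : ℝ) {r : ℝ} (hr : 0 < r) :
    rayPoint θ r = Complex.exp (Real.log r + θ * Complex.I) := by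
  rw [Complex.exp_add, ← Complex.ofReal_exp, Real.exp_log hr, rayPoint]

lemma rayPoint_exp (θ s : ℝ) : rayPoint θ (Real.exp s) = Complex.exp (s + θ * Complex.I) := by
  rw [rayPoint_eq_exp _ (Real.exp_pos s), Real.log_exp]

lemma norm_rayPoint (θ : ℝ) {r : ℝ} (hr : 0 ≤ r) : ‖rayPoint θ r‖ = r := by
  rw [rayPoint, norm_mul, Complex.norm_exp_ofReal_mul_I, mul_one, Complex.norm_real,
    Real.norm_of_nonneg hr]

lemma norm_exp_add_mul_I (s θ : ℝ) : ‖Complex.exp (s + θ * Complex.I)‖ = Real.exp s := by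
  rw [Complex.norm_exp]; simp

lemma polarAngle_exp {ζ : ℂ} (h0 : 0 ≤ ζ.im) (h1 : ζ.im < 2 * Real.pi) :
    polarAngle (Complex.exp ζ) = ζ.im := by
  have harg : (Complex.exp ζ).arg = toIocMod Real.two_pi_pos (-Real.pi) ζ.im := Complex.arg_exp ζ
  unfold polarAngle
  rw [harg]
  rcases le_or_gt ζ.im Real.pi with h | h
  · rw [(toIocMod_eq_self Real.two_pi_pos).mpr ⟨by linarith [Real.pi_pos], by linarith⟩, if_pos h0]
  · have : toIocMod Real.two_pi_pos (-Real.pi) ζ.im = ζ.im - 2 * Real.pi := by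
      rw [← toIocMod_sub, (toIocMod_eq_self Real.two_pi_pos).mpr ⟨by linarith, by linarith⟩]
    rw [this, if_neg (by linarith)]; ring

/-! ### Change of variables -/

lemma hasFDerivAt_exp_real (ζ : ℂ) :
    HasFDerivAt Complex.exp (ContinuousLinearMap.mul ℝ ℂ (Complex.exp ζ)) ζ := by
  have h := (Complex.hasDerivAt_exp ζ).hasFDerivAt.restrictScalars ℝ
  convert! h using 1
  ext x; simp [mul_comm]

lemma det_mul_complex (c : ℂ) : (ContinuousLinearMap.mul ℝ ℂ c).det = ‖c‖ ^ 2 := by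
  have h : (ContinuousLinearMap.mul ℝ ℂ c).det = Algebra.norm ℝ c := by
    rw [Algebra.norm_apply]; rfl
  rw [h, Algebra.norm_complex_apply, Complex.normSq_eq_norm_sq]

lemma lintegral_sector_eq_strip {Θ : ℝ} (hΘ : Θ < 2 * Real.pi) (F : ℂ → ℝ≥0∞) :
    ∫⁻ z, F z ∂(sectorMeasure Θ) =
      ∫⁻ ζ in strip Θ, ENNReal.ofReal (Real.exp (2 * ζ.re)) * F (Complex.exp ζ) := by
  rw [sectorMeasure, sector_eq_image, lintegral_image_eq_lintegral_abs_det_fderiv_mul volume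
    (isOpen_strip Θ).measurableSet (fun ζ _ => (hasFDerivAt_exp_real ζ).hasFDerivWithinAt)
    (injOn_exp_strip hΘ)]
  refine lintegral_congr fun ζ => ?_
  rw [det_mul_complex, abs_of_nonneg (by positivity), Complex.norm_exp, ← Real.exp_nat_mul]
  norm_num

lemma lintegral_strip_eq {Θ : ℝ} {F : ℂ → ℝ≥0∞} (hF : Measurable F) :
    ∫⁻ ζ in strip Θ, F ζ = ∫⁻ θ in Ioo 0 Θ, ∫⁻ s : ℝ, F (s + θ * Complex.I) := by
  have h1 : strip Θ = Complex.measurableEquivRealProd ⁻¹' (univ ×ˢ Ioo 0 Θ) := by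
    ext ζ; simp [strip]
  have h2 : ∫⁻ ζ in strip Θ, F ζ = ∫⁻ p : ℝ × ℝ in univ ×ˢ Ioo 0 Θ, F (p.1 + p.2 * Complex.I) := by
    rw [h1, ← Complex.volume_preserving_equiv_real_prod.setLIntegral_comp_preimage
      (MeasurableSet.univ.prod measurableSet_Ioo) (by fun_prop)]
    refine lintegral_congr fun ζ => ?_
    simp [Complex.re_add_im]
  rw [h2, Measure.volume_eq_prod, ← Measure.prod_restrict, Measure.restrict_univ,
    lintegral_prod_symm' _ (by fun_prop)]

/-- Integration over the sector in logarithmic polar coordinates. -/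
lemma lintegral_sector {Θ : ℝ} (hΘ : Θ < 2 * Real.pi) {F : ℂ → ℝ≥0∞} (hF : Measurable F) :
    ∫⁻ z, F z ∂(sectorMeasure Θ) = ∫⁻ θ in Ioo 0 Θ, ∫⁻ s : ℝ,
      ENNReal.ofReal (Real.exp (2 * s)) * F (Complex.exp (s + θ * Complex.I)) := by
  rw [lintegral_sector_eq_strip hΘ, lintegral_strip_eq (by fun_prop)]
  simp

/-- Integration over a half-line in the logarithmic coordinate. -/
lemma lintegral_ray (F : ℝ → ℝ≥0∞) :
    ∫⁻ r, F r ∂rayMeasure = ∫⁻ s : ℝ, ENNReal.ofReal (Real.exp s) * F (Real.exp s) := by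
  rw [rayMeasure, ← Real.range_exp, ← image_univ,
    lintegral_image_eq_lintegral_abs_deriv_mul MeasurableSet.univ
      (fun s _ => (Real.hasDerivAt_exp s).hasDerivWithinAt) Real.exp_injective.injOn]
  simp

/-! ### The Hilbert space `H¹(Ω)` -/

/-- The Hilbert space `L²(Ω)³`. -/
abbrev L2Triple (Θ : ℝ) : Type := PiLp 2 fun _ : Fin 3 => Lp ℂ 2 (sectorMeasure Θ)

lemma tendsto_L2Triple_iff {Θ : ℝ} {ι : Type*} {l : Filter ι} {W : ι → L2Triple Θ}
    {w : L2Triple Θ} : Tendsto W l (𝓝 w) ↔ ∀ i, Tendsto (fun n => W n i) l (𝓝 (w i)) := by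
  have h := (PiLp.continuousLinearEquiv 2 ℂ
    (fun _ : Fin 3 => Lp ℂ 2 (sectorMeasure Θ))).toHomeomorph.isInducing
  rw [h.tendsto_nhds_iff, tendsto_pi_nhds]
  rfl

lemma tendsto_toLp_iff {α ι : Type*} [MeasurableSpace α] {μ : Measure α} {l : Filter ι}
    {f : ι → α → ℂ} (hf : ∀ n, MemLp (f n) 2 μ) (g : Lp ℂ 2 μ) :
    Tendsto (fun n => (hf n).toLp (f n)) l (𝓝 g) ↔
      Tendsto (fun n => eLpNorm (fun z => f n z - g z) 2 μ) l (𝓝 0) := by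
  rw [Lp.tendsto_Lp_iff_tendsto_eLpNorm']
  refine tendsto_congr fun n => eLpNorm_congr_ae ?_
  filter_upwards [(hf n).coeFn_toLp] with z hz
  simp [hz]

lemma tendsto_toH1_iff {Θ : ℝ} {ι : Type*} {l : Filter ι} {v : ι → ℂ → ℂ}
    (hv : ∀ n, IsSmoothCompact (v n)) (w : H1 Θ) :
    Tendsto (fun n => toH1 Θ (v n) (hv n)) l (𝓝 w) ↔
      Tendsto (fun n => eLpNorm (fun z => v n z - w.1 0 z) 2 (sectorMeasure Θ)) l (𝓝 0) ∧
      Tendsto (fun n => eLpNorm (fun z => dirDeriv 1 (v n) z - w.1 1 z) 2 (sectorMeasure Θ))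
        l (𝓝 0) ∧
      Tendsto (fun n => eLpNorm (fun z => dirDeriv Complex.I (v n) z - w.1 2 z) 2
        (sectorMeasure Θ)) l (𝓝 0) := by
  rw [tendsto_subtype_rng, tendsto_L2Triple_iff, Fin.forall_fin_succ, Fin.forall_fin_succ,
    Fin.forall_fin_succ, ← tendsto_toLp_iff (fun n => (hv n).memLp Θ 2),
    ← tendsto_toLp_iff (fun n => (hv n).memLp_dirDeriv Θ 2 1),
    ← tendsto_toLp_iff (fun n => (hv n).memLp_dirDeriv Θ 2 Complex.I)]
  simp only [IsEmpty.forall_iff, and_true]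
  rfl

lemma L2_inner_eq_integral {α : Type*} [MeasurableSpace α] {μ : Measure α} (a b : Lp ℂ 2 μ) :
    inner ℂ (star a) b = ∫ z, b z * a z ∂μ := by
  rw [L2.inner_def]
  refine integral_congr_ae ?_
  filter_upwards [Lp.coeFn_star a] with z hz
  rw [hz]
  simp

lemma continuous_integral_mul {α : Type*} [MeasurableSpace α] {μ : Measure α} {v : α → ℂ}
    (hv : MemLp v 2 μ) : Continuous fun u : Lp ℂ 2 μ => ∫ z, u z * v z ∂μ := by
  have : (fun u : Lp ℂ 2 μ => ∫ z, u z * v z ∂μ) = fun u => inner ℂ (star (hv.toLp v)) u := by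
    ext u
    rw [L2_inner_eq_integral]
    refine integral_congr_ae ?_
    filter_upwards [hv.coeFn_toLp] with z hz
    rw [hz]
  rw [this]
  fun_prop

lemma isClosed_H1 (Θ : ℝ) : IsClosed (H1 Θ : Set (L2Triple Θ)) := by
  have hc : ∀ i, Continuous fun w : L2Triple Θ => w i := fun i =>
    PiLp.continuous_apply 2 (fun _ : Fin 3 => Lp ℂ 2 (sectorMeasure Θ)) i
  have key : ∀ (e : ℂ) (i : Fin 3), IsClosed {w : L2Triple Θ | IsWeakDeriv Θ e (w 0) (w i)} := by
    intro e i
    have : {w : L2Triple Θ | IsWeakDeriv Θ e (w 0) (w i)} =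
        ⋂ (v : ℂ → ℂ), ⋂ (_ : IsTest Θ v), {w : L2Triple Θ |
          ∫ z, w 0 z * dirDeriv e v z ∂(sectorMeasure Θ) =
            -∫ z, w i z * v z ∂(sectorMeasure Θ)} := by
      ext w; simp [IsWeakDeriv]
    rw [this]
    refine isClosed_iInter fun v => isClosed_iInter fun hv => isClosed_eq ?_ ?_
    · exact (continuous_integral_mul (hv.1.memLp_dirDeriv Θ 2 e)).comp (hc 0)
    · exact ((continuous_integral_mul (hv.1.memLp Θ 2)).comp (hc i)).neg
  exact (key 1 1).inter (key Complex.I 2)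

instance (Θ : ℝ) : CompleteSpace (H1 Θ) := (isClosed_H1 Θ).completeSpace_coe

/-- The element of `H¹(Ω)` given by a square integrable function and its weak derivatives. -/
def mkH1 {Θ : ℝ} {u u₁ u₂ : ℂ → ℂ} (h : MemLp u 2 (sectorMeasure Θ))
    (h₁ : MemLp u₁ 2 (sectorMeasure Θ)) (h₂ : MemLp u₂ 2 (sectorMeasure Θ))
    (d₁ : IsWeakDeriv Θ 1 u u₁) (d₂ : IsWeakDeriv Θ Complex.I u u₂) : H1 Θ :=
  ⟨WithLp.toLp 2 ![h.toLp u, h₁.toLp u₁, h₂.toLp u₂],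
    d₁.congr h.coeFn_toLp h₁.coeFn_toLp, d₂.congr h.coeFn_toLp h₂.coeFn_toLp⟩

lemma H1.ext_ae {Θ : ℝ} {w w' : H1 Θ} (h0 : w.1 0 = w'.1 0) (h1 : w.1 1 = w'.1 1)
    (h2 : w.1 2 = w'.1 2) : w = w' := by
  refine Subtype.ext (PiLp.ext fun i => ?_)
  fin_cases i
  · exact h0
  · exact h1
  · exact h2

/-! ### Test functions and complex conjugation -/

lemma IsSmoothCompact.dirDeriv {v : ℂ → ℂ} (hv : IsSmoothCompact v) (e : ℂ) :
    IsSmoothCompact (dirDeriv e v) :=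
  ⟨(hv.1.fderiv_right (m := (⊤ : ℕ∞)) (by simp)).clm_apply contDiff_const,
    hv.dirDeriv_compact e⟩

lemma IsTest.dirDeriv {Θ : ℝ} {v : ℂ → ℂ} (hv : IsTest Θ v) (e : ℂ) :
    IsTest Θ (dirDeriv e v) :=
  ⟨hv.1.dirDeriv e, (tsupport_fderiv_apply_subset ℝ e).trans hv.2⟩

lemma laplacian_eq_dirDeriv {v : ℂ → ℂ} {z : ℂ} (hv : ContDiffAt ℝ 2 v z) :
    Laplacian.laplacian v z = dirDeriv 1 (dirDeriv 1 v) z +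
      dirDeriv Complex.I (dirDeriv Complex.I v) z := by
  have hd : DifferentiableAt ℝ (fderiv ℝ v) z :=
    (hv.fderiv_right (m := 1) (by norm_num)).differentiableAt (by simp)
  have : ∀ e : ℂ, dirDeriv e (dirDeriv e v) z = fderiv ℝ (fderiv ℝ v) z e e := by
    intro e
    unfold dirDeriv
    rw [fderiv_clm_apply hd (differentiableAt_const _)]
    simp
  rw [InnerProductSpace.laplacian_eq_iteratedFDeriv_complexPlane, this, this]
  simp [iteratedFDeriv_two_apply]

lemma IsSmoothCompact.conj {v : ℂ → ℂ} (hv : IsSmoothCompact v) :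
    IsSmoothCompact fun z => starRingEnd ℂ (v z) :=
  ⟨Complex.conjCLE.contDiff.comp hv.1, hv.2.comp_left (g := starRingEnd ℂ) (by simp)⟩

lemma dirDeriv_conj {v : ℂ → ℂ} {z : ℂ} (hv : DifferentiableAt ℝ v z) (e : ℂ) :
    dirDeriv e (fun z => starRingEnd ℂ (v z)) z = starRingEnd ℂ (dirDeriv e v z) := by
  have h := (Complex.conjCLE.toContinuousLinearMap.hasFDerivAt (x := v z)).comp z hv.hasFDerivAt
  have h2 : fderiv ℝ (fun z => starRingEnd ℂ (v z)) z = _ := h.fderiv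
  unfold dirDeriv
  rw [h2]
  simp

lemma IsTest.conj {Θ : ℝ} {v : ℂ → ℂ} (hv : IsTest Θ v) :
    IsTest Θ fun z => starRingEnd ℂ (v z) := by
  refine ⟨hv.1.conj, (closure_mono fun z hz => ?_).trans hv.2⟩
  simpa using hz

lemma IsSmoothCompact.add {v w : ℂ → ℂ} (hv : IsSmoothCompact v) (hw : IsSmoothCompact w) :
    IsSmoothCompact (v + w) := ⟨hv.1.add hw.1, hv.2.add hw.2⟩

lemma IsSmoothCompact.smul {v : ℂ → ℂ} (c : ℂ) (hv : IsSmoothCompact v) :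
    IsSmoothCompact (c • v) := ⟨hv.1.const_smul c, hv.2.smul_left (f := fun _ => c)⟩

lemma IsSmoothCompact.differentiable {v : ℂ → ℂ} (hv : IsSmoothCompact v) :
    Differentiable ℝ v := hv.1.differentiable (by simp)

lemma dirDeriv_add {v w : ℂ → ℂ} {z : ℂ} (hv : DifferentiableAt ℝ v z)
    (hw : DifferentiableAt ℝ w z) (e : ℂ) :
    dirDeriv e (v + w) z = dirDeriv e v z + dirDeriv e w z := by
  unfold dirDeriv; rw [fderiv_add hv hw]; rfl

lemma dirDeriv_smul {v : ℂ → ℂ} {z : ℂ} (c : ℂ) (hv : DifferentiableAt ℝ v z) (e : ℂ) :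
    dirDeriv e (c • v) z = c * dirDeriv e v z := by
  unfold dirDeriv; rw [fderiv_const_smul hv c]; rfl

lemma dirDeriv_mul {v w : ℂ → ℂ} {z : ℂ} (hv : DifferentiableAt ℝ v z)
    (hw : DifferentiableAt ℝ w z) (e : ℂ) :
    dirDeriv e (fun z => v z * w z) z = dirDeriv e v z * w z + v z * dirDeriv e w z := by
  unfold dirDeriv; rw [fderiv_fun_mul hv hw]; simp; ring

lemma toH1_coe_ae {Θ : ℝ} {v : ℂ → ℂ} (hv : IsSmoothCompact v) :
    ((toH1 Θ v hv).1 0 =ᵐ[sectorMeasure Θ] v) ∧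
    ((toH1 Θ v hv).1 1 =ᵐ[sectorMeasure Θ] dirDeriv 1 v) ∧
    ((toH1 Θ v hv).1 2 =ᵐ[sectorMeasure Θ] dirDeriv Complex.I v) :=
  ⟨(hv.memLp Θ 2).coeFn_toLp, (hv.memLp_dirDeriv Θ 2 1).coeFn_toLp,
    (hv.memLp_dirDeriv Θ 2 Complex.I).coeFn_toLp⟩

lemma toH1_add {Θ : ℝ} {v w : ℂ → ℂ} (hv : IsSmoothCompact v) (hw : IsSmoothCompact w) :
    toH1 Θ (v + w) (hv.add hw) = toH1 Θ v hv + toH1 Θ w hw := by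
  obtain ⟨a0, a1, a2⟩ := toH1_coe_ae (Θ := Θ) (hv.add hw)
  obtain ⟨b0, b1, b2⟩ := toH1_coe_ae (Θ := Θ) hv
  obtain ⟨c0, c1, c2⟩ := toH1_coe_ae (Θ := Θ) hw
  refine H1.ext_ae (Lp.ext ?_) (Lp.ext ?_) (Lp.ext ?_)
  · filter_upwards [a0, b0, c0, Lp.coeFn_add ((toH1 Θ v hv).1 0) ((toH1 Θ w hw).1 0)]
      with z ha hb hc hd
    exact ha.trans ((hd.trans (by simp [hb, hc])).symm)
  · filter_upwards [a1, b1, c1, Lp.coeFn_add ((toH1 Θ v hv).1 1) ((toH1 Θ w hw).1 1)]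
      with z ha hb hc hd
    exact ha.trans ((hd.trans (by
      simp [hb, hc, dirDeriv_add (hv.differentiable z) (hw.differentiable z)])).symm)
  · filter_upwards [a2, b2, c2, Lp.coeFn_add ((toH1 Θ v hv).1 2) ((toH1 Θ w hw).1 2)]
      with z ha hb hc hd
    exact ha.trans ((hd.trans (by
      simp [hb, hc, dirDeriv_add (hv.differentiable z) (hw.differentiable z)])).symm)

lemma toH1_smul {Θ : ℝ} (c : ℂ) {v : ℂ → ℂ} (hv : IsSmoothCompact v) :
    toH1 Θ (c • v) (hv.smul c) = c • toH1 Θ v hv := by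
  obtain ⟨a0, a1, a2⟩ := toH1_coe_ae (Θ := Θ) (hv.smul c)
  obtain ⟨b0, b1, b2⟩ := toH1_coe_ae (Θ := Θ) hv
  refine H1.ext_ae (Lp.ext ?_) (Lp.ext ?_) (Lp.ext ?_)
  · filter_upwards [a0, b0, Lp.coeFn_smul c ((toH1 Θ v hv).1 0)] with z ha hb hd
    exact ha.trans ((hd.trans (by simp [hb])).symm)
  · filter_upwards [a1, b1, Lp.coeFn_smul c ((toH1 Θ v hv).1 1)] with z ha hb hd
    exact ha.trans ((hd.trans (by simp [hb, dirDeriv_smul c (hv.differentiable z)])).symm)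
  · filter_upwards [a2, b2, Lp.coeFn_smul c ((toH1 Θ v hv).1 2)] with z ha hb hd
    exact ha.trans ((hd.trans (by simp [hb, dirDeriv_smul c (hv.differentiable z)])).symm)

lemma IsTest.add {Θ : ℝ} {v w : ℂ → ℂ} (hv : IsTest Θ v) (hw : IsTest Θ w) :
    IsTest Θ (v + w) :=
  ⟨hv.1.add hw.1, (tsupport_add v w).trans (union_subset hv.2 hw.2)⟩

lemma IsTest.smul {Θ : ℝ} {v : ℂ → ℂ} (c : ℂ) (hv : IsTest Θ v) : IsTest Θ (c • v) :=
  ⟨hv.1.smul c, (closure_mono (Function.support_const_smul_subset c v)).trans hv.2⟩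

lemma isTest_zero (Θ : ℝ) : IsTest Θ 0 :=
  ⟨⟨contDiff_const, HasCompactSupport.zero⟩, by simp [tsupport]⟩

/-- The image of `𝒟(Ω)` in `L²(Ω)³`. -/
def testSubmodule (Θ : ℝ) : Submodule ℂ (L2Triple Θ) where
  carrier := {w | ∃ (v : ℂ → ℂ) (hv : IsTest Θ v), (toH1 Θ v hv.1).1 = w}
  add_mem' := by
    rintro _ _ ⟨v, hv, rfl⟩ ⟨w, hw, rfl⟩
    exact ⟨v + w, hv.add hw, congrArg Subtype.val (toH1_add hv.1 hw.1)⟩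
  zero_mem' := ⟨0, isTest_zero Θ, by
    have := toH1_smul (Θ := Θ) 0 (isTest_zero Θ).1
    simp only [zero_smul] at this
    rw [this]; rfl⟩
  smul_mem' := by
    rintro c _ ⟨v, hv, rfl⟩
    exact ⟨c • v, hv.smul c, congrArg Subtype.val (toH1_smul c hv.1)⟩

/-- `H¹₀(Ω)`, the closure of `𝒟(Ω)`. -/
def H10 (Θ : ℝ) : Submodule ℂ (L2Triple Θ) := (testSubmodule Θ).topologicalClosure

instance (Θ : ℝ) : CompleteSpace (H10 Θ) :=
  (Submodule.isClosed_topologicalClosure _).completeSpace_coe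

lemma toH1_mem_H10 {Θ : ℝ} {v : ℂ → ℂ} (hv : IsTest Θ v) : (toH1 Θ v hv.1).1 ∈ H10 Θ :=
  Submodule.le_topologicalClosure _ ⟨v, hv, rfl⟩

lemma testSubmodule_le_H1 (Θ : ℝ) : testSubmodule Θ ≤ H1 Θ := by
  rintro _ ⟨v, hv, rfl⟩; exact (toH1 Θ v hv.1).2

lemma H10_le_H1 (Θ : ℝ) : H10 Θ ≤ H1 Θ :=
  Submodule.topologicalClosure_minimal _ (testSubmodule_le_H1 Θ) (isClosed_H1 Θ)

/-- Complex conjugation on `L²(Ω)³`. -/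
def conjTriple {Θ : ℝ} (w : L2Triple Θ) : L2Triple Θ := WithLp.toLp 2 fun i => star (w i)

lemma inner_star_right {α : Type*} [MeasurableSpace α] {μ : Measure α} (a b : Lp ℂ 2 μ) :
    inner ℂ a (star b) = inner ℂ b (star a) := by
  have h1 := L2_inner_eq_integral (star a) (star b)
  have h2 := L2_inner_eq_integral (star b) (star a)
  rw [star_star] at h1 h2
  rw [h1, h2]
  simp_rw [mul_comm]

lemma inner_conjTriple_right {Θ : ℝ} (a b : L2Triple Θ) :
    inner ℂ a (conjTriple b) = inner ℂ b (conjTriple a) := by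
  simp only [PiLp.inner_apply, conjTriple]
  exact Finset.sum_congr rfl fun i _ => inner_star_right _ _

lemma conjTriple_conjTriple {Θ : ℝ} (a : L2Triple Θ) : conjTriple (conjTriple a) = a := by
  simp [conjTriple]

lemma continuous_conjTriple {Θ : ℝ} : Continuous (conjTriple : L2Triple Θ → L2Triple Θ) := by
  have hs : Continuous (fun a : Lp ℂ 2 (sectorMeasure Θ) => star a) := by
    refine (Isometry.of_dist_eq fun a b => ?_).continuous
    rw [Lp.dist_def, Lp.dist_def]
    congr 1
    refine eLpNorm_congr_norm_ae ?_
    filter_upwards [Lp.coeFn_star a, Lp.coeFn_star b] with z h1 h2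
    simp only [Pi.sub_apply, h1, h2, Pi.star_apply, ← star_sub, norm_star]
  refine continuous_iff_continuousAt.mpr fun w => tendsto_L2Triple_iff.mpr fun i => ?_
  exact (hs.comp (PiLp.continuous_apply 2 _ i)).continuousAt

lemma conjTriple_toH1 {Θ : ℝ} {v : ℂ → ℂ} (hv : IsSmoothCompact v) :
    conjTriple (toH1 Θ v hv).1 = (toH1 Θ _ hv.conj).1 := by
  obtain ⟨a0, a1, a2⟩ := toH1_coe_ae (Θ := Θ) hv
  obtain ⟨b0, b1, b2⟩ := toH1_coe_ae (Θ := Θ) hv.conj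
  refine PiLp.ext fun i => ?_
  fin_cases i
  · refine Lp.ext ?_
    filter_upwards [a0, b0, Lp.coeFn_star ((toH1 Θ v hv).1 0)] with z ha hb hc
    exact hc.trans (by simp only [Pi.star_apply]; rw [ha]; exact hb.symm)
  · refine Lp.ext ?_
    filter_upwards [a1, b1, Lp.coeFn_star ((toH1 Θ v hv).1 1)] with z ha hb hc
    refine hc.trans ?_
    simp only [Pi.star_apply]
    rw [ha]
    exact (dirDeriv_conj (hv.differentiable z) 1).symm.trans hb.symm
  · refine Lp.ext ?_
    filter_upwards [a2, b2, Lp.coeFn_star ((toH1 Θ v hv).1 2)] with z ha hb hc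
    refine hc.trans ?_
    simp only [Pi.star_apply]
    rw [ha]
    exact (dirDeriv_conj (hv.differentiable z) Complex.I).symm.trans hb.symm

lemma conjTriple_mem_H10 {Θ : ℝ} {w : L2Triple Θ} (hw : w ∈ H10 Θ) : conjTriple w ∈ H10 Θ := by
  refine map_mem_closure continuous_conjTriple hw ?_
  rintro _ ⟨v, hv, rfl⟩
  exact ⟨_, hv.conj, (conjTriple_toH1 hv.1).symm⟩

/-! ### The Helmholtz form and the Lax–Milgram theorem -/

/-- The map `(w, w₁, w₂) ↦ (a w, b w₁, b w₂)` of `L²(Ω)³`. -/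
def diagMap (Θ : ℝ) (a b : ℂ) : L2Triple Θ →L[ℂ] L2Triple Θ :=
  (PiLp.continuousLinearEquiv 2 ℂ
      (fun _ : Fin 3 => Lp ℂ 2 (sectorMeasure Θ))).symm.toContinuousLinearMap ∘L
    (ContinuousLinearMap.pi fun i : Fin 3 =>
      (![a, b, b] i) • ContinuousLinearMap.proj (R := ℂ) i) ∘L
    (PiLp.continuousLinearEquiv 2 ℂ
      (fun _ : Fin 3 => Lp ℂ 2 (sectorMeasure Θ))).toContinuousLinearMap

lemma inner_diagMap {Θ : ℝ} (a b : ℂ) (v w : L2Triple Θ) :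
    inner ℂ v (diagMap Θ a b w) =
      a * inner ℂ (v 0) (w 0) + b * inner ℂ (v 1) (w 1) + b * inner ℂ (v 2) (w 2) := by
  simp [PiLp.inner_apply, diagMap, Fin.sum_univ_three, inner_smul_right]

lemma diagMap_coercive {Θ μ₀ ρ₀ : ℝ} (hμ₀ : 0 < μ₀) (hρ₀ : 0 < ρ₀) {ω : ℂ} (hω : ω.im ≠ 0) :
    ∃ c : ℝ, 0 < c ∧ ∀ w : L2Triple Θ,
      c * ‖w‖ ^ 2 ≤ ‖inner ℂ w (diagMap Θ (ω ^ 2 * ρ₀) (-μ₀) w)‖ := by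
  have hω0 : ω ≠ 0 := by rintro rfl; simp at hω
  have hn : 0 < ‖ω‖ := norm_pos_iff.mpr hω0
  have hi : 0 < |ω.im| := abs_pos.mpr hω
  set m := min (‖ω‖ ^ 2 * ρ₀) μ₀
  have hm : 0 < m := lt_min (by positivity) hμ₀
  refine ⟨|ω.im| * m / ‖ω‖, by positivity, fun w => ?_⟩
  rw [inner_diagMap, PiLp.norm_sq_eq_of_L2, Fin.sum_univ_three]
  simp only [inner_self_eq_norm_sq_to_K]
  set A := ‖w 0‖
  set B := ‖w 1‖
  set C := ‖w 2‖
  set Z : ℂ := ω ^ 2 * ρ₀ * ((A : ℂ)) ^ 2 + -μ₀ * (B : ℂ) ^ 2 + -μ₀ * (C : ℂ) ^ 2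
  have h1 : (starRingEnd ℂ ω * Z).im = ω.im * (‖ω‖ ^ 2 * ρ₀ * A ^ 2 + μ₀ * (B ^ 2 + C ^ 2)) := by
    have : starRingEnd ℂ ω * Z = ((‖ω‖ ^ 2 * ρ₀ * A ^ 2 : ℝ) : ℂ) * ω -
        ((μ₀ * (B ^ 2 + C ^ 2) : ℝ) : ℂ) * starRingEnd ℂ ω := by
      have h2 : starRingEnd ℂ ω * ω = ((‖ω‖ ^ 2 : ℝ) : ℂ) := by
        rw [mul_comm, Complex.mul_conj, Complex.normSq_eq_norm_sq]
      calc starRingEnd ℂ ω * Z = (starRingEnd ℂ ω * ω) * (ρ₀ * (A : ℂ) ^ 2) * ω -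
            (μ₀ * ((B : ℂ) ^ 2 + (C : ℂ) ^ 2)) * starRingEnd ℂ ω := by simp only [Z]; ring
        _ = _ := by rw [h2]; push_cast; ring
    rw [this, Complex.sub_im, Complex.im_ofReal_mul, Complex.im_ofReal_mul, Complex.conj_im]
    ring
  have h3 : |ω.im| * (m * (A ^ 2 + B ^ 2 + C ^ 2)) ≤ ‖ω‖ * ‖Z‖ := by
    have h4 := Complex.abs_im_le_norm (starRingEnd ℂ ω * Z)
    rw [norm_mul, RCLike.norm_conj, h1, abs_mul] at h4
    refine le_trans (mul_le_mul_of_nonneg_left ?_ hi.le) h4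
    rw [abs_of_nonneg (by positivity)]
    have h5 : m ≤ ‖ω‖ ^ 2 * ρ₀ := min_le_left _ _
    have h6 : m ≤ μ₀ := min_le_right _ _
    nlinarith [sq_nonneg A, sq_nonneg B, sq_nonneg C,
      mul_le_mul_of_nonneg_right h5 (sq_nonneg A),
      mul_le_mul_of_nonneg_right h6 (sq_nonneg B), mul_le_mul_of_nonneg_right h6 (sq_nonneg C)]
  have h7 : |ω.im| * m / ‖ω‖ * (A ^ 2 + B ^ 2 + C ^ 2) =
      (|ω.im| * (m * (A ^ 2 + B ^ 2 + C ^ 2))) / ‖ω‖ := by ring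
  rw [h7, div_le_iff₀ hn, mul_comm ‖_‖]
  exact h3

/-- An operator whose quadratic form is bounded below in modulus is surjective. -/
lemma surjective_of_coercive {V : Type*} [NormedAddCommGroup V] [InnerProductSpace ℂ V]
    [CompleteSpace V] (T : V →L[ℂ] V) {c : ℝ} (hc : 0 < c)
    (h : ∀ v, c * ‖v‖ ^ 2 ≤ ‖inner ℂ v (T v)‖) : Function.Surjective T := by
  have hb : ∀ v, ‖v‖ ≤ c⁻¹ * ‖T v‖ := by
    intro v
    rcases eq_or_ne v 0 with rfl | hv
    · simp
    have hv' : 0 < ‖v‖ := norm_pos_iff.mpr hv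
    have h1 := (h v).trans (norm_inner_le_norm v (T v))
    rw [inv_mul_eq_div, le_div_iff₀ hc]
    nlinarith
  have hanti : AntilipschitzWith (c⁻¹).toNNReal T := by
    refine ContinuousLinearMap.antilipschitz_of_bound T fun v => ?_
    rw [Real.coe_toNNReal _ (inv_pos.mpr hc).le]
    exact hb v
  have hcl : IsClosed (T.range : Set V) := hanti.isClosed_range T.uniformContinuous
  have := hcl.completeSpace_coe
  have htop : T.range = ⊤ := by
    rw [← T.range.orthogonal_orthogonal, Submodule.eq_top_iff']
    intro v w hw
    obtain rfl : w = 0 := by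
      have h1 := h w
      have h5 : inner ℂ (T w) w = 0 := hw _ ⟨w, rfl⟩
      rw [← inner_conj_symm, RCLike.norm_conj, h5, norm_zero] at h1
      have h2 : ‖w‖ ^ 2 ≤ 0 := by nlinarith
      have : ‖w‖ = 0 := pow_eq_zero_iff two_ne_zero |>.mp (le_antisymm h2 (sq_nonneg _))
      exact norm_eq_zero.mp this
    exact inner_zero_left _
  exact LinearMap.range_eq_top.mp htop

/-- Solvability of the Helmholtz equation in `H¹₀(Ω)`, in the weak form. -/
lemma exists_weak_solution {Θ μ₀ ρ₀ : ℝ} (hμ₀ : 0 < μ₀) (hρ₀ : 0 < ρ₀) {ω : ℂ} (hω : ω.im ≠ 0)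
    (F : StrongDual ℂ (H10 Θ)) :
    ∃ w ∈ H10 Θ, ∀ v : H10 Θ,
      inner ℂ (conjTriple v.1) (diagMap Θ (ω ^ 2 * ρ₀) (-μ₀) w) = F v := by
  obtain ⟨c, hc, hcoer⟩ := diagMap_coercive (Θ := Θ) hμ₀ hρ₀ hω
  set S := diagMap Θ (ω ^ 2 * ρ₀) (-μ₀)
  have : (H10 Θ).HasOrthogonalProjection := inferInstance
  let T : H10 Θ →L[ℂ] H10 Θ := (H10 Θ).orthogonalProjectionOnto ∘L S ∘L (H10 Θ).subtypeL
  have hT : ∀ v w : H10 Θ, inner ℂ v (T w) = inner ℂ (v : L2Triple Θ) (S w) := fun v w => by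
    simp only [T, ContinuousLinearMap.comp_apply]
    rw [← Submodule.inner_orthogonalProjectionOnto_eq_of_mem_left]
    rfl
  have hsurj : Function.Surjective T := by
    refine surjective_of_coercive T hc fun v => ?_
    rw [hT]
    exact hcoer v
  let y := (InnerProductSpace.toDual ℂ (H10 Θ)).symm F
  obtain ⟨w, hw⟩ := hsurj ⟨conjTriple y.1, conjTriple_mem_H10 y.2⟩
  refine ⟨w.1, w.2, fun v => ?_⟩
  have h1 := hT ⟨conjTriple v.1, conjTriple_mem_H10 v.2⟩ w
  rw [hw] at h1
  rw [← h1, Submodule.coe_inner, inner_conjTriple_right, conjTriple_conjTriple]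
  have h2 : inner ℂ y v = F v := InnerProductSpace.toDual_symm_apply
  rw [← h2, Submodule.coe_inner]

/-- Uniqueness for the Helmholtz equation in `H¹₀(Ω)`, in the weak form. -/
lemma weak_solution_unique {Θ μ₀ ρ₀ : ℝ} (hμ₀ : 0 < μ₀) (hρ₀ : 0 < ρ₀) {ω : ℂ} (hω : ω.im ≠ 0)
    {w : L2Triple Θ} (hw : w ∈ H10 Θ)
    (h : ∀ (v : ℂ → ℂ) (hv : IsTest Θ v),
      inner ℂ (conjTriple (toH1 Θ v hv.1).1) (diagMap Θ (ω ^ 2 * ρ₀) (-μ₀) w) = 0) : w = 0 := by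
  obtain ⟨c, hc, hcoer⟩ := diagMap_coercive (Θ := Θ) hμ₀ hρ₀ hω
  have h1 : ∀ v ∈ H10 Θ, inner ℂ (conjTriple v) (diagMap Θ (ω ^ 2 * ρ₀) (-μ₀) w) = 0 := by
    intro v hv
    have hcl : IsClosed {v : L2Triple Θ |
        inner ℂ (conjTriple v) (diagMap Θ (ω ^ 2 * ρ₀) (-μ₀) w) = 0} :=
      isClosed_eq (continuous_conjTriple.inner continuous_const) continuous_const
    refine hcl.closure_subset_iff.mpr ?_ hv
    rintro _ ⟨v, hv, rfl⟩
    exact h v hv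
  have h2 := h1 _ (conjTriple_mem_H10 hw)
  rw [conjTriple_conjTriple] at h2
  have h3 := hcoer w
  rw [h2, norm_zero] at h3
  have h4 : ‖w‖ ^ 2 ≤ 0 := by nlinarith
  exact norm_eq_zero.mp (pow_eq_zero_iff two_ne_zero |>.mp (le_antisymm h4 (sq_nonneg _)))

/-- The distributional form of the Helmholtz equation for a function of `H¹(Ω)`. -/
lemma integral_helmholtz_eq {Θ μ₀ ρ₀ : ℝ} {ω : ℂ} (w : H1 Θ) {v : ℂ → ℂ} (hv : IsTest Θ v) :
    ∫ z, w.1 0 z * (μ₀ * Laplacian.laplacian v z + ω ^ 2 * ρ₀ * v z) ∂(sectorMeasure Θ) =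
      inner ℂ (conjTriple (toH1 Θ v hv.1).1) (diagMap Θ (ω ^ 2 * ρ₀) (-μ₀) w.1) := by
  rw [inner_diagMap]
  obtain ⟨b0, b1, b2⟩ := toH1_coe_ae (Θ := Θ) hv.1
  have e0 : inner ℂ (conjTriple (toH1 Θ v hv.1).1 0) (w.1 0) =
      ∫ z, w.1 0 z * v z ∂(sectorMeasure Θ) := by
    refine (L2_inner_eq_integral _ _).trans (integral_congr_ae ?_)
    filter_upwards [b0] with z hz; rw [hz]
  have e1 : inner ℂ (conjTriple (toH1 Θ v hv.1).1 1) (w.1 1) =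
      ∫ z, w.1 1 z * dirDeriv 1 v z ∂(sectorMeasure Θ) := by
    refine (L2_inner_eq_integral _ _).trans (integral_congr_ae ?_)
    filter_upwards [b1] with z hz; rw [hz]
  have e2 : inner ℂ (conjTriple (toH1 Θ v hv.1).1 2) (w.1 2) =
      ∫ z, w.1 2 z * dirDeriv Complex.I v z ∂(sectorMeasure Θ) := by
    refine (L2_inner_eq_integral _ _).trans (integral_congr_ae ?_)
    filter_upwards [b2] with z hz; rw [hz]
  rw [e0, e1, e2]
  have d1 := w.2.1 _ (hv.dirDeriv 1)
  have d2 := w.2.2 _ (hv.dirDeriv Complex.I)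
  have i0 : Integrable (fun z => w.1 0 z * v z) (sectorMeasure Θ) :=
    (Lp.memLp (w.1 0)).integrable_mul (hv.1.memLp Θ 2)
  have i1 : Integrable (fun z => w.1 0 z * dirDeriv 1 (dirDeriv 1 v) z) (sectorMeasure Θ) :=
    (Lp.memLp (w.1 0)).integrable_mul ((hv.1.dirDeriv 1).memLp_dirDeriv Θ 2 1)
  have i2 : Integrable (fun z => w.1 0 z * dirDeriv Complex.I (dirDeriv Complex.I v) z)
      (sectorMeasure Θ) :=
    (Lp.memLp (w.1 0)).integrable_mul ((hv.1.dirDeriv Complex.I).memLp_dirDeriv Θ 2 Complex.I)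
  have hL : ∀ z, w.1 0 z * (μ₀ * Laplacian.laplacian v z + ω ^ 2 * ρ₀ * v z) =
      μ₀ * (w.1 0 z * dirDeriv 1 (dirDeriv 1 v) z) +
      μ₀ * (w.1 0 z * dirDeriv Complex.I (dirDeriv Complex.I v) z) +
      ω ^ 2 * ρ₀ * (w.1 0 z * v z) := by
    intro z
    rw [laplacian_eq_dirDeriv (hv.1.1.contDiffAt.of_le (by norm_cast))]
    ring
  simp_rw [hL]
  have i12 : Integrable (fun z => μ₀ * (w.1 0 z * dirDeriv 1 (dirDeriv 1 v) z) +
      μ₀ * (w.1 0 z * dirDeriv Complex.I (dirDeriv Complex.I v) z)) (sectorMeasure Θ) :=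
    (i1.const_mul _).add (i2.const_mul _)
  rw [integral_add i12 (i0.const_mul _), integral_add (i1.const_mul _) (i2.const_mul _), integral_const_mul, integral_const_mul,
    integral_const_mul, d1, d2]
  ring

/-! ### Traces -/

lemma IsTrace.congr {Θ θ : ℝ} {w : H1 Θ} {t t' : ℝ → ℂ} (h : IsTrace Θ θ w t)
    (ht : t =ᵐ[rayMeasure] t') : IsTrace Θ θ w t' := by
  obtain ⟨h1, v, hv, h2, h3⟩ := h
  refine ⟨(memLp_congr_ae ht).mp h1, v, hv, h2, h3.congr fun n => eLpNorm_congr_ae ?_⟩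
  filter_upwards [ht] with r hr
  rw [hr]

lemma IsSmoothCompact.memLp_ray {v : ℂ → ℂ} (hv : IsSmoothCompact v) (θ : ℝ) :
    MemLp (fun r => v (rayPoint θ r)) 2 rayMeasure := by
  have hc : Continuous fun r : ℝ => v (rayPoint θ r) := by
    refine hv.continuous.comp ?_
    unfold rayPoint
    fun_prop
  refine (hc.memLp_of_hasCompactSupport ?_).restrict _
  obtain ⟨R, hR⟩ := hv.2.isCompact.isBounded.subset_closedBall 0
  refine HasCompactSupport.of_support_subset_isCompact (isCompact_Icc (a := -R) (b := R)) ?_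
  intro r hr
  have h1 := hR (subset_tsupport _ hr)
  rw [mem_closedBall_zero_iff, rayPoint, norm_mul, Complex.norm_exp_ofReal_mul_I, mul_one,
    Complex.norm_real, Real.norm_eq_abs, abs_le] at h1
  exact h1

lemma IsTrace.add {Θ θ : ℝ} {w w' : H1 Θ} {t t' : ℝ → ℂ} (h : IsTrace Θ θ w t)
    (h' : IsTrace Θ θ w' t') : IsTrace Θ θ (w + w') (t + t') := by
  obtain ⟨h1, v, hv, h2, h3⟩ := h
  obtain ⟨h1', v', hv', h2', h3'⟩ := h'
  refine ⟨h1.add h1', fun n => v n + v' n, fun n => (hv n).add (hv' n), ?_, ?_⟩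
  · simp_rw [toH1_add (hv _) (hv' _)]
    exact h2.add h2'
  · have h4 := h3.add h3'
    rw [add_zero] at h4
    refine tendsto_of_tendsto_of_tendsto_of_le_of_le tendsto_const_nhds h4
      (fun _ => zero_le) fun n => ?_
    refine le_trans (le_of_eq (eLpNorm_congr_ae (.of_forall fun r => ?_)))
      (eLpNorm_add_le (((hv n).memLp_ray θ).sub h1).1 (((hv' n).memLp_ray θ).sub h1').1 (by simp))
    simp only [Pi.add_apply]
    ring

lemma IsTrace.smul {Θ θ : ℝ} (c : ℂ) {w : H1 Θ} {t : ℝ → ℂ} (h : IsTrace Θ θ w t) :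
    IsTrace Θ θ (c • w) (c • t) := by
  obtain ⟨h1, v, hv, h2, h3⟩ := h
  refine ⟨h1.const_smul c, fun n => c • v n, fun n => (hv n).smul c, ?_, ?_⟩
  · simp_rw [toH1_smul c (hv _)]
    exact h2.const_smul c
  · have h4 := ENNReal.Tendsto.const_mul (a := ‖c‖ₑ) h3 (Or.inr (by simp))
    rw [mul_zero] at h4
    refine h4.congr fun n => ?_
    rw [← eLpNorm_const_smul]
    refine eLpNorm_congr_ae (.of_forall fun r => ?_)
    simp only [Pi.smul_apply, smul_eq_mul]
    ring

lemma IsTrace.sub {Θ θ : ℝ} {w w' : H1 Θ} {t t' : ℝ → ℂ} (h : IsTrace Θ θ w t)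
    (h' : IsTrace Θ θ w' t') : IsTrace Θ θ (w - w') (t - t') := by
  have := h.add (h'.smul (-1))
  simpa [sub_eq_add_neg] using this

/-- The graph of the trace is closed. -/
lemma IsTrace.of_tendsto {Θ θ : ℝ} {w : ℕ → H1 Θ} {t : ℕ → ℝ → ℂ} {w' : H1 Θ} {t' : ℝ → ℂ}
    (h : ∀ n, IsTrace Θ θ (w n) (t n)) (hw : Tendsto w atTop (𝓝 w')) (ht' : MemLp t' 2 rayMeasure)
    (ht : Tendsto (fun n => eLpNorm (fun r => t n r - t' r) 2 rayMeasure) atTop (𝓝 0)) :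
    IsTrace Θ θ w' t' := by
  have key : ∀ n : ℕ, ∃ (v : ℂ → ℂ) (hv : IsSmoothCompact v),
      edist (toH1 Θ v hv) (w n) < ((n : ℝ≥0∞) + 1)⁻¹ ∧
      eLpNorm (fun r => v (rayPoint θ r) - t n r) 2 rayMeasure < ((n : ℝ≥0∞) + 1)⁻¹ := by
    intro n
    obtain ⟨h1, v, hv, h2, h3⟩ := h n
    have hpos : (0 : ℝ≥0∞) < ((n : ℝ≥0∞) + 1)⁻¹ := by
      rw [ENNReal.inv_pos]; exact ENNReal.add_ne_top.mpr ⟨by simp, by simp⟩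
    obtain ⟨m, hm1, hm2⟩ := (((tendsto_iff_edist_tendsto_0.mp h2).eventually
      (gt_mem_nhds hpos)).and (h3.eventually (gt_mem_nhds hpos))).exists
    exact ⟨v m, hv m, hm1, hm2⟩
  choose v hv h1 h2 using key
  have hz : Tendsto (fun n : ℕ => ((n : ℝ≥0∞) + 1)⁻¹) atTop (𝓝 0) := by
    have := (tendsto_add_atTop_iff_nat 1).mpr ENNReal.tendsto_inv_nat_nhds_zero
    simpa using this
  refine ⟨ht', v, hv, ?_, ?_⟩
  · rw [tendsto_iff_edist_tendsto_0] at hw ⊢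
    have h4 := hz.add hw
    rw [add_zero] at h4
    exact tendsto_of_tendsto_of_tendsto_of_le_of_le tendsto_const_nhds h4
      (fun _ => zero_le) fun n => (edist_triangle _ (w n) _).trans (add_le_add (h1 n).le le_rfl)
  · have h4 := hz.add ht
    rw [add_zero] at h4
    refine tendsto_of_tendsto_of_tendsto_of_le_of_le tendsto_const_nhds h4
      (fun _ => zero_le) fun n => ?_
    have h5 := eLpNorm_add_le (((hv n).memLp_ray θ).sub (h n).1).1 ((h n).1.sub ht').1
      (p := 2) (by simp)
    refine le_trans (le_of_eq (eLpNorm_congr_ae (.of_forall fun r => ?_)))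
      (h5.trans (add_le_add (h2 n).le le_rfl))
    simp

lemma rayPoint_notMem_sector {Θ : ℝ} (hΘ₀ : 0 < Θ) (hΘ : Θ < 2 * Real.pi) {θ r : ℝ}
    (hθ : θ = 0 ∨ θ = Θ) (hr : 0 < r) : rayPoint θ r ∉ sector Θ := by
  intro h
  have h1 := lg_mem_strip hΘ h
  rw [rayPoint_eq_exp _ hr, lg_exp] at h1
  · rcases hθ with rfl | rfl
    · simpa using h1.1
    · simpa using h1.2
  · have : ((Real.log r : ℂ) + θ * Complex.I).im = θ := by simp
    rw [this]
    rcases hθ with rfl | rfl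
    · exact abs_sub_half_lt hΘ le_rfl hΘ₀.le
    · exact abs_sub_half_lt hΘ hΘ₀.le le_rfl

lemma isTrace_zero_of_mem_H10 {Θ : ℝ} (hΘ₀ : 0 < Θ) (hΘ : Θ < 2 * Real.pi) {θ : ℝ}
    (hθ : θ = 0 ∨ θ = Θ) (w : H1 Θ) (hw : w.1 ∈ H10 Θ) : IsTrace Θ θ w 0 := by
  obtain ⟨x, hx, hlim⟩ := mem_closure_iff_seq_limit.mp
    (show w.1 ∈ closure (testSubmodule Θ : Set (L2Triple Θ)) from hw)
  choose v hv hvx using hx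
  refine ⟨MemLp.zero, v, fun n => (hv n).1, ?_, ?_⟩
  · rw [tendsto_subtype_rng]
    simpa only [hvx] using hlim
  · refine tendsto_const_nhds.congr fun n => ?_
    refine (eLpNorm_zero (p := 2) (μ := rayMeasure) (α := ℝ) (ε := ℂ)).symm.trans
      (eLpNorm_congr_ae ?_)
    filter_upwards [ae_restrict_mem measurableSet_Ioi] with r hr
    have : v n (rayPoint θ r) = 0 := by
      by_contra h0
      exact rayPoint_notMem_sector hΘ₀ hΘ hθ hr ((hv n).2 (subset_tsupport _ h0))
    simp [this]

/-! ### Singular functions in logarithmic polar coordinates -/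

/-- The function `Im [e^{q L + k conj L} P(L)]` with `L = ζ - iΘ`. -/
def singStrip (Θ q : ℝ) (k : ℕ) (P : ℝ[X]) (ζ : ℂ) : ℂ :=
  ((Complex.exp (q * (ζ - Θ * Complex.I) + k * (starRingEnd ℂ) (ζ - Θ * Complex.I)) *
    aeval (ζ - Θ * Complex.I) P).im : ℂ)

lemma sing_exp {Θ q : ℝ} {k : ℕ} {P : ℝ[X]} {ζ : ℂ} (h0 : 0 ≤ ζ.im) (h1 : ζ.im < 2 * Real.pi) :
    sing Θ q k P (Complex.exp ζ) = singStrip Θ q k P ζ := by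
  unfold sing singStrip
  rw [polarAngle_exp h0 h1, Complex.norm_exp, Real.log_exp, ← Real.exp_mul, ← Real.exp_nat_mul,
    Complex.ofReal_exp, Complex.ofReal_exp, ← Complex.exp_add, ← Complex.exp_add,
    ← Complex.exp_add]
  have e1 : (ζ.re : ℂ) + (ζ.im - Θ) * Complex.I = ζ - Θ * Complex.I := by
    conv_rhs => rw [← Complex.re_add_im ζ]
    ring
  rw [e1]
  congr 4
  have e2 : (starRingEnd ℂ) (ζ - Θ * Complex.I) = ζ.re - (ζ.im - Θ) * Complex.I := by
    apply Complex.ext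
    · simp
    · simp; ring
  rw [e2, ← e1]
  push_cast
  ring

/-- `φ(e^{s+iθ}) = e^{ds} ∑_{j<N} s^j a_j(θ)` on the closed sector, with smooth `a_j` vanishing on
the side of direction `Θ`. -/
structure HasLogExpansion (Θ d : ℝ) (φ : ℂ → ℂ) (N : ℕ) (a : ℕ → ℝ → ℂ) : Prop where
  smooth : ∀ j, ContDiff ℝ (⊤ : ℕ∞) (a j)
  apply_top : ∀ j, a j Θ = 0
  vanish : ∀ j, N ≤ j → a j = 0
  eq : ∀ ζ : ℂ, 0 ≤ ζ.im → ζ.im < 2 * Real.pi → φ (Complex.exp ζ) =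
    (Real.exp (d * ζ.re) : ℂ) * ∑ j ∈ Finset.range N, (ζ.re : ℂ) ^ j * a j ζ.im

lemma HasLogExpansion.mono {Θ d : ℝ} {φ : ℂ → ℂ} {N M : ℕ} {a : ℕ → ℝ → ℂ}
    (h : HasLogExpansion Θ d φ N a) (hNM : N ≤ M) : HasLogExpansion Θ d φ M a := by
  refine ⟨h.smooth, h.apply_top, fun j hj => h.vanish j (hNM.trans hj), fun ζ h0 h1 => ?_⟩
  rw [h.eq ζ h0 h1, ← Finset.sum_subset (Finset.range_subset_range.mpr hNM)]
  intro j _ hj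
  rw [h.vanish j (by simpa using hj)]
  simp

lemma hasLogExpansion_sing (Θ q : ℝ) (k : ℕ) (P : ℝ[X]) :
    ∃ N a, HasLogExpansion Θ (q + k) (sing Θ q k P) N a := by
  let Pc : ℂ[X] := P.map (algebraMap ℝ ℂ)
  let a : ℕ → ℝ → ℂ := fun j θ =>
    ((Complex.exp ((q - k) * ((θ - Θ : ℝ) * Complex.I)) *
      (hasseDeriv j Pc).eval ((θ - Θ : ℝ) * Complex.I)).im : ℂ)
  refine ⟨Pc.natDegree + 1, a, ?_, ?_, ?_, ?_⟩
  · intro j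
    have h1 : ContDiff ℝ (⊤ : ℕ∞) fun θ : ℝ => (((θ - Θ : ℝ) : ℂ) * Complex.I) :=
      (Complex.ofRealCLM.contDiff.comp (contDiff_id.sub contDiff_const)).mul contDiff_const
    have h2 : ContDiff ℝ (⊤ : ℕ∞) fun z : ℂ => (hasseDeriv j Pc).eval z := by
      have h := Polynomial.contDiff_aeval (𝕜 := ℂ) (hasseDeriv j Pc) (⊤ : ℕ∞)
      simp only [coe_aeval_eq_eval] at h
      exact h.restrict_scalars ℝ
    have h3 : ContDiff ℝ (⊤ : ℕ∞) Complex.exp := Complex.contDiff_exp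
    exact Complex.ofRealCLM.contDiff.comp (Complex.imCLM.contDiff.comp
      ((h3.comp (contDiff_const.mul h1)).mul (h2.comp h1)))
  · intro j
    simp only [a, sub_self, Complex.ofReal_zero, zero_mul, mul_zero, Complex.exp_zero, one_mul]
    rw [← taylor_coeff, taylor_zero]
    simp [Pc]
  · intro j hj
    ext θ
    have : hasseDeriv j Pc = 0 := by
      refine Polynomial.ext fun n => ?_
      rw [hasseDeriv_coeff, coeff_eq_zero_of_natDegree_lt (by omega)]
      simp
    simp [a, this]
  · intro ζ h0 h1
    rw [sing_exp h0 h1, singStrip]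
    have hL : ζ - Θ * Complex.I = (ζ.re : ℂ) + (ζ.im - Θ : ℝ) * Complex.I := by
      conv_lhs => rw [← Complex.re_add_im ζ]
      push_cast; ring
    have hP : aeval (ζ - Θ * Complex.I) P = ∑ j ∈ Finset.range (Pc.natDegree + 1),
        (hasseDeriv j Pc).eval ((ζ.im - Θ : ℝ) * Complex.I) * (ζ.re : ℂ) ^ j := by
      have e1 : aeval (ζ - Θ * Complex.I) P = Pc.eval (ζ - Θ * Complex.I) := by
        rw [aeval_def, eval_map]
      have e2 := taylor_eval ((ζ.im - Θ : ℝ) * Complex.I) Pc (ζ.re : ℂ)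
      rw [e1, hL, ← e2, eval_eq_sum_range, natDegree_taylor]
      simp_rw [taylor_coeff]
    have hE : Complex.exp (q * (ζ - Θ * Complex.I) + k * (starRingEnd ℂ) (ζ - Θ * Complex.I)) =
        (Real.exp ((q + k) * ζ.re) : ℂ) *
          Complex.exp ((q - k) * ((ζ.im - Θ : ℝ) * Complex.I)) := by
      rw [Complex.ofReal_exp, ← Complex.exp_add, hL]
      congr 1
      simp only [map_add, map_mul, Complex.conj_ofReal, Complex.conj_I]
      push_cast; ring
    rw [hP, hE, mul_assoc, Complex.im_ofReal_mul, Finset.mul_sum, Complex.im_sum]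
    push_cast
    congr 1
    refine Finset.sum_congr rfl fun j _ => ?_
    rw [← mul_assoc, ← Complex.ofReal_pow, Complex.im_mul_ofReal]
    simp only [a]
    push_cast
    ring

lemma hasLogExpansion_of_mem {Θ d : ℝ} {φ : ℂ → ℂ} (hφ : φ ∈ singDeg Θ d) :
    ∃ N a, HasLogExpansion Θ d φ N a := by
  induction hφ using Submodule.span_induction with
  | mem φ h =>
    obtain ⟨q, k, P, rfl, rfl⟩ := h
    exact hasLogExpansion_sing Θ q k P
  | zero => exact ⟨0, 0, fun _ => contDiff_const, fun _ => rfl, fun _ _ => rfl, by simp⟩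
  | add φ φ' _ _ h h' =>
    obtain ⟨N, a, h⟩ := h
    obtain ⟨N', a', h'⟩ := h'
    have h := h.mono (le_max_left N N')
    have h' := h'.mono (le_max_right N N')
    refine ⟨max N N', fun j => a j + a' j, fun j => (h.smooth j).add (h'.smooth j), fun j => ?_,
      fun j hj => ?_, fun ζ h0 h1 => ?_⟩
    · simp [h.apply_top, h'.apply_top]
    · simp only [h.vanish j hj, h'.vanish j hj, add_zero]
    · simp only [Pi.add_apply, h.eq ζ h0 h1, h'.eq ζ h0 h1, mul_add, Finset.sum_add_distrib]
  | smul c φ _ h =>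
    obtain ⟨N, a, h⟩ := h
    refine ⟨N, fun j => c • a j, fun j => (h.smooth j).const_smul c, fun j => ?_,
      fun j hj => ?_, fun ζ h0 h1 => ?_⟩
    · simp [h.apply_top]
    · simp only [h.vanish j hj, smul_zero]
    · simp only [Pi.smul_apply, h.eq ζ h0 h1, smul_eq_mul, Finset.mul_sum]
      exact Finset.sum_congr rfl fun j _ => by ring

/-- Every singular function is a finite sum of its homogeneous parts. -/
lemma exists_homogeneous_parts {Θ : ℝ} {φ : ℂ → ℂ} (hφ : φ ∈ singSpace Θ) :
    ∃ f : ℝ →₀ (ℂ → ℂ), (∀ d, f d ∈ singDeg Θ d) ∧ f.sum (fun _ x => x) = φ :=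
  (Submodule.mem_iSup_iff_exists_finsupp _ _).mp hφ

lemma singDeg_le_singSpace (Θ d : ℝ) : singDeg Θ d ≤ singSpace Θ := le_iSup (singDeg Θ) d

lemma sing_mem_singDeg {Θ q d : ℝ} {k : ℕ} {P : ℝ[X]} (h : q + k = d) :
    sing Θ q k P ∈ singDeg Θ d := Submodule.subset_span ⟨q, k, P, h, rfl⟩

lemma singSpace_rayPoint_top {Θ : ℝ} (hΘ₀ : 0 < Θ) (hΘ : Θ < 2 * Real.pi) {φ : ℂ → ℂ}
    (hφ : φ ∈ singSpace Θ) {r : ℝ} (hr : 0 < r) : φ (rayPoint Θ r) = 0 := by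
  obtain ⟨f, hf, rfl⟩ := exists_homogeneous_parts hφ
  rw [Finsupp.sum, Finset.sum_apply]
  refine Finset.sum_eq_zero fun d _ => ?_
  obtain ⟨N, a, h⟩ := hasLogExpansion_of_mem (hf d)
  rw [rayPoint_eq_exp _ hr, h.eq _ (by simp; linarith) (by simp; linarith)]
  simp [h.apply_top]

/-! ### The linear forms `σ_d` -/

/-- The finite sum of singular functions with coefficients `c`. -/
def singSum (Θ : ℝ) (c : (ℝ × ℕ × ℝ[X]) →₀ ℂ) : ℂ → ℂ :=
  c.sum fun i a => a • sing Θ i.1 i.2.1 i.2.2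

open Classical in
/-- The value of `σ_d` read on the coefficients of a finite sum of singular functions. -/
def sigmaCoeff (d : ℝ) (c : (ℝ × ℕ × ℝ[X]) →₀ ℂ) : ℂ :=
  c.sum fun i a => a * (if i.1 = d ∧ i.2.1 = 0 then ((i.2.2.eval 0 : ℝ) : ℂ) else 0)

lemma singSum_add (Θ : ℝ) (c c' : (ℝ × ℕ × ℝ[X]) →₀ ℂ) :
    singSum Θ (c + c') = singSum Θ c + singSum Θ c' :=
  Finsupp.sum_add_index' (by simp) (by intros; simp [add_smul])

lemma singSum_smul (Θ : ℝ) (a : ℂ) (c : (ℝ × ℕ × ℝ[X]) →₀ ℂ) :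
    singSum Θ (a • c) = a • singSum Θ c := by
  rw [singSum, Finsupp.sum_smul_index (by simp), singSum, Finsupp.smul_sum]
  simp_rw [mul_smul]

lemma singSum_single (Θ : ℝ) (i : ℝ × ℕ × ℝ[X]) (a : ℂ) :
    singSum Θ (Finsupp.single i a) = a • sing Θ i.1 i.2.1 i.2.2 :=
  Finsupp.sum_single_index (by simp)

lemma sigmaCoeff_add (d : ℝ) (c c' : (ℝ × ℕ × ℝ[X]) →₀ ℂ) :
    sigmaCoeff d (c + c') = sigmaCoeff d c + sigmaCoeff d c' :=
  Finsupp.sum_add_index' (by simp) (by intros; rw [add_mul])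

lemma sigmaCoeff_smul (d : ℝ) (a : ℂ) (c : (ℝ × ℕ × ℝ[X]) →₀ ℂ) :
    sigmaCoeff d (a • c) = a * sigmaCoeff d c := by
  rw [sigmaCoeff, Finsupp.sum_smul_index (by simp), sigmaCoeff, Finsupp.mul_sum]
  simp_rw [mul_assoc]

open Classical in
lemma sigmaCoeff_single (d : ℝ) (i : ℝ × ℕ × ℝ[X]) (a : ℂ) :
    sigmaCoeff d (Finsupp.single i a) =
      a * (if i.1 = d ∧ i.2.1 = 0 then ((i.2.2.eval 0 : ℝ) : ℂ) else 0) :=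
  Finsupp.sum_single_index (by simp)

/-- Analytic continuation in the angle of a relation between singular functions. -/
lemma real_relation_of_singSum_eq_zero {Θ : ℝ} (hΘ₀ : 0 < Θ) (hΘ : Θ < 2 * Real.pi)
    {c : (ℝ × ℕ × ℝ[X]) →₀ ℂ} (h : ∀ z ∈ sector Θ, singSum Θ c z = 0) (a b : ℝ) :
    ∑ i ∈ c.support, c i * ((Real.exp (i.1 * a + i.2.1 * b) : ℂ) * (i.2.2.eval a : ℝ) -
      (Real.exp (i.1 * b + i.2.1 * a) : ℂ) * (i.2.2.eval b : ℝ)) = 0 := by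
  set s : ℝ := (a + b) / 2 with hs
  let H : ℂ → ℂ := fun φ => ∑ i ∈ c.support, c i *
    (Complex.exp ((i.1 + i.2.1) * s + (i.1 - i.2.1) * (φ * Complex.I)) *
        aeval (s + φ * Complex.I) i.2.2 -
      Complex.exp ((i.1 + i.2.1) * s - (i.1 - i.2.1) * (φ * Complex.I)) *
        aeval (s - φ * Complex.I) i.2.2)
  have hpol : ∀ P : ℝ[X], Differentiable ℂ fun z : ℂ => aeval z P := by
    intro P
    have : (fun z : ℂ => aeval z P) = fun z => (P.map (algebraMap ℝ ℂ)).eval z := by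
      ext z; rw [aeval_def, eval_map]
    rw [this]
    exact Polynomial.differentiable _
  have hHd : Differentiable ℂ H := by
    refine Differentiable.fun_sum fun i _ => ?_
    have d1 : Differentiable ℂ fun φ : ℂ => (s : ℂ) + φ * Complex.I := by fun_prop
    have d2 : Differentiable ℂ fun φ : ℂ => (s : ℂ) - φ * Complex.I := by fun_prop
    have d3 := (hpol i.2.2).comp d1
    have d4 := (hpol i.2.2).comp d2
    simp only [Function.comp_def] at d3 d4
    fun_prop
  have hH0 : ∀ φ : ℝ, -Θ < φ → φ < 0 → H φ = 0 := by
    intro φ h1 h2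
    have hmem : (s : ℂ) + (φ + Θ : ℝ) * Complex.I ∈ strip Θ := by
      constructor
      · simp; linarith
      · simp; linarith
    have h3 := h _ (exp_mem_sector hmem)
    rw [singSum, Finsupp.sum, Finset.sum_apply] at h3
    have h4 : H φ = 2 * Complex.I * ∑ i ∈ c.support,
        (c i • sing Θ i.1 i.2.1 i.2.2) (Complex.exp (s + (φ + Θ : ℝ) * Complex.I)) := by
      rw [Finset.mul_sum]
      refine Finset.sum_congr rfl fun i _ => ?_
      rw [Pi.smul_apply, sing_exp (by simp; linarith) (by simp; linarith), singStrip]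
      have e1 : (s : ℂ) + (φ + Θ : ℝ) * Complex.I - Θ * Complex.I = s + φ * Complex.I := by
        push_cast; ring
      have e2 : (starRingEnd ℂ) ((s : ℂ) + φ * Complex.I) = s - φ * Complex.I := by
        simp; ring
      rw [e1, e2]
      have e3 : ∀ w : ℂ, 2 * Complex.I * (w.im : ℂ) = w - starRingEnd ℂ w := by
        intro w
        rw [Complex.sub_conj]; push_cast; ring
      rw [smul_eq_mul, mul_left_comm (2 * Complex.I), e3, map_mul, ← Complex.exp_conj]
      have e4 : (starRingEnd ℂ) (aeval ((s : ℂ) + φ * Complex.I) i.2.2) =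
          aeval ((s : ℂ) - φ * Complex.I) i.2.2 := by
        rw [← e2, aeval_conj]
      rw [e4]
      simp only [map_add, map_mul, map_sub, Complex.conj_ofReal, Complex.conj_I, map_natCast]
      congr 3
      · congr 1; ring
      · congr 1; ring
    rw [h4, h3, mul_zero]
  have hzero : ∀ φ : ℂ, H φ = 0 := by
    have hA : AnalyticOnNhd ℂ H univ := fun z _ => hHd.analyticAt z
    have hfreq : ∃ᶠ z in 𝓝[≠] ((-(Θ / 2) : ℝ) : ℂ), H z = 0 := by
      have ht : Tendsto (fun x : ℝ => (x : ℂ)) (𝓝[≠] (-(Θ / 2))) (𝓝[≠] ((-(Θ / 2) : ℝ) : ℂ)) := by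
        refine tendsto_nhdsWithin_of_tendsto_nhds_of_eventually_within _
          ((Complex.continuous_ofReal.tendsto _).mono_left nhdsWithin_le_nhds) ?_
        filter_upwards [self_mem_nhdsWithin] with x hx
        exact fun hx' => hx (Complex.ofReal_injective hx')
      refine ht.frequently (Eventually.frequently ?_)
      filter_upwards [mem_nhdsWithin_of_mem_nhds
        (Ioo_mem_nhds (show -Θ < -(Θ / 2) by linarith) (show -(Θ / 2) < 0 by linarith))] with x hx
      exact hH0 x hx.1 hx.2
    have := hA.eqOn_zero_of_preconnected_of_frequently_eq_zero isPreconnected_univ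
      (mem_univ _) hfreq
    exact fun φ => this (mem_univ φ)
  have h5 := hzero (-((a - b) / 2 : ℝ) * Complex.I)
  have e5 : (-((a - b) / 2 : ℝ) * Complex.I) * Complex.I = (((a - b) / 2 : ℝ) : ℂ) := by
    rw [mul_assoc, Complex.I_mul_I]; ring
  simp only [H, e5] at h5
  rw [← h5]
  refine Finset.sum_congr rfl fun i _ => ?_
  have e6 : (s : ℂ) + ((a - b) / 2 : ℝ) = (a : ℂ) := by rw [hs]; push_cast; ring
  have e7 : (s : ℂ) - ((a - b) / 2 : ℝ) = (b : ℂ) := by rw [hs]; push_cast; ring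
  have e8 : ∀ x : ℝ, aeval (x : ℂ) i.2.2 = ((i.2.2.eval x : ℝ) : ℂ) := by
    intro x
    exact aeval_ofReal i.2.2 x
  rw [e6, e7, e8, e8, Complex.ofReal_exp, Complex.ofReal_exp]
  congr 4
  · rw [hs]; push_cast; ring
  · rw [hs]; push_cast; ring

lemma sigmaCoeff_eq_zero {Θ d : ℝ} (hΘ₀ : 0 < Θ) (hΘ : Θ < 2 * Real.pi) (hd : d < 0)
    {c : (ℝ × ℕ × ℝ[X]) →₀ ℂ} (h : ∀ z ∈ sector Θ, singSum Θ c z = 0) : sigmaCoeff d c = 0 := by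
  classical
  have hrel := real_relation_of_singSum_eq_zero hΘ₀ hΘ h
  have step1 : ∀ a : ℝ, ∑ i ∈ c.support, c i *
      ((if i.2.1 = 0 then (Real.exp (i.1 * a) : ℂ) * (i.2.2.eval a : ℝ) else 0) -
       (if i.1 = 0 then (Real.exp (i.2.1 * a) : ℂ) * (i.2.2.eval 0 : ℝ) else 0)) = 0 := by
    intro a
    let p : ℝ →₀ ℂ[X] := ∑ i ∈ c.support,
      (Finsupp.single (i.2.1 : ℝ) (C (c i * ((Real.exp (i.1 * a) : ℂ) * (i.2.2.eval a : ℝ)))) +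
        Finsupp.single i.1 (C (-(c i * (Real.exp (i.2.1 * a) : ℂ))) *
          i.2.2.map (algebraMap ℝ ℂ)))
    have hp : p = 0 := by
      refine expPoly_eq_zero_of_forall fun b => ?_
      rw [← hrel a b, expPoly_finset_sum]
      refine Finset.sum_congr rfl fun i _ => ?_
      rw [expPoly_add, expPoly_single, expPoly_single, eval_C, eval_mul, eval_C,
        show (b : ℂ) = algebraMap ℝ ℂ b from rfl, eval_map_algebraMap, aeval_algebraMap_apply]
      simp only [Complex.coe_algebraMap, coe_aeval_eq_eval]
      rw [Real.exp_add, Real.exp_add]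
      push_cast
      ring
    have h0 : (p 0).eval 0 = 0 := by rw [hp]; simp
    refine (?_ : _ = (p 0).eval 0).trans h0
    simp only [p, Finsupp.coe_finsetSum, Finset.sum_apply, eval_finsetSum]
    refine Finset.sum_congr rfl fun i _ => ?_
    rw [Finsupp.add_apply, Finsupp.single_apply, Finsupp.single_apply, eval_add]
    have e : eval 0 (i.2.2.map (algebraMap ℝ ℂ)) = ((i.2.2.eval 0 : ℝ) : ℂ) := by
      rw [show (0 : ℂ) = algebraMap ℝ ℂ 0 by simp, eval_map_algebraMap, aeval_algebraMap_apply]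
      simp
    split_ifs <;> simp_all <;> ring
  let p : ℝ →₀ ℂ[X] := ∑ i ∈ c.support,
    ((if i.2.1 = 0 then Finsupp.single i.1 (C (c i) * i.2.2.map (algebraMap ℝ ℂ)) else 0) +
     (if i.1 = 0 then Finsupp.single (i.2.1 : ℝ) (C (-(c i * (i.2.2.eval 0 : ℝ)))) else 0))
  have hp : p = 0 := by
    refine expPoly_eq_zero_of_forall fun a => ?_
    rw [← step1 a, expPoly_finset_sum]
    refine Finset.sum_congr rfl fun i _ => ?_
    have e : eval (a : ℂ) (i.2.2.map (algebraMap ℝ ℂ)) = ((i.2.2.eval a : ℝ) : ℂ) := by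
      rw [show (a : ℂ) = algebraMap ℝ ℂ a from rfl, eval_map_algebraMap, aeval_algebraMap_apply]
      simp
    have e0 : expPoly 0 a = 0 := by simp [expPoly]
    rw [expPoly_add]
    split_ifs <;> simp only [expPoly_single, e0, eval_mul, eval_C, e] <;> ring
  have h0 : (p d).eval 0 = 0 := by rw [hp]; simp
  rw [sigmaCoeff, Finsupp.sum]
  refine (?_ : _ = (p d).eval 0).trans h0
  simp only [p, Finsupp.coe_finsetSum, Finset.sum_apply, eval_finsetSum]
  refine Finset.sum_congr rfl fun i _ => ?_
  have e : eval 0 (i.2.2.map (algebraMap ℝ ℂ)) = ((i.2.2.eval 0 : ℝ) : ℂ) := by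
    rw [show (0 : ℂ) = algebraMap ℝ ℂ 0 by simp, eval_map_algebraMap, aeval_algebraMap_apply]
    simp
  have hk : (i.2.1 : ℝ) ≠ d := by
    have : (0 : ℝ) ≤ i.2.1 := Nat.cast_nonneg _
    intro h; linarith
  rw [Finsupp.add_apply, eval_add]
  by_cases hk0 : i.2.1 = 0
  · by_cases hq : i.1 = d
    · have hq0 : i.1 ≠ 0 := by rw [hq]; exact hd.ne
      simp [hk0, hq, e, hd.ne]
    · by_cases hq0 : i.1 = 0
      · simp [hk0, hq0, hd.ne']
      · simp [hk0, hq, hq0]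
  · by_cases hq0 : i.1 = 0
    · simp [hk0, hq0, hk]
    · simp [hk0, hq0]

lemma sing_add (Θ q : ℝ) (k : ℕ) (P Q : ℝ[X]) :
    sing Θ q k (P + Q) = sing Θ q k P + sing Θ q k Q := by
  ext z
  simp only [sing, map_add, mul_add, Complex.add_im, Complex.ofReal_add, Pi.add_apply]

/-- The redundancy between singular functions without logarithm and with integer exponents. -/
lemma sing_nat_swap (Θ : ℝ) (n k : ℕ) (a : ℝ) :
    sing Θ n k (C a) = -sing Θ k n (C a) := by
  ext z
  rw [Pi.neg_apply]
  unfold sing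
  rw [← Complex.ofReal_neg]
  congr 1
  rw [← Complex.conj_im]
  congr 1
  simp only [map_mul, Complex.conj_ofReal, ← Complex.exp_conj, map_sub, map_neg, Complex.conj_I,
    aeval_C, Complex.coe_algebraMap, map_natCast]
  have h1 : ∀ m : ℕ, ((‖z‖ ^ (m : ℝ) : ℝ)) = ‖z‖ ^ m := fun m => Real.rpow_natCast _ _
  rw [h1, h1]
  push_cast
  ring_nf

lemma IsExpansion.add {Θ : ℝ} {c c' : (ℝ × ℕ × ℝ[X]) →₀ ℂ} {φ φ' : ℂ → ℂ}
    (h : IsExpansion Θ c φ) (h' : IsExpansion Θ c' φ') : IsExpansion Θ (c + c') (φ + φ') := by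
  classical
  refine ⟨fun i hi => ?_, ?_⟩
  · rcases Finset.mem_union.mp (Finsupp.support_add hi) with hi | hi
    · exact h.1 i hi
    · exact h'.1 i hi
  · rw [h.2, h'.2]; exact (singSum_add Θ c c').symm

lemma IsExpansion.smul {Θ : ℝ} (a : ℂ) {c : (ℝ × ℕ × ℝ[X]) →₀ ℂ} {φ : ℂ → ℂ}
    (h : IsExpansion Θ c φ) : IsExpansion Θ (a • c) (a • φ) := by
  refine ⟨fun i hi => h.1 i (Finsupp.support_smul hi), ?_⟩
  rw [h.2]; exact (singSum_smul Θ a c).symm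

lemma exists_normalized_sing (Θ q : ℝ) (k : ℕ) (P : ℝ[X]) :
    ∃ c, IsExpansion Θ c (sing Θ q k P) := by
  classical
  have single : ∀ (q : ℝ) (k : ℕ) (P : ℝ[X]) (a : ℂ), IsNormalized q k P →
      IsExpansion Θ (Finsupp.single (q, k, P) a) (a • sing Θ q k P) := by
    intro q k P a h
    refine ⟨fun i hi => ?_, (singSum_single Θ (q, k, P) a).symm⟩
    have := Finsupp.support_single_subset hi
    rw [Finset.mem_singleton] at this
    rw [this]; exact h
  by_cases h : IsNormalized q k P
  · exact ⟨_, by simpa using single q k P 1 h⟩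
  · unfold IsNormalized at h
    push Not at h
    obtain ⟨⟨n, rfl⟩, hnk, -⟩ := h
    have hnk' : n ≤ k := by exact_mod_cast hnk
    have hdec : sing Θ n k P = sing Θ n k (P - C (P.eval 0)) + sing Θ n k (C (P.eval 0)) := by
      rw [← sing_add]; simp
    have h1 := single n k (P - C (P.eval 0)) 1 (Or.inr (Or.inr (by simp)))
    rcases eq_or_lt_of_le hnk' with rfl | hlt
    · have h0 : sing Θ n n (C (P.eval 0)) = 0 := by
        have := sing_nat_swap Θ n n (P.eval 0)
        exact self_eq_neg.mp this
      rw [hdec, h0, add_zero]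
      exact ⟨_, by simpa using h1⟩
    · have h2 := single k n (C (P.eval 0)) (-1) (Or.inr (Or.inl (by exact_mod_cast hlt)))
      have h3 := h1.add h2
      rw [one_smul, neg_one_smul, ← sing_nat_swap, ← hdec] at h3
      exact ⟨_, h3⟩

lemma exists_isExpansion {Θ : ℝ} {φ : ℂ → ℂ} (hφ : φ ∈ singSpace Θ) :
    ∃ c, IsExpansion Θ c φ := by
  refine Submodule.iSup_induction (singDeg Θ) (motive := fun φ => ∃ c, IsExpansion Θ c φ) hφ
    (fun d φ hφ => ?_) ⟨0, by simp, rfl⟩ ?_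
  · induction hφ using Submodule.span_induction with
    | mem φ h => obtain ⟨q, k, P, -, rfl⟩ := h; exact exists_normalized_sing Θ q k P
    | zero => exact ⟨0, by simp, rfl⟩
    | add φ φ' _ _ h h' =>
      obtain ⟨c, h⟩ := h
      obtain ⟨c', h'⟩ := h'
      exact ⟨_, h.add h'⟩
    | smul a φ _ h => obtain ⟨c, h⟩ := h; exact ⟨_, h.smul a⟩
  · rintro φ φ' ⟨c, h⟩ ⟨c', h'⟩
    exact ⟨_, h.add h'⟩

/-- `σ_d` may be computed on any finite sum of singular functions equal to `φ` on the sector. -/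
lemma sigma_eq {Θ d : ℝ} (hΘ₀ : 0 < Θ) (hΘ : Θ < 2 * Real.pi) (hd : d < 0) {φ : ℂ → ℂ}
    (hφ : φ ∈ singSpace Θ) {c : (ℝ × ℕ × ℝ[X]) →₀ ℂ} (h : EqOn φ (singSum Θ c) (sector Θ)) :
    sigma Θ d φ = sigmaCoeff d c := by
  have hex := exists_isExpansion hφ
  have h1 : sigma Θ d φ = sigmaCoeff d hex.choose := by
    unfold sigma
    rw [dif_pos hex]
    rfl
  have h2 : φ = singSum Θ hex.choose := hex.choose_spec.2
  have h3 : sigmaCoeff d (hex.choose + (-1 : ℂ) • c) = 0 := by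
    refine sigmaCoeff_eq_zero hΘ₀ hΘ hd fun z hz => ?_
    rw [singSum_add, singSum_smul, Pi.add_apply, ← h2, h hz]
    simp
  rw [sigmaCoeff_add, sigmaCoeff_smul] at h3
  rw [h1]
  linear_combination h3

lemma sigma_congr {Θ d : ℝ} (hΘ₀ : 0 < Θ) (hΘ : Θ < 2 * Real.pi) (hd : d < 0) {φ φ' : ℂ → ℂ}
    (hφ : φ ∈ singSpace Θ) (hφ' : φ' ∈ singSpace Θ) (h : EqOn φ φ' (sector Θ)) :
    sigma Θ d φ = sigma Θ d φ' := by
  obtain ⟨c, hc⟩ := exists_isExpansion hφ'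
  rw [sigma_eq hΘ₀ hΘ hd hφ' (c := c) (fun z _ => by rw [hc.2]; rfl),
    sigma_eq hΘ₀ hΘ hd hφ (c := c) (fun z hz => by rw [h hz, hc.2]; rfl)]

lemma sigma_add {Θ d : ℝ} (hΘ₀ : 0 < Θ) (hΘ : Θ < 2 * Real.pi) (hd : d < 0) {φ φ' : ℂ → ℂ}
    (hφ : φ ∈ singSpace Θ) (hφ' : φ' ∈ singSpace Θ) :
    sigma Θ d (φ + φ') = sigma Θ d φ + sigma Θ d φ' := by
  obtain ⟨c, hc⟩ := exists_isExpansion hφ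
  obtain ⟨c', hc'⟩ := exists_isExpansion hφ'
  rw [sigma_eq hΘ₀ hΘ hd hφ (c := c) (fun z _ => by rw [hc.2]; rfl),
    sigma_eq hΘ₀ hΘ hd hφ' (c := c') (fun z _ => by rw [hc'.2]; rfl),
    sigma_eq hΘ₀ hΘ hd (add_mem hφ hφ') (c := c + c')
      (fun z _ => by rw [(hc.add hc').2]; rfl), sigmaCoeff_add]

lemma sigma_smul {Θ d : ℝ} (hΘ₀ : 0 < Θ) (hΘ : Θ < 2 * Real.pi) (hd : d < 0) (a : ℂ) {φ : ℂ → ℂ}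
    (hφ : φ ∈ singSpace Θ) : sigma Θ d (a • φ) = a * sigma Θ d φ := by
  obtain ⟨c, hc⟩ := exists_isExpansion hφ
  rw [sigma_eq hΘ₀ hΘ hd hφ (c := c) (fun z _ => by rw [hc.2]; rfl),
    sigma_eq hΘ₀ hΘ hd (Submodule.smul_mem _ a hφ) (c := a • c)
      (fun z _ => by rw [(hc.smul a).2]; rfl), sigmaCoeff_smul]

lemma sigma_zero {Θ d : ℝ} (hΘ₀ : 0 < Θ) (hΘ : Θ < 2 * Real.pi) (hd : d < 0) :
    sigma Θ d 0 = 0 := by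
  have := sigma_smul hΘ₀ hΘ hd 0 (zero_mem (singSpace Θ))
  simpa using this

lemma sigma_sub {Θ d : ℝ} (hΘ₀ : 0 < Θ) (hΘ : Θ < 2 * Real.pi) (hd : d < 0) {φ φ' : ℂ → ℂ}
    (hφ : φ ∈ singSpace Θ) (hφ' : φ' ∈ singSpace Θ) :
    sigma Θ d (φ - φ') = sigma Θ d φ - sigma Θ d φ' := by
  rw [sub_eq_add_neg, ← neg_one_smul ℂ φ', sigma_add hΘ₀ hΘ hd hφ (Submodule.smul_mem _ _ hφ'),
    sigma_smul hΘ₀ hΘ hd _ hφ']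
  ring

lemma sigma_sum {Θ d : ℝ} (hΘ₀ : 0 < Θ) (hΘ : Θ < 2 * Real.pi) (hd : d < 0) {ι : Type*}
    (s : Finset ι) (φ : ι → ℂ → ℂ) (hφ : ∀ i ∈ s, φ i ∈ singSpace Θ) :
    sigma Θ d (∑ i ∈ s, φ i) = ∑ i ∈ s, sigma Θ d (φ i) := by
  classical
  induction s using Finset.induction_on with
  | empty => simpa using sigma_zero hΘ₀ hΘ hd
  | insert a s ha ih =>
    rw [Finset.sum_insert ha, Finset.sum_insert ha,
      sigma_add hΘ₀ hΘ hd (hφ a (Finset.mem_insert_self a s))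
        (Submodule.sum_mem _ fun i hi => hφ i (Finset.mem_insert_of_mem hi)),
      ih fun i hi => hφ i (Finset.mem_insert_of_mem hi)]

open Classical in
lemma sigma_sing {Θ d q : ℝ} (hΘ₀ : 0 < Θ) (hΘ : Θ < 2 * Real.pi) (hd : d < 0) (k : ℕ)
    (P : ℝ[X]) :
    sigma Θ d (sing Θ q k P) = if q = d ∧ k = 0 then ((P.eval 0 : ℝ) : ℂ) else 0 := by
  rw [sigma_eq hΘ₀ hΘ hd (singDeg_le_singSpace Θ _ (sing_mem_singDeg rfl))
    (c := Finsupp.single (q, k, P) 1) (fun z _ => by rw [singSum_single]; simp),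
    sigmaCoeff_single, one_mul]

lemma sigma_eq_zero_of_mem_singDeg {Θ d d' : ℝ} (hΘ₀ : 0 < Θ) (hΘ : Θ < 2 * Real.pi) (hd : d < 0)
    (hne : d' ≠ d) {φ : ℂ → ℂ} (hφ : φ ∈ singDeg Θ d') : sigma Θ d φ = 0 := by
  induction hφ using Submodule.span_induction with
  | mem φ h =>
    obtain ⟨q, k, P, hqk, rfl⟩ := h
    rw [sigma_sing hΘ₀ hΘ hd, if_neg]
    rintro ⟨rfl, rfl⟩
    exact hne (by simpa using hqk.symm)
  | zero => exact sigma_zero hΘ₀ hΘ hd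
  | add φ φ' h1 h2 h h' =>
    rw [sigma_add hΘ₀ hΘ hd (singDeg_le_singSpace _ _ h1) (singDeg_le_singSpace _ _ h2), h, h',
      add_zero]
  | smul a φ h1 h => rw [sigma_smul hΘ₀ hΘ hd _ (singDeg_le_singSpace _ _ h1), h, mul_zero]

/-! ### Calculus on the sector -/

lemma IsTest.mem_sector {Θ : ℝ} {v : ℂ → ℂ} (hv : IsTest Θ v) {z : ℂ} (h : v z ≠ 0) :
    z ∈ sector Θ := hv.2 (subset_tsupport _ h)

lemma IsTest.integrable_mul {Θ : ℝ} {v g : ℂ → ℂ} (hv : IsTest Θ v)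
    (hg : ContinuousOn g (sector Θ)) : Integrable fun z => g z * v z := by
  have h1 : IntegrableOn (fun z => g z * v z) (tsupport v) :=
    ((hg.mono hv.2).mul hv.1.continuous.continuousOn).integrableOn_compact hv.1.2
  refine (integrableOn_iff_integrable_of_support_subset fun z hz => ?_).mp h1
  exact subset_tsupport _ (right_ne_zero_of_mul hz)

lemma IsTest.integral_sector {Θ : ℝ} {v : ℂ → ℂ} (hv : IsTest Θ v) (g : ℂ → ℂ) :
    ∫ z, g z * v z ∂(sectorMeasure Θ) = ∫ z, g z * v z := by
  refine setIntegral_eq_integral_of_forall_compl_eq_zero fun z hz => ?_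
  have : v z = 0 := by by_contra h; exact hz (hv.mem_sector h)
  simp [this]

/-- Integration by parts against a test function. -/
lemma integral_mul_dirDeriv_test {Θ : ℝ} {v g : ℂ → ℂ} (hv : IsTest Θ v)
    (hg : ∀ z ∈ sector Θ, ContDiffAt ℝ 1 g z) (e : ℂ) :
    ∫ z, g z * dirDeriv e v z ∂(sectorMeasure Θ) =
      -∫ z, dirDeriv e g z * v z ∂(sectorMeasure Θ) := by
  rw [(hv.dirDeriv e).integral_sector, hv.integral_sector]
  have hgc : ContinuousOn g (sector Θ) := fun z hz => (hg z hz).continuousAt.continuousWithinAt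
  have hgd : ContinuousOn (dirDeriv e g) (sector Θ) := fun z hz => by
    have := ((hg z hz).fderiv_right (m := 0) (by simp)).continuousAt
    exact (this.clm_apply continuousAt_const).continuousWithinAt
  refine integral_mul_fderiv_eq_neg_fderiv_mul_of_integrable (hv.integrable_mul hgd)
    ((hv.dirDeriv e).integrable_mul hgc) (hv.integrable_mul hgc)
    (fun z hz => (hg z (hv.2 hz)).differentiableAt (by simp))
    (fun z _ => hv.1.differentiable z)

lemma contDiffAt_dirDeriv {g : ℂ → ℂ} {z : ℂ} (hg : ContDiffAt ℝ (⊤ : ℕ∞) g z) (e : ℂ) :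
    ContDiffAt ℝ (⊤ : ℕ∞) (dirDeriv e g) z :=
  (hg.fderiv_right (m := (⊤ : ℕ∞)) (by simp)).clm_apply contDiffAt_const

lemma integral_mul_laplacian_test {Θ : ℝ} {v g : ℂ → ℂ} (hv : IsTest Θ v)
    (hg : ∀ z ∈ sector Θ, ContDiffAt ℝ (⊤ : ℕ∞) g z) :
    ∫ z, g z * Laplacian.laplacian v z ∂(sectorMeasure Θ) =
      ∫ z, Laplacian.laplacian g z * v z ∂(sectorMeasure Θ) := by
  have hc : ∀ f : ℂ → ℂ, (∀ z ∈ sector Θ, ContDiffAt ℝ (⊤ : ℕ∞) f z) →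
      ContinuousOn f (sector Θ) := fun f hf z hz => (hf z hz).continuousAt.continuousWithinAt
  have h1 : ∀ z ∈ sector Θ, ∀ e, ContDiffAt ℝ (⊤ : ℕ∞) (dirDeriv e g) z :=
    fun z hz e => contDiffAt_dirDeriv (hg z hz) e
  have h2 : ∀ e : ℂ, ∫ z, g z * dirDeriv e (dirDeriv e v) z ∂(sectorMeasure Θ) =
      ∫ z, dirDeriv e (dirDeriv e g) z * v z ∂(sectorMeasure Θ) := by
    intro e
    rw [integral_mul_dirDeriv_test (hv.dirDeriv e) (fun z hz => (hg z hz).of_le (by simp)),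
      integral_mul_dirDeriv_test hv (fun z hz => (h1 z hz e).of_le (by simp)), neg_neg]
  have i1 : ∀ e : ℂ, Integrable (fun z => g z * dirDeriv e (dirDeriv e v) z) (sectorMeasure Θ) :=
    fun e => (((hv.dirDeriv e).dirDeriv e).integrable_mul (hc g hg)).restrict
  have i2 : ∀ e : ℂ, Integrable (fun z => dirDeriv e (dirDeriv e g) z * v z) (sectorMeasure Θ) :=
    fun e => (hv.integrable_mul (hc _ fun z hz => contDiffAt_dirDeriv (h1 z hz e) e)).restrict
  have e1 : ∀ z, g z * Laplacian.laplacian v z = g z * dirDeriv 1 (dirDeriv 1 v) z +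
      g z * dirDeriv Complex.I (dirDeriv Complex.I v) z := fun z => by
    rw [laplacian_eq_dirDeriv (hv.1.1.contDiffAt.of_le (by norm_cast)), mul_add]
  have e2 : ∫ z, Laplacian.laplacian g z * v z ∂(sectorMeasure Θ) =
      ∫ z, dirDeriv 1 (dirDeriv 1 g) z * v z +
        dirDeriv Complex.I (dirDeriv Complex.I g) z * v z ∂(sectorMeasure Θ) := by
    refine setIntegral_congr_fun (measurableSet_sector Θ) fun z hz => ?_
    rw [laplacian_eq_dirDeriv ((hg z hz).of_le (by norm_cast)), add_mul]
  simp_rw [e1]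
  rw [e2, integral_add (i1 1) (i1 Complex.I), integral_add (i2 1) (i2 Complex.I), h2, h2]

/-- The fundamental lemma of the calculus of variations on the sector. -/
lemma eqOn_zero_of_integral_test {Θ : ℝ} {g : ℂ → ℂ} (hg : ContinuousOn g (sector Θ))
    (h : ∀ v, IsTest Θ v → ∫ z, g z * v z ∂(sectorMeasure Θ) = 0) : ∀ z ∈ sector Θ, g z = 0 := by
  have h1 : ∀ᵐ z, z ∈ sector Θ → g z = 0 := by
    refine (isOpen_sector Θ).ae_eq_zero_of_integral_contDiff_smul_eq_zero
      (hg.locallyIntegrableOn (measurableSet_sector Θ)) fun v hv1 hv2 hv3 => ?_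
    have hv : IsTest Θ fun z => (v z : ℂ) := by
      refine ⟨⟨Complex.ofRealCLM.contDiff.comp hv1, hv2.comp_left (g := ((↑) : ℝ → ℂ)) rfl⟩,
        (closure_mono fun z hz => ?_).trans hv3⟩
      simpa using hz
    rw [← h _ hv, hv.integral_sector]
    refine integral_congr_ae (.of_forall fun z => ?_)
    simp [mul_comm]
  have h2 : g =ᵐ[volume.restrict (sector Θ)] 0 :=
    (ae_restrict_iff' (measurableSet_sector Θ)).mpr h1
  exact Measure.eqOn_open_of_ae_eq h2 (isOpen_sector Θ) hg continuousOn_const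

lemma isPreconnected_sector (Θ : ℝ) : IsPreconnected (sector Θ) := by
  rw [sector_eq_image]
  refine IsPreconnected.image (Convex.isPreconnected ?_) _ Complex.continuous_exp.continuousOn
  have : strip Θ = Complex.imLm ⁻¹' Ioo 0 Θ := by ext; simp [strip]
  rw [this]
  exact (convex_Ioo 0 Θ).linear_preimage _

/-! ### Functions with a logarithmic expansion -/

/-- The function `e^{ds} ∑_{j<N} s^j a_j(θ)` of `ζ = s + iθ`. -/
def logFun (d : ℝ) (N : ℕ) (a : ℕ → ℝ → ℂ) (ζ : ℂ) : ℂ :=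
  (Real.exp (d * ζ.re) : ℂ) * ∑ j ∈ Finset.range N, (ζ.re : ℂ) ^ j * a j ζ.im

lemma contDiff_logFun (d : ℝ) (N : ℕ) {a : ℕ → ℝ → ℂ} (ha : ∀ j, ContDiff ℝ (⊤ : ℕ∞) (a j)) :
    ContDiff ℝ (⊤ : ℕ∞) (logFun d N a) := by
  unfold logFun
  have hre : ContDiff ℝ (⊤ : ℕ∞) fun ζ : ℂ => ζ.re := Complex.reCLM.contDiff
  have him : ContDiff ℝ (⊤ : ℕ∞) fun ζ : ℂ => ζ.im := Complex.imCLM.contDiff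
  refine ContDiff.mul (Complex.ofRealCLM.contDiff.comp
    (Real.contDiff_exp.comp (contDiff_const.mul hre))) (ContDiff.sum fun j _ => ?_)
  exact ((Complex.ofRealCLM.contDiff.comp hre).pow j).mul ((ha j).comp him)

lemma HasLogExpansion.eqOn {Θ d : ℝ} {φ : ℂ → ℂ} {N : ℕ} {a : ℕ → ℝ → ℂ}
    (hΘ : Θ < 2 * Real.pi) (h : HasLogExpansion Θ d φ N a) {z : ℂ} (hz : z ∈ sector Θ) :
    φ z = logFun d N a (lg Θ z) := by
  have h1 := lg_mem_strip hΘ hz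
  rw [← exp_lg Θ (ne_zero_of_mem_slit (sector_subset_slit hΘ hz)), h.eq _ h1.1.le (by
    linarith [h1.2]), lg_exp (abs_sub_half_lt hΘ h1.1.le h1.2.le)]
  rfl

lemma HasLogExpansion.contDiffAt {Θ d : ℝ} {φ : ℂ → ℂ} {N : ℕ} {a : ℕ → ℝ → ℂ}
    (hΘ : Θ < 2 * Real.pi) (h : HasLogExpansion Θ d φ N a) {z : ℂ} (hz : z ∈ sector Θ) :
    ContDiffAt ℝ (⊤ : ℕ∞) φ z := by
  have h1 : ContDiffAt ℝ (⊤ : ℕ∞) (fun z => logFun d N a (lg Θ z)) z :=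
    (contDiff_logFun d N h.smooth).contDiffAt.comp z (contDiffAt_lg (sector_subset_slit hΘ hz))
  refine h1.congr_of_eventuallyEq ?_
  filter_upwards [(isOpen_sector Θ).mem_nhds hz] with w hw
  exact h.eqOn hΘ hw

lemma singDeg_contDiffAt {Θ d : ℝ} (hΘ : Θ < 2 * Real.pi) {φ : ℂ → ℂ} (hφ : φ ∈ singDeg Θ d)
    {z : ℂ} (hz : z ∈ sector Θ) : ContDiffAt ℝ (⊤ : ℕ∞) φ z := by
  obtain ⟨N, a, h⟩ := hasLogExpansion_of_mem hφ
  exact h.contDiffAt hΘ hz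

lemma singSpace_contDiffAt {Θ : ℝ} (hΘ : Θ < 2 * Real.pi) {φ : ℂ → ℂ} (hφ : φ ∈ singSpace Θ)
    {z : ℂ} (hz : z ∈ sector Θ) : ContDiffAt ℝ (⊤ : ℕ∞) φ z := by
  obtain ⟨f, hf, rfl⟩ := exists_homogeneous_parts hφ
  have : (f.sum fun _ x => x) = fun z => ∑ d ∈ f.support, f d z := by
    ext z; rw [Finsupp.sum, Finset.sum_apply]
  rw [this]
  exact ContDiffAt.sum fun d _ => singDeg_contDiffAt hΘ (hf d) hz

lemma singSpace_continuousOn {Θ : ℝ} (hΘ : Θ < 2 * Real.pi) {φ : ℂ → ℂ} (hφ : φ ∈ singSpace Θ) :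
    ContinuousOn φ (sector Θ) := fun _ hz =>
  (singSpace_contDiffAt hΘ hφ hz).continuousAt.continuousWithinAt

/-! ### Scaling -/

lemma exp_smul_mem_sector {Θ : ℝ} (τ : ℝ) {z : ℂ} (hz : z ∈ sector Θ) :
    Real.exp τ • z ∈ sector Θ := by
  obtain ⟨r, θ, hr, h0, h1, rfl⟩ := hz
  refine ⟨Real.exp τ * r, θ, by positivity, h0, h1, ?_⟩
  rw [Complex.real_smul]; push_cast; ring

lemma exp_smul_mem_sector_iff {Θ : ℝ} (τ : ℝ) {z : ℂ} :
    Real.exp τ • z ∈ sector Θ ↔ z ∈ sector Θ := by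
  refine ⟨fun h => ?_, exp_smul_mem_sector τ⟩
  have := exp_smul_mem_sector (-τ) h
  rwa [smul_smul, ← Real.exp_add, neg_add_cancel, Real.exp_zero, one_smul] at this

lemma lg_exp_smul (Θ τ : ℝ) {z : ℂ} (hz : z ≠ 0) : lg Θ (Real.exp τ • z) = τ + lg Θ z := by
  unfold lg
  rw [Complex.real_smul, mul_assoc, Complex.log_ofReal_mul (Real.exp_pos τ)
    (mul_ne_zero hz (Complex.exp_ne_zero _)), Real.log_exp, add_assoc]

/-- The function `z ↦ v(e^{-τ} z)`. -/
def rescale (τ : ℝ) (v : ℂ → ℂ) (z : ℂ) : ℂ := v (Real.exp (-τ) • z)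

lemma dirDeriv_rescale (τ : ℝ) {v : ℂ → ℂ} (hv : Differentiable ℝ v) (e z : ℂ) :
    dirDeriv e (rescale τ v) z = (Real.exp (-τ) : ℂ) * rescale τ (dirDeriv e v) z := by
  have h1 : HasFDerivAt (fun z : ℂ => Real.exp (-τ) • z)
      (Real.exp (-τ) • ContinuousLinearMap.id ℝ ℂ) z :=
    (Real.exp (-τ) • ContinuousLinearMap.id ℝ ℂ).hasFDerivAt
  have h2 := (hv (Real.exp (-τ) • z)).hasFDerivAt.comp z h1
  have h3 : fderiv ℝ (rescale τ v) z = _ := h2.fderiv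
  unfold dirDeriv
  rw [h3]
  simp [rescale]

lemma isTest_rescale {Θ : ℝ} {v : ℂ → ℂ} (hv : IsTest Θ v) (τ : ℝ) :
    IsTest Θ (rescale τ v) := by
  have hne : Real.exp (-τ) ≠ 0 := (Real.exp_pos _).ne'
  refine ⟨⟨hv.1.1.comp (contDiff_id.const_smul (Real.exp (-τ))), ?_⟩, ?_⟩
  · exact hv.1.2.comp_homeomorph (Homeomorph.smulOfNeZero _ hne)
  · have h1 : tsupport (rescale τ v) = (Real.exp (-τ) • ·) ⁻¹' tsupport v :=
      tsupport_comp_eq_preimage v (Homeomorph.smulOfNeZero (Real.exp (-τ)) hne)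
    rw [h1]
    intro z hz
    exact (exp_smul_mem_sector_iff (-τ)).mp (hv.2 hz)

open scoped Pointwise in
lemma integral_rescale {Θ : ℝ} (τ : ℝ) (F : ℂ → ℂ) (v : ℂ → ℂ) :
    ∫ z, F z * rescale τ v z ∂(sectorMeasure Θ) =
      (Real.exp (2 * τ) : ℂ) * ∫ z, F (Real.exp τ • z) * v z ∂(sectorMeasure Θ) := by
  have h := Measure.setIntegral_comp_smul (volume : Measure ℂ)
    (fun z => F z * rescale τ v z) (sector Θ) (Real.exp_pos τ).ne'
  have hs : Real.exp τ • sector Θ = sector Θ := by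
    ext z
    rw [Set.mem_smul_set_iff_inv_smul_mem₀ (Real.exp_pos τ).ne', ← Real.exp_neg,
      exp_smul_mem_sector_iff]
  rw [hs, Complex.finrank_real_complex, abs_of_pos (by positivity)] at h
  have h2 : ∀ z : ℂ, rescale τ v (Real.exp τ • z) = v z := fun z => by
    rw [rescale, smul_smul, ← Real.exp_add, neg_add_cancel, Real.exp_zero, one_smul]
  simp_rw [h2] at h
  rw [h, Complex.real_smul, ← mul_assoc]
  have : (Real.exp (2 * τ) : ℂ) * (((Real.exp τ ^ 2)⁻¹ : ℝ) : ℂ) = 1 := by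
    rw [← Complex.ofReal_mul, ← Real.exp_nat_mul]
    norm_num
  rw [this, one_mul]

lemma HasLogExpansion.eq_scaled {Θ d : ℝ} {φ : ℂ → ℂ} {N : ℕ} {a : ℕ → ℝ → ℂ}
    (hΘ : Θ < 2 * Real.pi) (h : HasLogExpansion Θ d φ N a) (τ : ℝ) {z : ℂ} (hz : z ∈ sector Θ) :
    φ (Real.exp τ • z) = (Real.exp (d * τ) : ℂ) * ∑ j ∈ Finset.range N,
      ∑ i ∈ Finset.range (j + 1), (τ : ℂ) ^ i * ((Real.exp (d * (lg Θ z).re) : ℂ) *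
        ((lg Θ z).re : ℂ) ^ (j - i) * (j.choose i) * a j (lg Θ z).im) := by
  rw [h.eqOn hΘ (exp_smul_mem_sector τ hz),
    lg_exp_smul Θ τ (ne_zero_of_mem_slit (sector_subset_slit hΘ hz)), logFun]
  simp only [Complex.add_re, Complex.ofReal_re, Complex.add_im, Complex.ofReal_im, zero_add]
  rw [mul_add, Real.exp_add, Complex.ofReal_mul, mul_assoc, Finset.mul_sum]
  congr 1
  refine Finset.sum_congr rfl fun j _ => ?_
  push_cast
  rw [add_pow, Finset.sum_mul, Finset.mul_sum]
  refine Finset.sum_congr rfl fun i _ => ?_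
  ring

/-- The pairing of a dilated singular function with a test function is an exponential
monomial of the dilation parameter. -/
lemma exists_polynomial_scaled_integral {Θ d : ℝ} (hΘ : Θ < 2 * Real.pi) {φ : ℂ → ℂ}
    (hφ : φ ∈ singDeg Θ d) {v : ℂ → ℂ} (hv : IsTest Θ v) :
    ∃ P : ℂ[X], (∀ τ : ℝ, ∫ z, φ (Real.exp τ • z) * v z ∂(sectorMeasure Θ) =
      (Real.exp (d * τ) : ℂ) * P.eval (τ : ℂ)) ∧
      P.eval 0 = ∫ z, φ z * v z ∂(sectorMeasure Θ) := by
  obtain ⟨N, a, h⟩ := hasLogExpansion_of_mem hφ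
  let g : ℕ → ℕ → ℂ → ℂ := fun j i z => (Real.exp (d * (lg Θ z).re) : ℂ) *
        ((lg Θ z).re : ℂ) ^ (j - i) * (j.choose i) * a j (lg Θ z).im
  have hgc : ∀ j i, ContinuousOn (g j i) (sector Θ) := by
    intro j i
    have hl : ContinuousOn (lg Θ) (sector Θ) := (continuousOn_lg Θ).mono (sector_subset_slit hΘ)
    have hr : ContinuousOn (fun z => (lg Θ z).re) (sector Θ) :=
      Complex.continuous_re.comp_continuousOn hl
    have hi : ContinuousOn (fun z => a j (lg Θ z).im) (sector Θ) :=
      (h.smooth j).continuous.comp_continuousOn (Complex.continuous_im.comp_continuousOn hl)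
    have hof : ∀ f : ℂ → ℝ, ContinuousOn f (sector Θ) →
        ContinuousOn (fun z => (f z : ℂ)) (sector Θ) :=
      fun f hf => Complex.continuous_ofReal.comp_continuousOn hf
    exact (((hof _ (Real.continuous_exp.comp_continuousOn (continuousOn_const.mul hr))).mul
      ((hof _ hr).pow _)).mul continuousOn_const).mul hi
  let P : ℂ[X] := ∑ j ∈ Finset.range N, ∑ i ∈ Finset.range (j + 1),
    C (∫ z, g j i z * v z ∂(sectorMeasure Θ)) * Polynomial.X ^ i
  have key : ∀ τ : ℝ, ∫ z, φ (Real.exp τ • z) * v z ∂(sectorMeasure Θ) =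
      (Real.exp (d * τ) : ℂ) * P.eval (τ : ℂ) := by
    intro τ
    have e1 : ∫ z, φ (Real.exp τ • z) * v z ∂(sectorMeasure Θ) =
        ∫ z, (Real.exp (d * τ) : ℂ) * ∑ j ∈ Finset.range N, ∑ i ∈ Finset.range (j + 1),
          (τ : ℂ) ^ i * (g j i z * v z) ∂(sectorMeasure Θ) := by
      refine setIntegral_congr_fun (measurableSet_sector Θ) fun z hz => ?_
      rw [h.eq_scaled hΘ τ hz, mul_assoc, Finset.sum_mul]
      congr 1
      refine Finset.sum_congr rfl fun j _ => ?_
      rw [Finset.sum_mul]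
      refine Finset.sum_congr rfl fun i _ => ?_
      simp only [g]
      ring
    rw [e1, integral_const_mul, integral_finsetSum _ fun j _ =>
      integrable_finsetSum _ fun i _ => ((hv.integrable_mul (hgc j i)).restrict).const_mul _]
    congr 1
    rw [eval_finsetSum]
    refine Finset.sum_congr rfl fun j _ => ?_
    rw [integral_finsetSum _ fun i _ => ((hv.integrable_mul (hgc j i)).restrict).const_mul _,
      eval_finsetSum]
    refine Finset.sum_congr rfl fun i _ => ?_
    rw [integral_const_mul]
    rw [eval_mul, eval_C, eval_pow, eval_X, mul_comm]
  refine ⟨P, key, ?_⟩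
  have h0 := key 0
  rw [mul_zero, Real.exp_zero, Complex.ofReal_one, one_mul, Complex.ofReal_zero] at h0
  rw [← h0]
  exact integral_congr_ae (.of_forall fun z => by simp only [one_smul])

lemma enorm_integral_mul_le {α : Type*} [MeasurableSpace α] {μ : Measure α} {a b : α → ℂ}
    (ha : AEStronglyMeasurable a μ) (hb : AEStronglyMeasurable b μ) :
    ‖∫ z, a z * b z ∂μ‖ₑ ≤
      (∫⁻ z, ‖a z‖ₑ ^ 2 ∂μ) ^ (1 / 2 : ℝ) * (∫⁻ z, ‖b z‖ₑ ^ 2 ∂μ) ^ (1 / 2 : ℝ) := by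
  refine (enorm_integral_le_lintegral_enorm _).trans ?_
  simp_rw [enorm_mul]
  have h := ENNReal.lintegral_mul_le_Lp_mul_Lq μ (p := 2) (q := 2)
    (Real.HolderConjugate.two_two) ha.enorm hb.enorm
  simpa using h

lemma Lp.lintegral_sq_ne_top {α : Type*} [MeasurableSpace α] {μ : Measure α} {a : α → ℂ}
    (ha : MemLp a 2 μ) : ∫⁻ z, ‖a z‖ₑ ^ 2 ∂μ ≠ ⊤ := by
  have h := lintegral_rpow_enorm_lt_top_of_eLpNorm_lt_top (by simp) (by simp) ha.2
  simpa using h.ne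

/-- A square integrable function does not concentrate at the vertex. -/
lemma tendsto_integral_rescale {Θ : ℝ} {a : ℂ → ℂ} (ha : MemLp a 2 (sectorMeasure Θ)) {v : ℂ → ℂ}
    (hv : IsTest Θ v) :
    Tendsto (fun τ : ℝ => (Real.exp (-τ) : ℂ) * ∫ z, a z * rescale τ v z ∂(sectorMeasure Θ))
      atBot (𝓝 0) := by
  obtain ⟨R, hR0, hR⟩ := hv.1.2.isCompact.isBounded.subset_closedBall_lt 0 0
  let B : ℝ → Set ℂ := fun τ => Metric.closedBall 0 (R * Real.exp τ)
  have hB : Tendsto (fun τ => ∫⁻ z in B τ, ‖a z‖ₑ ^ 2 ∂(sectorMeasure Θ)) atBot (𝓝 0) := by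
    refine tendsto_setLIntegral_zero (Lp.lintegral_sq_ne_top ha) ?_
    have h1 : Tendsto (fun τ => ENNReal.ofReal (R * Real.exp τ) ^ (2:ℝ) * NNReal.pi) atBot (𝓝 0) := by
      have h2 : Tendsto (fun τ => R * Real.exp τ) atBot (𝓝 0) := by
        simpa using Real.tendsto_exp_atBot.const_mul R
      have h3 := ENNReal.tendsto_ofReal h2
      rw [ENNReal.ofReal_zero] at h3
      have h4 := ENNReal.Tendsto.mul_const (b := (NNReal.pi : ℝ≥0∞)) (h3.ennrpow_const 2) (Or.inr (by simp))
      simpa using h4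
    refine tendsto_of_tendsto_of_tendsto_of_le_of_le tendsto_const_nhds h1 (fun _ => zero_le)
      fun τ => ?_
    refine (Measure.restrict_apply_le _ _).trans ?_
    rw [Complex.volume_closedBall]
    norm_num
  set V := ∫⁻ z, ‖v z‖ₑ ^ 2
  have hV : V ≠ ⊤ := Lp.lintegral_sq_ne_top (hv.1.continuous.memLp_of_hasCompactSupport hv.1.2)
  have hlim : Tendsto (fun τ => (∫⁻ z in B τ, ‖a z‖ₑ ^ 2 ∂(sectorMeasure Θ)) ^ (1 / 2 : ℝ) *
      V ^ (1 / 2 : ℝ)) atBot (𝓝 0) := by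
    have h1 := hB.ennrpow_const (1 / 2 : ℝ)
    rw [ENNReal.zero_rpow_of_pos (by norm_num)] at h1
    have h2 := ENNReal.Tendsto.mul_const (b := V ^ (1 / 2 : ℝ)) h1
      (Or.inr (ENNReal.rpow_ne_top_of_nonneg (by norm_num) hV))
    simpa using h2
  rw [tendsto_zero_iff_enorm_tendsto_zero]
  refine tendsto_of_tendsto_of_tendsto_of_le_of_le tendsto_const_nhds hlim (fun _ => zero_le)
    fun τ => ?_
  have hz : ∀ z, z ∉ B τ → rescale τ v z = 0 := by
    intro z hz
    by_contra h
    have h1 := hR (subset_tsupport _ h)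
    apply hz
    rw [mem_closedBall_zero_iff] at h1 ⊢
    rw [norm_smul, Real.norm_eq_abs, Real.abs_exp, Real.exp_neg, inv_mul_le_iff₀ (Real.exp_pos τ)]
      at h1
    linarith
  have e1 : ∫ z, a z * rescale τ v z ∂(sectorMeasure Θ) =
      ∫ z in B τ, a z * rescale τ v z ∂(sectorMeasure Θ) :=
    (setIntegral_eq_integral_of_forall_compl_eq_zero fun z h => by rw [hz z h, mul_zero]).symm
  have hrv := (isTest_rescale hv τ).1
  have h2 := enorm_integral_mul_le (μ := (sectorMeasure Θ).restrict (B τ)) ha.1.restrict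
    hrv.continuous.aestronglyMeasurable
  have h3 : ∫⁻ z in B τ, ‖rescale τ v z‖ₑ ^ 2 ∂(sectorMeasure Θ) ≤
      ENNReal.ofReal (Real.exp τ) ^ 2 * V := by
    calc _ ≤ ∫⁻ z, ‖rescale τ v z‖ₑ ^ 2 :=
          lintegral_mono' (Measure.restrict_le_self.trans Measure.restrict_le_self) le_rfl
      _ = _ := by
        have hmap := Measure.map_addHaar_smul (volume : Measure ℂ) (Real.exp_pos (-τ)).ne'
        have h4 : ∫⁻ z, ‖rescale τ v z‖ₑ ^ 2 =
            ∫⁻ z, ‖v z‖ₑ ^ 2 ∂(Measure.map (Real.exp (-τ) • ·) volume) := by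
          rw [lintegral_map (by have := hv.1.continuous; fun_prop) (by fun_prop)]
          rfl
        rw [h4, hmap, lintegral_smul_measure, Complex.finrank_real_complex, abs_of_pos
          (by positivity), smul_eq_mul, ← ENNReal.ofReal_pow (Real.exp_pos _).le]
        congr 2
        rw [← inv_pow, Real.exp_neg, inv_inv]
  rw [enorm_mul, e1]
  refine (mul_le_mul_right (h2.trans (mul_le_mul_right (ENNReal.rpow_le_rpow h3
    (by norm_num)) _)) _).trans (le_of_eq ?_)
  rw [ENNReal.mul_rpow_of_nonneg _ _ (by norm_num), ← ENNReal.rpow_natCast, ← ENNReal.rpow_mul]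
  norm_num
  have h5 : ‖Complex.exp (-(τ : ℂ))‖ₑ * ENNReal.ofReal (Real.exp τ) = 1 := by
    rw [← ofReal_norm, ← ENNReal.ofReal_mul (norm_nonneg _), Complex.norm_exp]
    simp [← Real.exp_add]
  calc _ = ‖Complex.exp (-(τ : ℂ))‖ₑ * ENNReal.ofReal (Real.exp τ) *
      ((∫⁻ z in B τ, ‖a z‖ₑ ^ 2 ∂(sectorMeasure Θ)) ^ (1 / 2 : ℝ) * V ^ (1 / 2 : ℝ)) := by ring
    _ = _ := by rw [h5, one_mul]

/-! ### Separation of the singular terms by dilation -/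

lemma sum_apply_eq {f : ℝ →₀ (ℂ → ℂ)} (z : ℂ) :
    f.sum (fun _ x => x) z = ∑ d ∈ f.support, f d z := by
  rw [Finsupp.sum, Finset.sum_apply]

lemma exists_expPoly_scaled_integral {Θ : ℝ} (hΘ : Θ < 2 * Real.pi) {f : ℝ →₀ (ℂ → ℂ)}
    (hf : ∀ d, f d ∈ singDeg Θ d) {v : ℂ → ℂ} (hv : IsTest Θ v) :
    ∃ P : ℝ → ℂ[X], (∀ τ : ℝ,
      ∫ z, f.sum (fun _ x => x) (Real.exp τ • z) * v z ∂(sectorMeasure Θ) =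
        ∑ d ∈ f.support, (Real.exp (d * τ) : ℂ) * (P d).eval (τ : ℂ)) ∧
      ∀ d, (P d).eval 0 = ∫ z, f d z * v z ∂(sectorMeasure Θ) := by
  choose P hP hP0 using fun d => exists_polynomial_scaled_integral hΘ (hf d) hv
  refine ⟨P, fun τ => ?_, hP0⟩
  have hint : ∀ d, Integrable (fun z => f d (Real.exp τ • z) * v z) (sectorMeasure Θ) := by
    intro d
    refine (hv.integrable_mul (g := fun z => f d (Real.exp τ • z)) fun z hz => ?_).restrict
    have h1 := (singDeg_contDiffAt hΘ (hf d) (exp_smul_mem_sector τ hz)).continuousAt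
    exact (ContinuousAt.comp (f := fun z : ℂ => Real.exp τ • z) h1
      (continuous_const_smul _).continuousAt).continuousWithinAt
  rw [← Finset.sum_congr rfl fun d _ => hP d τ, ← integral_finsetSum _ fun d _ => hint d]
  refine integral_congr_ae (.of_forall fun z => ?_)
  simp only [sum_apply_eq, Finset.sum_mul]

lemma expPoly_sum_single {ι : Type*} (s : Finset ι) (e : ι → ℝ) (P : ι → ℂ[X]) (x : ℝ) :
    expPoly (∑ i ∈ s, Finsupp.single (e i) (P i)) x =
      ∑ i ∈ s, (Real.exp (e i * x) : ℂ) * (P i).eval (x : ℂ) := by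
  rw [expPoly_finset_sum]
  exact Finset.sum_congr rfl fun i _ => expPoly_single _ _ _

lemma eventually_cutoff_eq_one {χ : ℂ → ℂ} (hχ : ∀ᶠ z in 𝓝 0, χ z = 1) {v : ℂ → ℂ}
    (hv : HasCompactSupport v) : ∀ᶠ τ in atBot, ∀ z, rescale τ v z ≠ 0 → χ z = 1 := by
  obtain ⟨R, hR0, hR⟩ := hv.isCompact.isBounded.subset_closedBall_lt 0 0
  obtain ⟨ε, hε, h⟩ := Metric.eventually_nhds_iff.mp hχ
  have h1 : Tendsto (fun τ => R * Real.exp τ) atBot (𝓝 0) := by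
    simpa using Real.tendsto_exp_atBot.const_mul R
  filter_upwards [h1.eventually_lt_const hε] with τ hτ z hz
  refine h (lt_of_le_of_lt ?_ hτ)
  have h2 := hR (subset_tsupport _ hz)
  rw [mem_closedBall_zero_iff, norm_smul, Real.norm_eq_abs, Real.abs_exp, Real.exp_neg,
    inv_mul_le_iff₀ (Real.exp_pos τ)] at h2
  rw [dist_zero_right]
  linarith

lemma integral_cutoff_mul_rescale {Θ : ℝ} {χ ψ v : ℂ → ℂ} {τ : ℝ}
    (h : ∀ z, rescale τ v z ≠ 0 → χ z = 1) :
    ∫ z, χ z * ψ z * rescale τ v z ∂(sectorMeasure Θ) =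
      (Real.exp (2 * τ) : ℂ) * ∫ z, ψ (Real.exp τ • z) * v z ∂(sectorMeasure Θ) := by
  rw [← integral_rescale]
  refine integral_congr_ae (.of_forall fun z => ?_)
  by_cases hz : rescale τ v z = 0
  · simp [hz]
  · simp [h z hz]

lemma eq_zero_of_fderiv_eq_zero {Θ d : ℝ} (hΘ₀ : 0 < Θ) (hΘ : Θ < 2 * Real.pi) {φ : ℂ → ℂ}
    (hφ : φ ∈ singDeg Θ d) (h : ∀ z ∈ sector Θ, ∀ e, e = 1 ∨ e = Complex.I → dirDeriv e φ z = 0) :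
    ∀ z ∈ sector Θ, φ z = 0 := by
  have h0 : EqOn (fderiv ℝ φ) 0 (sector Θ) := by
    intro z hz
    ext1 e
    have : e = e.re • (1 : ℂ) + e.im • Complex.I := by
      simp
    rw [this, map_add, map_smul, map_smul]
    have h1 := h z hz 1 (Or.inl rfl)
    have h2 := h z hz Complex.I (Or.inr rfl)
    unfold dirDeriv at h1 h2
    simp [h1, h2]
  intro z hz
  obtain ⟨N, a, ha⟩ := hasLogExpansion_of_mem hφ
  have hcont : Continuous fun θ : ℝ => logFun d N a (θ * Complex.I) :=
    (contDiff_logFun d N ha.smooth).continuous.comp (by fun_prop)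
  have hlim : Tendsto (fun θ : ℝ => logFun d N a (θ * Complex.I)) (𝓝[<] Θ) (𝓝 0) := by
    have h1 := (hcont.tendsto Θ).mono_left (nhdsWithin_le_nhds (s := Iio Θ))
    have h2 : logFun d N a (Θ * Complex.I) = 0 := by
      simp [logFun, ha.apply_top]
    rwa [h2] at h1
  refine tendsto_nhds_unique (tendsto_const_nhds.congr' ?_) hlim
  filter_upwards [Ioo_mem_nhdsLT hΘ₀] with θ hθ
  have hm : Complex.exp (θ * Complex.I) ∈ sector Θ := exp_mem_sector (by simpa [strip] using hθ)
  rw [(isOpen_sector Θ).is_const_of_fderiv_eq_zero (isPreconnected_sector Θ)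
    (fun z hz => ((singDeg_contDiffAt hΘ hφ hz).differentiableAt (by simp)).differentiableWithinAt)
    h0 hz hm, ha.eqOn hΘ hm, lg_exp (abs_sub_half_lt hΘ (by simpa using hθ.1.le)
      (by simpa using hθ.2.le))]

/-- If singular terms of nonpositive degree are of finite energy near the vertex, they vanish. -/
lemma singular_eq_zero_of_H1 {Θ : ℝ} (hΘ₀ : 0 < Θ) (hΘ : Θ < 2 * Real.pi) {χ : ℂ → ℂ}
    (hχ : ∀ᶠ z in 𝓝 0, χ z = 1) {f : ℝ →₀ (ℂ → ℂ)} (hf : ∀ d, f d ∈ singDeg Θ d)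
    (w : H1 Θ) (h : ∀ᵐ z ∂(sectorMeasure Θ), χ z * f.sum (fun _ x => x) z = fnOf w z)
    {d : ℝ} (hd : d ≤ 0) : ∀ z ∈ sector Θ, f d z = 0 := by
  have key : ∀ e we, IsWeakDeriv Θ e (fnOf w) we → MemLp we 2 (sectorMeasure Θ) →
      ∀ v, IsTest Θ v → ∫ z, f d z * dirDeriv e v z ∂(sectorMeasure Θ) = 0 := by
    intro e we hwe hm v hv
    obtain ⟨P, hP, hP0⟩ := exists_expPoly_scaled_integral hΘ hf (hv.dirDeriv e)
    rw [← hP0]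
    have hlim : Tendsto (expPoly (∑ d ∈ f.support, Finsupp.single d (P d))) atBot (𝓝 0) := by
      have h1 := (tendsto_integral_rescale hm hv).neg
      rw [neg_zero] at h1
      refine h1.congr' ?_
      filter_upwards [eventually_cutoff_eq_one hχ (hv.dirDeriv e).1.2] with τ hτ
      rw [expPoly_sum_single, ← hP]
      have h2 := hwe _ (isTest_rescale hv τ)
      have h3 : ∫ z, fnOf w z * dirDeriv e (rescale τ v) z ∂(sectorMeasure Θ) =
          (Real.exp (-τ) : ℂ) * ∫ z, χ z * f.sum (fun _ x => x) z * rescale τ (dirDeriv e v) z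
            ∂(sectorMeasure Θ) := by
        rw [← integral_const_mul]
        refine integral_congr_ae ?_
        filter_upwards [h] with z hz
        rw [dirDeriv_rescale τ hv.1.differentiable, hz]
        ring
      rw [h3, integral_cutoff_mul_rescale hτ] at h2
      rw [← mul_neg, ← h2, ← mul_assoc, ← mul_assoc, ← Complex.ofReal_mul, ← Complex.ofReal_mul,
        ← Real.exp_add, ← Real.exp_add]
      ring_nf
      simp
    have h0 := expPoly_apply_eq_zero_of_tendsto hlim hd
    rw [Finsupp.finsetSum_apply] at h0
    by_cases hs : d ∈ f.support
    · rw [Finset.sum_eq_single_of_mem d hs (fun b _ hb => Finsupp.single_eq_of_ne hb.symm),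
        Finsupp.single_eq_same] at h0
      rw [h0, eval_zero]
    · rw [hP0, Finsupp.notMem_support_iff.mp hs]
      simp
  have key2 : ∀ e we, IsWeakDeriv Θ e (fnOf w) we → MemLp we 2 (sectorMeasure Θ) →
      ∀ z ∈ sector Θ, dirDeriv e (f d) z = 0 := by
    intro e we hwe hm
    refine eqOn_zero_of_integral_test (fun z hz => (contDiffAt_dirDeriv
      (singDeg_contDiffAt hΘ (hf d) hz) e).continuousAt.continuousWithinAt) fun v hv => ?_
    have h1 := integral_mul_dirDeriv_test hv (fun z hz =>
      (singDeg_contDiffAt hΘ (hf d) hz).of_le (by simp)) e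
    rw [key e we hwe hm v hv] at h1
    exact neg_eq_zero.mp h1.symm
  refine eq_zero_of_fderiv_eq_zero hΘ₀ hΘ (hf d) fun z hz e he => ?_
  rcases he with rfl | rfl
  · exact key2 _ _ w.2.1 (Lp.memLp _) z hz
  · exact key2 _ _ w.2.2 (Lp.memLp _) z hz

lemma laplacian_test {Θ : ℝ} {v : ℂ → ℂ} (hv : IsTest Θ v) :
    Laplacian.laplacian v = dirDeriv 1 (dirDeriv 1 v) + dirDeriv Complex.I (dirDeriv Complex.I v) :=
  funext fun _ => laplacian_eq_dirDeriv (hv.1.1.contDiffAt.of_le (by norm_cast))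

lemma isTest_laplacian {Θ : ℝ} {v : ℂ → ℂ} (hv : IsTest Θ v) :
    IsTest Θ (Laplacian.laplacian v) := by
  rw [laplacian_test hv]
  exact ((hv.dirDeriv 1).dirDeriv 1).add ((hv.dirDeriv _).dirDeriv _)

lemma laplacian_rescale {Θ : ℝ} (τ : ℝ) {v : ℂ → ℂ} (hv : IsTest Θ v) (z : ℂ) :
    Laplacian.laplacian (rescale τ v) z =
      (Real.exp (-(2 * τ)) : ℂ) * rescale τ (Laplacian.laplacian v) z := by
  have h1 : ∀ e, dirDeriv e (dirDeriv e (rescale τ v)) z =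
      (Real.exp (-(2 * τ)) : ℂ) * rescale τ (dirDeriv e (dirDeriv e v)) z := by
    intro e
    have h2 : dirDeriv e (rescale τ v) = (Real.exp (-τ) : ℂ) • rescale τ (dirDeriv e v) :=
      funext fun z => dirDeriv_rescale τ hv.1.differentiable e z
    rw [h2, dirDeriv_smul _ ((isTest_rescale (hv.dirDeriv e) τ).1.differentiable _),
      dirDeriv_rescale τ (hv.dirDeriv e).1.differentiable, ← mul_assoc, ← Complex.ofReal_mul,
      ← Real.exp_add]
    ring_nf
  rw [laplacian_test (isTest_rescale hv τ), laplacian_test hv, Pi.add_apply, h1, h1, ← mul_add]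
  rfl

/-- The homogeneous Helmholtz equation near the vertex, separated by degrees. -/
lemma integral_laplacian_eq_zero_of_solves {Θ μ₀ ρ₀ : ℝ} {ω : ℂ} (hΘ : Θ < 2 * Real.pi)
    (hμ₀ : 0 < μ₀) {χ : ℂ → ℂ}
    (hχ : ∀ᶠ z in 𝓝 0, χ z = 1) {f : ℝ →₀ (ℂ → ℂ)} (hf : ∀ d, f d ∈ singDeg Θ d)
    (w : H1 Θ) (hint : ∀ v, IsTest Θ v →
      Integrable (fun z => χ z * f.sum (fun _ x => x) z * v z) (sectorMeasure Θ))
    (h : ∀ v, IsTest Θ v → ∫ z, (fnOf w z + χ z * f.sum (fun _ x => x) z) *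
      (μ₀ * Laplacian.laplacian v z + ω ^ 2 * ρ₀ * v z) ∂(sectorMeasure Θ) = 0)
    {d : ℝ} (hd : d ≤ 0) (hlow : ∀ z ∈ sector Θ, f (d - 2) z = 0) {v : ℂ → ℂ} (hv : IsTest Θ v) :
    ∫ z, f d z * Laplacian.laplacian v z ∂(sectorMeasure Θ) = 0 := by
  obtain ⟨P, hP, hP0⟩ := exists_expPoly_scaled_integral hΘ hf (isTest_laplacian hv)
  obtain ⟨Q, hQ, hQ0⟩ := exists_expPoly_scaled_integral hΘ hf hv
  set ψ := f.sum fun _ x => x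
  have hmw : MemLp (fnOf w) 2 (sectorMeasure Θ) := Lp.memLp _
  have hlim : Tendsto (expPoly (∑ d ∈ f.support, Finsupp.single d (C (μ₀ : ℂ) * P d) +
      ∑ d ∈ f.support, Finsupp.single (d + 2) (C (ω ^ 2 * ρ₀) * Q d))) atBot (𝓝 0) := by
    have t1 := tendsto_integral_rescale (Lp.memLp (w.1 1)) (hv.dirDeriv 1)
    have t2 := tendsto_integral_rescale (Lp.memLp (w.1 2)) (hv.dirDeriv Complex.I)
    have t3 := (Complex.continuous_ofReal.tendsto 0).comp Real.tendsto_exp_atBot |>.mul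
      (tendsto_integral_rescale hmw hv)
    have t4 := ((t1.add t2).const_mul (μ₀ : ℂ)).sub (t3.const_mul (ω ^ 2 * ρ₀))
    simp only [add_zero, mul_zero, sub_zero] at t4
    refine t4.congr' ?_
    filter_upwards [eventually_cutoff_eq_one hχ (isTest_laplacian hv).1.2,
      eventually_cutoff_eq_one hχ hv.1.2] with τ hτ1 hτ2
    have hvτ := isTest_rescale hv τ
    have e0 := h _ hvτ
    have e1 : ∫ z, χ z * ψ z * (μ₀ * Laplacian.laplacian (rescale τ v) z +
        ω ^ 2 * ρ₀ * rescale τ v z) ∂(sectorMeasure Θ) =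
        expPoly (∑ d ∈ f.support, Finsupp.single d (C (μ₀ : ℂ) * P d) +
          ∑ d ∈ f.support, Finsupp.single (d + 2) (C (ω ^ 2 * ρ₀) * Q d)) τ := by
      have i1 : ∫ z, χ z * ψ z * (μ₀ * Laplacian.laplacian (rescale τ v) z +
          ω ^ 2 * ρ₀ * rescale τ v z) ∂(sectorMeasure Θ) =
          ∫ z, (μ₀ * (Real.exp (-(2 * τ)) : ℂ)) *
              (χ z * ψ z * rescale τ (Laplacian.laplacian v) z) +
            ω ^ 2 * ρ₀ * (χ z * ψ z * rescale τ v z) ∂(sectorMeasure Θ) := by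
        refine integral_congr_ae (.of_forall fun z => ?_)
        simp only
        rw [laplacian_rescale τ hv]
        ring
      rw [i1, integral_add ((hint _ (isTest_rescale (isTest_laplacian hv) τ)).const_mul _)
        ((hint _ hvτ).const_mul _), integral_const_mul, integral_const_mul,
        integral_cutoff_mul_rescale hτ1, integral_cutoff_mul_rescale hτ2, hP, hQ, expPoly_add,
        expPoly_sum_single, expPoly_sum_single, mul_assoc, ← mul_assoc (Real.exp _ : ℂ),
        ← Complex.ofReal_mul, ← Real.exp_add, neg_add_cancel, Real.exp_zero, Complex.ofReal_one,
        one_mul, Finset.mul_sum, Finset.mul_sum, Finset.mul_sum]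
      congr 1
      · refine Finset.sum_congr rfl fun d _ => ?_
        rw [eval_mul, eval_C]; ring
      · refine Finset.sum_congr rfl fun d _ => ?_
        rw [eval_mul, eval_C, add_mul, Real.exp_add, Complex.ofReal_mul]; ring
    have e2 : ∫ z, fnOf w z * (μ₀ * Laplacian.laplacian (rescale τ v) z +
        ω ^ 2 * ρ₀ * rescale τ v z) ∂(sectorMeasure Θ) =
        -(μ₀ * ((Real.exp (-τ) : ℂ) * ∫ z, w.1 1 z * rescale τ (dirDeriv 1 v) z ∂(sectorMeasure Θ) +
          (Real.exp (-τ) : ℂ) *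
            ∫ z, w.1 2 z * rescale τ (dirDeriv Complex.I v) z ∂(sectorMeasure Θ)) -
          ω ^ 2 * ρ₀ * ((Real.exp τ : ℂ) * ((Real.exp (-τ) : ℂ) *
            ∫ z, fnOf w z * rescale τ v z ∂(sectorMeasure Θ)))) := by
      have j : ∀ u : ℂ → ℂ, IsTest Θ u → Integrable (fun z => fnOf w z * u z) (sectorMeasure Θ) :=
        fun u hu => hmw.integrable_mul (hu.1.memLp Θ 2)
      have k : ∀ e we, IsWeakDeriv Θ e (fnOf w) we →
          ∫ z, fnOf w z * dirDeriv e (dirDeriv e (rescale τ v)) z ∂(sectorMeasure Θ) =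
          -((Real.exp (-τ) : ℂ) * ∫ z, we z * rescale τ (dirDeriv e v) z ∂(sectorMeasure Θ)) := by
        intro e we hwe
        rw [hwe _ (hvτ.dirDeriv e), ← integral_const_mul]
        congr 1
        refine integral_congr_ae (.of_forall fun z => ?_)
        simp only
        rw [dirDeriv_rescale τ hv.1.differentiable]
        ring
      have i1 : ∫ z, fnOf w z * (μ₀ * Laplacian.laplacian (rescale τ v) z +
          ω ^ 2 * ρ₀ * rescale τ v z) ∂(sectorMeasure Θ) =
          ∫ z, (μ₀ : ℂ) * (fnOf w z * dirDeriv 1 (dirDeriv 1 (rescale τ v)) z +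
            fnOf w z * dirDeriv Complex.I (dirDeriv Complex.I (rescale τ v)) z) +
            ω ^ 2 * ρ₀ * (fnOf w z * rescale τ v z) ∂(sectorMeasure Θ) := by
        refine integral_congr_ae (.of_forall fun z => ?_)
        simp only
        rw [laplacian_test hvτ, Pi.add_apply]
        ring
      have ji : ∀ e, Integrable (fun z => fnOf w z * dirDeriv e (dirDeriv e (rescale τ v)) z)
        (sectorMeasure Θ) := fun e => j _ ((hvτ.dirDeriv e).dirDeriv e)
      have js : Integrable (fun z => fnOf w z * dirDeriv 1 (dirDeriv 1 (rescale τ v)) z +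
          fnOf w z * dirDeriv Complex.I (dirDeriv Complex.I (rescale τ v)) z) (sectorMeasure Θ) :=
        (ji 1).add (ji Complex.I)
      rw [i1, integral_add (js.const_mul _) ((j _ hvτ).const_mul _),
        integral_const_mul, integral_const_mul, integral_add (ji 1) (ji _), k _ _ w.2.1,
        k _ _ w.2.2, ← mul_assoc (Real.exp τ : ℂ), ← Complex.ofReal_mul, ← Real.exp_add,
        add_neg_cancel, Real.exp_zero, Complex.ofReal_one, one_mul]
      ring
    have hG : IsTest Θ (fun z => μ₀ * Laplacian.laplacian (rescale τ v) z +
        ω ^ 2 * ρ₀ * rescale τ v z) :=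
      ((isTest_laplacian hvτ).smul (μ₀ : ℂ)).add (hvτ.smul (ω ^ 2 * ρ₀))
    have i3 : Integrable (fun z => fnOf w z * (μ₀ * Laplacian.laplacian (rescale τ v) z +
        ω ^ 2 * ρ₀ * rescale τ v z)) (sectorMeasure Θ) := hmw.integrable_mul (hG.1.memLp Θ 2)
    simp_rw [add_mul] at e0
    rw [integral_add i3 (hint _ hG), e1, e2] at e0
    exact (add_neg_eq_zero.mp (by rw [add_comm]; exact e0)).symm
  have h0 := congrArg (eval 0) (expPoly_apply_eq_zero_of_tendsto hlim hd)
  rw [Finsupp.add_apply, Finsupp.finsetSum_apply, Finsupp.finsetSum_apply, eval_add, eval_zero,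
    eval_finsetSum, eval_finsetSum] at h0
  have z2 : ∑ e ∈ f.support, eval 0 (Finsupp.single (e + 2) (C (ω ^ 2 * (ρ₀ : ℂ)) * Q e) d) = 0 := by
    refine Finset.sum_eq_zero fun e _ => ?_
    by_cases he : e + 2 = d
    · obtain rfl : e = d - 2 := by linarith
      rw [he, Finsupp.single_eq_same, eval_mul, hQ0, setIntegral_congr_fun (g := fun _ => (0 : ℂ))
        (measurableSet_sector Θ) fun z hz => by simp only [hlow z hz, zero_mul]]
      simp
    · rw [Finsupp.single_eq_of_ne (Ne.symm he), eval_zero]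
  rw [z2, add_zero] at h0
  by_cases hs : d ∈ f.support
  · rw [Finset.sum_eq_single_of_mem d hs
      (fun b _ hb => by rw [Finsupp.single_eq_of_ne hb.symm, eval_zero]),
      Finsupp.single_eq_same, eval_mul, eval_C, hP0] at h0
    exact (mul_eq_zero.mp h0).resolve_left (by exact_mod_cast hμ₀.ne')
  · rw [Finsupp.notMem_support_iff.mp hs]
    simp

/-! ### Harmonic functions of logarithmic type -/

lemma hasFDerivAt_mul_of_hasDerivAt {f : ℂ → ℂ} {c z : ℂ} (h : HasDerivAt f c z) :
    HasFDerivAt f (ContinuousLinearMap.mul ℝ ℂ c) z :=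
  (h.hasFDerivAt.restrictScalars ℝ).congr_fderiv (by ext; simp [mul_comm])

/-- The Laplacian is conformally covariant under the logarithm. -/
lemma laplacian_comp_lg {Θ : ℝ} {g : ℂ → ℂ} {z : ℂ} (hz : z ∈ slit Θ)
    (hg : ContDiff ℝ (⊤ : ℕ∞) g) :
    Laplacian.laplacian (fun z => g (lg Θ z)) z =
      (‖z⁻¹‖ ^ 2 : ℝ) * Laplacian.laplacian g (lg Θ z) := by
  have hlg : ∀ w ∈ slit Θ, HasFDerivAt (lg Θ) (ContinuousLinearMap.mul ℝ ℂ w⁻¹) w :=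
    fun w hw => hasFDerivAt_mul_of_hasDerivAt (hasDerivAt_lg hw)
  have h1 : ∀ e, ∀ w ∈ slit Θ, dirDeriv e (fun z => g (lg Θ z)) w =
      fderiv ℝ g (lg Θ w) (w⁻¹ * e) := by
    intro e w hw
    have h := ((hg.differentiable (by simp) (lg Θ w)).hasFDerivAt.comp w (hlg w hw)).fderiv
    unfold dirDeriv
    change (fderiv ℝ (g ∘ lg Θ) w) e = _
    rw [h]
    rfl
  have h2 : ∀ e, dirDeriv e (dirDeriv e (fun z => g (lg Θ z))) z =
      fderiv ℝ (fderiv ℝ g) (lg Θ z) (z⁻¹ * e) (z⁻¹ * e) +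
        fderiv ℝ g (lg Θ z) (-(z ^ 2)⁻¹ * e * e) := by
    intro e
    have hev : dirDeriv e (fun z => g (lg Θ z)) =ᶠ[𝓝 z]
        fun w => fderiv ℝ g (lg Θ w) (w⁻¹ * e) := by
      filter_upwards [(isOpen_slit Θ).mem_nhds hz] with w hw
      exact h1 e w hw
    have hd : HasFDerivAt (fun w => fderiv ℝ g (lg Θ w))
        ((fderiv ℝ (fderiv ℝ g) (lg Θ z)).comp (ContinuousLinearMap.mul ℝ ℂ z⁻¹)) z :=
      (((hg.fderiv_right (m := (⊤ : ℕ∞)) (by simp)).differentiable (by simp)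
        (lg Θ z)).hasFDerivAt).comp z (hlg z hz)
    have hi : HasFDerivAt (fun w : ℂ => w⁻¹ * e)
        (ContinuousLinearMap.mul ℝ ℂ (-(z ^ 2)⁻¹ * e)) z :=
      hasFDerivAt_mul_of_hasDerivAt ((hasDerivAt_inv (ne_zero_of_mem_slit hz)).mul_const e)
    have := (hd.clm_apply hi).fderiv
    change fderiv ℝ (dirDeriv e (fun z => g (lg Θ z))) z e = _
    rw [hev.fderiv_eq, this]
    simp [add_comm]
  have hc : ContDiffAt ℝ 2 (fun z => g (lg Θ z)) z :=
    (hg.contDiffAt.comp z (contDiffAt_lg hz)).of_le (by norm_cast)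
  have hgg : ∀ e, dirDeriv e (dirDeriv e g) (lg Θ z) =
      fderiv ℝ (fderiv ℝ g) (lg Θ z) e e := by
    intro e
    have hd := ((hg.fderiv_right (m := (⊤ : ℕ∞)) (by simp)).differentiable (by simp)
        (lg Θ z)).hasFDerivAt
    have := (hd.clm_apply (hasFDerivAt_const e (lg Θ z))).fderiv
    change fderiv ℝ (fun w => fderiv ℝ g w e) (lg Θ z) e = _
    rw [this]
    simp
  rw [laplacian_eq_dirDeriv hc, laplacian_eq_dirDeriv (hg.contDiffAt.of_le (by norm_cast)), h2, h2,
    hgg, hgg]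
  set B := fderiv ℝ (fderiv ℝ g) (lg Θ z)
  have e1 : -(z ^ 2)⁻¹ * Complex.I * Complex.I = -(-(z ^ 2)⁻¹ * 1 * 1) := by
    rw [mul_assoc, Complex.I_mul_I]; ring
  rw [e1, map_neg]
  have e2 : z⁻¹ * 1 = (z⁻¹).re • (1 : ℂ) + (z⁻¹).im • Complex.I := by
    rw [mul_one, Complex.real_smul, Complex.real_smul, mul_one, Complex.re_add_im]
  have e3 : z⁻¹ * Complex.I = (-(z⁻¹).im) • (1 : ℂ) + (z⁻¹).re • Complex.I := by
    apply Complex.ext <;> simp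
  have e4 : ‖z⁻¹‖ ^ 2 = (z⁻¹).re ^ 2 + (z⁻¹).im ^ 2 := by
    rw [Complex.sq_norm, Complex.normSq_apply]; ring
  rw [e2, e3, e4]
  simp only [map_add, map_smul, add_apply, smul_apply]
  simp only [Complex.real_smul]
  push_cast
  ring

lemma logFun_apply (d : ℝ) (N : ℕ) (a : ℕ → ℝ → ℂ) (s θ : ℝ) :
    logFun d N a (s + θ * Complex.I) =
      (Real.exp (d * s) : ℂ) * ∑ j ∈ Finset.range N, (s : ℂ) ^ j * a j θ := by
  simp [logFun]

lemma dirDeriv_eq_deriv_line {g : ℂ → ℂ} {ζ e : ℂ} (hg : DifferentiableAt ℝ g ζ) :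
    HasDerivAt (fun t : ℝ => g (ζ + t * e)) (dirDeriv e g ζ) 0 := by
  have h1 : HasDerivAt (fun t : ℝ => ζ + t * e) e 0 := by
    simpa using ((Complex.ofRealCLM.hasDerivAt (x := 0)).mul_const e).const_add ζ
  have h2 : HasFDerivAt g (fderiv ℝ g ζ) (ζ + ((0 : ℝ) : ℂ) * e) := by simpa using hg.hasFDerivAt
  exact h2.comp_hasDerivAt (0 : ℝ) h1

lemma dirDeriv_one_logFun (d : ℝ) {N : ℕ} {a : ℕ → ℝ → ℂ} (ha : ∀ j, ContDiff ℝ (⊤ : ℕ∞) (a j))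
    (hN : ∀ j, N ≤ j → a j = 0) :
    dirDeriv 1 (logFun d N a) = logFun d N fun j θ => d * a j θ + (j + 1) * a (j + 1) θ := by
  funext ζ
  have h1 := dirDeriv_eq_deriv_line (e := 1)
    ((contDiff_logFun d N ha).differentiable (by simp) ζ)
  have hre : HasDerivAt (fun t : ℝ => ((ζ.re + t : ℝ) : ℂ)) 1 0 := by
    simpa using ((hasDerivAt_id (0 : ℝ)).const_add ζ.re).ofReal_comp
  have hex : HasDerivAt (fun t : ℝ => (Real.exp (d * (ζ.re + t)) : ℂ))
      ((Real.exp (d * ζ.re) * d : ℝ) : ℂ) 0 := by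
    have h := (((hasDerivAt_id (0 : ℝ)).const_add ζ.re).const_mul d).exp.ofReal_comp
    simpa using h
  have h2 : HasDerivAt (fun t : ℝ => logFun d N a (ζ + t * 1))
      (((Real.exp (d * ζ.re) * d : ℝ) : ℂ) * (∑ j ∈ Finset.range N, (ζ.re : ℂ) ^ j * a j ζ.im) +
        (Real.exp (d * ζ.re) : ℂ) *
          ∑ j ∈ Finset.range N, (j * (ζ.re : ℂ) ^ (j - 1)) * a j ζ.im) 0 := by
    have h3 : HasDerivAt (fun t : ℝ => ∑ j ∈ Finset.range N,
        ((ζ.re + t : ℝ) : ℂ) ^ j * a j ζ.im)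
        (∑ j ∈ Finset.range N, (j * (ζ.re : ℂ) ^ (j - 1)) * a j ζ.im) 0 := by
      refine HasDerivAt.fun_sum fun j _ => ?_
      have := (hre.pow j).mul_const (a j ζ.im)
      simpa using this
    have h4 := hex.mul h3
    refine (h4.congr_deriv ?_).congr_of_eventuallyEq (.of_forall fun t => by simp [logFun])
    simp
  rw [h1.unique h2]
  unfold logFun
  rw [Complex.ofReal_mul, mul_assoc, ← mul_add]
  congr 1
  simp only [mul_add, Finset.sum_add_distrib, Finset.mul_sum]
  congr 1
  · exact Finset.sum_congr rfl fun j _ => by ring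
  · cases N with
    | zero => simp
    | succ M =>
      rw [Finset.sum_range_succ', Finset.sum_range_succ, hN (M + 1) le_rfl]
      simp only [Nat.cast_zero, zero_mul, add_zero, Pi.zero_apply, mul_zero]
      refine Finset.sum_congr rfl fun j _ => ?_
      push_cast
      ring

lemma dirDeriv_I_logFun (d : ℝ) {N : ℕ} {a : ℕ → ℝ → ℂ} (ha : ∀ j, ContDiff ℝ (⊤ : ℕ∞) (a j)) :
    dirDeriv Complex.I (logFun d N a) = logFun d N fun j => deriv (a j) := by
  funext ζ
  have h1 := dirDeriv_eq_deriv_line (e := Complex.I)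
    ((contDiff_logFun d N ha).differentiable (by simp) ζ)
  have h2 : HasDerivAt (fun t : ℝ => logFun d N a (ζ + t * Complex.I))
      (logFun d N (fun j => deriv (a j)) ζ) 0 := by
    have h3 : HasDerivAt (fun t : ℝ => ∑ j ∈ Finset.range N, (ζ.re : ℂ) ^ j * a j (ζ.im + t))
        (∑ j ∈ Finset.range N, (ζ.re : ℂ) ^ j * deriv (a j) ζ.im) 0 := by
      refine HasDerivAt.fun_sum fun j _ => ?_
      have h4 : HasDerivAt (a j) (deriv (a j) ζ.im) (ζ.im + 0) := by
        rw [add_zero]; exact ((ha j).differentiable (by simp) _).hasDerivAt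
      exact (h4.comp_const_add ζ.im 0).const_mul _
    exact (h3.const_mul (Real.exp (d * ζ.re) : ℂ)).congr_of_eventuallyEq
      (.of_forall fun t => by simp [logFun])
  exact h1.unique h2

/-- The coefficients of the Laplacian in logarithmic polar coordinates. -/
def lapCoeff (d : ℝ) (a : ℕ → ℝ → ℂ) (j : ℕ) (θ : ℝ) : ℂ :=
  deriv (deriv (a j)) θ + d ^ 2 * a j θ + 2 * d * (j + 1) * a (j + 1) θ +
    (j + 1) * (j + 2) * a (j + 2) θ

lemma contDiff_deriv_top {a : ℝ → ℂ} (ha : ContDiff ℝ (⊤ : ℕ∞) a) :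
    ContDiff ℝ (⊤ : ℕ∞) (deriv a) := ((contDiff_infty_iff_deriv (𝕜 := ℝ)).mp ha).2

lemma laplacian_logFun (d : ℝ) {N : ℕ} {a : ℕ → ℝ → ℂ} (ha : ∀ j, ContDiff ℝ (⊤ : ℕ∞) (a j))
    (hN : ∀ j, N ≤ j → a j = 0) :
    Laplacian.laplacian (logFun d N a) = logFun d N (lapCoeff d a) := by
  funext ζ
  rw [laplacian_eq_dirDeriv ((contDiff_logFun d N ha).contDiffAt.of_le (by norm_cast)),
    dirDeriv_one_logFun d ha hN, dirDeriv_I_logFun d ha, dirDeriv_one_logFun d, dirDeriv_I_logFun]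
  · unfold logFun
    rw [← mul_add, ← Finset.sum_add_distrib]
    congr 1
    refine Finset.sum_congr rfl fun j _ => ?_
    simp only [lapCoeff]
    push_cast
    ring
  · exact fun j => contDiff_deriv_top (ha j)
  · intro j
    exact (contDiff_const.mul (ha j)).add (contDiff_const.mul (ha (j + 1)))
  · intro j hj
    funext θ
    simp [hN j hj, hN (j + 1) (by omega)]

lemma coeff_eq_zero_of_forall_sum {N : ℕ} {b : ℕ → ℂ}
    (h : ∀ s : ℝ, ∑ j ∈ Finset.range N, (s : ℂ) ^ j * b j = 0) {j : ℕ} (hj : j < N) : b j = 0 := by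
  let p : ℂ[X] := ∑ j ∈ Finset.range N, C (b j) * Polynomial.X ^ j
  have hp : p = 0 := by
    refine Polynomial.eq_zero_of_infinite_isRoot p ?_
    refine (Set.infinite_range_of_injective Complex.ofReal_injective).mono ?_
    rintro _ ⟨s, rfl⟩
    change eval _ p = 0
    rw [eval_finsetSum, ← h s]
    refine Finset.sum_congr rfl fun j _ => ?_
    rw [eval_mul, eval_C, eval_pow, eval_X, mul_comm]
  have h1 := congrArg (fun q => Polynomial.coeff q j) hp
  simpa [p, Polynomial.finsetSum_coeff, Polynomial.coeff_C_mul, Polynomial.coeff_X_pow, hj]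
    using h1

lemma HasLogExpansion.lapCoeff_eq_zero {Θ d : ℝ} (hΘ₀ : 0 < Θ) (hΘ : Θ < 2 * Real.pi) {φ : ℂ → ℂ}
    {N : ℕ} {a : ℕ → ℝ → ℂ} (h : HasLogExpansion Θ d φ N a)
    (hφ : ∀ z ∈ sector Θ, Laplacian.laplacian φ z = 0) (j : ℕ) {θ : ℝ} (hθ : θ ∈ Icc 0 Θ) :
    lapCoeff d a j θ = 0 := by
  by_cases hj : j < N
  swap
  · push Not at hj
    simp only [lapCoeff]
    rw [h.vanish j hj, h.vanish (j + 1) (by omega), h.vanish (j + 2) (by omega)]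
    have : deriv (0 : ℝ → ℂ) = 0 := by funext x; simp
    simp [this]
  have hc : Continuous (lapCoeff d a j) := by
    unfold lapCoeff
    have h1 := (contDiff_deriv_top (contDiff_deriv_top (h.smooth j))).continuous
    have h2 := (h.smooth j).continuous
    have h3 := (h.smooth (j + 1)).continuous
    have h4 := (h.smooth (j + 2)).continuous
    fun_prop
  have hin : ∀ θ ∈ Ioo 0 Θ, lapCoeff d a j θ = 0 := by
    intro θ hθ
    refine coeff_eq_zero_of_forall_sum (b := fun j => lapCoeff d a j θ) (N := N) (fun s => ?_) hj
    have hm : Complex.exp (s + θ * Complex.I) ∈ sector Θ :=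
      exp_mem_sector (by simpa [strip] using hθ)
    have hsl := sector_subset_slit hΘ hm
    have h1 := hφ _ hm
    have hev : φ =ᶠ[𝓝 (Complex.exp (s + θ * Complex.I))] fun z => logFun d N a (lg Θ z) := by
      filter_upwards [(isOpen_sector Θ).mem_nhds hm] with w hw
      exact h.eqOn hΘ hw
    rw [(InnerProductSpace.laplacian_congr_nhds hev).eq_of_nhds,
      laplacian_comp_lg hsl (contDiff_logFun d N h.smooth), laplacian_logFun d h.smooth h.vanish,
      lg_exp (abs_sub_half_lt hΘ (by simpa using hθ.1.le) (by simpa using hθ.2.le)),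
      logFun_apply] at h1
    have hne : ((‖(Complex.exp (s + θ * Complex.I))⁻¹‖ ^ 2 : ℝ) : ℂ) ≠ 0 := by
      rw [norm_inv, norm_exp_add_mul_I]
      exact_mod_cast (by positivity : (((Real.exp s)⁻¹) ^ 2 : ℝ) ≠ 0)
    have hne2 : (Real.exp (d * s) : ℂ) ≠ 0 := by exact_mod_cast (Real.exp_pos _).ne'
    exact (mul_eq_zero.mp ((mul_eq_zero.mp h1).resolve_left hne)).resolve_left hne2
  have hcl : IsClosed {θ | lapCoeff d a j θ = 0} := isClosed_eq hc continuous_const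
  have := hcl.closure_subset_iff.mpr (show Ioo 0 Θ ⊆ {θ | lapCoeff d a j θ = 0} from hin)
  rw [closure_Ioo hΘ₀.ne] at this
  exact this hθ

/-- Solutions of `a'' + d² a = 0` which vanish at the endpoint. -/
lemma ode_solution {d Θ : ℝ} {a : ℝ → ℂ} (ha : ContDiff ℝ (⊤ : ℕ∞) a) (hΘ : a Θ = 0)
    (h : ∀ θ ∈ Icc 0 Θ, deriv (deriv a) θ + d ^ 2 * a θ = 0) :
    if d = 0 then ∃ c : ℂ, ∀ θ ∈ Icc 0 Θ, a θ = c * (θ - Θ)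
    else ∃ c : ℂ, ∀ θ ∈ Icc 0 Θ, a θ = c * Real.sin (d * (θ - Θ)) := by
  have ha1 : ∀ θ, HasDerivAt a (deriv a θ) θ := fun θ =>
    (ha.differentiable (by simp) θ).hasDerivAt
  have ha2 : ∀ θ, HasDerivAt (deriv a) (deriv (deriv a) θ) θ := fun θ =>
    ((contDiff_deriv_top ha).differentiable (by simp) θ).hasDerivAt
  have const : ∀ f : ℝ → ℂ, (∀ θ ∈ Icc 0 Θ, HasDerivAt f 0 θ) → ∀ θ ∈ Icc 0 Θ, f θ = f Θ := by
    intro f hf θ hθ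
    have h1 := constant_of_has_deriv_right_zero
      (fun x hx => (hf x hx).continuousAt.continuousWithinAt)
      (fun x hx => (hf x ⟨hx.1, hx.2.le⟩).hasDerivWithinAt)
    rw [h1 θ hθ, h1 Θ ⟨hθ.1.trans hθ.2, le_rfl⟩]
  split_ifs with hd
  · subst hd
    have hd0 : ∀ θ ∈ Icc 0 Θ, deriv a θ = deriv a Θ := by
      refine const _ fun θ hθ => ?_
      have := h θ hθ
      simp only [Complex.ofReal_zero, ne_eq, OfNat.ofNat_ne_zero, not_false_eq_true, zero_pow,
        zero_mul, add_zero] at this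
      rw [← this]; exact ha2 θ
    refine ⟨deriv a Θ, fun θ hθ => ?_⟩
    have := const (fun θ => a θ - deriv a Θ * (θ - Θ)) (fun θ hθ => ?_) θ hθ
    · simp only [sub_self, mul_zero, hΘ] at this
      exact sub_eq_zero.mp this
    · have h1 : HasDerivAt (fun θ : ℝ => (θ : ℂ) - Θ) 1 θ :=
        (Complex.ofRealCLM.hasDerivAt (x := θ)).sub_const _
      have h2 := (ha1 θ).sub (h1.const_mul (deriv a Θ))
      rw [hd0 θ hθ, mul_one, sub_self] at h2
      exact h2
  · have hdc : (d : ℂ) ≠ 0 := by exact_mod_cast hd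
    have hlin : ∀ θ : ℝ, HasDerivAt (fun θ : ℝ => d * (θ - Θ)) d θ := fun θ => by
      simpa using ((hasDerivAt_id θ).sub_const Θ).const_mul d
    have hs : ∀ θ : ℝ, HasDerivAt (fun θ : ℝ => (Real.sin (d * (θ - Θ)) : ℂ))
        (Real.cos (d * (θ - Θ)) * d : ℝ) θ := fun θ => (hlin θ).sin.ofReal_comp
    have hc : ∀ θ : ℝ, HasDerivAt (fun θ : ℝ => (Real.cos (d * (θ - Θ)) : ℂ))
        (-Real.sin (d * (θ - Θ)) * d : ℝ) θ := fun θ => (hlin θ).cos.ofReal_comp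
    have hp := const (fun θ => a θ * Real.cos (d * (θ - Θ)) -
      deriv a θ * Real.sin (d * (θ - Θ)) / d) fun θ hθ => by
        have h1 := ((ha1 θ).mul (hc θ)).sub (((ha2 θ).mul (hs θ)).div_const (d : ℂ))
        refine h1.congr_deriv ?_
        rw [eq_neg_of_add_eq_zero_left (h θ hθ)]
        push_cast
        field_simp
        ring
    have hq := const (fun θ => a θ * Real.sin (d * (θ - Θ)) +
      deriv a θ * Real.cos (d * (θ - Θ)) / d) fun θ hθ => by
        have h1 := ((ha1 θ).mul (hs θ)).add (((ha2 θ).mul (hc θ)).div_const (d : ℂ))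
        refine h1.congr_deriv ?_
        rw [eq_neg_of_add_eq_zero_left (h θ hθ)]
        push_cast
        field_simp
        ring
    refine ⟨deriv a Θ / d, fun θ hθ => ?_⟩
    have h1 := hp θ hθ
    have h2 := hq θ hθ
    simp only [sub_self, mul_zero, Real.sin_zero, Real.cos_zero, Complex.ofReal_zero,
      Complex.ofReal_one, mul_one, hΘ, zero_div, zero_add] at h1 h2
    have h3 : (Real.sin (d * (θ - Θ)) : ℂ) ^ 2 + (Real.cos (d * (θ - Θ)) : ℂ) ^ 2 = 1 := by
      exact_mod_cast Real.sin_sq_add_cos_sq _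
    rw [← h2]
    linear_combination (Real.cos (d * (θ - Θ)) : ℂ) * h1 - a θ * h3

/-- A homogeneous harmonic function which vanishes on both sides of the sector. -/
lemma exists_eqOn_sing_of_harmonic {Θ d : ℝ} (hΘ₀ : 0 < Θ) (hΘ : Θ < 2 * Real.pi) {φ : ℂ → ℂ}
    (hφ : φ ∈ singDeg Θ d) (hΔ : ∀ z ∈ sector Θ, Laplacian.laplacian φ z = 0)
    (h0 : ∀ r, 0 < r → φ (rayPoint 0 r) = 0) :
    ∃ c : ℂ, (c = 0 ∨ (d ≠ 0 ∧ Real.sin (d * Θ) = 0)) ∧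
      EqOn φ (c • sing Θ d 0 1) (sector Θ) := by
  obtain ⟨N, a, h⟩ := hasLogExpansion_of_mem hφ
  have ha0 : ∀ j, a j 0 = 0 := by
    intro j
    by_cases hj : j < N
    swap
    · rw [h.vanish j (by omega)]; rfl
    refine coeff_eq_zero_of_forall_sum (b := fun j => a j 0) (fun s => ?_) hj
    have h1 := h0 _ (Real.exp_pos s)
    rw [rayPoint_exp, h.eq _ (by simp) (by simpa using Real.pi_pos)] at h1
    have hne2 : (Real.exp (d * s) : ℂ) ≠ 0 := by exact_mod_cast (Real.exp_pos _).ne'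
    simpa [hne2] using h1
  have hL : ∀ j, ∀ θ ∈ Icc 0 Θ, lapCoeff d a j θ = 0 := fun j θ hθ =>
    h.lapCoeff_eq_zero hΘ₀ hΘ hΔ j hθ
  have step : ∀ n, (∀ j, n + 1 < j → ∀ θ ∈ Icc 0 Θ, a j θ = 0) →
      ∀ θ ∈ Icc 0 Θ, a (n + 1) θ = 0 := by
    intro n hn
    have e1 : ∀ θ ∈ Icc 0 Θ, deriv (deriv (a (n + 1))) θ + d ^ 2 * a (n + 1) θ = 0 := by
      intro θ hθ
      have := hL (n + 1) θ hθ
      rw [lapCoeff, hn (n + 1 + 1) (by omega) θ hθ, hn (n + 1 + 2) (by omega) θ hθ] at this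
      simpa using this
    have h1 := ode_solution (h.smooth (n + 1)) (h.apply_top _) e1
    have hm0 : (0 : ℝ) ∈ Icc 0 Θ := ⟨le_rfl, hΘ₀.le⟩
    split_ifs at h1 with hd
    · obtain ⟨c, hc⟩ := h1
      have h2 := hc 0 hm0
      have hne : (Θ : ℂ) ≠ 0 := by exact_mod_cast hΘ₀.ne'
      have hc0 : c = 0 := by simpa [ha0, hne, eq_comm] using h2
      intro θ hθ
      rw [hc θ hθ, hc0, zero_mul]
    · obtain ⟨c, hc⟩ := h1
      have h2 := hc 0 hm0
      rw [ha0] at h2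
      suffices c = 0 by
        intro θ hθ; rw [hc θ hθ, this, zero_mul]
      by_contra hc0
      have hS0 : (Real.sin (d * (0 - Θ)) : ℂ) = 0 := by
        rcases mul_eq_zero.mp h2.symm with h3 | h3
        · exact absurd h3 hc0
        · exact h3
      let S : ℝ → ℝ := fun θ => Real.sin (d * (θ - Θ))
      have hS1 : ∀ θ, HasDerivAt (fun θ => (S θ : ℂ)) (Real.cos (d * (θ - Θ)) * d : ℝ) θ := by
        intro θ
        have hlin : HasDerivAt (fun θ : ℝ => d * (θ - Θ)) d θ := by
          simpa using ((hasDerivAt_id θ).sub_const Θ).const_mul d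
        exact hlin.sin.ofReal_comp
      have hS2 : ∀ θ, HasDerivAt (fun θ : ℝ => ((Real.cos (d * (θ - Θ)) * d : ℝ) : ℂ))
          (-Real.sin (d * (θ - Θ)) * d * d : ℝ) θ := by
        intro θ
        have hlin : HasDerivAt (fun θ : ℝ => d * (θ - Θ)) d θ := by
          simpa using ((hasDerivAt_id θ).sub_const Θ).const_mul d
        exact (hlin.cos.mul_const d).ofReal_comp
      have ha1 : ∀ θ, HasDerivAt (a n) (deriv (a n) θ) θ := fun θ =>
        ((h.smooth n).differentiable (by simp) θ).hasDerivAt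
      have ha2 : ∀ θ, HasDerivAt (deriv (a n)) (deriv (deriv (a n)) θ) θ := fun θ =>
        ((contDiff_deriv_top (h.smooth n)).differentiable (by simp) θ).hasDerivAt
      have hW : ∀ θ ∈ uIcc 0 Θ, HasDerivAt (fun θ => deriv (a n) θ * (S θ : ℂ) -
          a n θ * (Real.cos (d * (θ - Θ)) * d : ℝ)) (-2 * d * (n + 1) * c * ((S θ ^ 2 : ℝ) : ℂ)) θ := by
        intro θ hθ
        rw [uIcc_of_le hΘ₀.le] at hθ
        refine (((ha2 θ).mul (hS1 θ)).sub ((ha1 θ).mul (hS2 θ))).congr_deriv ?_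
        have h3 := hL n θ hθ
        rw [lapCoeff, hn (n + 2) (by omega) θ hθ, hc θ hθ] at h3
        simp only [S]
        push_cast at h3 ⊢
        linear_combination (Complex.sin (d * (θ - Θ))) * h3
      have hint := intervalIntegral.integral_eq_sub_of_hasDerivAt hW
        (Continuous.intervalIntegrable (by fun_prop) _ _)
      have hSz : (S 0 : ℂ) = 0 := hS0
      have hST : (S Θ : ℂ) = 0 := by simp [S]
      rw [hSz, hST, ha0, h.apply_top, intervalIntegral.integral_const_mul,
        intervalIntegral.integral_ofReal] at hint
      simp only [mul_zero, zero_mul, sub_zero] at hint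
      have hn1 : ((n : ℂ) + 1) ≠ 0 := by exact_mod_cast Nat.succ_ne_zero n
      have hdc : (d : ℂ) ≠ 0 := by exact_mod_cast hd
      have hz : ∫ θ in (0 : ℝ)..Θ, S θ ^ 2 = 0 := by
        have : -2 * (d : ℂ) * (n + 1) * c ≠ 0 :=
          mul_ne_zero (mul_ne_zero (mul_ne_zero (by norm_num) hdc) hn1) hc0
        exact_mod_cast (mul_eq_zero.mp hint).resolve_left this
      have hcS : Continuous fun θ => S θ ^ 2 := by fun_prop
      have hS : ∀ θ ∈ Ioo 0 Θ, S θ ^ 2 = 0 := by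
        have h3 := (intervalIntegral.integral_eq_zero_iff_of_le_of_nonneg_ae hΘ₀.le
          (.of_forall fun θ => sq_nonneg _) (hcS.intervalIntegrable _ _)).mp hz
        have h4 : (fun θ => S θ ^ 2) =ᵐ[volume.restrict (Ioo 0 Θ)] fun _ => 0 :=
          ae_restrict_of_ae_restrict_of_subset Ioo_subset_Ioc_self h3
        exact Measure.eqOn_open_of_ae_eq h4 isOpen_Ioo hcS.continuousOn continuousOn_const
      have hev : (fun θ => (S θ : ℂ)) =ᶠ[𝓝[<] Θ] fun _ => 0 := by
        filter_upwards [Ioo_mem_nhdsLT hΘ₀] with θ hθ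
        have := pow_eq_zero_iff (two_ne_zero) |>.mp (hS θ hθ)
        rw [this]; rfl
      have h5 := (hS1 Θ).hasDerivWithinAt (s := Iio Θ)
      have h6 := (hasDerivWithinAt_const Θ (Iio Θ) (0 : ℂ)).congr_of_eventuallyEq hev hST
      have h7 := (uniqueDiffWithinAt_Iio Θ).eq_deriv _ h5 h6
      simp [hd] at h7
  have hall : ∀ j, ∀ θ ∈ Icc 0 Θ, a (j + 1) θ = 0 := by
    suffices ∀ m j, N ≤ j + m → ∀ θ ∈ Icc 0 Θ, a (j + 1) θ = 0 from
      fun j => this N j (by omega)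
    intro m
    induction m with
    | zero =>
      intro j hj θ _
      rw [h.vanish _ (by omega)]; rfl
    | succ m ih =>
      intro j hj
      refine step j fun i hi => ?_
      obtain ⟨i, rfl⟩ : ∃ i', i = i' + 1 := ⟨i - 1, by omega⟩
      exact ih i (by omega)
  have hφ0 : ∀ ζ ∈ strip Θ, φ (Complex.exp ζ) = (Real.exp (d * ζ.re) : ℂ) * a 0 ζ.im := by
    intro ζ hζ
    rw [h.eq ζ hζ.1.le (by linarith [hζ.2])]
    congr 1
    cases N with
    | zero => simp [h.vanish 0 le_rfl]
    | succ M =>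
      rw [Finset.sum_range_succ', Finset.sum_eq_zero, pow_zero, one_mul, zero_add]
      intro j _
      rw [hall j _ ⟨hζ.1.le, hζ.2.le⟩, mul_zero]
  have e1 : ∀ θ ∈ Icc 0 Θ, deriv (deriv (a 0)) θ + d ^ 2 * a 0 θ = 0 := by
    intro θ hθ
    have := hL 0 θ hθ
    rw [lapCoeff, hall 0 θ hθ, hall 1 θ hθ] at this
    simpa using this
  have h1 := ode_solution (h.smooth 0) (h.apply_top _) e1
  have hm0 : (0 : ℝ) ∈ Icc 0 Θ := ⟨le_rfl, hΘ₀.le⟩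
  split_ifs at h1 with hd
  · obtain ⟨c, hc⟩ := h1
    have h2 := hc 0 hm0
    have hne : (Θ : ℂ) ≠ 0 := by exact_mod_cast hΘ₀.ne'
    have hc0 : c = 0 := by simpa [ha0, hne, eq_comm] using h2
    refine ⟨0, Or.inl rfl, fun z hz => ?_⟩
    rw [sector_eq_image] at hz
    obtain ⟨ζ, hζ, rfl⟩ := hz
    rw [hφ0 ζ hζ, hc _ ⟨hζ.1.le, hζ.2.le⟩, hc0]
    simp
  · obtain ⟨c, hc⟩ := h1
    have h2 := hc 0 hm0
    rw [ha0] at h2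
    refine ⟨c, ?_, fun z hz => ?_⟩
    · rcases mul_eq_zero.mp h2.symm with h3 | h3
      · exact Or.inl h3
      · refine Or.inr ⟨hd, ?_⟩
        rw [zero_sub, mul_neg, Real.sin_neg] at h3
        exact_mod_cast neg_eq_zero.mp (Complex.ofReal_eq_zero.mp h3)
    · rw [sector_eq_image] at hz
      obtain ⟨ζ, hζ, rfl⟩ := hz
      rw [hφ0 ζ hζ, hc _ ⟨hζ.1.le, hζ.2.le⟩, Pi.smul_apply, sing_exp hζ.1.le
        (by linarith [hζ.2]), singStrip]
      simp [Complex.exp_im]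
      ring

/-- A homogeneous harmonic function of degree `d ≤ 0` which vanishes on both sides of the sector
and whose coefficient `σ_d` is zero vanishes. -/
lemma eqOn_zero_of_harmonic {Θ d : ℝ} (hΘ₀ : 0 < Θ) (hΘ : Θ < 2 * Real.pi) (hd : d ≤ 0) {φ : ℂ → ℂ}
    (hφ : φ ∈ singDeg Θ d) (hΔ : ∀ z ∈ sector Θ, Laplacian.laplacian φ z = 0)
    (h0 : ∀ r, 0 < r → φ (rayPoint 0 r) = 0)
    (hσ : ∀ n : ℕ+, d = -(Real.pi / Θ) * (n : ℝ) → sigma Θ d φ = 0) :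
    ∀ z ∈ sector Θ, φ z = 0 := by
  obtain ⟨c, hc, h⟩ := exists_eqOn_sing_of_harmonic hΘ₀ hΘ hφ hΔ h0
  suffices c = 0 by
    intro z hz
    rw [h hz, this, zero_smul]; rfl
  rcases hc with hc | ⟨hd0, hs⟩
  · exact hc
  have hd' : d < 0 := lt_of_le_of_ne hd hd0
  obtain ⟨n, hn⟩ := Real.sin_eq_zero_iff.mp hs
  have hn0 : n < 0 := by
    by_contra hcon
    push Not at hcon
    have h1 : (0 : ℝ) ≤ n * Real.pi := mul_nonneg (by exact_mod_cast hcon) Real.pi_pos.le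
    nlinarith
  have hdn : d = -(Real.pi / Θ) * ((⟨n.natAbs, by omega⟩ : ℕ+) : ℝ) := by
    have : ((n.natAbs : ℕ) : ℝ) = -n := by
      rw [Nat.cast_natAbs, abs_of_neg hn0]; push_cast; ring
    change d = -(Real.pi / Θ) * ((n.natAbs : ℕ) : ℝ)
    rw [this]
    field_simp
    linarith
  have h1 := hσ _ hdn
  have hm : sing Θ d 0 1 ∈ singSpace Θ := singDeg_le_singSpace Θ d (sing_mem_singDeg (by simp))
  rw [sigma_congr hΘ₀ hΘ hd' (singDeg_le_singSpace Θ d hφ) (Submodule.smul_mem _ c hm) h,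
    sigma_smul hΘ₀ hΘ hd' c hm, sigma_sing hΘ₀ hΘ hd'] at h1
  simpa using h1

/-! ### Cutoffs in logarithmic coordinates -/

/-- The product of `U` with the cutoff `X ∘ lg`, extended by zero. -/
def cutProd (Θ : ℝ) (X U : ℂ → ℂ) : ℂ → ℂ := (slit Θ).indicator fun z => X (lg Θ z) * U z

lemma isSmoothCompact_cutProd {Θ : ℝ} {X U : ℂ → ℂ} {K : Set ℂ} (hK : IsCompact K)
    (hKΘ : ∀ ζ ∈ K, |ζ.im - Θ / 2| < Real.pi) (hX : ContDiff ℝ (⊤ : ℕ∞) X)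
    (hXK : Function.support X ⊆ K) (hU : ∀ z ∈ slit Θ, ContDiffAt ℝ (⊤ : ℕ∞) U z) :
    IsSmoothCompact (cutProd Θ X U) ∧ tsupport (cutProd Θ X U) ⊆ Complex.exp '' K := by
  have hKc : IsCompact (Complex.exp '' K) := hK.image Complex.continuous_exp
  have hsub : Complex.exp '' K ⊆ slit Θ := by
    rintro _ ⟨ζ, hζ, rfl⟩
    exact exp_mem_slit (hKΘ ζ hζ)
  have hz : ∀ z, z ∉ Complex.exp '' K → cutProd Θ X U z = 0 := by
    intro z hz
    by_cases hs : z ∈ slit Θ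
    · rw [cutProd, indicator_of_mem hs]
      have : X (lg Θ z) = 0 := by
        by_contra h
        exact hz ⟨_, hXK h, exp_lg Θ (ne_zero_of_mem_slit hs)⟩
      rw [this, zero_mul]
    · rw [cutProd, indicator_of_notMem hs]
  have hts : tsupport (cutProd Θ X U) ⊆ Complex.exp '' K :=
    closure_minimal (fun z h => by by_contra hc; exact h (hz z hc)) hKc.isClosed
  refine ⟨⟨contDiff_iff_contDiffAt.mpr fun z => ?_, hKc.of_isClosed_subset (isClosed_tsupport _)
    hts⟩, hts⟩
  by_cases hs : z ∈ slit Θ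
  · refine (((hX.contDiffAt).comp z (contDiffAt_lg hs)).mul (hU z hs)).congr_of_eventuallyEq ?_
    filter_upwards [(isOpen_slit Θ).mem_nhds hs] with w hw
    rw [cutProd, indicator_of_mem hw]; rfl
  · refine (contDiffAt_const (c := (0 : ℂ))).congr_of_eventuallyEq ?_
    filter_upwards [hKc.isClosed.isOpen_compl.mem_nhds fun h => hs (hsub h)] with w hw
    exact hz w hw

lemma eLpNorm_two_eq {α : Type*} [MeasurableSpace α] (μ : Measure α) (f : α → ℂ) :
    eLpNorm f 2 μ = (∫⁻ x, ‖f x‖ₑ ^ 2 ∂μ) ^ (1 / 2 : ℝ) := by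
  rw [eLpNorm_eq_lintegral_rpow_enorm_toReal (by simp) (by simp)]
  simp

lemma memLp_two_of_lintegral_lt_top {α : Type*} [MeasurableSpace α] {μ : Measure α} {f : α → ℂ}
    (hf : AEStronglyMeasurable f μ) (h : ∫⁻ x, ‖f x‖ₑ ^ 2 ∂μ < ⊤) : MemLp f 2 μ := by
  refine ⟨hf, ?_⟩
  rw [eLpNorm_two_eq]
  exact ENNReal.rpow_lt_top_of_nonneg (by norm_num) h.ne

/-- Dominated convergence for products with bounded multipliers. -/
lemma tendsto_eLpNorm_mul_zero {α : Type*} [MeasurableSpace α] {μ : Measure α} {f : α → ℂ}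
    (hf : MemLp f 2 μ) {g : ℕ → α → ℂ} (hg : ∀ n, AEStronglyMeasurable (g n) μ) {C : ℝ}
    (hC : ∀ n x, ‖g n x‖ ≤ C) (h0 : ∀ᵐ x ∂μ, Tendsto (fun n => g n x) atTop (𝓝 0)) :
    Tendsto (fun n => eLpNorm (fun x => g n x * f x) 2 μ) atTop (𝓝 0) := by
  have h : Tendsto (fun n => ∫⁻ x, ‖g n x * f x‖ₑ ^ 2 ∂μ) atTop (𝓝 (∫⁻ _, 0 ∂μ)) := by
    refine tendsto_lintegral_of_dominated_convergence'
      (fun x => ENNReal.ofReal C ^ 2 * ‖f x‖ₑ ^ 2)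
      (fun n => (((hg n).mul hf.1).enorm.pow_const 2)) (fun n => Eventually.of_forall fun x => ?_)
      ?_ ?_
    · simp only
      rw [enorm_mul, mul_pow]
      gcongr
      rw [← ofReal_norm]
      exact ENNReal.ofReal_le_ofReal (hC n x)
    · rw [lintegral_const_mul'' _ (hf.1.enorm.pow_const 2)]
      exact ENNReal.mul_ne_top (by simp) (Lp.lintegral_sq_ne_top hf)
    · filter_upwards [h0] with x hx
      have h1 := ((hx.mul_const (f x)).enorm).ennrpow_const (2 : ℝ)
      simpa using h1
  rw [lintegral_zero] at h
  have h1 := h.ennrpow_const (1 / 2 : ℝ)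
  rw [ENNReal.zero_rpow_of_pos (by norm_num)] at h1
  exact h1.congr fun n => (eLpNorm_two_eq _ _).symm

/-- A smooth plateau function on the line. -/
def plateau : ContDiffBump (0 : ℝ) := ⟨1, 2, one_pos, one_lt_two⟩

/-- A smooth plateau function for the angle. -/
def anglePlateau (Θ : ℝ) (hΘ₀ : 0 < Θ) (hΘ : Θ < 2 * Real.pi) : ContDiffBump (Θ / 2) :=
  ⟨(Θ + Real.pi) / 3, (Θ / 2 + 2 * Real.pi) / 3, by positivity, by linarith⟩

/-- The cutoff in the strip `Θ / 2 - π < im ζ < Θ / 2 + π` equal to `1` for `|re ζ| ≤ n + 1`. -/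
def stripCut (Θ : ℝ) (hΘ₀ : 0 < Θ) (hΘ : Θ < 2 * Real.pi) (n : ℕ) (ζ : ℂ) : ℂ :=
  ((plateau (ζ.re / (n + 1)) * anglePlateau Θ hΘ₀ hΘ ζ.im : ℝ) : ℂ)

lemma contDiff_stripCut {Θ : ℝ} (hΘ₀ : 0 < Θ) (hΘ : Θ < 2 * Real.pi) (n : ℕ) :
    ContDiff ℝ (⊤ : ℕ∞) (stripCut Θ hΘ₀ hΘ n) := by
  have hre : ContDiff ℝ (⊤ : ℕ∞) fun ζ : ℂ => ζ.re := Complex.reCLM.contDiff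
  have him : ContDiff ℝ (⊤ : ℕ∞) fun ζ : ℂ => ζ.im := Complex.imCLM.contDiff
  exact Complex.ofRealCLM.contDiff.comp ((plateau.contDiff.comp (hre.div_const _)).mul
    ((anglePlateau Θ hΘ₀ hΘ).contDiff.comp him))

/-- The compact rectangle which contains the support of `stripCut`. -/
def stripRect (Θ : ℝ) (n : ℕ) : Set ℂ :=
  Icc (-(2 * (n + 1) : ℝ)) (2 * (n + 1)) ×ℂ
    Icc (Θ / 2 - (Θ / 2 + 2 * Real.pi) / 3) (Θ / 2 + (Θ / 2 + 2 * Real.pi) / 3)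

lemma isCompact_stripRect (Θ : ℝ) (n : ℕ) : IsCompact (stripRect Θ n) :=
  isCompact_Icc.reProdIm isCompact_Icc

lemma stripRect_im {Θ : ℝ} (hΘ : Θ < 2 * Real.pi) {n : ℕ} {ζ : ℂ} (h : ζ ∈ stripRect Θ n) :
    |ζ.im - Θ / 2| < Real.pi := by
  have := h.2
  rw [abs_lt]
  constructor <;> linarith [this.1, this.2]

lemma support_stripCut {Θ : ℝ} (hΘ₀ : 0 < Θ) (hΘ : Θ < 2 * Real.pi) (n : ℕ) :
    Function.support (stripCut Θ hΘ₀ hΘ n) ⊆ stripRect Θ n := by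
  intro ζ hζ
  have h : plateau (ζ.re / (n + 1)) * anglePlateau Θ hΘ₀ hΘ ζ.im ≠ 0 := by
    intro h; exact hζ (by rw [stripCut, h, Complex.ofReal_zero])
  have h1 : ζ.re / (n + 1) ∈ Metric.ball (0 : ℝ) 2 := by
    have := left_ne_zero_of_mul h
    rwa [← Function.mem_support, plateau.support_eq] at this
  have h2 : ζ.im ∈ Metric.ball (Θ / 2) ((Θ / 2 + 2 * Real.pi) / 3) := by
    have := right_ne_zero_of_mul h
    rwa [← Function.mem_support, (anglePlateau Θ hΘ₀ hΘ).support_eq] at this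
  rw [Real.ball_eq_Ioo] at h1 h2
  have hn : (0 : ℝ) < n + 1 := by positivity
  rw [mem_Ioo, lt_div_iff₀ hn, div_lt_iff₀ hn] at h1
  exact ⟨⟨by linarith [h1.1], by linarith [h1.2]⟩, ⟨h2.1.le, h2.2.le⟩⟩

lemma stripCut_eq {Θ : ℝ} (hΘ₀ : 0 < Θ) (hΘ : Θ < 2 * Real.pi) (n : ℕ) {ζ : ℂ} (h0 : 0 ≤ ζ.im)
    (h1 : ζ.im ≤ Θ) : stripCut Θ hΘ₀ hΘ n ζ = (plateau (ζ.re / (n + 1)) : ℂ) := by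
  rw [stripCut, (anglePlateau Θ hΘ₀ hΘ).one_of_mem_closedBall, mul_one]
  rw [Real.closedBall_eq_Icc]
  change ζ.im ∈ Icc (Θ / 2 - (Θ + Real.pi) / 3) (Θ / 2 + (Θ + Real.pi) / 3)
  constructor <;> linarith

lemma tendsto_plateau (s : ℝ) : Tendsto (fun n : ℕ => plateau (s / (n + 1))) atTop (𝓝 1) := by
  have h1 : Tendsto (fun n : ℕ => s / ((n : ℝ) + 1)) atTop (𝓝 0) :=
    Tendsto.div_atTop tendsto_const_nhds (tendsto_atTop_add_const_right _ _
      tendsto_natCast_atTop_atTop)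
  have h2 := (plateau.contDiff (n := 0)).continuous.tendsto (0 : ℝ)
  have h3 : plateau (0 : ℝ) = 1 := plateau.one_of_mem_closedBall (by
    rw [Metric.mem_closedBall, dist_self]; exact plateau.rIn_pos.le)
  rw [h3] at h2
  exact h2.comp h1

lemma exists_deriv_plateau_bound : ∃ C : ℝ, ∀ x, ‖deriv plateau x‖ ≤ C :=
  (((contDiff_infty_iff_deriv (𝕜 := ℝ)).mp plateau.contDiff).2.continuous).bounded_above_of_compact_support
    plateau.hasCompactSupport.deriv

/-- The radial cutoff. -/
def radialCut (Θ : ℝ) (n : ℕ) (z : ℂ) : ℂ := (plateau ((lg Θ z).re / (n + 1)) : ℂ)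

lemma radialCut_dirDeriv {Θ : ℝ} {C : ℝ} (hC : ∀ x, ‖deriv plateau x‖ ≤ C) (n : ℕ) {z : ℂ}
    (hz : z ∈ slit Θ) (e : ℂ) (he : ‖e‖ = 1) :
    DifferentiableAt ℝ (radialCut Θ n) z ∧
      ‖dirDeriv e (radialCut Θ n) z‖ ≤ C / (n + 1) * ‖z‖⁻¹ := by
  have h1 : HasFDerivAt (fun z => (lg Θ z).re / (n + 1)) _ z :=
    (((Complex.reCLM.hasFDerivAt).comp z
      (hasFDerivAt_mul_of_hasDerivAt (hasDerivAt_lg hz))).mul_const ((n : ℝ) + 1)⁻¹)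
  have h2 : HasDerivAt plateau (deriv plateau ((lg Θ z).re / (n + 1))) ((lg Θ z).re / (n + 1)) :=
    ((plateau.contDiff (n := 1)).differentiable (by simp) _).hasDerivAt
  have h3 := (Complex.ofRealCLM.hasFDerivAt).comp z (h2.comp_hasFDerivAt z h1)
  have h4 : HasFDerivAt (radialCut Θ n) _ z := h3
  refine ⟨h4.differentiableAt, ?_⟩
  rw [dirDeriv, h4.fderiv]
  have hn : (0 : ℝ) < n + 1 := by positivity
  have hC0 : 0 ≤ C := (norm_nonneg _).trans (hC 0)
  have h5 : |(z⁻¹ * e).re| ≤ ‖z‖⁻¹ := by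
    refine (Complex.abs_re_le_norm _).trans ?_
    rw [norm_mul, he, norm_inv, mul_one]
  have h6 : ‖deriv plateau ((lg Θ z).re / (n + 1)) * (((n : ℝ) + 1)⁻¹ * (z⁻¹ * e).re)‖ ≤
      C / (n + 1) * ‖z‖⁻¹ := by
    rw [norm_mul, norm_mul, norm_inv, Real.norm_of_nonneg hn.le, div_eq_mul_inv C, mul_assoc C,
      Real.norm_eq_abs (z⁻¹ * e).re]
    exact mul_le_mul (hC _) (by gcongr) (by positivity) hC0
  refine le_trans (le_of_eq ?_) h6
  simp [-Complex.mul_re]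
  left; left
  have : ((n : ℂ) + 1) = (((n : ℝ) + 1 : ℝ) : ℂ) := by push_cast; rfl
  rw [this, Complex.norm_real, Real.norm_eq_abs]

/-- Functions which are smooth up to the sides, with finite weighted energy, are in `H¹(Ω)`, and
their traces are their restrictions. -/
lemma exists_H1_of_smooth {Θ : ℝ} (hΘ₀ : 0 < Θ) (hΘ : Θ < 2 * Real.pi) {U : ℂ → ℂ}
    (hU : ∀ z ∈ slit Θ, ContDiffAt ℝ (⊤ : ℕ∞) U z) (h0 : MemLp U 2 (sectorMeasure Θ))
    (hd : MemLp (fun z => (‖z‖⁻¹ : ℂ) * U z) 2 (sectorMeasure Θ))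
    (h1 : MemLp (dirDeriv 1 U) 2 (sectorMeasure Θ))
    (h2 : MemLp (dirDeriv Complex.I U) 2 (sectorMeasure Θ))
    (ht : ∀ θ, θ = 0 ∨ θ = Θ → MemLp (fun r => U (rayPoint θ r)) 2 rayMeasure) :
    ∃ w : H1 Θ, w.1 0 =ᵐ[sectorMeasure Θ] U ∧ w.1 1 =ᵐ[sectorMeasure Θ] dirDeriv 1 U ∧
      w.1 2 =ᵐ[sectorMeasure Θ] dirDeriv Complex.I U ∧
      ∀ θ, θ = 0 ∨ θ = Θ → IsTrace Θ θ w fun r => U (rayPoint θ r) := by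
  have hUs : ∀ z ∈ sector Θ, ContDiffAt ℝ 1 U z := fun z hz =>
    (hU z (sector_subset_slit hΘ hz)).of_le (by simp)
  let w : H1 Θ := mkH1 h0 h1 h2 (fun v hv => integral_mul_dirDeriv_test hv hUs 1)
    fun v hv => integral_mul_dirDeriv_test hv hUs Complex.I
  have w0 : w.1 0 =ᵐ[sectorMeasure Θ] U := h0.coeFn_toLp
  have w1 : w.1 1 =ᵐ[sectorMeasure Θ] dirDeriv 1 U := h1.coeFn_toLp
  have w2 : w.1 2 =ᵐ[sectorMeasure Θ] dirDeriv Complex.I U := h2.coeFn_toLp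
  let c : ℕ → ℂ → ℂ := fun n => cutProd Θ (stripCut Θ hΘ₀ hΘ n) U
  have hc : ∀ n, IsSmoothCompact (c n) := fun n =>
    (isSmoothCompact_cutProd (isCompact_stripRect Θ n) (fun ζ h => stripRect_im hΘ h)
      (contDiff_stripCut hΘ₀ hΘ n) (support_stripCut hΘ₀ hΘ n) hU).1
  have hcs : ∀ n, ∀ z ∈ sector Θ, c n z = radialCut Θ n z * U z := by
    intro n z hz
    have h := lg_mem_strip hΘ hz
    change cutProd Θ _ U z = _
    rw [cutProd, indicator_of_mem (sector_subset_slit hΘ hz), stripCut_eq hΘ₀ hΘ n h.1.le h.2.le]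
    rfl
  obtain ⟨C, hC⟩ := exists_deriv_plateau_bound
  have hmeas : ∀ n, Measurable fun z => radialCut Θ n z - 1 := by
    intro n
    have := (plateau.contDiff (n := 0)).continuous.measurable
    have h := measurable_lg Θ
    unfold radialCut
    fun_prop
  have hb : ∀ x : ℝ, ‖((plateau x : ℝ) : ℂ) - 1‖ ≤ 1 := by
    intro x
    rw [← Complex.ofReal_one, ← Complex.ofReal_sub, Complex.norm_real, Real.norm_eq_abs, abs_le]
    constructor <;> linarith [plateau.nonneg (x := x), plateau.le_one (x := x)]
  have hlim : ∀ s : ℝ, Tendsto (fun n : ℕ => ((plateau (s / (n + 1)) : ℝ) : ℂ) - 1) atTop (𝓝 0) := by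
    intro s
    have := ((Complex.continuous_ofReal.tendsto 1).comp (tendsto_plateau s)).sub_const 1
    simpa using this
  have main : ∀ f : ℂ → ℂ, MemLp f 2 (sectorMeasure Θ) →
      Tendsto (fun n => eLpNorm (fun z => (radialCut Θ n z - 1) * f z) 2 (sectorMeasure Θ))
        atTop (𝓝 0) := fun f hf =>
    tendsto_eLpNorm_mul_zero hf (fun n => (hmeas n).aestronglyMeasurable) (fun n z => hb _)
      (.of_forall fun z => hlim _)
  have hmem := ae_mem_sector Θ
  have hder : ∀ (e : ℂ), ‖e‖ = 1 → MemLp (dirDeriv e U) 2 (sectorMeasure Θ) → ∀ we : ℂ → ℂ,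
      we =ᵐ[sectorMeasure Θ] dirDeriv e U →
      Tendsto (fun n => eLpNorm (fun z => dirDeriv e (c n) z - we z) 2 (sectorMeasure Θ))
        atTop (𝓝 0) := by
    intro e he hm we hwe
    have hmul : ∀ n, ∀ z ∈ sector Θ, dirDeriv e (c n) z =
        dirDeriv e (radialCut Θ n) z * U z + radialCut Θ n z * dirDeriv e U z := by
      intro n z hz
      have hev : c n =ᶠ[𝓝 z] fun z => radialCut Θ n z * U z := by
        filter_upwards [(isOpen_sector Θ).mem_nhds hz] with y hy using hcs n y hy
      rw [dirDeriv, hev.fderiv_eq]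
      exact dirDeriv_mul (radialCut_dirDeriv hC n (sector_subset_slit hΘ hz) e he).1
        ((hUs z hz).differentiableAt (by simp)) e
    have hd2 : Tendsto (fun n : ℕ => ENNReal.ofReal (C / (n + 1)) *
        eLpNorm (fun z => (‖z‖⁻¹ : ℂ) * U z) 2 (sectorMeasure Θ)) atTop (𝓝 0) := by
      have a1 : Tendsto (fun n : ℕ => C / ((n : ℝ) + 1)) atTop (𝓝 0) :=
        Tendsto.div_atTop tendsto_const_nhds (tendsto_atTop_add_const_right _ _
          tendsto_natCast_atTop_atTop)
      have a2 := ENNReal.Tendsto.mul_const (b := eLpNorm (fun z => (‖z‖⁻¹ : ℂ) * U z) 2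
        (sectorMeasure Θ)) (ENNReal.tendsto_ofReal a1) (Or.inr hd.2.ne)
      simpa using a2
    have hsum := (main _ hm).add hd2
    rw [add_zero] at hsum
    refine tendsto_of_tendsto_of_tendsto_of_le_of_le tendsto_const_nhds hsum (fun _ => zero_le)
      fun n => ?_
    have hA : AEStronglyMeasurable (fun z => (radialCut Θ n z - 1) * dirDeriv e U z)
      (sectorMeasure Θ) := (hmeas n).aestronglyMeasurable.mul hm.1
    have hB : AEStronglyMeasurable (fun z => dirDeriv e (c n) z - we z -
        (radialCut Θ n z - 1) * dirDeriv e U z) (sectorMeasure Θ) :=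
      (((hc n).dirDeriv_continuous e).aestronglyMeasurable.sub (hm.1.congr hwe.symm)).sub hA
    calc eLpNorm (fun z => dirDeriv e (c n) z - we z) 2 (sectorMeasure Θ)
        = eLpNorm ((fun z => (radialCut Θ n z - 1) * dirDeriv e U z) +
          fun z => dirDeriv e (c n) z - we z - (radialCut Θ n z - 1) * dirDeriv e U z) 2
            (sectorMeasure Θ) := by
          congr 1; funext z; simp
      _ ≤ _ := eLpNorm_add_le hA hB (by norm_num)
      _ ≤ _ := by
        gcongr
        refine (eLpNorm_le_mul_eLpNorm_of_ae_le_mul (g := fun z => (‖z‖⁻¹ : ℂ) * U z)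
          (c := C / (n + 1)) ?_ 2)
        filter_upwards [hmem, hwe] with z hz hw
        rw [hmul n z hz, hw]
        have e1 : dirDeriv e (radialCut Θ n) z * U z + radialCut Θ n z * dirDeriv e U z -
          dirDeriv e U z - (radialCut Θ n z - 1) * dirDeriv e U z =
          dirDeriv e (radialCut Θ n) z * U z := by ring
        rw [e1, norm_mul, norm_mul, ← mul_assoc]
        gcongr
        have := (radialCut_dirDeriv hC n (sector_subset_slit hΘ hz) e he).2
        simpa using this
  refine ⟨w, w0, w1, w2, fun θ hθ => ⟨ht θ hθ, c, hc, ?_, ?_⟩⟩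
  · refine (tendsto_toH1_iff hc w).mpr ⟨?_, hder 1 (by simp) h1 _ w1, hder _ (by simp) h2 _ w2⟩
    refine (main U h0).congr fun n => eLpNorm_congr_ae ?_
    filter_upwards [hmem, w0] with z hz hw
    rw [hcs n z hz, hw]
    ring
  · have hθ' : 0 ≤ θ ∧ θ ≤ Θ := by rcases hθ with rfl | rfl <;> constructor <;> linarith
    have h := tendsto_eLpNorm_mul_zero (ht θ hθ)
      (g := fun n r => ((plateau (Real.log r / (n + 1)) : ℝ) : ℂ) - 1)
      (fun n => by
        have := (plateau.contDiff (n := 0)).continuous.measurable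
        exact (by fun_prop : Measurable fun r : ℝ =>
          ((plateau (Real.log r / (n + 1)) : ℝ) : ℂ) - 1).aestronglyMeasurable)
      (fun n r => hb _) (.of_forall fun r => hlim _)
    refine h.congr fun n => eLpNorm_congr_ae ?_
    filter_upwards [ae_restrict_mem measurableSet_Ioi] with r hr
    have habs : |(Real.log r + θ * Complex.I : ℂ).im - Θ / 2| < Real.pi := by
      simpa using abs_sub_half_lt hΘ hθ'.1 hθ'.2
    change _ = cutProd Θ _ U (rayPoint θ r) - _
    rw [rayPoint_eq_exp θ hr, cutProd, indicator_of_mem (exp_mem_slit habs), lg_exp habs,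
      stripCut_eq hΘ₀ hΘ n (by simpa using hθ'.1) (by simpa using hθ'.2)]
    simp
    ring

/-! ### Singular functions of positive degree -/

lemma memLp_sector_of_norm_le {Θ : ℝ} (hΘ : Θ < 2 * Real.pi) {F : ℂ → ℂ}
    (hF : AEStronglyMeasurable F (sectorMeasure Θ)) {p C R : ℝ} (hp : -1 < p) (hR : 0 < R)
    (h : ∀ z ∈ sector Θ, ‖z‖ ≤ R → ‖F z‖ ≤ C * ‖z‖ ^ p)
    (h0 : ∀ z ∈ sector Θ, R < ‖z‖ → F z = 0) : MemLp F 2 (sectorMeasure Θ) := by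
  refine memLp_two_of_lintegral_lt_top hF ?_
  let G : ℂ → ℝ≥0∞ := (Metric.closedBall 0 R).indicator fun z => ENNReal.ofReal ((C * ‖z‖ ^ p) ^ 2)
  have hG : Measurable G := by
    refine Measurable.indicator ?_ Metric.isClosed_closedBall.measurableSet
    fun_prop
  have h1 : ∫⁻ z, ‖F z‖ₑ ^ 2 ∂(sectorMeasure Θ) ≤ ∫⁻ z, G z ∂(sectorMeasure Θ) := by
    refine lintegral_mono_ae ?_
    filter_upwards [ae_mem_sector Θ] with z hz
    by_cases hzR : ‖z‖ ≤ R
    · have hm : z ∈ Metric.closedBall (0 : ℂ) R := mem_closedBall_zero_iff.mpr hzR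
      simp only [G]
      rw [indicator_of_mem hm, ← ofReal_norm, ← ENNReal.ofReal_pow (norm_nonneg _)]
      exact ENNReal.ofReal_le_ofReal (pow_le_pow_left₀ (norm_nonneg _) (h z hz hzR) 2)
    · rw [h0 z hz (not_le.mp hzR)]; simp
  refine h1.trans_lt ?_
  rw [lintegral_sector hΘ hG]
  have h2 : ∀ θ s : ℝ, ENNReal.ofReal (Real.exp (2 * s)) * G (Complex.exp (s + θ * Complex.I)) =
      (Iic (Real.log R)).indicator
        (fun s => ENNReal.ofReal (C ^ 2 * Real.exp ((2 + 2 * p) * s))) s := by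
    intro θ s
    have hiff : Complex.exp (s + θ * Complex.I) ∈ Metric.closedBall (0 : ℂ) R ↔
        s ∈ Iic (Real.log R) := by
      rw [mem_closedBall_zero_iff, norm_exp_add_mul_I, mem_Iic, Real.le_log_iff_exp_le hR]
    by_cases hs : s ∈ Iic (Real.log R)
    · simp only [G]
      rw [indicator_of_mem (hiff.mpr hs), indicator_of_mem hs, norm_exp_add_mul_I,
        ← ENNReal.ofReal_mul (Real.exp_pos _).le, ← Real.exp_mul]
      congr 1
      rw [mul_pow, ← Real.exp_nat_mul, mul_left_comm, ← Real.exp_add]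
      congr 2
      push_cast; ring
    · simp only [G]
      rw [indicator_of_notMem (fun h => hs (hiff.mp h)), indicator_of_notMem hs, mul_zero]
  simp_rw [h2]
  rw [lintegral_const, lintegral_indicator measurableSet_Iic]
  refine ENNReal.mul_lt_top ?_ (by simp)
  have h3 : IntegrableOn (fun s => C ^ 2 * Real.exp ((2 + 2 * p) * s)) (Iic (Real.log R)) :=
    (integrableOn_exp_mul_Iic (by linarith) _).const_mul _
  exact h3.lintegral_lt_top

lemma memLp_ray_of_norm_le {F : ℝ → ℂ} (hF : AEStronglyMeasurable F rayMeasure) {C R : ℝ}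
    (h : ∀ r, 0 < r → ‖F r‖ ≤ C) (h0 : ∀ r, R < r → F r = 0) : MemLp F 2 rayMeasure := by
  refine memLp_two_of_lintegral_lt_top hF ?_
  have h1 : ∫⁻ r, ‖F r‖ₑ ^ 2 ∂rayMeasure ≤
      ∫⁻ r, (Icc 0 R).indicator (fun _ => ENNReal.ofReal C ^ 2) r := by
    refine (lintegral_mono_ae ?_).trans (lintegral_mono' Measure.restrict_le_self le_rfl)
    filter_upwards [ae_restrict_mem measurableSet_Ioi] with r hr
    by_cases hrR : r ≤ R
    · rw [indicator_of_mem (show r ∈ Icc 0 R from ⟨(mem_Ioi.mp hr).le, hrR⟩)]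
      gcongr
      rw [← ofReal_norm]
      exact ENNReal.ofReal_le_ofReal (h r hr)
    · rw [h0 r (not_le.mp hrR)]; simp
  refine h1.trans_lt ?_
  rw [lintegral_indicator measurableSet_Icc, setLIntegral_const]
  exact ENNReal.mul_lt_top (by simp) (by simp)

lemma exists_pow_mul_exp_bound {ε : ℝ} (hε : 0 < ε) (S : ℝ) (j : ℕ) :
    ∃ C, 0 ≤ C ∧ ∀ s ≤ S, |s| ^ j * Real.exp (ε * s) ≤ C := by
  have h1 : Tendsto (fun s : ℝ => |s| ^ j * Real.exp (ε * s)) atBot (𝓝 0) := by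
    have := (tendsto_exp_mul_eval_atBot hε (Polynomial.X ^ j)).norm
    simp only [eval_pow, eval_X, norm_mul, norm_zero, norm_pow, Complex.norm_real,
      Real.norm_eq_abs, Real.abs_exp] at this
    simpa [mul_comm] using this
  obtain ⟨B, hB⟩ := eventually_atBot.mp (h1.eventually (gt_mem_nhds zero_lt_one))
  have hc : ContinuousOn (fun s : ℝ => |s| ^ j * Real.exp (ε * s)) (Icc B S) := by fun_prop
  obtain ⟨C, hC⟩ := isCompact_Icc.exists_bound_of_continuousOn hc
  refine ⟨max C 1, by positivity, fun s hs => ?_⟩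
  rcases le_total s B with h | h
  · exact (hB s h).le.trans (le_max_right _ _)
  · exact (le_abs_self _).trans ((hC s ⟨h, hs⟩).trans (le_max_left _ _))

/-- A logarithmic function of degree `d` is dominated by powers of smaller degree. -/
lemma exists_logFun_bound (Θ : ℝ) {d p : ℝ} (hp : p < d) (S : ℝ) (N : ℕ) {a : ℕ → ℝ → ℂ}
    (ha : ∀ j, Continuous (a j)) :
    ∃ C, 0 ≤ C ∧ ∀ ζ : ℂ, ζ.re ≤ S → 0 ≤ ζ.im → ζ.im ≤ Θ →
      ‖logFun d N a ζ‖ ≤ C * Real.exp (p * ζ.re) := by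
  choose A hA using fun j => isCompact_Icc.exists_bound_of_continuousOn (ha j).continuousOn
    (s := Icc 0 Θ)
  choose B hB0 hB using fun j => exists_pow_mul_exp_bound (sub_pos.mpr hp) S j
  refine ⟨∑ j ∈ Finset.range N, B j * |A j|,
    Finset.sum_nonneg fun j _ => mul_nonneg (hB0 j) (abs_nonneg _), fun ζ h1 h2 h3 => ?_⟩
  rw [logFun, norm_mul, Complex.norm_real, Real.norm_eq_abs, Real.abs_exp]
  have e1 : Real.exp (d * ζ.re) = Real.exp ((d - p) * ζ.re) * Real.exp (p * ζ.re) := by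
    rw [← Real.exp_add]; ring_nf
  rw [e1, mul_right_comm]
  refine mul_le_mul_of_nonneg_right ?_ (Real.exp_pos _).le
  refine (mul_le_mul_of_nonneg_left (norm_sum_le _ _) (Real.exp_pos _).le).trans ?_
  rw [Finset.mul_sum]
  refine Finset.sum_le_sum fun j _ => ?_
  rw [norm_mul, norm_pow, Complex.norm_real, Real.norm_eq_abs, ← mul_assoc,
    mul_comm (Real.exp _)]
  exact mul_le_mul (hB j _ h1) ((hA j _ ⟨h2, h3⟩).trans (le_abs_self _)) (norm_nonneg _) (hB0 j)

lemma dirDeriv_comp_lg_eq {Θ : ℝ} {X : ℂ → ℂ} (hX : ContDiff ℝ (⊤ : ℕ∞) X) {z : ℂ}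
    (hz : z ∈ slit Θ) (e : ℂ) :
    dirDeriv e (fun z => X (lg Θ z)) z = fderiv ℝ X (lg Θ z) (z⁻¹ * e) := by
  have h1 := ((hX.differentiable (by simp) (lg Θ z)).hasFDerivAt.comp z
    (hasFDerivAt_mul_of_hasDerivAt (hasDerivAt_lg hz))).fderiv
  change (fderiv ℝ (X ∘ lg Θ) z) e = _
  rw [h1]
  rfl

lemma dirDeriv_comp_lg {Θ : ℝ} {X : ℂ → ℂ} (hX : ContDiff ℝ (⊤ : ℕ∞) X) {z : ℂ} (hz : z ∈ slit Θ)
    (e : ℂ) : dirDeriv e (fun z => X (lg Θ z)) z =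
      ((z⁻¹ * e).re : ℂ) * dirDeriv 1 X (lg Θ z) +
      ((z⁻¹ * e).im : ℂ) * dirDeriv Complex.I X (lg Θ z) := by
  have e2 : z⁻¹ * e = (z⁻¹ * e).re • (1 : ℂ) + (z⁻¹ * e).im • Complex.I := by
    rw [Complex.real_smul, Complex.real_smul, mul_one, Complex.re_add_im]
  rw [dirDeriv_comp_lg_eq hX hz]
  conv_lhs => rw [e2]
  rw [map_add, map_smul, map_smul, Complex.real_smul, Complex.real_smul]
  rfl

lemma dirDeriv_logFun_lg {Θ d : ℝ} {N : ℕ} {a : ℕ → ℝ → ℂ} (ha : ∀ j, ContDiff ℝ (⊤ : ℕ∞) (a j))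
    (hN : ∀ j, N ≤ j → a j = 0) {z : ℂ} (hz : z ∈ slit Θ) (e : ℂ) :
    dirDeriv e (fun z => logFun d N a (lg Θ z)) z =
      ((z⁻¹ * e).re : ℂ) *
        logFun d N (fun j θ => d * a j θ + (j + 1) * a (j + 1) θ) (lg Θ z) +
      ((z⁻¹ * e).im : ℂ) * logFun d N (fun j => deriv (a j)) (lg Θ z) := by
  rw [dirDeriv_comp_lg (contDiff_logFun d N ha) hz, dirDeriv_one_logFun d ha hN,
    dirDeriv_I_logFun d ha]

lemma IsCutoff.isSmoothCompact {χ : ℂ → ℂ} (hχ : IsCutoff χ) : IsSmoothCompact χ := by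
  refine ⟨hχ.smooth, ?_⟩
  rw [hasCompactSupport_iff_eventuallyEq, coclosedCompact_eq_cocompact]
  exact hχ.zero_near_infty

lemma IsSmoothCompact.exists_bound {v : ℂ → ℂ} (hv : IsSmoothCompact v) :
    ∃ C, 0 ≤ C ∧ ∀ z, ‖v z‖ ≤ C := by
  obtain ⟨C, hC⟩ := hv.continuous.bounded_above_of_compact_support hv.2
  exact ⟨C, (norm_nonneg _).trans (hC 0), hC⟩

lemma IsSmoothCompact.exists_radius {v : ℂ → ℂ} (hv : IsSmoothCompact v) :
    ∃ R, 0 < R ∧ ∀ z, R < ‖z‖ → v z = 0 := by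
  obtain ⟨R, hR0, hR⟩ := hv.2.isCompact.isBounded.subset_closedBall_lt 0 0
  refine ⟨R, hR0, fun z hz => ?_⟩
  by_contra h
  have := mem_closedBall_zero_iff.mp (hR (subset_tsupport _ h))
  linarith

lemma singDeg_rayPoint {Θ d : ℝ} (hΘ : Θ < 2 * Real.pi) {φ : ℂ → ℂ} {N : ℕ} {a : ℕ → ℝ → ℂ}
    (h : HasLogExpansion Θ d φ N a) {θ r : ℝ} (h0 : 0 ≤ θ) (h1 : θ ≤ Θ) (hr : 0 < r) :
    φ (rayPoint θ r) = logFun d N a (lg Θ (rayPoint θ r)) := by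
  rw [rayPoint_eq_exp θ hr, h.eq _ (by simpa using h0) (by simpa using h1.trans_lt hΘ), lg_exp
    (by simpa using abs_sub_half_lt hΘ h0 h1)]
  rfl

/-- Cut off singular functions of positive degree are in `H¹(Ω)`. -/
lemma exists_H1_of_singDeg_pos {Θ d : ℝ} (hΘ₀ : 0 < Θ) (hΘ : Θ < 2 * Real.pi) {χ : ℂ → ℂ}
    (hχ : IsSmoothCompact χ) (hd : 0 < d) {φ : ℂ → ℂ} (hφ : φ ∈ singDeg Θ d) :
    ∃ w : H1 Θ, (∀ᵐ z ∂(sectorMeasure Θ), fnOf w z = χ z * φ z) ∧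
      ∀ θ, θ = 0 ∨ θ = Θ → IsTrace Θ θ w fun r => χ (rayPoint θ r) * φ (rayPoint θ r) := by
  obtain ⟨N, a, h⟩ := hasLogExpansion_of_mem hφ
  obtain ⟨R, hR0, hR⟩ := hχ.exists_radius
  obtain ⟨C₀, hC₀, hχ0⟩ := hχ.exists_bound
  have hda : ∀ j, ContDiff ℝ (⊤ : ℕ∞) (deriv (a j)) := fun j => contDiff_deriv_top (h.smooth j)
  have hsa : ∀ j : ℕ, ContDiff ℝ (⊤ : ℕ∞) fun θ => d * a j θ + (j + 1) * a (j + 1) θ := fun j =>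
    (contDiff_const.mul (h.smooth j)).add (contDiff_const.mul (h.smooth (j + 1)))
  obtain ⟨C₁, hC₁, hb1⟩ := exists_logFun_bound Θ (half_lt_self hd) (Real.log R) N
    fun j => (h.smooth j).continuous
  obtain ⟨C₂, hC₂, hb2⟩ := exists_logFun_bound Θ (half_lt_self hd) (Real.log R) N
    fun j => (hsa j).continuous
  obtain ⟨C₃, hC₃, hb3⟩ := exists_logFun_bound Θ (half_lt_self hd) (Real.log R) N
    fun j => (hda j).continuous
  let g : ℂ → ℂ := fun z => logFun d N a (lg Θ z)
  let U : ℂ → ℂ := fun z => χ z * g z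
  have hg : ∀ z ∈ slit Θ, ContDiffAt ℝ (⊤ : ℕ∞) g z := fun z hz =>
    (contDiff_logFun d N h.smooth).contDiffAt.comp z (contDiffAt_lg hz)
  have hU : ∀ z ∈ slit Θ, ContDiffAt ℝ (⊤ : ℕ∞) U z := fun z hz => hχ.1.contDiffAt.mul (hg z hz)
  have hpow : ∀ z : ℂ, z ≠ 0 → ∀ p : ℝ, Real.exp (p * (lg Θ z).re) = ‖z‖ ^ p := by
    intro z hz p
    rw [lg_re, Real.rpow_def_of_pos (norm_pos_iff.mpr hz), mul_comm]
  have hre : ∀ z ∈ sector Θ, ‖z‖ ≤ R → (lg Θ z).re ≤ Real.log R := fun z hz hzR => by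
    rw [lg_re]
    exact Real.log_le_log (norm_pos_iff.mpr (ne_zero_of_mem_slit (sector_subset_slit hΘ hz))) hzR
  have bound : ∀ z ∈ sector Θ, ‖z‖ ≤ R →
      ‖g z‖ ≤ C₁ * ‖z‖ ^ (d / 2) ∧ ∀ e : ℂ, ‖e‖ = 1 →
        ‖dirDeriv e g z‖ ≤ (C₂ + C₃) * ‖z‖ ^ (d / 2 - 1) := by
    intro z hz hzR
    have hs := sector_subset_slit hΘ hz
    have hne := ne_zero_of_mem_slit hs
    have him := lg_mem_strip hΘ hz
    have hr := hre z hz hzR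
    refine ⟨?_, fun e he => ?_⟩
    · rw [← hpow z hne]
      exact hb1 _ hr him.1.le him.2.le
    · have e1 := hb2 _ hr him.1.le him.2.le
      have e2 := hb3 _ hr him.1.le him.2.le
      have e3 : ‖z⁻¹ * e‖ = ‖z‖⁻¹ := by rw [norm_mul, he, mul_one, norm_inv]
      change ‖dirDeriv e (fun z => logFun d N a (lg Θ z)) z‖ ≤ _
      rw [dirDeriv_logFun_lg h.smooth h.vanish hs, Real.rpow_sub_one (norm_ne_zero_iff.mpr hne),
        ← hpow z hne]
      refine (norm_add_le _ _).trans ?_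
      rw [norm_mul, norm_mul, Complex.norm_real, Complex.norm_real, Real.norm_eq_abs,
        Real.norm_eq_abs]
      have e4 := (Complex.abs_re_le_norm (z⁻¹ * e)).trans e3.le
      have e5 := (Complex.abs_im_le_norm (z⁻¹ * e)).trans e3.le
      calc _ ≤ ‖z‖⁻¹ * (C₂ * Real.exp (d / 2 * (lg Θ z).re)) +
            ‖z‖⁻¹ * (C₃ * Real.exp (d / 2 * (lg Θ z).re)) := by gcongr
        _ = _ := by ring
  have hdχ : ∀ e, IsSmoothCompact (dirDeriv e χ) := fun e => hχ.dirDeriv e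
  have hUd : ∀ z ∈ sector Θ, ∀ e, dirDeriv e U z = dirDeriv e χ z * g z + χ z * dirDeriv e g z :=
    fun z hz e => dirDeriv_mul (hχ.differentiable z)
      ((hg z (sector_subset_slit hΘ hz)).differentiableAt (by simp)) e
  have hUc : ContinuousOn U (sector Θ) := fun z hz =>
    (hU z (sector_subset_slit hΘ hz)).continuousAt.continuousWithinAt
  have hms : ∀ f : ℂ → ℂ, ContinuousOn f (sector Θ) → AEStronglyMeasurable f (sectorMeasure Θ) :=
    fun f hf => hf.aestronglyMeasurable (measurableSet_sector Θ)
  have hp : -1 < d / 2 - 1 := by linarith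
  have hR' : ∀ z : ℂ, 0 ≤ ‖z‖ → ‖z‖ ≤ R → z ≠ 0 → ‖z‖ ^ (d / 2) ≤ R * ‖z‖ ^ (d / 2 - 1) := by
    intro z _ hzR hz
    rw [Real.rpow_sub_one (norm_ne_zero_iff.mpr hz), mul_div_assoc', le_div_iff₀
      (norm_pos_iff.mpr hz), mul_comm]
    gcongr
  have m0 : MemLp U 2 (sectorMeasure Θ) := by
    refine memLp_sector_of_norm_le hΘ (hms U hUc) (p := d / 2) (C := C₀ * C₁) (by linarith) hR0
      (fun z hz hzR => ?_) fun z _ hz => by simp only [U]; rw [hR z hz, zero_mul]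
    rw [norm_mul, mul_assoc]
    exact mul_le_mul (hχ0 z) (bound z hz hzR).1 (norm_nonneg _) hC₀
  have md : MemLp (fun z => (‖z‖⁻¹ : ℂ) * U z) 2 (sectorMeasure Θ) := by
    refine memLp_sector_of_norm_le hΘ ?_ (p := d / 2 - 1) (C := C₀ * C₁) hp hR0
      (fun z hz hzR => ?_) fun z _ hz => by simp only [U]; rw [hR z hz, zero_mul, mul_zero]
    · refine AEStronglyMeasurable.mul ?_ (hms U hUc)
      exact (by fun_prop : Measurable fun z : ℂ => ((‖z‖ : ℂ)⁻¹)).aestronglyMeasurable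
    · have hne := ne_zero_of_mem_slit (sector_subset_slit hΘ hz)
      rw [norm_mul, norm_mul, norm_inv, Complex.norm_real, norm_norm,
        Real.rpow_sub_one (norm_ne_zero_iff.mpr hne)]
      calc ‖z‖⁻¹ * (‖χ z‖ * ‖g z‖) ≤ ‖z‖⁻¹ * (C₀ * (C₁ * ‖z‖ ^ (d / 2))) := by
            gcongr
            · exact hχ0 z
            · exact (bound z hz hzR).1
        _ = _ := by ring
  have m1 : ∀ e : ℂ, ‖e‖ = 1 → MemLp (dirDeriv e U) 2 (sectorMeasure Θ) := by
    intro e he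
    obtain ⟨C₄, hC₄, hχ4⟩ := (hdχ e).exists_bound
    refine memLp_sector_of_norm_le hΘ (hms _ fun z hz => (contDiffAt_dirDeriv (hU z
      (sector_subset_slit hΘ hz)) e).continuousAt.continuousWithinAt) (p := d / 2 - 1)
      (C := C₄ * (C₁ * R) + C₀ * (C₂ + C₃)) hp hR0 (fun z hz hzR => ?_) fun z hz hzR => ?_
    · have hne := ne_zero_of_mem_slit (sector_subset_slit hΘ hz)
      rw [hUd z hz]
      refine (norm_add_le _ _).trans ?_
      rw [norm_mul, norm_mul]
      calc _ ≤ C₄ * (C₁ * (R * ‖z‖ ^ (d / 2 - 1))) + C₀ * ((C₂ + C₃) * ‖z‖ ^ (d / 2 - 1)) := by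
            gcongr
            · exact hχ4 z
            · exact (bound z hz hzR).1.trans (by gcongr; exact hR' z (norm_nonneg _) hzR hne)
            · exact hχ0 z
            · exact (bound z hz hzR).2 e he
        _ = _ := by ring
    · have hev : U =ᶠ[𝓝 z] fun _ => 0 := by
        filter_upwards [(isOpen_lt continuous_const continuous_norm).mem_nhds hzR] with y hy
        simp only [U]
        rw [hR y hy, zero_mul]
      rw [dirDeriv, hev.fderiv_eq]
      simp
  have mt : ∀ θ, θ = 0 ∨ θ = Θ → MemLp (fun r => U (rayPoint θ r)) 2 rayMeasure := by
    intro θ hθ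
    have hθ' : 0 ≤ θ ∧ θ ≤ Θ := by rcases hθ with rfl | rfl <;> constructor <;> linarith
    have hsl : ∀ r, 0 < r → rayPoint θ r ∈ slit Θ := fun r hr => by
      rw [rayPoint_eq_exp θ hr]
      exact exp_mem_slit (by simpa using abs_sub_half_lt hΘ hθ'.1 hθ'.2)
    have hrc : Continuous (rayPoint θ) := by unfold rayPoint; fun_prop
    refine memLp_ray_of_norm_le (C := C₀ * (C₁ * R ^ (d / 2))) (R := R) ?_ (fun r hr => ?_)
      fun r hr => ?_
    · refine ContinuousOn.aestronglyMeasurable (fun r hr => ?_) measurableSet_Ioi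
      exact (ContinuousAt.comp (f := rayPoint θ) (hU _ (hsl r hr)).continuousAt
        hrc.continuousAt).continuousWithinAt
    · by_cases hrR : r ≤ R
      · simp only [U, norm_mul]
        have him : (lg Θ (rayPoint θ r)).im = θ := by
          rw [rayPoint_eq_exp θ hr, lg_exp (by simpa using abs_sub_half_lt hΘ hθ'.1 hθ'.2)]
          simp
        have hlr : (lg Θ (rayPoint θ r)).re = Real.log r := by
          rw [lg_re, norm_rayPoint θ hr.le]
        refine mul_le_mul (hχ0 _) ?_ (norm_nonneg _) hC₀
        refine (hb1 _ (by rw [hlr]; exact Real.log_le_log hr hrR) (by rw [him]; exact hθ'.1)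
          (by rw [him]; exact hθ'.2)).trans ?_
        rw [hpow _ (ne_zero_of_mem_slit (hsl r hr)), norm_rayPoint θ hr.le]
        gcongr
      · simp only [U]
        rw [hR _ (by rw [norm_rayPoint θ hr.le]; exact not_le.mp hrR), zero_mul, norm_zero]
        positivity
    · simp only [U]
      rw [hR _ (by rw [norm_rayPoint θ (hR0.trans hr).le]; exact hr), zero_mul]
  obtain ⟨w, w0, -, -, hw⟩ := exists_H1_of_smooth hΘ₀ hΘ hU m0 md (m1 1 (by simp))
    (m1 Complex.I (by simp)) mt
  refine ⟨w, ?_, fun θ hθ => (hw θ hθ).congr ?_⟩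
  · filter_upwards [w0, ae_mem_sector Θ] with z hz hm
    rw [fnOf, hz, h.eqOn hΘ hm]
  · have hθ' : 0 ≤ θ ∧ θ ≤ Θ := by rcases hθ with rfl | rfl <;> constructor <;> linarith
    filter_upwards [ae_restrict_mem measurableSet_Ioi] with r hr
    rw [singDeg_rayPoint hΘ h hθ'.1 hθ'.2 hr]

lemma exists_H1_of_sum_pos {Θ : ℝ} (hΘ₀ : 0 < Θ) (hΘ : Θ < 2 * Real.pi) {χ : ℂ → ℂ}
    (hχ : IsSmoothCompact χ) (s : Finset ℝ) (hs : ∀ d ∈ s, 0 < d) {f : ℝ → ℂ → ℂ}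
    (hf : ∀ d, f d ∈ singDeg Θ d) :
    ∃ w : H1 Θ, (∀ᵐ z ∂(sectorMeasure Θ), fnOf w z = χ z * ∑ d ∈ s, f d z) ∧
      ∀ θ, θ = 0 ∨ θ = Θ → IsTrace Θ θ w fun r =>
        χ (rayPoint θ r) * ∑ d ∈ s, f d (rayPoint θ r) := by
  classical
  induction s using Finset.induction_on with
  | empty =>
    refine ⟨0, ?_, fun θ hθ => ?_⟩
    · have : fnOf (0 : H1 Θ) =ᵐ[sectorMeasure Θ] 0 := Lp.coeFn_zero ..
      filter_upwards [this] with z hz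
      simp [hz]
    · have := isTrace_zero_of_mem_H10 hΘ₀ hΘ hθ 0 (Submodule.zero_mem _)
      exact this.congr (.of_forall fun r => by simp)
  | insert d s hd ih =>
    obtain ⟨w, h1, h2⟩ := ih fun e he => hs e (Finset.mem_insert_of_mem he)
    obtain ⟨w', h1', h2'⟩ := exists_H1_of_singDeg_pos hΘ₀ hΘ hχ
      (hs d (Finset.mem_insert_self _ _)) (hf d)
    refine ⟨w' + w, ?_, fun θ hθ => ((h2' θ hθ).add (h2 θ hθ)).congr ?_⟩
    · have : fnOf (w' + w) =ᵐ[sectorMeasure Θ] fnOf w' + fnOf w := Lp.coeFn_add ..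
      filter_upwards [this, h1, h1'] with z hz ha hb
      rw [hz, Pi.add_apply, ha, hb, Finset.sum_insert hd, mul_add]
    · filter_upwards with r
      rw [Pi.add_apply, Finset.sum_insert hd, mul_add]

/-! ### A Hardy inequality in the angular variable -/

/-- The part of the plane cut along a half-line with polar angle in `(a, b)` and radius in `E`. -/
def cone (Θ a b : ℝ) (E : Set ℝ) : Set ℂ := {z | (lg Θ z).im ∈ Ioo a b ∧ ‖z‖ ∈ E}

lemma measurableSet_cone (Θ a b : ℝ) {E : Set ℝ} (hE : MeasurableSet E) :
    MeasurableSet (cone Θ a b E) :=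
  ((Complex.measurable_im.comp (measurable_lg Θ)) measurableSet_Ioo).inter (measurable_norm hE)

lemma lintegral_cone {Θ a b : ℝ} (hΘ : Θ < 2 * Real.pi) (ha : 0 ≤ a) (hb : b ≤ Θ) {E : Set ℝ}
    (hE : MeasurableSet E) {F : ℂ → ℝ≥0∞} (hF : Measurable F) :
    ∫⁻ z in cone Θ a b E, F z ∂(sectorMeasure Θ) = ∫⁻ θ in Ioo a b, ∫⁻ s in Real.exp ⁻¹' E,
      ENNReal.ofReal (Real.exp (2 * s)) * F (Complex.exp (s + θ * Complex.I)) := by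
  have hm := measurableSet_cone Θ a b hE
  have hE' : MeasurableSet (Real.exp ⁻¹' E) := Real.measurable_exp hE
  rw [← lintegral_indicator hm, lintegral_sector hΘ (hF.indicator hm),
    ← inter_eq_self_of_subset_left (Ioo_subset_Ioo ha hb), ← setLIntegral_indicator measurableSet_Ioo]
  refine setLIntegral_congr_fun measurableSet_Ioo fun θ hθ => ?_
  have hlg : ∀ s : ℝ, lg Θ (Complex.exp (s + θ * Complex.I)) = s + θ * Complex.I := fun s =>
    lg_exp (by simpa using abs_sub_half_lt hΘ hθ.1.le hθ.2.le)
  have hiff : ∀ s : ℝ, Complex.exp (s + θ * Complex.I) ∈ cone Θ a b E ↔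
      θ ∈ Ioo a b ∧ s ∈ Real.exp ⁻¹' E := by
    intro s
    change (lg Θ _).im ∈ _ ∧ ‖_‖ ∈ E ↔ _
    rw [hlg, norm_exp_add_mul_I]
    simp
  by_cases hθ' : θ ∈ Ioo a b
  · simp only [indicator_of_mem hθ']
    rw [← lintegral_indicator hE']
    refine lintegral_congr fun s => ?_
    by_cases hs : s ∈ Real.exp ⁻¹' E
    · rw [indicator_of_mem ((hiff s).mpr ⟨hθ', hs⟩), indicator_of_mem hs]
    · rw [indicator_of_notMem (fun h => hs ((hiff s).mp h).2), indicator_of_notMem hs, mul_zero]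
  · simp only [indicator_of_notMem hθ']
    rw [← lintegral_zero (μ := (volume : Measure ℝ))]
    refine lintegral_congr fun s => ?_
    rw [indicator_of_notMem (fun h => hθ' ((hiff s).mp h).1), mul_zero]

lemma setLIntegral_ray {E : Set ℝ} (hE : MeasurableSet E) (F : ℝ → ℝ≥0∞) :
    ∫⁻ r in E, F r ∂rayMeasure =
      ∫⁻ s in Real.exp ⁻¹' E, ENNReal.ofReal (Real.exp s) * F (Real.exp s) := by
  rw [← lintegral_indicator hE, lintegral_ray, ← lintegral_indicator (Real.measurable_exp hE)]
  refine lintegral_congr fun s => ?_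
  by_cases hs : s ∈ Real.exp ⁻¹' E
  · rw [indicator_of_mem hs, indicator_of_mem (show Real.exp s ∈ E from hs)]
  · rw [indicator_of_notMem hs, indicator_of_notMem (show Real.exp s ∉ E from hs), mul_zero]

lemma lintegral_sq_le {α : Type*} [MeasurableSpace α] {μ : Measure α} {g : α → ℝ≥0∞}
    (hg : AEMeasurable g μ) : (∫⁻ x, g x ∂μ) ^ 2 ≤ μ univ * ∫⁻ x, g x ^ 2 ∂μ := by
  have h := ENNReal.lintegral_mul_le_Lp_mul_Lq μ (p := 2) (q := 2)
    (Real.HolderConjugate.two_two) hg (aemeasurable_const (b := (1 : ℝ≥0∞)))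
  simp only [Pi.mul_apply, mul_one, ENNReal.rpow_two, one_pow, lintegral_const, one_mul] at h
  calc _ ≤ ((∫⁻ x, g x ^ 2 ∂μ) ^ (1 / 2 : ℝ) * μ univ ^ (1 / 2 : ℝ)) ^ 2 := by gcongr
    _ = _ := by
      rw [mul_pow, ← ENNReal.rpow_natCast, ← ENNReal.rpow_natCast, ← ENNReal.rpow_mul,
        ← ENNReal.rpow_mul]
      norm_num
      exact mul_comm _ _

/-- The squared norm of the gradient. -/
def gradSq (v : ℂ → ℂ) (z : ℂ) : ℝ≥0∞ := ‖dirDeriv 1 v z‖ₑ ^ 2 + ‖dirDeriv Complex.I v z‖ₑ ^ 2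

lemma enorm_add_sq_le (x y : ℂ) : ‖x + y‖ₑ ^ 2 ≤ 2 * ‖x‖ₑ ^ 2 + 2 * ‖y‖ₑ ^ 2 := by
  have h : ‖x + y‖ ^ 2 ≤ 2 * ‖x‖ ^ 2 + 2 * ‖y‖ ^ 2 := by
    have := norm_add_le x y
    nlinarith [sq_nonneg (‖x‖ - ‖y‖), norm_nonneg (x + y)]
  have h1 := ENNReal.ofReal_le_ofReal h
  rw [ENNReal.ofReal_add (by positivity) (by positivity), ENNReal.ofReal_mul (by norm_num),
    ENNReal.ofReal_mul (by norm_num), ENNReal.ofReal_pow (norm_nonneg _),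
    ENNReal.ofReal_pow (norm_nonneg _), ENNReal.ofReal_pow (norm_nonneg _), ofReal_norm,
    ofReal_norm, ofReal_norm] at h1
  simpa using h1

lemma enorm_dirDeriv_sq_le (v : ℂ → ℂ) (z c : ℂ) :
    ‖dirDeriv c v z‖ₑ ^ 2 ≤ 2 * ‖c‖ₑ ^ 2 * gradSq v z := by
  have e2 : c = c.re • (1 : ℂ) + c.im • Complex.I := by
    rw [Complex.real_smul, Complex.real_smul, mul_one, Complex.re_add_im]
  have e3 : dirDeriv c v z = c.re * dirDeriv 1 v z + c.im * dirDeriv Complex.I v z := by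
    unfold dirDeriv
    conv_lhs => rw [e2]
    rw [map_add, map_smul, map_smul, Complex.real_smul, Complex.real_smul]
  rw [e3]
  refine (enorm_add_sq_le _ _).trans ?_
  rw [enorm_mul, enorm_mul, mul_pow, mul_pow, gradSq, mul_add, mul_assoc, mul_assoc]
  have h1 : ‖(c.re : ℂ)‖ₑ ≤ ‖c‖ₑ := by
    rw [← ofReal_norm, ← ofReal_norm, Complex.norm_real]
    exact ENNReal.ofReal_le_ofReal (Complex.abs_re_le_norm c)
  have h2 : ‖(c.im : ℂ)‖ₑ ≤ ‖c‖ₑ := by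
    rw [← ofReal_norm, ← ofReal_norm, Complex.norm_real]
    exact ENNReal.ofReal_le_ofReal (Complex.abs_im_le_norm c)
  gcongr

lemma measurable_gradSq {v : ℂ → ℂ} (hv : IsSmoothCompact v) : Measurable (gradSq v) :=
  ((hv.dirDeriv_continuous 1).measurable.enorm.pow_const 2).add
    ((hv.dirDeriv_continuous _).measurable.enorm.pow_const 2)

lemma angular_estimate {v : ℂ → ℂ} (hv : IsSmoothCompact v) {a b : ℝ} (s : ℝ) {θ₁ θ₂ : ℝ}
    (h1 : θ₁ ∈ Icc a b) (h2 : θ₂ ∈ Icc a b) :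
    ‖v (Complex.exp (s + θ₁ * Complex.I))‖ₑ ^ 2 ≤
      2 * ‖v (Complex.exp (s + θ₂ * Complex.I))‖ₑ ^ 2 +
      4 * ENNReal.ofReal (b - a) * ∫⁻ τ in Ioo a b, ENNReal.ofReal (Real.exp (2 * s)) *
        gradSq v (Complex.exp (s + τ * Complex.I)) := by
  let f : ℝ → ℂ := fun τ => v (Complex.exp (s + τ * Complex.I))
  have hcd : ContDiff ℝ 1 f := by
    refine (hv.1.of_le (by simp)).comp (Complex.contDiff_exp.comp ?_)
    exact contDiff_const.add (Complex.ofRealCLM.contDiff.mul contDiff_const)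
  have hder : ∀ τ, deriv f τ = dirDeriv (Complex.exp (s + τ * Complex.I) * Complex.I) v
      (Complex.exp (s + τ * Complex.I)) := by
    intro τ
    have e1 : HasDerivAt (fun τ : ℝ => (s : ℂ) + τ * Complex.I) Complex.I τ := by
      simpa using ((Complex.ofRealCLM.hasDerivAt (x := τ)).mul_const Complex.I).const_add (s : ℂ)
    exact ((hv.differentiable _).hasFDerivAt.comp_hasDerivAt τ e1.cexp).deriv
  have hdm : Measurable fun τ => ‖deriv f τ‖ₑ := (hcd.continuous_deriv le_rfl).measurable.enorm
  have hle : ∀ τ, ‖deriv f τ‖ₑ ^ 2 ≤ 2 * (ENNReal.ofReal (Real.exp (2 * s)) *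
      gradSq v (Complex.exp (s + τ * Complex.I))) := by
    intro τ
    rw [hder]
    refine (enorm_dirDeriv_sq_le _ _ _).trans (le_of_eq ?_)
    rw [enorm_mul, mul_pow, ← ofReal_norm, norm_exp_add_mul_I, ← ENNReal.ofReal_pow
      (Real.exp_pos _).le, ← Real.exp_nat_mul, mul_assoc]
    have : ‖Complex.I‖ₑ = 1 := by rw [← ofReal_norm]; simp
    simp [this]
  have hab : ∀ x y, x ∈ Icc a b → y ∈ Icc a b → x ≤ y → ‖f y - f x‖ₑ ^ 2 ≤
      2 * ENNReal.ofReal (b - a) * ∫⁻ τ in Ioo a b, ENNReal.ofReal (Real.exp (2 * s)) *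
        gradSq v (Complex.exp (s + τ * Complex.I)) := by
    intro x y hx hy hxy
    have e1 := enorm_sub_le_lintegral_deriv_of_contDiffOn_Icc (hcd.contDiffOn (s := Icc x y)) hxy
    have e2 : ∫⁻ τ in Icc x y, ‖deriv f τ‖ₑ ≤ ∫⁻ τ in Ioo a b, ‖deriv f τ‖ₑ := by
      rw [restrict_Ioo_eq_restrict_Icc]
      exact lintegral_mono_set (Icc_subset_Icc hx.1 hy.2)
    have e3 := lintegral_sq_le (μ := volume.restrict (Ioo a b)) hdm.aemeasurable
    rw [Measure.restrict_apply_univ, Real.volume_Ioo] at e3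
    calc _ ≤ (∫⁻ τ in Ioo a b, ‖deriv f τ‖ₑ) ^ 2 := by
          gcongr; exact e1.trans e2
      _ ≤ _ := e3
      _ ≤ ENNReal.ofReal (b - a) * ∫⁻ τ in Ioo a b, 2 * (ENNReal.ofReal (Real.exp (2 * s)) *
        gradSq v (Complex.exp (s + τ * Complex.I))) := by
          gcongr with τ; exact hle τ
      _ = _ := by
        rw [lintegral_const_mul' _ _ (by simp), ← mul_assoc, mul_comm (ENNReal.ofReal _) 2]
  have hfin : ‖f θ₁ - f θ₂‖ₑ ^ 2 ≤
      2 * ENNReal.ofReal (b - a) * ∫⁻ τ in Ioo a b, ENNReal.ofReal (Real.exp (2 * s)) *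
        gradSq v (Complex.exp (s + τ * Complex.I)) := by
    rcases le_total θ₁ θ₂ with h | h
    · rw [← enorm_neg, neg_sub]; exact hab _ _ h1 h2 h
    · exact hab _ _ h2 h1 h
  calc ‖f θ₁‖ₑ ^ 2 = ‖f θ₂ + (f θ₁ - f θ₂)‖ₑ ^ 2 := by rw [add_sub_cancel]
    _ ≤ 2 * ‖f θ₂‖ₑ ^ 2 + 2 * ‖f θ₁ - f θ₂‖ₑ ^ 2 := enorm_add_sq_le _ _
    _ ≤ 2 * ‖f θ₂‖ₑ ^ 2 + 2 * (2 * ENNReal.ofReal (b - a) * _) := by gcongr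
    _ = _ := by ring

/-- The weight `|z|⁻²`. -/
def invSq (z : ℂ) : ℝ≥0∞ := ENNReal.ofReal ((‖z‖ ^ 2)⁻¹)

lemma measurable_invSq : Measurable invSq := by unfold invSq; fun_prop

lemma ofReal_exp_mul_invSq (s θ : ℝ) :
    ENNReal.ofReal (Real.exp (2 * s)) * invSq (Complex.exp (s + θ * Complex.I)) = 1 := by
  rw [invSq, norm_exp_add_mul_I, ← ENNReal.ofReal_mul (Real.exp_pos _).le, ← Real.exp_nat_mul,
    ← Real.exp_neg, ← Real.exp_add]
  simp

section smooth

variable {Θ a b : ℝ} {E : Set ℝ} {v : ℂ → ℂ} {θ₀ : ℝ}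

lemma lintegral_cone_invSq (hΘ : Θ < 2 * Real.pi) (ha : 0 ≤ a) (hb : b ≤ Θ) (hE : MeasurableSet E)
    (hv : IsSmoothCompact v) : ∫⁻ z in cone Θ a b E, invSq z * ‖v z‖ₑ ^ 2 ∂(sectorMeasure Θ) =
      ∫⁻ θ in Ioo a b, ∫⁻ s in Real.exp ⁻¹' E, ‖v (Complex.exp (s + θ * Complex.I))‖ₑ ^ 2 := by
  have hm : Measurable fun z => invSq z * ‖v z‖ₑ ^ 2 :=
    measurable_invSq.mul (hv.continuous.measurable.enorm.pow_const 2)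
  rw [lintegral_cone hΘ ha hb hE hm]
  refine lintegral_congr fun θ => lintegral_congr fun s => ?_
  rw [← mul_assoc, ofReal_exp_mul_invSq, one_mul]

lemma lintegral_ray_inv (hE : MeasurableSet E) (v : ℂ → ℂ) :
    ∫⁻ r in E, ENNReal.ofReal r⁻¹ * ‖v (rayPoint θ₀ r)‖ₑ ^ 2 ∂rayMeasure =
      ∫⁻ s in Real.exp ⁻¹' E, ‖v (Complex.exp (s + θ₀ * Complex.I))‖ₑ ^ 2 := by
  rw [setLIntegral_ray hE]
  refine lintegral_congr fun s => ?_
  rw [← mul_assoc, ← ENNReal.ofReal_mul (Real.exp_pos s).le, mul_inv_cancel₀ (Real.exp_pos s).ne',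
    ENNReal.ofReal_one, one_mul, rayPoint_exp]

lemma lintegral_cone_gradSq (hΘ : Θ < 2 * Real.pi) (ha : 0 ≤ a) (hb : b ≤ Θ)
    (hE : MeasurableSet E) (hv : IsSmoothCompact v) :
    ∫⁻ z in cone Θ a b E, gradSq v z ∂(sectorMeasure Θ) = ∫⁻ s in Real.exp ⁻¹' E,
      ∫⁻ τ in Ioo a b, ENNReal.ofReal (Real.exp (2 * s)) *
        gradSq v (Complex.exp (s + τ * Complex.I)) := by
  have := measurable_gradSq hv
  rw [lintegral_cone hΘ ha hb hE this, lintegral_lintegral_swap]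
  fun_prop

lemma hardy_smooth_in (hΘ : Θ < 2 * Real.pi) (ha : 0 ≤ a) (hb : b ≤ Θ) (hE : MeasurableSet E)
    (hv : IsSmoothCompact v) (h0 : θ₀ ∈ Icc a b) :
    ∫⁻ z in cone Θ a b E, invSq z * ‖v z‖ₑ ^ 2 ∂(sectorMeasure Θ) ≤
      ENNReal.ofReal (b - a) * (2 * (∫⁻ r in E, ENNReal.ofReal r⁻¹ * ‖v (rayPoint θ₀ r)‖ₑ ^ 2
          ∂rayMeasure) +
        4 * ENNReal.ofReal (b - a) * ∫⁻ z in cone Θ a b E, gradSq v z ∂(sectorMeasure Θ)) := by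
  rw [lintegral_cone_invSq hΘ ha hb hE hv, lintegral_ray_inv hE, lintegral_cone_gradSq hΘ ha hb hE hv]
  have hvm := hv.continuous.measurable
  have := measurable_gradSq hv
  calc _ ≤ ∫⁻ θ in Ioo a b, ∫⁻ s in Real.exp ⁻¹' E,
        (2 * ‖v (Complex.exp (s + θ₀ * Complex.I))‖ₑ ^ 2 +
        4 * ENNReal.ofReal (b - a) * ∫⁻ τ in Ioo a b, ENNReal.ofReal (Real.exp (2 * s)) *
          gradSq v (Complex.exp (s + τ * Complex.I))) := by
        refine setLIntegral_mono' measurableSet_Ioo fun θ hθ => lintegral_mono fun s => ?_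
        exact angular_estimate hv s (Ioo_subset_Icc_self hθ) h0
    _ = _ := by
      rw [setLIntegral_const, Real.volume_Ioo, lintegral_add_left (by fun_prop),
        lintegral_const_mul' _ _ (by simp), lintegral_const_mul' _ _
        (ENNReal.mul_ne_top (by simp) (by simp)), mul_comm]

lemma hardy_smooth_out (hΘ : Θ < 2 * Real.pi) (ha : 0 ≤ a) (hb : b ≤ Θ) (hE : MeasurableSet E)
    (hv : IsSmoothCompact v) (h0 : θ₀ ∈ Icc a b) :
    ENNReal.ofReal (b - a) * ∫⁻ r in E, ENNReal.ofReal r⁻¹ * ‖v (rayPoint θ₀ r)‖ₑ ^ 2 ∂rayMeasure ≤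
      2 * (∫⁻ z in cone Θ a b E, invSq z * ‖v z‖ₑ ^ 2 ∂(sectorMeasure Θ)) +
        ENNReal.ofReal (b - a) *
          (4 * ENNReal.ofReal (b - a) * ∫⁻ z in cone Θ a b E, gradSq v z ∂(sectorMeasure Θ)) := by
  rw [lintegral_cone_invSq hΘ ha hb hE hv, lintegral_ray_inv hE, lintegral_cone_gradSq hΘ ha hb hE hv]
  have hvm := hv.continuous.measurable
  have := measurable_gradSq hv
  calc _ = ∫⁻ θ in Ioo a b, ∫⁻ s in Real.exp ⁻¹' E,
        ‖v (Complex.exp (s + θ₀ * Complex.I))‖ₑ ^ 2 := by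
        rw [setLIntegral_const, Real.volume_Ioo, mul_comm]
    _ ≤ ∫⁻ θ in Ioo a b, ((∫⁻ s in Real.exp ⁻¹' E,
        2 * ‖v (Complex.exp (s + θ * Complex.I))‖ₑ ^ 2) + ∫⁻ s in Real.exp ⁻¹' E,
        4 * ENNReal.ofReal (b - a) * ∫⁻ τ in Ioo a b, ENNReal.ofReal (Real.exp (2 * s)) *
          gradSq v (Complex.exp (s + τ * Complex.I))) := by
        refine setLIntegral_mono' measurableSet_Ioo fun θ hθ => ?_
        rw [← lintegral_add_left (by fun_prop)]
        exact lintegral_mono fun s => angular_estimate hv s h0 (Ioo_subset_Icc_self hθ)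
    _ = _ := by
      rw [lintegral_add_right _ (by fun_prop), setLIntegral_const, Real.volume_Ioo]
      simp_rw [lintegral_const_mul' (2 : ℝ≥0∞) _ (by simp)]
      rw [lintegral_const_mul' _ _ (ENNReal.mul_ne_top (by simp) (by simp)), mul_comm _
        (ENNReal.ofReal (b - a))]

end smooth

/-! ### Passage to the limit -/

lemma tendsto_lintegral_sq {α : Type*} [MeasurableSpace α] {μ : Measure α} {f : ℕ → α → ℂ}
    {g : α → ℂ} (hf : ∀ n, AEStronglyMeasurable (f n) μ) (hg : MemLp g 2 μ)
    (h : Tendsto (fun n => eLpNorm (fun x => f n x - g x) 2 μ) atTop (𝓝 0)) :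
    Tendsto (fun n => ∫⁻ x, ‖f n x‖ₑ ^ 2 ∂μ) atTop (𝓝 (∫⁻ x, ‖g x‖ₑ ^ 2 ∂μ)) := by
  have h1 : Tendsto (fun n => eLpNorm (f n) 2 μ) atTop (𝓝 (eLpNorm g 2 μ)) := by
    have hu : Tendsto (fun n => eLpNorm g 2 μ + eLpNorm (fun x => f n x - g x) 2 μ) atTop
        (𝓝 (eLpNorm g 2 μ)) := by simpa using h.const_add (eLpNorm g 2 μ)
    have hl : Tendsto (fun n => eLpNorm g 2 μ - eLpNorm (fun x => f n x - g x) 2 μ) atTop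
        (𝓝 (eLpNorm g 2 μ)) := by
      simpa using ENNReal.Tendsto.sub tendsto_const_nhds h (Or.inl hg.2.ne)
    refine tendsto_of_tendsto_of_tendsto_of_le_of_le hl hu (fun n => ?_) fun n => ?_
    · rw [tsub_le_iff_right]
      calc eLpNorm g 2 μ = eLpNorm (f n - fun x => f n x - g x) 2 μ := by
            congr 1; funext x; simp
        _ ≤ _ := eLpNorm_sub_le (hf n) ((hf n).sub hg.1) (by norm_num)
    · calc eLpNorm (f n) 2 μ = eLpNorm (g + fun x => f n x - g x) 2 μ := by
            congr 1; funext x; simp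
        _ ≤ _ := eLpNorm_add_le hg.1 ((hf n).sub hg.1) (by norm_num)
  have h2 := h1.ennrpow_const (2 : ℝ)
  simp_rw [eLpNorm_two_eq, ← ENNReal.rpow_mul] at h2
  simpa using h2

lemma tendsto_lintegral_weight_sq {α : Type*} [MeasurableSpace α] {μ : Measure α} {f : ℕ → α → ℂ}
    {g : α → ℂ} (hf : ∀ n, AEStronglyMeasurable (f n) μ) (hg : MemLp g 2 μ)
    (h : Tendsto (fun n => eLpNorm (fun x => f n x - g x) 2 μ) atTop (𝓝 0)) {A : Set α}
    {k : α → ℝ≥0∞} (hA : MeasurableSet A) (hk : Measurable k) {c : ℝ≥0∞} (hc : c ≠ ⊤)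
    (hkc : ∀ x ∈ A, k x ≤ c) :
    Tendsto (fun n => ∫⁻ x in A, k x * ‖f n x‖ₑ ^ 2 ∂μ) atTop
      (𝓝 (∫⁻ x in A, k x * ‖g x‖ₑ ^ 2 ∂μ)) := by
  set ν := (μ.restrict A).withDensity k
  have hν : ν ≤ c • μ := by
    refine (Measure.le_iff.mpr fun s hs => ?_ : ν ≤ c • μ.restrict A).trans ?_
    · rw [withDensity_apply _ hs, Measure.smul_apply, smul_eq_mul, ← setLIntegral_const]
      exact lintegral_mono_ae (ae_restrict_of_ae (by
        filter_upwards [ae_restrict_mem hA] with x hx using hkc x hx))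
    · exact Measure.le_iff.mpr fun s _ => by
        simp only [Measure.smul_apply, smul_eq_mul]
        gcongr
        exact Measure.restrict_le_self
  have hac : ν ≪ μ := (Measure.absolutelyContinuous_of_le hν).trans
    (Measure.smul_absolutelyContinuous)
  have key := tendsto_lintegral_sq (μ := ν) (f := f) (g := g) (fun n => (hf n).mono_ac hac)
    (hg.of_measure_le_smul hc hν) ?_
  · have e : ∀ u : α → ℂ, AEStronglyMeasurable u μ →
        ∫⁻ x, ‖u x‖ₑ ^ 2 ∂ν = ∫⁻ x in A, k x * ‖u x‖ₑ ^ 2 ∂μ := fun u hu =>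
      lintegral_withDensity_eq_lintegral_mul₀ hk.aemeasurable (hu.restrict.enorm.pow_const 2)
    rw [e g hg.1] at key
    exact key.congr fun n => e _ (hf n)
  · have h1 := ENNReal.Tendsto.const_mul (a := c ^ (1 / 2 : ℝ)) h
      (Or.inr (ENNReal.rpow_ne_top_of_nonneg (by norm_num) hc))
    rw [mul_zero] at h1
    refine tendsto_of_tendsto_of_tendsto_of_le_of_le tendsto_const_nhds h1 (fun _ => zero_le)
      fun n => ?_
    refine (eLpNorm_mono_measure _ hν).trans (le_of_eq ?_)
    rw [eLpNorm_smul_measure_of_ne_top (by simp)]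
    simp

/-- The squared norm of the weak gradient. -/
def weakGradSq {Θ : ℝ} (w : H1 Θ) (z : ℂ) : ℝ≥0∞ := ‖w.1 1 z‖ₑ ^ 2 + ‖w.1 2 z‖ₑ ^ 2

lemma lintegral_weakGradSq_lt_top {Θ : ℝ} (w : H1 Θ) :
    ∫⁻ z, weakGradSq w z ∂(sectorMeasure Θ) < ⊤ := by
  unfold weakGradSq
  rw [lintegral_add_left' ((Lp.aestronglyMeasurable _).enorm.pow_const 2)]
  exact ENNReal.add_lt_top.mpr ⟨(Lp.lintegral_sq_ne_top (Lp.memLp _)).lt_top,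
    (Lp.lintegral_sq_ne_top (Lp.memLp _)).lt_top⟩

section limit

variable {Θ a b θ₀ δ : ℝ} {w : H1 Θ} {t : ℝ → ℂ}

lemma IsTrace.exists_approx (ht : IsTrace Θ θ₀ w t) (hδ : 0 < δ) :
    ∃ v : ℕ → ℂ → ℂ, (∀ n, IsSmoothCompact (v n)) ∧
      Tendsto (fun n => ∫⁻ z in cone Θ a b (Ioi δ), invSq z * ‖v n z‖ₑ ^ 2 ∂(sectorMeasure Θ)) atTop
        (𝓝 (∫⁻ z in cone Θ a b (Ioi δ), invSq z * ‖fnOf w z‖ₑ ^ 2 ∂(sectorMeasure Θ))) ∧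
      Tendsto (fun n => ∫⁻ z in cone Θ a b (Ioi δ), gradSq (v n) z ∂(sectorMeasure Θ)) atTop
        (𝓝 (∫⁻ z in cone Θ a b (Ioi δ), weakGradSq w z ∂(sectorMeasure Θ))) ∧
      Tendsto (fun n => ∫⁻ r in Ioi δ, ENNReal.ofReal r⁻¹ * ‖v n (rayPoint θ₀ r)‖ₑ ^ 2 ∂rayMeasure)
        atTop (𝓝 (∫⁻ r in Ioi δ, ENNReal.ofReal r⁻¹ * ‖t r‖ₑ ^ 2 ∂rayMeasure)) := by
  obtain ⟨htm, v, hv, hw, ht⟩ := ht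
  obtain ⟨h0, h1, h2⟩ := (tendsto_toH1_iff hv w).mp hw
  have hcone := measurableSet_cone Θ a b (measurableSet_Ioi (a := δ))
  refine ⟨v, hv, ?_, ?_, ?_⟩
  · refine tendsto_lintegral_weight_sq (fun n => ((hv n).memLp Θ 2).1) (Lp.memLp (w.1 0)) h0 hcone
      measurable_invSq (c := ENNReal.ofReal ((δ ^ 2)⁻¹)) (by simp) fun z hz => ?_
    refine ENNReal.ofReal_le_ofReal ?_
    have : δ < ‖z‖ := hz.2
    gcongr
  · have k1 := tendsto_lintegral_weight_sq (k := fun _ => 1) (fun n => ((hv n).memLp_dirDeriv Θ 2 1).1)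
      (Lp.memLp (w.1 1)) h1 hcone measurable_const (c := 1) (by simp) (fun _ _ => le_rfl)
    have k2 := tendsto_lintegral_weight_sq (k := fun _ => 1)
      (fun n => ((hv n).memLp_dirDeriv Θ 2 Complex.I).1)
      (Lp.memLp (w.1 2)) h2 hcone measurable_const (c := 1) (by simp) (fun _ _ => le_rfl)
    simp only [one_mul] at k1 k2
    have k3 := k1.add k2
    unfold weakGradSq gradSq
    rw [lintegral_add_left' ((Lp.aestronglyMeasurable _).restrict.enorm.pow_const 2)]
    refine k3.congr fun n => ?_
    rw [lintegral_add_left (((hv n).dirDeriv_continuous 1).measurable.enorm.pow_const 2)]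
  · refine tendsto_lintegral_weight_sq (fun n => ((hv n).memLp_ray θ₀).1) htm ht measurableSet_Ioi
      (by fun_prop) (c := ENNReal.ofReal δ⁻¹) (by simp) fun r hr => ?_
    refine ENNReal.ofReal_le_ofReal ?_
    have : δ < r := hr
    gcongr

lemma hardy_in (hΘ : Θ < 2 * Real.pi) (ha : 0 ≤ a) (hb : b ≤ Θ) (h0 : θ₀ ∈ Icc a b)
    (hδ : 0 < δ) (ht : IsTrace Θ θ₀ w t) :
    ∫⁻ z in cone Θ a b (Ioi δ), invSq z * ‖fnOf w z‖ₑ ^ 2 ∂(sectorMeasure Θ) ≤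
      ENNReal.ofReal (b - a) * (2 * (∫⁻ r in Ioi δ, ENNReal.ofReal r⁻¹ * ‖t r‖ₑ ^ 2 ∂rayMeasure) +
        4 * ENNReal.ofReal (b - a) *
          ∫⁻ z in cone Θ a b (Ioi δ), weakGradSq w z ∂(sectorMeasure Θ)) := by
  obtain ⟨v, hv, h1, h2, h3⟩ := ht.exists_approx (a := a) (b := b) hδ
  refine le_of_tendsto_of_tendsto' h1 ?_ fun n =>
    hardy_smooth_in hΘ ha hb measurableSet_Ioi (hv n) h0
  refine ENNReal.Tendsto.const_mul ((ENNReal.Tendsto.const_mul h3 (Or.inr (by simp))).add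
    (ENNReal.Tendsto.const_mul h2 (Or.inr (ENNReal.mul_ne_top (by simp) (by simp)))))
    (Or.inr (by simp))

lemma hardy_out (hΘ : Θ < 2 * Real.pi) (ha : 0 ≤ a) (hb : b ≤ Θ) (h0 : θ₀ ∈ Icc a b)
    (hδ : 0 < δ) (ht : IsTrace Θ θ₀ w t) :
    ENNReal.ofReal (b - a) * ∫⁻ r in Ioi δ, ENNReal.ofReal r⁻¹ * ‖t r‖ₑ ^ 2 ∂rayMeasure ≤
      2 * (∫⁻ z in cone Θ a b (Ioi δ), invSq z * ‖fnOf w z‖ₑ ^ 2 ∂(sectorMeasure Θ)) +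
        ENNReal.ofReal (b - a) * (4 * ENNReal.ofReal (b - a) *
          ∫⁻ z in cone Θ a b (Ioi δ), weakGradSq w z ∂(sectorMeasure Θ)) := by
  obtain ⟨v, hv, h1, h2, h3⟩ := ht.exists_approx (a := a) (b := b) hδ
  refine le_of_tendsto_of_tendsto' (ENNReal.Tendsto.const_mul h3 (Or.inr (by simp))) ?_ fun n =>
    hardy_smooth_out hΘ ha hb measurableSet_Ioi (hv n) h0
  refine (ENNReal.Tendsto.const_mul h1 (Or.inr (by simp))).add (ENNReal.Tendsto.const_mul
    (ENNReal.Tendsto.const_mul h2 (Or.inr (ENNReal.mul_ne_top (by simp) (by simp))))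
    (Or.inr (by simp)))

lemma setLIntegral_le_of_forall_pos {α : Type*} [MeasurableSpace α] {μ : Measure α}
    {A : ℝ → Set α} {F : α → ℝ≥0∞} {c : ℝ≥0∞}
    (hanti : Antitone A) (h : ∀ δ, 0 < δ → ∫⁻ x in A δ, F x ∂μ ≤ c) :
    ∫⁻ x in ⋃ n : ℕ, A (1 / (n + 1)), F x ∂μ ≤ c := by
  rw [setLIntegral_iUnion_of_directed]
  · exact iSup_le fun n => h _ (by positivity)
  · refine (monotone_nat_of_le_succ fun n => hanti ?_).directed_le
    exact one_div_le_one_div_of_le (by positivity) (by push_cast; linarith)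

lemma iUnion_Ioi_one_div : ⋃ n : ℕ, Ioi (1 / ((n : ℝ) + 1)) = Ioi 0 := by
  ext r
  simp only [mem_iUnion, mem_Ioi]
  exact ⟨fun ⟨n, hn⟩ => lt_trans (by positivity) hn, fun h => exists_nat_one_div_lt h⟩

/-- The Hardy inequality for functions which vanish on one side. -/
lemma hardy_zero (hΘ : Θ < 2 * Real.pi) (ha : 0 ≤ a) (hb : b ≤ Θ) (h0 : θ₀ ∈ Icc a b)
    (ht : IsTrace Θ θ₀ w 0) :
    ∫⁻ z in cone Θ a b (Ioi 0), invSq z * ‖fnOf w z‖ₑ ^ 2 ∂(sectorMeasure Θ) ≤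
      4 * ENNReal.ofReal (b - a) ^ 2 *
        ∫⁻ z in cone Θ a b (Ioi 0), weakGradSq w z ∂(sectorMeasure Θ) := by
  have h : ∀ δ, 0 < δ → ∫⁻ z in cone Θ a b (Ioi δ), invSq z * ‖fnOf w z‖ₑ ^ 2 ∂(sectorMeasure Θ) ≤
      4 * ENNReal.ofReal (b - a) ^ 2 *
        ∫⁻ z in cone Θ a b (Ioi 0), weakGradSq w z ∂(sectorMeasure Θ) := by
    intro δ hδ
    refine (hardy_in hΘ ha hb h0 hδ ht).trans ?_
    simp only [Pi.zero_apply, enorm_zero, ne_eq, OfNat.ofNat_ne_zero, not_false_eq_true, zero_pow,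
      mul_zero, lintegral_zero, zero_add]
    rw [← mul_assoc, mul_left_comm, pow_two]
    gcongr
    exact fun z hz => ⟨hz.1, lt_trans hδ hz.2⟩
  have := setLIntegral_le_of_forall_pos
    (show Antitone fun δ => cone Θ a b (Ioi δ) from
      fun δ δ' hd z hz => ⟨hz.1, lt_of_le_of_lt hd hz.2⟩) h
  convert this using 3
  rw [← iUnion_Ioi_one_div]
  ext z
  simp [cone]

/-- A function which vanishes on `Σ` has a trace on `Γ` which is small near the vertex. -/
lemma lintegral_trace_inv_lt_top (hΘ₀ : 0 < Θ) (hΘ : Θ < 2 * Real.pi) (h : IsTrace Θ Θ w 0)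
    (ht : IsTrace Θ 0 w t) : ∫⁻ r, ENNReal.ofReal r⁻¹ * ‖t r‖ₑ ^ 2 ∂rayMeasure < ⊤ := by
  set B := ∫⁻ z, weakGradSq w z ∂(sectorMeasure Θ)
  have hB : B < ⊤ := lintegral_weakGradSq_lt_top w
  have hΘ' : ENNReal.ofReal Θ ≠ 0 := by simpa using hΘ₀
  have h1 := hardy_zero hΘ le_rfl le_rfl (⟨hΘ₀.le, le_rfl⟩ : Θ ∈ Icc 0 Θ) h
  rw [sub_zero] at h1
  have h2 : ∀ δ, 0 < δ → ∫⁻ r in Ioi δ, ENNReal.ofReal r⁻¹ * ‖t r‖ₑ ^ 2 ∂rayMeasure ≤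
      (ENNReal.ofReal Θ)⁻¹ * (2 * (4 * ENNReal.ofReal Θ ^ 2 * B) +
        ENNReal.ofReal Θ * (4 * ENNReal.ofReal Θ * B)) := by
    intro δ hδ
    have h3 := hardy_out hΘ le_rfl le_rfl (⟨le_rfl, hΘ₀.le⟩ : (0 : ℝ) ∈ Icc 0 Θ) hδ ht
    rw [sub_zero] at h3
    rw [← ENNReal.mul_le_iff_le_inv hΘ' (by simp)]
    refine h3.trans ?_
    gcongr
    · refine le_trans (lintegral_mono_set (show cone Θ 0 Θ (Ioi δ) ⊆ cone Θ 0 Θ (Ioi 0) from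
        fun z hz => ⟨hz.1, lt_trans hδ hz.2⟩)) (h1.trans ?_)
      gcongr
      exact setLIntegral_le_lintegral _ _
    · exact setLIntegral_le_lintegral _ _
  have h4 := setLIntegral_le_of_forall_pos
    (fun δ δ' hd => Ioi_subset_Ioi hd) h2
  rw [iUnion_Ioi_one_div, Measure.restrict_restrict measurableSet_Ioi, inter_self] at h4
  refine h4.trans_lt (ENNReal.mul_lt_top (ENNReal.inv_lt_top.mpr (pos_iff_ne_zero.mpr hΘ')) ?_)
  have : ENNReal.ofReal Θ < ⊤ := ENNReal.ofReal_lt_top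
  refine ENNReal.add_lt_top.mpr ⟨?_, ?_⟩
  · exact ENNReal.mul_lt_top (by simp) (ENNReal.mul_lt_top (ENNReal.mul_lt_top (by simp)
      (ENNReal.pow_lt_top this)) hB)
  · exact ENNReal.mul_lt_top this (ENNReal.mul_lt_top (ENNReal.mul_lt_top (by simp) this) hB)

end limit

/-! ### Functions with vanishing traces -/

/-- A cutoff in product form. -/
def prodCut (A B : ℝ → ℝ) (ζ : ℂ) : ℂ := ((A ζ.re * B ζ.im : ℝ) : ℂ)

lemma contDiff_prodCut {A B : ℝ → ℝ} (hA : ContDiff ℝ (⊤ : ℕ∞) A) (hB : ContDiff ℝ (⊤ : ℕ∞) B) :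
    ContDiff ℝ (⊤ : ℕ∞) (prodCut A B) :=
  Complex.ofRealCLM.contDiff.comp ((hA.comp Complex.reCLM.contDiff).mul
    (hB.comp Complex.imCLM.contDiff))

lemma dirDeriv_one_prodCut {A B : ℝ → ℝ} (hA : ContDiff ℝ (⊤ : ℕ∞) A)
    (hB : ContDiff ℝ (⊤ : ℕ∞) B) (ζ : ℂ) :
    dirDeriv 1 (prodCut A B) ζ = ((deriv A ζ.re * B ζ.im : ℝ) : ℂ) := by
  refine (dirDeriv_eq_deriv_line
    ((contDiff_prodCut hA hB).differentiable (by simp) ζ)).unique ?_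
  have h1 : HasDerivAt A (deriv A ζ.re) (ζ.re + 0) := by
    rw [add_zero]; exact (hA.differentiable (by simp) _).hasDerivAt
  refine ((h1.comp_const_add ζ.re 0).mul_const (B ζ.im)).ofReal_comp.congr_of_eventuallyEq
    (.of_forall fun t => ?_)
  simp [prodCut]

lemma dirDeriv_I_prodCut {A B : ℝ → ℝ} (hA : ContDiff ℝ (⊤ : ℕ∞) A)
    (hB : ContDiff ℝ (⊤ : ℕ∞) B) (ζ : ℂ) :
    dirDeriv Complex.I (prodCut A B) ζ = ((A ζ.re * deriv B ζ.im : ℝ) : ℂ) := by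
  refine (dirDeriv_eq_deriv_line
    ((contDiff_prodCut hA hB).differentiable (by simp) ζ)).unique ?_
  have h1 : HasDerivAt B (deriv B ζ.im) (ζ.im + 0) := by
    rw [add_zero]; exact (hB.differentiable (by simp) _).hasDerivAt
  refine ((h1.comp_const_add ζ.im 0).const_mul (A ζ.re)).ofReal_comp.congr_of_eventuallyEq
    (.of_forall fun t => ?_)
  simp [prodCut]

/-- A smooth step from `0` on `(-∞, 1]` to `1` on `[2, ∞)`. -/
def smoothStep (x : ℝ) : ℝ := Real.smoothTransition (x - 1)

lemma contDiff_smoothStep : ContDiff ℝ (⊤ : ℕ∞) smoothStep :=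
  Real.smoothTransition.contDiff.comp (contDiff_id.sub contDiff_const)

lemma smoothStep_zero {x : ℝ} (h : x ≤ 1) : smoothStep x = 0 :=
  Real.smoothTransition.zero_of_nonpos (by linarith)

lemma smoothStep_one {x : ℝ} (h : 2 ≤ x) : smoothStep x = 1 :=
  Real.smoothTransition.one_of_one_le (by linarith)

lemma smoothStep_nonneg (x : ℝ) : 0 ≤ smoothStep x := Real.smoothTransition.nonneg _

lemma smoothStep_le_one (x : ℝ) : smoothStep x ≤ 1 := Real.smoothTransition.le_one _

lemma exists_deriv_smoothStep_bound :
    ∃ C : ℝ, 0 ≤ C ∧ ∀ x, ‖deriv smoothStep x‖ ≤ C ∧ (2 < x → deriv smoothStep x = 0) := by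
  have h1 : ∀ x, x < 1 → deriv smoothStep x = 0 := by
    intro x hx
    have : smoothStep =ᶠ[𝓝 x] fun _ => 0 := by
      filter_upwards [Iio_mem_nhds hx] with y hy using smoothStep_zero (le_of_lt hy)
    rw [this.deriv_eq, deriv_const]
  have h2 : ∀ x, 2 < x → deriv smoothStep x = 0 := by
    intro x hx
    have : smoothStep =ᶠ[𝓝 x] fun _ => 1 := by
      filter_upwards [Ioi_mem_nhds hx] with y hy using smoothStep_one (le_of_lt hy)
    rw [this.deriv_eq, deriv_const]
  have hc : HasCompactSupport (deriv smoothStep) := by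
    refine HasCompactSupport.of_support_subset_isCompact (isCompact_Icc (a := 1) (b := 2)) ?_
    intro x hx
    constructor
    · by_contra h; exact hx (h1 x (not_le.mp h))
    · by_contra h; exact hx (h2 x (not_le.mp h))
  obtain ⟨C, hC⟩ := (((contDiff_infty_iff_deriv (𝕜 := ℝ)).mp
    contDiff_smoothStep).2.continuous).bounded_above_of_compact_support hc
  exact ⟨C, (norm_nonneg _).trans (hC 0), fun x => ⟨hC x, h2 x⟩⟩

/-- The angular cutoff which vanishes near both sides. -/
def sideCut (Θ : ℝ) (n : ℕ) (θ : ℝ) : ℝ :=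
  smoothStep ((n + 1) * θ) * smoothStep ((n + 1) * (Θ - θ))

/-- The radial cutoff in the logarithmic variable. -/
def logCut (n : ℕ) (s : ℝ) : ℝ := plateau (s / (n + 1))

lemma contDiff_sideCut (Θ : ℝ) (n : ℕ) : ContDiff ℝ (⊤ : ℕ∞) (sideCut Θ n) :=
  (contDiff_smoothStep.comp (contDiff_const.mul contDiff_id)).mul
    (contDiff_smoothStep.comp (contDiff_const.mul (contDiff_const.sub contDiff_id)))

lemma contDiff_logCut (n : ℕ) : ContDiff ℝ (⊤ : ℕ∞) (logCut n) :=
  plateau.contDiff.comp (contDiff_id.div_const _)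

/-- The cutoff, as a test function. -/
def vertexCut (Θ : ℝ) (n : ℕ) : ℂ → ℂ := cutProd Θ (prodCut (logCut n) (sideCut Θ n)) fun _ => 1

lemma isTest_vertexCut {Θ : ℝ} (hΘ : Θ < 2 * Real.pi) (n : ℕ) :
    IsTest Θ (vertexCut Θ n) := by
  have hn : (0 : ℝ) < n + 1 := by positivity
  let K : Set ℂ := Icc (-(2 * (n + 1) : ℝ)) (2 * (n + 1)) ×ℂ Icc (1 / (n + 1)) (Θ - 1 / (n + 1))
  have hKs : K ⊆ strip Θ := by
    intro ζ hζ
    have h2 := hζ.2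
    have h3 : (0 : ℝ) < 1 / (n + 1) := by positivity
    exact ⟨lt_of_lt_of_le h3 h2.1, lt_of_le_of_lt h2.2 (by linarith)⟩
  have hsupp : Function.support (prodCut (logCut n) (sideCut Θ n)) ⊆ K := by
    intro ζ hζ
    have h : logCut n ζ.re * sideCut Θ n ζ.im ≠ 0 := by
      intro h; exact hζ (by rw [prodCut, h, Complex.ofReal_zero])
    have h1 : ζ.re / (n + 1) ∈ Metric.ball (0 : ℝ) 2 := by
      have := left_ne_zero_of_mul h
      rwa [logCut, ← Function.mem_support, plateau.support_eq] at this
    rw [Real.ball_eq_Ioo, mem_Ioo, lt_div_iff₀ hn, div_lt_iff₀ hn] at h1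
    have h2 := left_ne_zero_of_mul (right_ne_zero_of_mul h)
    have h3 := right_ne_zero_of_mul (right_ne_zero_of_mul h)
    have h2' : 1 < (n + 1) * ζ.im := by by_contra hc; exact h2 (smoothStep_zero (not_lt.mp hc))
    have h3' : 1 < (n + 1) * (Θ - ζ.im) := by
      by_contra hc; exact h3 (smoothStep_zero (not_lt.mp hc))
    refine ⟨⟨by linarith [h1.1], by linarith [h1.2]⟩, ?_, ?_⟩
    · rw [div_le_iff₀ hn]; linarith
    · have : 1 / ((n : ℝ) + 1) ≤ Θ - ζ.im := by rw [div_le_iff₀ hn]; linarith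
      linarith
  have hm := isSmoothCompact_cutProd (Θ := Θ) (U := fun _ => 1)
    (isCompact_Icc.reProdIm isCompact_Icc : IsCompact K)
    (fun ζ hζ => abs_sub_half_lt hΘ (hKs hζ).1.le (hKs hζ).2.le)
    (contDiff_prodCut (contDiff_logCut n) (contDiff_sideCut Θ n)) hsupp (fun _ _ => contDiffAt_const)
  refine ⟨hm.1, hm.2.trans ?_⟩
  rw [sector_eq_image]
  exact image_mono hKs

lemma vertexCut_eq {Θ : ℝ} {n : ℕ} {z : ℂ} (hz : z ∈ slit Θ) :
    vertexCut Θ n z = prodCut (logCut n) (sideCut Θ n) (lg Θ z) := by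
  rw [vertexCut, cutProd, indicator_of_mem hz, mul_one]

lemma tendsto_vertexCut {Θ : ℝ} (hΘ : Θ < 2 * Real.pi) {z : ℂ} (hz : z ∈ sector Θ) :
    Tendsto (fun n => vertexCut Θ n z) atTop (𝓝 1) := by
  have him := lg_mem_strip hΘ hz
  have hs := sector_subset_slit hΘ hz
  have h1 := (Complex.continuous_ofReal.tendsto 1).comp (tendsto_plateau (lg Θ z).re)
  have hN : ∀ x : ℝ, 0 < x → ∀ᶠ n : ℕ in atTop, 2 ≤ ((n : ℝ) + 1) * x := by
    intro x hx
    have : Tendsto (fun n : ℕ => ((n : ℝ) + 1) * x) atTop atTop :=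
      (tendsto_atTop_add_const_right _ _ tendsto_natCast_atTop_atTop).atTop_mul_const hx
    exact this.eventually_ge_atTop 2
  rw [Complex.ofReal_one] at h1
  refine h1.congr' ?_
  filter_upwards [hN _ him.1, hN (Θ - (lg Θ z).im) (by linarith [him.2])] with n ha hb
  rw [vertexCut_eq hs, prodCut, sideCut, smoothStep_one ha, smoothStep_one hb, one_mul, mul_one]
  rfl

lemma norm_vertexCut_sub_one_le (Θ : ℝ) (n : ℕ) (z : ℂ) : ‖vertexCut Θ n z - 1‖ ≤ 1 := by
  by_cases hz : z ∈ slit Θ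
  · rw [vertexCut_eq hz, prodCut, ← Complex.ofReal_one, ← Complex.ofReal_sub, Complex.norm_real,
      Real.norm_eq_abs, sideCut, logCut]
    have h1 := plateau.nonneg (x := (lg Θ z).re / (n + 1))
    have h2 := plateau.le_one (x := (lg Θ z).re / (n + 1))
    have h3 := smoothStep_nonneg ((n + 1) * (lg Θ z).im)
    have h4 := smoothStep_le_one ((n + 1) * (lg Θ z).im)
    have h5 := smoothStep_nonneg ((n + 1) * (Θ - (lg Θ z).im))
    have h6 := smoothStep_le_one ((n + 1) * (Θ - (lg Θ z).im))
    have h7 := mul_nonneg h1 (mul_nonneg h3 h5)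
    have h8 := mul_le_one₀ h2 (mul_nonneg h3 h5) (mul_le_one₀ h4 h5 h6)
    rw [abs_le]
    constructor <;> linarith
  · rw [vertexCut, cutProd, indicator_of_notMem hz]; simp

/-- The derivative of the cutoff is of size `|z|⁻¹ (1/n + n 1_{near the sides})`. -/
lemma exists_dirDeriv_vertexCut_bound {Θ : ℝ} (hΘ : Θ < 2 * Real.pi) :
    ∃ C : ℝ, 0 ≤ C ∧ ∀ (n : ℕ) (e : ℂ), ‖e‖ = 1 → ∀ z ∈ sector Θ,
      ‖dirDeriv e (vertexCut Θ n) z‖ₑ ^ 2 ≤ ENNReal.ofReal C * (invSq z *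
        (ENNReal.ofReal (1 / (n + 1)) ^ 2 + ENNReal.ofReal ((n : ℝ) + 1) ^ 2 *
          ((cone Θ 0 (3 / (n + 1)) (Ioi 0)).indicator 1 z +
            (cone Θ (Θ - 3 / (n + 1)) Θ (Ioi 0)).indicator 1 z))) := by
  obtain ⟨C₁, hC₁⟩ := exists_deriv_plateau_bound
  have hC₁0 : 0 ≤ C₁ := (norm_nonneg _).trans (hC₁ 0)
  obtain ⟨C₂, hC₂0, hC₂⟩ := exists_deriv_smoothStep_bound
  refine ⟨3 * (C₁ ^ 2 + C₂ ^ 2), by positivity, fun n e he z hz => ?_⟩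
  have hs := sector_subset_slit hΘ hz
  have him := lg_mem_strip hΘ hz
  have hn : (0 : ℝ) < n + 1 := by positivity
  set N : ℝ := n + 1
  set θ := (lg Θ z).im
  have hz0 : 0 < ‖z‖ := norm_pos_iff.mpr (ne_zero_of_mem_slit hs)
  let i1 : ℝ := if θ < 3 / N then 1 else 0
  let i2 : ℝ := if Θ - 3 / N < θ then 1 else 0
  have hi1 : (cone Θ 0 (3 / N) (Ioi 0)).indicator 1 z = ENNReal.ofReal i1 := by
    by_cases h : θ < 3 / N
    · rw [indicator_of_mem (show z ∈ cone Θ 0 (3 / N) (Ioi 0) from ⟨⟨him.1, h⟩, hz0⟩)]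
      simp [i1, h]
    · rw [indicator_of_notMem (fun hc => h hc.1.2)]
      simp [i1, h]
  have hi2 : (cone Θ (Θ - 3 / N) Θ (Ioi 0)).indicator 1 z = ENNReal.ofReal i2 := by
    by_cases h : Θ - 3 / N < θ
    · rw [indicator_of_mem (show z ∈ cone Θ (Θ - 3 / N) Θ (Ioi 0) from ⟨⟨h, him.2⟩, hz0⟩)]
      simp [i2, h]
    · rw [indicator_of_notMem (fun hc => h hc.1.1)]
      simp [i2, h]
  have hev : vertexCut Θ n =ᶠ[𝓝 z] fun z => prodCut (logCut n) (sideCut Θ n) (lg Θ z) := by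
    filter_upwards [(isOpen_slit Θ).mem_nhds hs] with y hy using vertexCut_eq hy
  have hA := contDiff_logCut n
  have hB := contDiff_sideCut Θ n
  have hdA : ‖deriv (logCut n) (lg Θ z).re‖ ≤ C₁ / N := by
    have h1 : HasDerivAt plateau (deriv plateau ((lg Θ z).re / N)) ((lg Θ z).re / N) :=
      ((plateau.contDiff (n := 1)).differentiable (by simp) _).hasDerivAt
    have h2 := h1.comp (lg Θ z).re ((hasDerivAt_id _).div_const N)
    have h3 : deriv (logCut n) (lg Θ z).re = _ := h2.deriv
    rw [h3, norm_mul, norm_div, norm_one, Real.norm_of_nonneg hn.le, mul_one_div]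
    gcongr
    exact hC₁ _
  have hdB : ‖deriv (sideCut Θ n) θ‖ ≤ C₂ * N * i1 + C₂ * N * i2 := by
    have hst : ∀ x, HasDerivAt smoothStep (deriv smoothStep x) x := fun x =>
      (contDiff_smoothStep.differentiable (by simp) x).hasDerivAt
    have h1 : HasDerivAt (fun θ => smoothStep (N * θ)) (deriv smoothStep (N * θ) * N) θ :=
      HasDerivAt.comp (h₂ := smoothStep) θ (hst (N * θ))
        (by simpa using (hasDerivAt_id θ).const_mul N)
    have h2 : HasDerivAt (fun θ => smoothStep (N * (Θ - θ)))
        (deriv smoothStep (N * (Θ - θ)) * (-N)) θ :=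
      HasDerivAt.comp (h₂ := smoothStep) θ (hst (N * (Θ - θ)))
        (by simpa using ((hasDerivAt_id θ).const_sub Θ).const_mul N)
    have h3 : deriv (sideCut Θ n) θ = _ := (h1.mul h2).deriv
    rw [h3]
    refine (norm_add_le _ _).trans ?_
    rw [norm_mul, norm_mul, norm_mul, norm_mul, norm_neg, Real.norm_of_nonneg hn.le,
      Real.norm_of_nonneg (smoothStep_nonneg _), Real.norm_of_nonneg (smoothStep_nonneg _)]
    have g1 : ‖deriv smoothStep (N * θ)‖ ≤ C₂ * i1 := by
      by_cases h : θ < 3 / N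
      · simp only [i1, if_pos h, mul_one]; exact (hC₂ _).1
      · have : 2 < N * θ := by
          rw [not_lt, div_le_iff₀ hn] at h; linarith
        rw [(hC₂ _).2 this, norm_zero]
        simp [i1, h]
    have g2 : ‖deriv smoothStep (N * (Θ - θ))‖ ≤ C₂ * i2 := by
      by_cases h : Θ - 3 / N < θ
      · simp only [i2, if_pos h, mul_one]; exact (hC₂ _).1
      · have : 2 < N * (Θ - θ) := by
          have h' : 3 / N ≤ Θ - θ := by linarith [not_lt.mp h]
          rw [div_le_iff₀ hn] at h'; linarith
        rw [(hC₂ _).2 this, norm_zero]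
        simp [i2, h]
    have p1 : ‖deriv smoothStep (N * θ)‖ * N * smoothStep (N * (Θ - θ)) ≤ C₂ * i1 * N * 1 :=
      mul_le_mul (mul_le_mul_of_nonneg_right g1 hn.le) (smoothStep_le_one _) (smoothStep_nonneg _)
        (mul_nonneg ((norm_nonneg _).trans g1) hn.le)
    have p2 : smoothStep (N * θ) * (‖deriv smoothStep (N * (Θ - θ))‖ * N) ≤ 1 * (C₂ * i2 * N) :=
      mul_le_mul (smoothStep_le_one _) (mul_le_mul_of_nonneg_right g2 hn.le)
        (mul_nonneg (norm_nonneg _) hn.le) zero_le_one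
    linarith
  have hi1' : i1 ^ 2 = i1 ∧ 0 ≤ i1 := by simp only [i1]; split_ifs <;> norm_num
  have hi2' : i2 ^ 2 = i2 ∧ 0 ≤ i2 := by simp only [i2]; split_ifs <;> norm_num
  have hmain : ‖dirDeriv e (vertexCut Θ n) z‖ ≤ ‖z‖⁻¹ * (C₁ / N + (C₂ * N * i1 + C₂ * N * i2)) := by
    rw [dirDeriv, hev.fderiv_eq]
    change ‖dirDeriv e (fun z => prodCut (logCut n) (sideCut Θ n) (lg Θ z)) z‖ ≤ _
    rw [dirDeriv_comp_lg (contDiff_prodCut hA hB) hs, dirDeriv_one_prodCut hA hB,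
      dirDeriv_I_prodCut hA hB]
    have e3 : ‖z⁻¹ * e‖ = ‖z‖⁻¹ := by rw [norm_mul, he, mul_one, norm_inv]
    have e4 := (Complex.abs_re_le_norm (z⁻¹ * e)).trans e3.le
    have e5 := (Complex.abs_im_le_norm (z⁻¹ * e)).trans e3.le
    refine (norm_add_le _ _).trans ?_
    simp only [norm_mul, Complex.norm_real, Real.norm_eq_abs] at hdA hdB ⊢
    have hb1 : |sideCut Θ n θ| ≤ 1 := by
      rw [sideCut, abs_mul, abs_of_nonneg (smoothStep_nonneg _), abs_of_nonneg (smoothStep_nonneg _)]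
      exact mul_le_one₀ (smoothStep_le_one _) (smoothStep_nonneg _) (smoothStep_le_one _)
    have hb2 : |logCut n (lg Θ z).re| ≤ 1 := by
      rw [logCut, abs_of_nonneg plateau.nonneg]; exact plateau.le_one
    rw [mul_add]
    refine add_le_add (mul_le_mul e4 ?_ (by positivity) (by positivity))
      (mul_le_mul e5 ?_ (by positivity) (by positivity))
    · calc _ ≤ C₁ / N * 1 := mul_le_mul hdA hb1 (abs_nonneg _) (by positivity)
        _ = _ := mul_one _
    · calc _ ≤ 1 * (C₂ * N * i1 + C₂ * N * i2) :=
            mul_le_mul hb2 hdB (abs_nonneg _) zero_le_one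
        _ = _ := one_mul _
  rw [hi1, hi2, ← ofReal_norm, ← ENNReal.ofReal_pow (norm_nonneg _), invSq,
    ← ENNReal.ofReal_pow (show (0 : ℝ) ≤ 1 / N by positivity), ← ENNReal.ofReal_pow hn.le,
    ← ENNReal.ofReal_add hi1'.2 hi2'.2,
    ← ENNReal.ofReal_mul (by positivity), ← ENNReal.ofReal_add (by positivity)
      (mul_nonneg (by positivity) (add_nonneg hi1'.2 hi2'.2)),
    ← ENNReal.ofReal_mul (by positivity), ← ENNReal.ofReal_mul (by positivity)]
  refine ENNReal.ofReal_le_ofReal ((pow_le_pow_left₀ (norm_nonneg _) hmain 2).trans ?_)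
  have h3 : ∀ x y w : ℝ, (x + (y + w)) ^ 2 ≤ 3 * (x ^ 2 + y ^ 2 + w ^ 2) := fun x y w => by
    nlinarith [sq_nonneg (x - y), sq_nonneg (x - w), sq_nonneg (y - w)]
  have q1 : 0 ≤ C₂ ^ 2 * (1 / N) ^ 2 := by positivity
  have q2 : 0 ≤ C₁ ^ 2 * (N ^ 2 * (i1 + i2)) :=
    mul_nonneg (sq_nonneg _) (mul_nonneg (sq_nonneg _) (add_nonneg hi1'.2 hi2'.2))
  rw [mul_pow, inv_pow]
  refine (mul_le_mul_of_nonneg_left ((h3 _ _ _).trans ?_)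
    (inv_nonneg.mpr (sq_nonneg _)) : _ ≤ (‖z‖ ^ 2)⁻¹ *
      (3 * (C₁ ^ 2 + C₂ ^ 2) * ((1 / N) ^ 2 + N ^ 2 * (i1 + i2)))).trans (le_of_eq (by ring))
  rw [mul_pow (C₂ * N) i1, mul_pow (C₂ * N) i2, hi1'.1, hi2'.1, div_eq_mul_one_div C₁]
  nlinarith

/-- The product of an element of `H¹(Ω)` with a test function is in `H¹₀(Ω)`. -/
lemma exists_testMul_mem_H10 {Θ : ℝ} {q : ℂ → ℂ} (hq : IsTest Θ q) (w : H1 Θ) {v : ℕ → ℂ → ℂ}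
    (hv : ∀ n, IsSmoothCompact (v n)) (h : Tendsto (fun n => toH1 Θ (v n) (hv n)) atTop (𝓝 w)) :
    ∃ T ∈ H10 Θ, T 0 =ᵐ[sectorMeasure Θ] (fun z => q z * w.1 0 z) ∧
      T 1 =ᵐ[sectorMeasure Θ] (fun z => q z * w.1 1 z + dirDeriv 1 q z * w.1 0 z) ∧
      T 2 =ᵐ[sectorMeasure Θ] (fun z => q z * w.1 2 z + dirDeriv Complex.I q z * w.1 0 z) := by
  obtain ⟨h0, h1, h2⟩ := (tendsto_toH1_iff hv w).mp h
  have bd : ∀ p : ℂ → ℂ, IsSmoothCompact p → ∀ u : ℂ → ℂ, MemLp u 2 (sectorMeasure Θ) →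
      MemLp (fun z => p z * u z) 2 (sectorMeasure Θ) := by
    intro p hp u hu
    obtain ⟨C, -, hC⟩ := hp.exists_bound
    exact hu.of_le_mul (hp.continuous.aestronglyMeasurable.mul hu.1)
      (.of_forall fun z => by rw [norm_mul]; gcongr; exact hC z)
  have hqd : ∀ e, IsSmoothCompact (dirDeriv e q) := fun e => hq.1.dirDeriv e
  have hw := fun i => Lp.memLp (w.1 i)
  have m0 := bd q hq.1 _ (hw 0)
  have m1 := (bd q hq.1 _ (hw 1)).add (bd _ (hqd 1) _ (hw 0))
  have m2 := (bd q hq.1 _ (hw 2)).add (bd _ (hqd Complex.I) _ (hw 0))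
  let T : L2Triple Θ := WithLp.toLp 2 ![m0.toLp _, m1.toLp _, m2.toLp _]
  have hqv : ∀ n, IsTest Θ (fun z => q z * v n z) := fun n =>
    ⟨⟨hq.1.1.mul (hv n).1, hq.1.2.mul_right⟩, (tsupport_mul_subset_left).trans hq.2⟩
  have lim : ∀ p : ℂ → ℂ, IsSmoothCompact p → ∀ (f : ℕ → ℂ → ℂ) (u : ℂ → ℂ),
      Tendsto (fun n => eLpNorm (fun z => f n z - u z) 2 (sectorMeasure Θ)) atTop (𝓝 0) →
      Tendsto (fun n => eLpNorm (fun z => p z * f n z - p z * u z) 2 (sectorMeasure Θ)) atTop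
        (𝓝 0) := by
    intro p hp f u hfu
    obtain ⟨C, hC0, hC⟩ := hp.exists_bound
    have k := ENNReal.Tendsto.const_mul (a := ENNReal.ofReal C) hfu (Or.inr (by simp))
    rw [mul_zero] at k
    refine tendsto_of_tendsto_of_tendsto_of_le_of_le tendsto_const_nhds k (fun _ => zero_le)
      fun n => eLpNorm_le_mul_eLpNorm_of_ae_le_mul (.of_forall fun z => ?_) 2
    rw [← mul_sub, norm_mul]
    gcongr
    exact hC z
  have limd : ∀ e we, Tendsto (fun n => eLpNorm (fun z => dirDeriv e (v n) z - we z) 2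
      (sectorMeasure Θ)) atTop (𝓝 0) → MemLp we 2 (sectorMeasure Θ) → ∀ g : ℂ → ℂ,
      g =ᵐ[sectorMeasure Θ] (fun z => q z * we z + dirDeriv e q z * w.1 0 z) →
      Tendsto (fun n => eLpNorm (fun z => dirDeriv e (fun z => q z * v n z) z - g z) 2
        (sectorMeasure Θ)) atTop (𝓝 0) := by
    intro e we hwe hm g hg
    have k := (lim q hq.1 _ _ hwe).add (lim _ (hqd e) _ _ h0)
    rw [add_zero] at k
    refine tendsto_of_tendsto_of_tendsto_of_le_of_le tendsto_const_nhds k (fun _ => zero_le)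
      fun n => ?_
    have a1 : AEStronglyMeasurable (fun z => q z * dirDeriv e (v n) z - q z * we z)
        (sectorMeasure Θ) := (hq.1.continuous.aestronglyMeasurable.mul
          ((hv n).dirDeriv_continuous e).aestronglyMeasurable).sub
          (hq.1.continuous.aestronglyMeasurable.mul hm.1)
    have a2 : AEStronglyMeasurable (fun z => dirDeriv e q z * v n z - dirDeriv e q z * w.1 0 z)
        (sectorMeasure Θ) := ((hqd e).continuous.aestronglyMeasurable.mul
          (hv n).continuous.aestronglyMeasurable).sub
          ((hqd e).continuous.aestronglyMeasurable.mul (hw 0).1)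
    refine (le_of_eq (eLpNorm_congr_ae ?_)).trans (eLpNorm_add_le a1 a2 (by norm_num))
    filter_upwards [hg] with z hz
    rw [hz, Pi.add_apply, dirDeriv_mul (hq.1.differentiable z) ((hv n).differentiable z)]
    ring
  have hT : Tendsto (fun n => (toH1 Θ _ (hqv n).1).1) atTop (𝓝 T) := by
    rw [tendsto_L2Triple_iff]
    intro i
    fin_cases i
    · refine (tendsto_toLp_iff (fun n => (hqv n).1.memLp Θ 2) _).mpr ?_
      refine (lim q hq.1 v _ h0).congr fun n => eLpNorm_congr_ae ?_
      filter_upwards [m0.coeFn_toLp] with z hz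
      change _ = _ - (m0.toLp _) z
      rw [hz]
    · exact (tendsto_toLp_iff (fun n => (hqv n).1.memLp_dirDeriv Θ 2 1) _).mpr
        (limd 1 _ h1 (hw 1) _ m1.coeFn_toLp)
    · exact (tendsto_toLp_iff (fun n => (hqv n).1.memLp_dirDeriv Θ 2 Complex.I) _).mpr
        (limd _ _ h2 (hw 2) _ m2.coeFn_toLp)
  refine ⟨T, ?_, m0.coeFn_toLp, m1.coeFn_toLp, m2.coeFn_toLp⟩
  exact (Submodule.isClosed_topologicalClosure _).mem_of_tendsto hT
    (.of_forall fun n => toH1_mem_H10 (hqv n))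

lemma tendsto_lintegral_cone_zero {Θ : ℝ} (w : H1 Θ) {a b : ℕ → ℝ}
    (h : ∀ x, ∀ᶠ n in atTop, x ∉ Ioo (a n) (b n)) :
    Tendsto (fun n => ∫⁻ z in cone Θ (a n) (b n) (Ioi 0), weakGradSq w z ∂(sectorMeasure Θ)) atTop
      (𝓝 0) := by
  have hm : AEMeasurable (weakGradSq w) (sectorMeasure Θ) :=
    ((Lp.aestronglyMeasurable _).enorm.pow_const 2).add
      ((Lp.aestronglyMeasurable _).enorm.pow_const 2)
  have hcone : ∀ n, MeasurableSet (cone Θ (a n) (b n) (Ioi 0)) := fun n =>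
    measurableSet_cone Θ _ _ measurableSet_Ioi
  have k := tendsto_lintegral_of_dominated_convergence' (μ := sectorMeasure Θ)
    (F := fun n => (cone Θ (a n) (b n) (Ioi 0)).indicator (weakGradSq w)) (f := fun _ => 0)
    (weakGradSq w) (fun n => hm.indicator (hcone n))
    (fun n => Eventually.of_forall fun z => indicator_le_self' (fun _ _ => zero_le) z)
    (lintegral_weakGradSq_lt_top w).ne (.of_forall fun z => ?_)
  · rw [lintegral_zero] at k
    exact k.congr fun n => lintegral_indicator (hcone n) _
  · refine tendsto_const_nhds.congr' ?_
    filter_upwards [h (lg Θ z).im] with n hn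
    rw [indicator_of_notMem fun hc => hn hc.1]

/-- A function of `H¹(Ω)` whose traces vanish is in `H¹₀(Ω)`. -/
lemma mem_H10_of_trace_zero {Θ : ℝ} (hΘ₀ : 0 < Θ) (hΘ : Θ < 2 * Real.pi) {w : H1 Θ}
    (h0 : IsTrace Θ 0 w 0) (h1 : IsTrace Θ Θ w 0) : w.1 ∈ H10 Θ := by
  obtain ⟨-, v, hv, hvw, -⟩ := id h0
  choose T hT hT0 hT1 hT2 using fun n => exists_testMul_mem_H10 (isTest_vertexCut hΘ n) w hv hvw
  refine (Submodule.isClosed_topologicalClosure _).mem_of_tendsto (f := T) (b := atTop) ?_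
    (.of_forall hT)
  have hmem := ae_mem_sector Θ
  have hw := fun i => Lp.memLp (w.1 i)
  have main : ∀ f : ℂ → ℂ, MemLp f 2 (sectorMeasure Θ) →
      Tendsto (fun n => eLpNorm (fun z => (vertexCut Θ n z - 1) * f z) 2 (sectorMeasure Θ))
        atTop (𝓝 0) := by
    intro f hf
    refine tendsto_eLpNorm_mul_zero hf (fun n =>
      ((isTest_vertexCut hΘ n).1.continuous.sub continuous_const).aestronglyMeasurable)
      (fun n z => norm_vertexCut_sub_one_le Θ n z) ?_
    filter_upwards [hmem] with z hz
    simpa using (tendsto_vertexCut hΘ hz).sub_const 1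
  obtain ⟨C, hC0, hC⟩ := exists_dirDeriv_vertexCut_bound hΘ
  have hder : ∀ e : ℂ, ‖e‖ = 1 → Tendsto (fun n => eLpNorm (fun z => dirDeriv e (vertexCut Θ n) z *
      w.1 0 z) 2 (sectorMeasure Θ)) atTop (𝓝 0) := by
    intro e he
    set H := ∫⁻ z in cone Θ 0 Θ (Ioi 0), invSq z * ‖fnOf w z‖ₑ ^ 2 ∂(sectorMeasure Θ)
    have hH : H < ⊤ := by
      refine (hardy_zero hΘ le_rfl le_rfl (⟨hΘ₀.le, le_rfl⟩ : Θ ∈ Icc 0 Θ) h1).trans_lt ?_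
      refine ENNReal.mul_lt_top (ENNReal.mul_lt_top (by simp) (by simp)) ?_
      exact (setLIntegral_le_lintegral _ _).trans_lt (lintegral_weakGradSq_lt_top w)
    let G1 : ℕ → ℝ≥0∞ := fun n => ∫⁻ z in cone Θ 0 (3 / (n + 1)) (Ioi 0), weakGradSq w z
      ∂(sectorMeasure Θ)
    let G2 : ℕ → ℝ≥0∞ := fun n => ∫⁻ z in cone Θ (Θ - 3 / (n + 1)) Θ (Ioi 0), weakGradSq w z
      ∂(sectorMeasure Θ)
    have t3 : Tendsto (fun n : ℕ => 3 / ((n : ℝ) + 1)) atTop (𝓝 0) :=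
      Tendsto.div_atTop tendsto_const_nhds (tendsto_atTop_add_const_right _ _
        tendsto_natCast_atTop_atTop)
    have t1 : Tendsto (fun n : ℕ => 1 / ((n : ℝ) + 1)) atTop (𝓝 0) :=
      tendsto_one_div_add_atTop_nhds_zero_nat
    have hG1 : Tendsto G1 atTop (𝓝 0) := by
      refine tendsto_lintegral_cone_zero w fun x => ?_
      by_cases hx : 0 < x
      · filter_upwards [t3.eventually_lt_const hx] with n hn hc
        exact absurd hc.2 (not_lt.mpr hn.le)
      · exact Eventually.of_forall fun n hc => hx hc.1
    have hG2 : Tendsto G2 atTop (𝓝 0) := by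
      refine tendsto_lintegral_cone_zero w fun x => ?_
      by_cases hx : x < Θ
      · filter_upwards [t3.eventually_lt_const (sub_pos.mpr hx)] with n hn hc
        have := hc.1
        linarith
      · exact Eventually.of_forall fun n hc => hx hc.2
    have hbound : Tendsto (fun n : ℕ => ENNReal.ofReal C * (ENNReal.ofReal (1 / (n + 1)) ^ (2 : ℝ) * H +
        36 * (G1 n + G2 n))) atTop (𝓝 0) := by
      have k1 := (ENNReal.tendsto_ofReal t1).ennrpow_const 2
      rw [ENNReal.ofReal_zero, ENNReal.zero_rpow_of_pos (by norm_num)] at k1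
      have k2 := ENNReal.Tendsto.mul_const (b := H) k1 (Or.inr hH.ne)
      have k3 := ENNReal.Tendsto.const_mul (a := 36) (hG1.add hG2) (Or.inr (by simp))
      have k4 := ENNReal.Tendsto.const_mul (a := ENNReal.ofReal C) (k2.add k3) (Or.inr (by simp))
      simpa using k4
    have hsq : Tendsto (fun n => ∫⁻ z, ‖dirDeriv e (vertexCut Θ n) z * w.1 0 z‖ₑ ^ 2
        ∂(sectorMeasure Θ)) atTop (𝓝 0) := by
      refine tendsto_of_tendsto_of_tendsto_of_le_of_le' tendsto_const_nhds hbound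
        (.of_forall fun _ => zero_le) ?_
      filter_upwards [t3.eventually_lt_const hΘ₀] with n hn
      have hn1 : (0 : ℝ) < n + 1 := by positivity
      set N : ℝ := n + 1
      have h3N : 0 < 3 / N := by positivity
      set φ : ℂ → ℝ≥0∞ := fun z => invSq z * ‖fnOf w z‖ₑ ^ 2
      have hφ : AEMeasurable φ (sectorMeasure Θ) := measurable_invSq.aemeasurable.mul
        ((hw 0).1.enorm.pow_const 2)
      have c0 := measurableSet_cone Θ 0 Θ (measurableSet_Ioi (a := (0 : ℝ)))
      have c1 := measurableSet_cone Θ 0 (3 / N) (measurableSet_Ioi (a := (0 : ℝ)))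
      have c2 := measurableSet_cone Θ (Θ - 3 / N) Θ (measurableSet_Ioi (a := (0 : ℝ)))
      have b1 := hardy_zero hΘ le_rfl hn.le (⟨le_rfl, h3N.le⟩ : (0 : ℝ) ∈ Icc 0 (3 / N)) h0
      have b2 := hardy_zero hΘ (sub_nonneg.mpr hn.le) le_rfl
        (⟨by linarith, le_rfl⟩ : Θ ∈ Icc (Θ - 3 / N) Θ) h1
      rw [sub_zero] at b1
      rw [sub_sub_cancel] at b2
      have hN9 : ∀ x : ℝ≥0∞, ENNReal.ofReal N ^ 2 * (4 * ENNReal.ofReal (3 / N) ^ 2 * x) = 36 * x := by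
        intro x
        rw [← mul_assoc, ← mul_assoc, mul_comm _ (4 : ℝ≥0∞), mul_assoc 4, ← mul_pow,
          ← ENNReal.ofReal_mul hn1.le, mul_div_cancel₀ _ hn1.ne']
        norm_num
      calc _ ≤ ∫⁻ z, ENNReal.ofReal C * (ENNReal.ofReal (1 / N) ^ 2 *
              (cone Θ 0 Θ (Ioi 0)).indicator φ z + ENNReal.ofReal N ^ 2 *
              ((cone Θ 0 (3 / N) (Ioi 0)).indicator φ z +
                (cone Θ (Θ - 3 / N) Θ (Ioi 0)).indicator φ z)) ∂(sectorMeasure Θ) := by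
            refine lintegral_mono_ae ?_
            filter_upwards [hmem] with z hz
            have hs := sector_subset_slit hΘ hz
            have hzc : z ∈ cone Θ 0 Θ (Ioi 0) := ⟨lg_mem_strip hΘ hz,
              norm_pos_iff.mpr (ne_zero_of_mem_slit hs)⟩
            have hind : ∀ A : Set ℂ, A.indicator φ z = φ z * A.indicator 1 z := by
              intro A
              by_cases hA : z ∈ A
              · rw [indicator_of_mem hA, indicator_of_mem hA, Pi.one_apply, mul_one]
              · rw [indicator_of_notMem hA, indicator_of_notMem hA, mul_zero]
            rw [enorm_mul, mul_pow, hind (cone Θ 0 (3 / N) (Ioi 0)),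
              hind (cone Θ (Θ - 3 / N) Θ (Ioi 0)), indicator_of_mem hzc]
            refine (mul_le_mul_left (hC n e he z hz) _).trans (le_of_eq ?_)
            simp only [φ, fnOf]
            ring
        _ = ENNReal.ofReal C * (ENNReal.ofReal (1 / N) ^ 2 * H + ENNReal.ofReal N ^ 2 *
              ((∫⁻ z in cone Θ 0 (3 / N) (Ioi 0), φ z ∂(sectorMeasure Θ)) +
                ∫⁻ z in cone Θ (Θ - 3 / N) Θ (Ioi 0), φ z ∂(sectorMeasure Θ))) := by
            rw [lintegral_const_mul' _ _ (by simp), lintegral_add_left'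
              ((hφ.indicator c0).const_mul _), lintegral_const_mul' _ _ (by simp),
              lintegral_const_mul' _ _ (by simp), lintegral_add_left' (hφ.indicator c1),
              lintegral_indicator c0, lintegral_indicator c1, lintegral_indicator c2]
        _ ≤ ENNReal.ofReal C * (ENNReal.ofReal (1 / N) ^ 2 * H + ENNReal.ofReal N ^ 2 *
              (4 * ENNReal.ofReal (3 / N) ^ 2 * G1 n + 4 * ENNReal.ofReal (3 / N) ^ 2 * G2 n)) := by
            gcongr
        _ = _ := by
            rw [mul_add (ENNReal.ofReal N ^ 2), hN9, hN9, ← mul_add, ENNReal.rpow_two]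
    have k := hsq.ennrpow_const (1 / 2 : ℝ)
    rw [ENNReal.zero_rpow_of_pos (by norm_num)] at k
    exact k.congr fun n => (eLpNorm_two_eq _ _).symm
  have hcomp : ∀ (e : ℂ), ‖e‖ = 1 → ∀ (i : Fin 3), (∀ n, T n i =ᵐ[sectorMeasure Θ]
      (fun z => vertexCut Θ n z * w.1 i z + dirDeriv e (vertexCut Θ n) z * w.1 0 z)) →
      Tendsto (fun n => T n i) atTop (𝓝 (w.1 i)) := by
    intro e he i hTi
    rw [Lp.tendsto_Lp_iff_tendsto_eLpNorm']
    have k := (main _ (hw i)).add (hder e he)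
    rw [add_zero] at k
    refine tendsto_of_tendsto_of_tendsto_of_le_of_le tendsto_const_nhds k (fun _ => zero_le)
      fun n => ?_
    have ht := (isTest_vertexCut hΘ n).1
    refine (le_of_eq (eLpNorm_congr_ae ?_)).trans (eLpNorm_add_le
      ((ht.continuous.sub continuous_const).aestronglyMeasurable.mul (hw i).1)
      ((ht.dirDeriv_continuous e).aestronglyMeasurable.mul (hw 0).1) (by norm_num))
    filter_upwards [hTi n] with z hz
    simp only [Pi.sub_apply, Pi.add_apply]
    rw [hz]
    ring
  rw [tendsto_L2Triple_iff]
  intro i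
  fin_cases i
  · change Tendsto (fun n => T n 0) atTop (𝓝 (w.1 0))
    rw [Lp.tendsto_Lp_iff_tendsto_eLpNorm']
    refine (main _ (hw 0)).congr fun n => eLpNorm_congr_ae ?_
    filter_upwards [hT0 n] with z hz
    simp only [Pi.sub_apply]
    rw [hz]
    ring
  · exact hcomp 1 (by simp) 1 hT1
  · exact hcomp Complex.I (by simp) 2 hT2

lemma H1.ext_fnOf {Θ : ℝ} {w w' : H1 Θ} (h : fnOf w =ᵐ[sectorMeasure Θ] fnOf w') : w = w' := by
  have key : ∀ (e : ℂ) (a b : Lp ℂ 2 (sectorMeasure Θ)),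
      IsWeakDeriv Θ e (fnOf w) a → IsWeakDeriv Θ e (fnOf w) b → a = b := by
    intro e a b ha hb
    have hloc : ∀ c : Lp ℂ 2 (sectorMeasure Θ), LocallyIntegrableOn c (sector Θ) volume := by
      intro c
      refine (locallyIntegrableOn_iff (isOpen_sector Θ).isLocallyClosed).mpr fun K hK hKc => ?_
      have : IsFiniteMeasure ((sectorMeasure Θ).restrict K) :=
        ⟨by rw [Measure.restrict_apply_univ]; exact hKc.measure_lt_top⟩
      have := ((Lp.memLp c).restrict K).integrable (by norm_num)
      rwa [Measure.restrict_restrict_of_subset hK] at this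
    have h0 : ∀ᵐ z, z ∈ sector Θ → (a - b : ℂ → ℂ) z = 0 := by
      refine IsOpen.ae_eq_zero_of_integral_contDiff_smul_eq_zero (isOpen_sector Θ)
        ((hloc a).sub (hloc b)) fun g hg hgc hgs => ?_
      have hv : IsTest Θ fun z => (g z : ℂ) :=
        ⟨⟨Complex.ofRealCLM.contDiff.comp hg, hgc.comp_left (g := Complex.ofReal) (by simp)⟩,
          (closure_mono fun z hz => by
            simpa [Function.mem_support] using hz).trans hgs⟩
      have h1 := (ha _ hv).symm.trans (hb _ hv)
      rw [neg_inj] at h1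
      have i1 : ∀ c : Lp ℂ 2 (sectorMeasure Θ),
          Integrable (fun z => c z * (g z : ℂ)) (sectorMeasure Θ) := fun c =>
        (Lp.memLp c).integrable_mul (hv.1.memLp Θ 2)
      have h2 : ∫ z, (a z * (g z : ℂ) - b z * (g z : ℂ)) ∂(sectorMeasure Θ) = 0 := by
        rw [integral_sub (i1 a) (i1 b), h1, sub_self]
      rw [← h2, ← setIntegral_eq_integral_of_forall_compl_eq_zero (s := sector Θ) fun z hz => ?_]
      · refine integral_congr_ae (.of_forall fun z => ?_)
        simp only [Pi.sub_apply, Complex.real_smul]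
        ring
      · have : g z = 0 := by
          by_contra hne
          exact hz (hgs (subset_tsupport _ hne))
        simp [this]
    rw [← ae_restrict_iff' (measurableSet_sector Θ)] at h0
    refine Lp.ext ?_
    filter_upwards [h0] with z hz using sub_eq_zero.mp hz
  have h' : w.1 0 = w'.1 0 := Lp.ext h
  exact H1.ext_ae h' (key 1 _ _ w.2.1 (w'.2.1.congr h .rfl))
    (key Complex.I _ _ w.2.2 (w'.2.2.congr h .rfl))

/-- `u = w + χ₀ ∑ f_d` on `Ω`, where `f_d` is homogeneous of degree `d` and only nonpositive degrees
occur. -/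
structure IsReduced (Θ : ℝ) (χ : ℂ → ℂ) (u : ℂ → ℂ) (w : H1 Θ) (f : ℝ →₀ (ℂ → ℂ)) : Prop where
  mem : ∀ d, f d ∈ singDeg Θ d
  pos : ∀ d, 0 < d → f d = 0
  ae : ∀ᵐ z ∂(sectorMeasure Θ), u z = fnOf w z + χ z * f.sum (fun _ x => x) z

lemma sum_mem_singSpace {Θ : ℝ} {f : ℝ →₀ (ℂ → ℂ)} (hf : ∀ d, f d ∈ singDeg Θ d) :
    f.sum (fun _ x => x) ∈ singSpace Θ :=
  Submodule.sum_mem _ fun d _ => singDeg_le_singSpace Θ d (hf d)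

lemma sum_sub_apply (f g : ℝ →₀ (ℂ → ℂ)) (z : ℂ) :
    (f - g).sum (fun _ x => x) z = f.sum (fun _ x => x) z - g.sum (fun _ x => x) z := by
  rw [Finsupp.sum_sub_index (fun _ _ _ => rfl)]; rfl

lemma fnOf_sub {Θ : ℝ} (w w' : H1 Θ) :
    fnOf (w - w') =ᵐ[sectorMeasure Θ] fun z => fnOf w z - fnOf w' z := Lp.coeFn_sub _ _

lemma fnOf_add {Θ : ℝ} (w w' : H1 Θ) :
    fnOf (w + w') =ᵐ[sectorMeasure Θ] fun z => fnOf w z + fnOf w' z := Lp.coeFn_add _ _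

lemma IsReduced.sub {Θ : ℝ} {χ u u' : ℂ → ℂ} {w w' : H1 Θ} {f f' : ℝ →₀ (ℂ → ℂ)}
    (h : IsReduced Θ χ u w f) (h' : IsReduced Θ χ u' w' f') :
    IsReduced Θ χ (u - u') (w - w') (f - f') := by
  refine ⟨fun d => Submodule.sub_mem _ (h.mem d) (h'.mem d), fun d hd => ?_, ?_⟩
  · rw [Finsupp.sub_apply, h.pos d hd, h'.pos d hd, sub_self]
  · filter_upwards [h.ae, h'.ae, fnOf_sub w w'] with z h1 h2 h3
    rw [Pi.sub_apply, h1, h2, h3, sum_sub_apply]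
    ring

lemma IsReduced.unique {Θ : ℝ} (hΘ₀ : 0 < Θ) (hΘ : Θ < 2 * Real.pi) {χ u : ℂ → ℂ}
    (hχ : ∀ᶠ z in 𝓝 0, χ z = 1) {w w' : H1 Θ} {f f' : ℝ →₀ (ℂ → ℂ)}
    (h : IsReduced Θ χ u w f) (h' : IsReduced Θ χ u w' f') :
    (∀ d, EqOn (f d) (f' d) (sector Θ)) ∧ w = w' := by
  have hs := h.sub h'
  have key : ∀ d, ∀ z ∈ sector Θ, (f - f') d z = 0 := by
    intro d z hz
    rcases le_or_gt d 0 with hd | hd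
    · refine singular_eq_zero_of_H1 hΘ₀ hΘ hχ hs.mem (w' - w) ?_ hd z hz
      filter_upwards [hs.ae, fnOf_sub w w', fnOf_sub w' w] with z h1 h2 h3
      rw [Pi.sub_apply, sub_self, h2] at h1
      rw [h3]
      linear_combination -h1
    · rw [hs.pos d hd]; rfl
  refine ⟨fun d z hz => sub_eq_zero.mp (key d z hz), H1.ext_fnOf ?_⟩
  filter_upwards [h.ae, h'.ae, ae_mem_sector Θ] with z h1 h2 hz
  have : (f - f').sum (fun _ x => x) z = 0 := by
    rw [sum_apply_eq]; exact Finset.sum_eq_zero fun d _ => key d z hz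
  rw [sum_sub_apply] at this
  rw [h1] at h2
  linear_combination h2 - χ z * this

lemma exists_isReduced {Θ : ℝ} (hΘ₀ : 0 < Θ) (hΘ : Θ < 2 * Real.pi) {χ : ℂ → ℂ}
    (hχ : IsSmoothCompact χ) {u : FunOn Θ} {w : H1 Θ} {ψ : ℂ → ℂ} (h : IsDecomp Θ χ u w ψ) :
    ∃ w' f, IsReduced Θ χ u w' f ∧ (∀ d < 0, sigma Θ d ψ = sigma Θ d (f d)) ∧
      ∀ θ t, θ = 0 ∨ θ = Θ → IsTrace Θ θ w t → ∃ t', IsTrace Θ θ w' t' ∧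
        ∀ r, t' r + χ (rayPoint θ r) * f.sum (fun _ x => x) (rayPoint θ r) =
          t r + χ (rayPoint θ r) * ψ (rayPoint θ r) := by
  classical
  obtain ⟨g, hg, rfl⟩ := exists_homogeneous_parts h.1
  obtain ⟨v, hv, hvt⟩ := exists_H1_of_sum_pos hΘ₀ hΘ hχ (g.support.filter (0 < ·))
    (fun d hd => (Finset.mem_filter.mp hd).2) hg
  have hsum : ∀ z, (g.filter (· ≤ 0)).sum (fun _ x => x) z +
      ∑ d ∈ g.support.filter (0 < ·), g d z = g.sum (fun _ x => x) z := by
    intro z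
    rw [sum_apply_eq, sum_apply_eq, Finsupp.support_filter,
      ← Finset.sum_filter_add_sum_filter_not g.support (· ≤ 0) fun d => g d z]
    simp only [not_le]
    congr 1
    refine Finset.sum_congr rfl fun d hd => ?_
    rw [Finsupp.filter_apply_pos (fun x : ℝ => x ≤ 0) _ (Finset.mem_filter.mp hd).2]
  refine ⟨w + v, g.filter (· ≤ 0), ⟨fun d => ?_, fun d hd => ?_, ?_⟩, fun d hd => ?_,
    fun θ t hθ ht => ⟨_, ht.add (hvt θ hθ), fun r => ?_⟩⟩
  · rw [Finsupp.filter_apply]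
    split_ifs
    · exact hg d
    · exact Submodule.zero_mem _
  · exact Finsupp.filter_apply_neg (fun x : ℝ => x ≤ 0) _ (not_le.mpr hd)
  · filter_upwards [h.2, hv, fnOf_add w v] with z h1 h2 h3
    rw [h1, h3, h2, ← hsum z]
    ring
  · rw [Finsupp.filter_apply_pos (fun x : ℝ => x ≤ 0) _ hd.le, Finsupp.sum,
      sigma_sum hΘ₀ hΘ hd _ _ fun i _ => singDeg_le_singSpace Θ i (hg i),
      Finset.sum_eq_single d (fun i _ hi => sigma_eq_zero_of_mem_singDeg hΘ₀ hΘ hd hi (hg i))]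
    intro hnot
    rw [Finsupp.notMem_support_iff.mp hnot, sigma_zero hΘ₀ hΘ hd]
  · rw [Pi.add_apply, ← hsum]
    ring

lemma farSigma_eq {Θ d : ℝ} (hΘ₀ : 0 < Θ) (hΘ : Θ < 2 * Real.pi) (hd : d < 0) {χ : ℂ → ℂ}
    (hχ : IsCutoff χ) {u : FunOn Θ} {w : H1 Θ} {ψ : ℂ → ℂ} (h : IsDecomp Θ χ u w ψ) :
    farSigma Θ χ d u = sigma Θ d ψ := by
  have hex : ∃ ψ w, IsDecomp Θ χ u w ψ := ⟨ψ, w, h⟩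
  rw [farSigma, dif_pos hex]
  obtain ⟨w', hw'⟩ := hex.choose_spec
  obtain ⟨v, f, hf, hs, -⟩ := exists_isReduced hΘ₀ hΘ hχ.isSmoothCompact h
  obtain ⟨v', f', hf', hs', -⟩ := exists_isReduced hΘ₀ hΘ hχ.isSmoothCompact hw'
  rw [hs d hd, hs' d hd]
  exact sigma_congr hΘ₀ hΘ hd (singDeg_le_singSpace Θ d (hf'.mem d))
    (singDeg_le_singSpace Θ d (hf.mem d)) ((hf'.unique hΘ₀ hΘ hχ.one_near_zero hf).1 d)

lemma continuousOn_laplacian {g : ℂ → ℂ} {Θ : ℝ}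
    (hg : ∀ z ∈ sector Θ, ContDiffAt ℝ (⊤ : ℕ∞) g z) :
    ContinuousOn (Laplacian.laplacian g) (sector Θ) := by
  have h : ContinuousOn (fun z => dirDeriv 1 (dirDeriv 1 g) z +
      dirDeriv Complex.I (dirDeriv Complex.I g) z) (sector Θ) := fun z hz =>
    ((contDiffAt_dirDeriv (contDiffAt_dirDeriv (hg z hz) 1) 1).continuousAt.add
      (contDiffAt_dirDeriv (contDiffAt_dirDeriv (hg z hz) Complex.I) Complex.I).continuousAt
      ).continuousWithinAt
  exact h.congr fun z hz => laplacian_eq_dirDeriv ((hg z hz).of_le (WithTop.coe_le_coe.mpr (le_top : (2 : ℕ∞) ≤ ⊤)))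

lemma apply_ray_eq_zero {Θ : ℝ} (hΘ₀ : 0 < Θ) (hΘ : Θ < 2 * Real.pi) {χ : ℂ → ℂ}
    (hχ : ∀ᶠ z in 𝓝 0, χ z = 1) {f : ℝ →₀ (ℂ → ℂ)} (hf : ∀ d, f d ∈ singDeg Θ d) {w : H1 Θ}
    (h1 : IsTrace Θ Θ w 0)
    (h0 : IsTrace Θ 0 w fun r => -(χ (rayPoint 0 r) * f.sum (fun _ x => x) (rayPoint 0 r)))
    {d : ℝ} (hd : d ≤ 0) {r : ℝ} (hr : 0 < r) : f d (rayPoint 0 r) = 0 := by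
  classical
  choose N a ha using fun d => hasLogExpansion_of_mem (hf d)
  let P : ℝ → ℂ[X] := fun d => ∑ j ∈ Finset.range (N d), X ^ j * C (a d j 0)
  have hP : ∀ d s, f d (rayPoint 0 (Real.exp s)) = (Real.exp (d * s) : ℂ) * (P d).eval (s : ℂ) := by
    intro d s
    rw [rayPoint_exp, (ha d).eq _ (by simp) (by simpa using Real.two_pi_pos)]
    simp [P, eval_finsetSum]
    exact Finset.sum_congr rfl fun _ _ => mul_comm _ _
  have hfin := lintegral_trace_inv_lt_top hΘ₀ hΘ h1 h0
  rw [lintegral_ray] at hfin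
  have hlim : Tendsto (fun s : ℝ => rayPoint 0 (Real.exp s)) atBot (𝓝 0) := by
    have : Tendsto (fun s : ℝ => ((Real.exp s : ℝ) : ℂ)) atBot (𝓝 ((0 : ℝ) : ℂ)) :=
      (Complex.continuous_ofReal.tendsto 0).comp Real.tendsto_exp_atBot
    simpa [rayPoint] using this
  obtain ⟨b, hb⟩ := eventually_atBot.mp (hlim.eventually hχ)
  let p : ℝ →₀ ℂ[X] := ∑ d ∈ f.support, Finsupp.single d (P d)
  have hp : ∀ s, expPoly p s = f.sum (fun _ x => x) (rayPoint 0 (Real.exp s)) := by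
    intro s
    rw [expPoly_sum_single, sum_apply_eq]
    exact Finset.sum_congr rfl fun d _ => (hP d s).symm
  have h2 : ∫⁻ x in Iio b, ‖expPoly p x‖ₑ ^ 2 < ⊤ := by
    refine lt_of_le_of_lt ?_ hfin
    refine (setLIntegral_mono' measurableSet_Iio fun s hs => ?_).trans (setLIntegral_le_lintegral _ _)
    rw [hb s hs.le, one_mul, enorm_neg, hp, ← mul_assoc, ← ENNReal.ofReal_mul (Real.exp_pos s).le,
      mul_inv_cancel₀ (Real.exp_ne_zero s), ENNReal.ofReal_one, one_mul]
  have h3 := expPoly_apply_eq_zero_of_lintegral h2 hd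
  by_cases hdf : d ∈ f.support
  · have : p d = P d := by
      simp [p, Finsupp.finsetSum_apply, Finsupp.single_apply, hdf] 
    rw [← Real.exp_log hr, hP, ← this, h3]
    simp
  · rw [Finsupp.notMem_support_iff.mp hdf]; rfl

lemma IsReduced.eq_zero {Θ μ₀ ρ₀ : ℝ} (hΘ₀ : 0 < Θ) (hΘ : Θ < 2 * Real.pi) (hμ₀ : 0 < μ₀)
    (hρ₀ : 0 < ρ₀) {ω : ℂ} (hω : ω.im ≠ 0) {χ u : ℂ → ℂ} (hχ : IsCutoff χ) {w : H1 Θ}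
    {f : ℝ →₀ (ℂ → ℂ)} (h : IsReduced Θ χ u w f) {t : ℝ → ℂ} (ht : IsTrace Θ 0 w t)
    (ht' : ∀ᵐ r ∂rayMeasure, t r + χ (rayPoint 0 r) * f.sum (fun _ x => x) (rayPoint 0 r) = 0)
    (h1 : IsTrace Θ Θ w 0)
    (hσ : ∀ n : ℕ+, sigma Θ (-(Real.pi / Θ) * (n : ℝ)) (f (-(Real.pi / Θ) * (n : ℝ))) = 0)
    (hu : ∀ v, IsTest Θ v →
      ∫ z, u z * (μ₀ * Laplacian.laplacian v z + ω ^ 2 * ρ₀ * v z) ∂(sectorMeasure Θ) = 0) :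
    u =ᵐ[sectorMeasure Θ] 0 := by
  classical
  have hχc := hχ.isSmoothCompact
  have h0 := ht.congr (t' := fun r => -(χ (rayPoint 0 r) * f.sum (fun _ x => x) (rayPoint 0 r)))
    (by filter_upwards [ht'] with r hr using eq_neg_of_add_eq_zero_left hr)
  have hray : ∀ d, ∀ r, 0 < r → f d (rayPoint 0 r) = 0 := by
    intro d r hr
    rcases le_or_gt d 0 with hd | hd
    · exact apply_ray_eq_zero hΘ₀ hΘ hχ.one_near_zero h.mem h1 h0 hd hr
    · rw [h.pos d hd]; rfl
  have hcont : ContinuousOn (fun z => χ z * f.sum (fun _ x => x) z) (sector Θ) :=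
    hχc.continuous.continuousOn.mul (singSpace_continuousOn hΘ (sum_mem_singSpace h.mem))
  have hu' : ∀ v, IsTest Θ v → ∫ z, (fnOf w z + χ z * f.sum (fun _ x => x) z) *
      (μ₀ * Laplacian.laplacian v z + ω ^ 2 * ρ₀ * v z) ∂(sectorMeasure Θ) = 0 := by
    intro v hv
    rw [← hu v hv]
    refine integral_congr_ae ?_
    filter_upwards [h.ae] with z hz
    rw [hz]
  have hzero : ∀ d, ∀ z ∈ sector Θ, f d z = 0 := by
    by_contra! hcon
    obtain ⟨d₁, z₁, hz₁, hne₁⟩ := hcon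
    let B := f.support.filter fun d => ∃ z ∈ sector Θ, f d z ≠ 0
    have hB : ∀ d, (∃ z ∈ sector Θ, f d z ≠ 0) → d ∈ B := fun d hd =>
      Finset.mem_filter.mpr ⟨Finsupp.mem_support_iff.mpr fun h0 => by
        obtain ⟨z, -, hz⟩ := hd; exact hz (by rw [h0]; rfl), hd⟩
    have hBne : B.Nonempty := ⟨d₁, hB _ ⟨z₁, hz₁, hne₁⟩⟩
    obtain ⟨z, hz, hne⟩ := (Finset.mem_filter.mp (B.min'_mem hBne)).2
    set d := B.min' hBne
    have hd : d ≤ 0 := by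
      by_contra hd
      exact hne (by rw [h.pos d (not_le.mp hd)]; rfl)
    have hlow : ∀ z ∈ sector Θ, f (d - 2) z = 0 := by
      by_contra! hc
      have := B.min'_le _ (hB _ hc)
      linarith
    have hsm : ∀ z ∈ sector Θ, ContDiffAt ℝ (⊤ : ℕ∞) (f d) z := fun z hz =>
      singDeg_contDiffAt hΘ (h.mem d) hz
    have hΔ : ∀ z ∈ sector Θ, Laplacian.laplacian (f d) z = 0 :=
      eqOn_zero_of_integral_test (continuousOn_laplacian hsm) fun v hv => by
        rw [← integral_mul_laplacian_test hv hsm]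
        exact integral_laplacian_eq_zero_of_solves hΘ hμ₀ hχ.one_near_zero h.mem w
          (fun v hv => (hv.integrable_mul hcont).restrict) hu' hd hlow hv
    exact hne (eqOn_zero_of_harmonic hΘ₀ hΘ hd (h.mem d) hΔ (hray d)
      (fun n hn => by have := hσ n; rwa [← hn] at this) z hz)
  have hsum0 : ∀ z ∈ sector Θ, f.sum (fun _ x => x) z = 0 := fun z hz => by
    rw [sum_apply_eq]; exact Finset.sum_eq_zero fun d _ => hzero d z hz
  have h0' : IsTrace Θ 0 w 0 := h0.congr (by
    filter_upwards [ae_restrict_mem measurableSet_Ioi] with r hr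
    rw [sum_apply_eq, Finset.sum_eq_zero fun d _ => hray d r hr]
    simp)
  have hw : w.1 = 0 := weak_solution_unique hμ₀ hρ₀ hω (mem_H10_of_trace_zero hΘ₀ hΘ h0' h1)
    fun v hv => by
      rw [← integral_helmholtz_eq w hv, ← hu' v hv]
      refine integral_congr_ae ?_
      filter_upwards [ae_mem_sector Θ] with z hz
      rw [hsum0 z hz, mul_zero, add_zero]
      rfl
  have hw0 : fnOf w =ᵐ[sectorMeasure Θ] 0 := by
    have : w = 0 := Subtype.ext hw
    rw [this]
    exact Lp.coeFn_zero _ _ _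
  filter_upwards [h.ae, hw0, ae_mem_sector Θ] with z h1 h2 hz
  rw [h1, h2, hsum0 z hz]
  simp

/-- The boundary values and the singular coefficients of a solution in a reduced decomposition. -/
lemma exists_isReduced_of_bdryValue {Θ : ℝ} (hΘ₀ : 0 < Θ) (hΘ : Θ < 2 * Real.pi) {χ : ℂ → ℂ}
    (hχ : IsCutoff χ) {u : FunOn Θ} {g : ℝ → ℂ} (h0 : HasBdryValue Θ χ 0 u g)
    (h1 : HasBdryValue Θ χ Θ u 0) :
    ∃ w f t, IsReduced Θ χ u w f ∧ IsTrace Θ 0 w t ∧ IsTrace Θ Θ w 0 ∧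
      (∀ᵐ r ∂rayMeasure, t r + χ (rayPoint 0 r) * f.sum (fun _ x => x) (rayPoint 0 r) = g r) ∧
      ∀ d < 0, farSigma Θ χ d u = sigma Θ d (f d) := by
  obtain ⟨w₀, ψ₀, t₀, hd₀, ht₀, hg₀⟩ := h0
  obtain ⟨w₁, ψ₁, t₁, hd₁, ht₁, hg₁⟩ := h1
  obtain ⟨v₀, f₀, hf₀, hs₀, hr₀⟩ := exists_isReduced hΘ₀ hΘ hχ.isSmoothCompact hd₀
  obtain ⟨v₁, f₁, hf₁, -, hr₁⟩ := exists_isReduced hΘ₀ hΘ hχ.isSmoothCompact hd₁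
  obtain ⟨s₀, hs0, he₀⟩ := hr₀ 0 t₀ (.inl rfl) ht₀
  obtain ⟨s₁, hs1, he₁⟩ := hr₁ Θ t₁ (.inr rfl) ht₁
  refine ⟨v₀, f₀, s₀, hf₀, hs0, ?_, ?_, fun d hd => ?_⟩
  · rw [(hf₀.unique hΘ₀ hΘ hχ.one_near_zero hf₁).2]
    refine hs1.congr ?_
    filter_upwards [hg₁, ae_restrict_mem measurableSet_Ioi] with r hr hr0
    rw [← he₁, singSpace_rayPoint_top hΘ₀ hΘ (sum_mem_singSpace hf₁.mem) hr0] at hr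
    simpa using hr
  · filter_upwards [hg₀] with r hr
    rw [he₀, hr]
  · rw [farSigma_eq hΘ₀ hΘ hd hχ hd₀, hs₀ d hd]

lemma neg_pi_div_mul_neg {Θ : ℝ} (hΘ₀ : 0 < Θ) (n : ℕ+) : -(Real.pi / Θ) * (n : ℝ) < 0 := by
  have : 0 < Real.pi / Θ * (n : ℝ) :=
    mul_pos (div_pos Real.pi_pos hΘ₀) (Nat.cast_pos.mpr n.pos)
  linarith

lemma integrable_helmholtz {Θ : ℝ} (hΘ : Θ < 2 * Real.pi) {χ : ℂ → ℂ} (hχ : IsCutoff χ) (w : H1 Θ)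
    {ψ : ℂ → ℂ} (hψ : ψ ∈ singSpace Θ) (a b : ℂ) {v : ℂ → ℂ} (hv : IsTest Θ v) :
    Integrable (fun z => fnOf w z * (a * Laplacian.laplacian v z + b * v z)) (sectorMeasure Θ) ∧
      Integrable (fun z => χ z * ψ z * (a * Laplacian.laplacian v z + b * v z))
        (sectorMeasure Θ) := by
  have hv' : IsTest Θ ((a • Laplacian.laplacian v) + b • v) :=
    ((isTest_laplacian hv).smul _).add (hv.smul _)
  exact ⟨(Lp.memLp (w.1 0)).integrable_mul (hv'.1.memLp Θ 2),
    (hv'.integrable_mul (hχ.isSmoothCompact.continuous.continuousOn.mul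
      (singSpace_continuousOn hΘ hψ))).restrict⟩

theorem solution_unique {Θ μ₀ ρ₀ : ℝ} (hΘ₀ : 0 < Θ) (hΘ : Θ < 2 * Real.pi) (hμ₀ : 0 < μ₀)
    (hρ₀ : 0 < ρ₀) {ω : ℂ} (hω : ω.im ≠ 0) {χ : ℂ → ℂ} (hχ : IsCutoff χ)
    {F : StrongDual ℂ (H1 Θ)} {g : ℝ → ℂ} {u u' : FunOn Θ}
    (hu : SolvesHelmholtz Θ μ₀ ρ₀ ω F u) (hu' : SolvesHelmholtz Θ μ₀ ρ₀ ω F u')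
    (h0 : HasBdryValue Θ χ 0 u g) (h0' : HasBdryValue Θ χ 0 u' g)
    (h1 : HasBdryValue Θ χ Θ u 0) (h1' : HasBdryValue Θ χ Θ u' 0)
    (hσ : ∀ n : ℕ+, farSigma Θ χ (-(Real.pi / Θ) * (n : ℝ)) u =
      farSigma Θ χ (-(Real.pi / Θ) * (n : ℝ)) u') : u = u' := by
  obtain ⟨w, f, t, hf, ht, ht1, hg, hs⟩ := exists_isReduced_of_bdryValue hΘ₀ hΘ hχ h0 h1
  obtain ⟨w', f', t', hf', ht', ht1', hg', hs'⟩ := exists_isReduced_of_bdryValue hΘ₀ hΘ hχ h0' h1'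
  have hint : ∀ (u : FunOn Θ) (w : H1 Θ) (f : ℝ →₀ (ℂ → ℂ)), IsReduced Θ χ u w f → ∀ v, IsTest Θ v →
      Integrable (fun z => u z * (μ₀ * Laplacian.laplacian v z + ω ^ 2 * ρ₀ * v z))
        (sectorMeasure Θ) := by
    intro u w f hf v hv
    obtain ⟨i1, i2⟩ := integrable_helmholtz hΘ hχ w (sum_mem_singSpace hf.mem) μ₀ (ω ^ 2 * ρ₀) hv
    refine (i1.add i2).congr ?_
    filter_upwards [hf.ae] with z hz
    rw [Pi.add_apply, hz]
    ring
  have h := (hf.sub hf').eq_zero hΘ₀ hΘ hμ₀ hρ₀ hω hχ (ht.sub ht') (by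
      filter_upwards [hg, hg'] with r hr hr'
      rw [sum_sub_apply, Pi.sub_apply]
      linear_combination hr - hr') (by simpa using ht1.sub ht1')
    (fun n => by
      have hn := neg_pi_div_mul_neg hΘ₀ n
      have := hσ n
      rw [hs _ hn, hs' _ hn] at this
      rw [Finsupp.sub_apply, sigma_sub hΘ₀ hΘ hn (singDeg_le_singSpace _ _ (hf.mem _))
        (singDeg_le_singSpace _ _ (hf'.mem _)), this, sub_self])
    (fun v hv => by
      simp only [Pi.sub_apply, sub_mul]
      rw [integral_sub (hint u w f hf v hv) (hint u' w' f' hf' v hv), hu v hv, hu' v hv, sub_self])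
  refine AEEqFun.ext ?_
  filter_upwards [h] with z hz using sub_eq_zero.mp hz

/-! ### Solving with homogeneous singular functions -/

/-- `Im (c F conj G)`. -/
def imMul (c : ℂ) (F G : ℂ → ℂ) (ζ : ℂ) : ℂ := ((c * F ζ * starRingEnd ℂ (G ζ)).im : ℂ)

lemma contDiff_imMul (c : ℂ) {F G : ℂ → ℂ} (hF : Differentiable ℂ F) (hG : Differentiable ℂ G) :
    ContDiff ℝ (⊤ : ℕ∞) (imMul c F G) := by
  have h : ∀ H : ℂ → ℂ, Differentiable ℂ H → ContDiff ℝ (⊤ : ℕ∞) H := fun H hH =>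
    (hH.contDiff (n := (⊤ : ℕ∞))).restrict_scalars ℝ
  exact Complex.ofRealCLM.contDiff.comp (Complex.imCLM.contDiff.comp
    ((contDiff_const.mul (h F hF)).mul (Complex.conjCLE.contDiff.comp (h G hG))))

lemma dirDeriv_imMul (c e : ℂ) {F G : ℂ → ℂ} (hF : Differentiable ℂ F) (hG : Differentiable ℂ G) :
    dirDeriv e (imMul c F G) =
      imMul (c * e) (deriv F) G + imMul (c * starRingEnd ℂ e) F (deriv G) := by
  funext ζ
  have h := (dirDeriv_eq_deriv_line (e := e)
    ((contDiff_imMul c hF hG).differentiable (by simp) ζ))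
  have hl : HasDerivAt (fun t : ℝ => ζ + t * e) e 0 := by
    simpa using ((Complex.ofRealCLM.hasDerivAt (x := (0 : ℝ))).mul_const e).const_add ζ
  have hl' : ∀ H : ℂ → ℂ, Differentiable ℂ H →
      HasDerivAt (fun t : ℝ => H (ζ + t * e)) (deriv H ζ * e) 0 := fun H hH => by
    have := (hH (ζ + (0 : ℝ) * e)).hasDerivAt.scomp (0 : ℝ) hl
    exact this.congr_deriv (by simp [mul_comm])
  have h2 : HasDerivAt (fun t : ℝ => imMul c F G (ζ + t * e))
      (((c * (deriv F ζ * e) * starRingEnd ℂ (G ζ) +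
        c * F ζ * starRingEnd ℂ (deriv G ζ * e)).im : ℝ) : ℂ) 0 := by
    have hm := (((hl' F hF).const_mul c).mul (hl' G hG).star)
    have := (Complex.ofRealCLM.hasFDerivAt.comp_hasDerivAt (0 : ℝ)
      (Complex.imCLM.hasFDerivAt.comp_hasDerivAt (0 : ℝ) hm))
    exact this.congr_deriv (by simp)
  rw [h.unique h2]
  simp only [imMul, Pi.add_apply, ← Complex.ofReal_add, ← Complex.add_im, map_mul]
  congr 2
  ring

lemma laplacian_imMul {F G : ℂ → ℂ} (hF : Differentiable ℂ F) (hG : Differentiable ℂ G) :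
    Laplacian.laplacian (imMul 1 F G) = imMul 4 (deriv F) (deriv G) := by
  funext ζ
  have hs : ∀ (c : ℂ) {A B : ℂ → ℂ}, Differentiable ℂ A → Differentiable ℂ B →
      DifferentiableAt ℝ (imMul c A B) ζ := fun c A B hA hB =>
    (contDiff_imMul c hA hB).differentiable (by simp) ζ
  have hF' := hF.deriv
  have hG' := hG.deriv
  rw [laplacian_eq_dirDeriv ((contDiff_imMul 1 hF hG).contDiffAt.of_le
    (WithTop.coe_le_coe.mpr (le_top : (2 : ℕ∞) ≤ ⊤)))]
  simp only [dirDeriv_imMul 1 _ hF hG]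
  rw [dirDeriv_add (hs _ hF' hG) (hs _ hF hG'), dirDeriv_add (hs _ hF' hG) (hs _ hF hG'),
    dirDeriv_imMul _ _ hF' hG, dirDeriv_imMul _ _ hF hG', dirDeriv_imMul _ _ hF' hG,
    dirDeriv_imMul _ _ hF hG']
  simp only [imMul, Pi.add_apply, ← Complex.ofReal_add, ← Complex.add_im]
  congr 2
  simp only [map_one, Complex.conj_I]
  linear_combination (deriv (deriv F) ζ * starRingEnd ℂ (G ζ) +
    F ζ * starRingEnd ℂ (deriv (deriv G) ζ) - 2 * deriv F ζ * starRingEnd ℂ (deriv G ζ)) *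
    Complex.I_mul_I

lemma singStrip_eq_imMul (Θ q : ℝ) (k : ℕ) (P : ℝ[X]) :
    singStrip Θ q k P = imMul 1
      (fun ζ => Complex.exp (q * (ζ - Θ * Complex.I)) * aeval (ζ - Θ * Complex.I) P)
      (fun ζ => Complex.exp (k * (ζ - Θ * Complex.I))) := by
  funext ζ
  simp only [singStrip, imMul, ← Complex.exp_conj, map_mul, Complex.exp_add, map_natCast]
  congr 2
  ring

lemma laplacian_sing {Θ : ℝ} (hΘ : Θ < 2 * Real.pi) (q : ℝ) (k : ℕ) (P : ℝ[X]) {z : ℂ}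
    (hz : z ∈ sector Θ) :
    Laplacian.laplacian (sing Θ q k P) z =
      (4 * k : ℝ) * sing Θ (q - 1) (k - 1) (C q * P + derivative P) z := by
  have hF : ∀ ζ, HasDerivAt
      (fun ζ => Complex.exp (q * (ζ - Θ * Complex.I)) * aeval (ζ - Θ * Complex.I) P)
      (Complex.exp (q * (ζ - Θ * Complex.I)) *
        aeval (ζ - Θ * Complex.I) (C q * P + derivative P)) ζ := by
    intro ζ
    have h1 := (hasDerivAt_id ζ).sub_const (Θ * Complex.I)
    have h2 := (P.hasDerivAt_aeval (ζ - Θ * Complex.I)).comp ζ h1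
    refine ((h1.const_mul (q : ℂ)).cexp.mul h2).congr_deriv ?_
    simp
    ring
  have hG : ∀ ζ, HasDerivAt (fun ζ => Complex.exp (k * (ζ - Θ * Complex.I)))
      (k * Complex.exp (k * (ζ - Θ * Complex.I))) ζ := by
    intro ζ
    refine (((hasDerivAt_id ζ).sub_const (Θ * Complex.I)).const_mul (k : ℂ)).cexp.congr_deriv ?_
    simp
    ring
  have hs : ContDiff ℝ (⊤ : ℕ∞) (singStrip Θ q k P) := by
    rw [singStrip_eq_imMul]
    exact contDiff_imMul 1 (fun ζ => (hF ζ).differentiableAt) fun ζ => (hG ζ).differentiableAt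
  have hev : sing Θ q k P =ᶠ[𝓝 z] fun z => singStrip Θ q k P (lg Θ z) := by
    filter_upwards [(isOpen_sector Θ).mem_nhds hz] with w hw
    have h := lg_mem_strip hΘ hw
    rw [← sing_exp h.1.le (h.2.trans hΘ),
      exp_lg Θ (ne_zero_of_mem_slit (sector_subset_slit hΘ hw))]
  have h := lg_mem_strip hΘ hz
  have hz' := exp_lg Θ (ne_zero_of_mem_slit (sector_subset_slit hΘ hz))
  rw [InnerProductSpace.laplacian_congr_nhds hev |>.eq_of_nhds,
    laplacian_comp_lg (sector_subset_slit hΘ hz) hs, singStrip_eq_imMul,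
    laplacian_imMul (fun ζ => (hF ζ).differentiableAt) fun ζ => (hG ζ).differentiableAt]
  set ζ := lg Θ z
  rw [← hz', sing_exp h.1.le (h.2.trans hΘ), singStrip, imMul, (hF ζ).deriv, (hG ζ).deriv,
    ← Complex.exp_neg, Complex.norm_exp, ← Real.exp_nat_mul, ← Complex.ofReal_mul,
    ← Complex.ofReal_mul]
  congr 1
  rw [← Complex.im_ofReal_mul, ← Complex.im_ofReal_mul]
  rcases Nat.eq_zero_or_pos k with rfl | hk
  · simp
  congr 1
  obtain ⟨m, rfl⟩ := Nat.exists_eq_succ_of_ne_zero hk.ne'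
  have e1 : (Real.exp (((2 : ℕ) : ℝ) * (-ζ).re) : ℂ) = Complex.exp (-(ζ - Θ * Complex.I) +
      -starRingEnd ℂ (ζ - Θ * Complex.I)) := by
    rw [Complex.ofReal_exp]
    congr 1
    apply Complex.ext <;> simp <;> ring
  rw [e1, map_mul, ← Complex.exp_conj]
  simp only [map_mul, map_natCast, Nat.succ_sub_one]
  have e2 : ∀ a b : ℂ, Complex.exp (-a + -b) * (4 * Complex.exp (q * a) *
      (((m : ℂ) + 1) * Complex.exp (((m : ℂ) + 1) * b))) =
      4 * ((m : ℂ) + 1) * Complex.exp ((q - 1) * a + m * b) := by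
    intro a b
    have : (q - 1) * a + m * b = (-a + -b) + (q * a + ((m : ℂ) + 1) * b) := by ring
    rw [this, Complex.exp_add (-a + -b), Complex.exp_add (q * a)]
    ring
  have := e2 (ζ - Θ * Complex.I) (starRingEnd ℂ (ζ - Θ * Complex.I))
  push_cast
  linear_combination (aeval (ζ - Θ * Complex.I) (C q * P + derivative P)) * this

lemma exists_polynomial_mul_add_derivative (q : ℝ) (R : ℝ[X]) :
    ∃ P : ℝ[X], C q * P + derivative P = R := by
  by_cases hq : q = 0
  · subst hq
    induction R using Polynomial.induction_on' with
    | add a b ha hb =>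
      obtain ⟨A, rfl⟩ := ha
      obtain ⟨B, rfl⟩ := hb
      exact ⟨A + B, by simp⟩
    | monomial n c =>
      refine ⟨monomial (n + 1) (c / (n + 1)), ?_⟩
      have : (n : ℝ) + 1 ≠ 0 := by positivity
      simp [this]
  · have key : ∀ (n : ℕ) (R : ℝ[X]), R.natDegree < n → ∃ P : ℝ[X], C q * P + derivative P = R := by
      intro n
      induction n with
      | zero => intro R hR; omega
      | succ n ih =>
        intro R hR
        have hC : C q * C q⁻¹ = (1 : ℝ[X]) := by rw [← C_mul, mul_inv_cancel₀ hq, C_1]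
        by_cases h0 : R.natDegree = 0
        · obtain ⟨c, rfl⟩ := natDegree_eq_zero.mp h0
          refine ⟨C q⁻¹ * C c, ?_⟩
          rw [derivative_mul, derivative_C, derivative_C]
          linear_combination C c * hC
        · obtain ⟨P, hP⟩ := ih (derivative R)
            ((natDegree_derivative_lt h0).trans_le (Nat.lt_succ_iff.mp hR))
          refine ⟨C q⁻¹ * (R - P), ?_⟩
          rw [derivative_mul, derivative_C, zero_mul, zero_add, derivative_sub, ← hP]
          linear_combination R * hC
    exact key _ R (Nat.lt_succ_self _)

lemma two_le_infty : (2 : WithTop ℕ∞) ≤ ((⊤ : ℕ∞) : WithTop ℕ∞) :=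
  WithTop.coe_le_coe.mpr (le_top : (2 : ℕ∞) ≤ ⊤)

lemma laplacian_add_singSpace {Θ : ℝ} (hΘ : Θ < 2 * Real.pi) {φ ψ : ℂ → ℂ}
    (hφ : φ ∈ singSpace Θ) (hψ : ψ ∈ singSpace Θ) {z : ℂ} (hz : z ∈ sector Θ) :
    Laplacian.laplacian (φ + ψ) z = Laplacian.laplacian φ z + Laplacian.laplacian ψ z :=
  ((singSpace_contDiffAt hΘ hφ hz).of_le two_le_infty).laplacian_add
    ((singSpace_contDiffAt hΘ hψ hz).of_le two_le_infty)

lemma laplacian_smul_singSpace {Θ : ℝ} (hΘ : Θ < 2 * Real.pi) (a : ℂ) {φ : ℂ → ℂ}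
    (hφ : φ ∈ singSpace Θ) {z : ℂ} (hz : z ∈ sector Θ) :
    Laplacian.laplacian (a • φ) z = a * Laplacian.laplacian φ z :=
  InnerProductSpace.laplacian_smul a ((singSpace_contDiffAt hΘ hφ hz).of_le two_le_infty)

lemma laplacian_zero_apply (z : ℂ) : Laplacian.laplacian (0 : ℂ → ℂ) z = 0 := by
  have := InnerProductSpace.laplacian_smul (0 : ℂ) (f := (0 : ℂ → ℂ)) (x := z) contDiffAt_const
  simpa using this

lemma exists_laplacian_eq {Θ d : ℝ} (hΘ₀ : 0 < Θ) (hΘ : Θ < 2 * Real.pi) {R : ℂ → ℂ}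
    (hR : R ∈ singDeg Θ d) : ∃ ψ ∈ singDeg Θ (d + 2),
      (∀ z ∈ sector Θ, Laplacian.laplacian ψ z = R z) ∧ ∀ e < 0, sigma Θ e ψ = 0 := by
  have hle := singDeg_le_singSpace Θ (d + 2)
  induction hR using Submodule.span_induction with
  | mem R h =>
    obtain ⟨q, k, P, rfl, rfl⟩ := h
    obtain ⟨Q, rfl⟩ := exists_polynomial_mul_add_derivative (q + 1) P
    have hmem : sing Θ (q + 1) (k + 1) Q ∈ singDeg Θ (q + k + 2) :=
      sing_mem_singDeg (by push_cast; ring)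
    refine ⟨((4 * (k + 1 : ℝ) : ℝ) : ℂ)⁻¹ • sing Θ (q + 1) (k + 1) Q,
      Submodule.smul_mem _ _ hmem, fun z hz => ?_, fun e he => ?_⟩
    · rw [laplacian_smul_singSpace hΘ _ (hle hmem) hz, laplacian_sing hΘ _ _ _ hz,
        Nat.add_sub_cancel, add_sub_cancel_right, Nat.cast_succ, inv_mul_cancel_left₀]
      exact_mod_cast (by positivity : (4 * ((k : ℝ) + 1)) ≠ 0)
    · rw [sigma_smul hΘ₀ hΘ he _ (hle hmem), sigma_sing hΘ₀ hΘ he, if_neg (by simp), mul_zero]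
  | zero => exact ⟨0, Submodule.zero_mem _, fun z _ => laplacian_zero_apply z,
      fun e he => sigma_zero hΘ₀ hΘ he⟩
  | add a b _ _ ha hb =>
    obtain ⟨A, hA, hA1, hA2⟩ := ha
    obtain ⟨B, hB, hB1, hB2⟩ := hb
    refine ⟨A + B, Submodule.add_mem _ hA hB, fun z hz => ?_, fun e he => ?_⟩
    · rw [laplacian_add_singSpace hΘ (hle hA) (hle hB) hz, hA1 z hz, hB1 z hz]; rfl
    · rw [sigma_add hΘ₀ hΘ he (hle hA) (hle hB), hA2 e he, hB2 e he, add_zero]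
  | smul c a _ ha =>
    obtain ⟨A, hA, hA1, hA2⟩ := ha
    refine ⟨c • A, Submodule.smul_mem _ _ hA, fun z hz => ?_, fun e he => ?_⟩
    · rw [laplacian_smul_singSpace hΘ _ (hle hA) hz, hA1 z hz]; rfl
    · rw [sigma_smul hΘ₀ hΘ he _ (hle hA), hA2 e he, mul_zero]

/-- Every real polynomial in `L` is of the form `Im [e^{-idΘ} P(L - iΘ)]`. -/
lemma exists_polynomial_im_eval {Θ : ℝ} (hΘ₀ : 0 < Θ) (d : ℝ) (n : ℕ) :
    ∃ P : ℝ[X], (Real.sin (d * Θ) = 0 → P.eval 0 = 0) ∧ ∀ L : ℝ,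
      (Complex.exp (-(d * Θ : ℝ) * Complex.I) * aeval (L - Θ * Complex.I : ℂ) P).im = L ^ n := by
  set κ := Complex.exp (-(d * Θ : ℝ) * Complex.I) with hκ
  have hκ1 : κ.im = -Real.sin (d * Θ) := by
    rw [hκ, ← Complex.ofReal_neg, Complex.exp_ofReal_mul_I_im, Real.sin_neg]
  have hκ2 : κ.re = Real.cos (d * Θ) := by
    rw [hκ, ← Complex.ofReal_neg, Complex.exp_ofReal_mul_I_re, Real.cos_neg]
  let S : Submodule ℝ ℝ[X] :=
    { carrier := {Q | ∃ P : ℝ[X], (Real.sin (d * Θ) = 0 → P.eval 0 = 0) ∧ ∀ L : ℝ,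
        (κ * aeval (L - Θ * Complex.I : ℂ) P).im = Q.eval L}
      add_mem' := by
        rintro A B ⟨P, hP, hP'⟩ ⟨Q, hQ, hQ'⟩
        refine ⟨P + Q, fun h => by rw [eval_add, hP h, hQ h, add_zero], fun L => ?_⟩
        rw [map_add, mul_add, Complex.add_im, hP', hQ', eval_add]
      zero_mem' := ⟨0, fun _ => eval_zero, fun L => by simp⟩
      smul_mem' := by
        rintro c A ⟨P, hP, hP'⟩
        refine ⟨c • P, fun h => by rw [eval_smul, hP h, smul_zero], fun L => ?_⟩
        rw [map_smul, mul_smul_comm, Complex.smul_im, hP', eval_smul] }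
  suffices h : ∀ n, (X ^ n : ℝ[X]) ∈ S by
    obtain ⟨P, hP, hP'⟩ := h n
    exact ⟨P, hP, fun L => by rw [hP', eval_pow, eval_X]⟩
  intro n
  induction n using Nat.strong_induction_on with
  | _ n ih =>
  let B : ℕ → ℕ → ℝ := fun m j => (κ * ((-(Θ * Complex.I)) ^ (m - j) * (m.choose j : ℂ))).im
  have hexp : ∀ (m : ℕ) (L : ℝ), (κ * aeval (L - Θ * Complex.I : ℂ) (X ^ m : ℝ[X])).im =
      ∑ j ∈ Finset.range (m + 1), B m j * L ^ j := by
    intro m L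
    rw [map_pow, aeval_X, sub_eq_add_neg, add_pow, Finset.mul_sum, Complex.im_sum]
    refine Finset.sum_congr rfl fun j _ => ?_
    rw [← Complex.im_mul_ofReal]
    congr 1
    push_cast
    ring
  have hfin : ∀ (m : ℕ) (c : ℝ), c ≠ 0 → (Real.sin (d * Θ) = 0 → (0 : ℝ) ^ m = 0) →
      (∀ L : ℝ, ∑ j ∈ Finset.range (m + 1), B m j * L ^ j =
        ∑ j ∈ Finset.range n, B m j * L ^ j + c * L ^ n) → (X ^ n : ℝ[X]) ∈ S := by
    intro m c hc h0 hL
    have h1 : (∑ j ∈ Finset.range n, B m j • X ^ j + c • X ^ n : ℝ[X]) ∈ S :=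
      ⟨X ^ m, fun h => by simpa using h0 h, fun L => by
        rw [hexp, hL]
        simp [eval_finsetSum]⟩
    have h2 : (∑ j ∈ Finset.range n, B m j • X ^ j : ℝ[X]) ∈ S :=
      Submodule.sum_mem _ fun j hj => Submodule.smul_mem _ _ (ih j (Finset.mem_range.mp hj))
    exact (Submodule.smul_mem_iff _ hc).mp ((Submodule.add_mem_iff_right _ h2).mp h1)
  by_cases hs : Real.sin (d * Θ) = 0
  · refine hfin (n + 1) (B (n + 1) n) ?_ (fun _ => zero_pow n.succ_ne_zero) fun L => ?_
    · have hcos : Real.cos (d * Θ) ≠ 0 := fun hc => by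
        have := Real.sin_sq_add_cos_sq (d * Θ)
        rw [hs, hc] at this
        norm_num at this
      have : B (n + 1) n = -(Θ * (n + 1)) * Real.cos (d * Θ) := by
        simp only [B, Nat.add_sub_cancel_left, pow_one, Nat.choose_succ_self_right]
        rw [← hκ2]
        simp
        ring
      rw [this]
      exact mul_ne_zero (neg_ne_zero.mpr (mul_ne_zero hΘ₀.ne' (by positivity))) hcos
    · have : B (n + 1) (n + 1) = 0 := by simp [B, hκ1, hs]
      rw [Finset.sum_range_succ, Finset.sum_range_succ, this]
      ring
  · refine hfin n (B n n) ?_ (fun h => absurd h hs) fun L => Finset.sum_range_succ _ _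
    simpa [B, hκ1] using hs

lemma sing_rayPoint_zero {Θ d : ℝ} (P : ℝ[X]) {r : ℝ} (hr : 0 < r) :
    sing Θ d 0 P (rayPoint 0 r) = ((r ^ d : ℝ) : ℂ) *
      ((Complex.exp (-(d * Θ : ℝ) * Complex.I) *
        aeval (Real.log r - Θ * Complex.I : ℂ) P).im : ℝ) := by
  rw [rayPoint_eq_exp _ hr, sing_exp (by simp) (by simpa using Real.two_pi_pos), singStrip,
    ← Complex.ofReal_mul, ← Complex.im_ofReal_mul, Real.rpow_def_of_pos hr, Complex.ofReal_exp,
    ← mul_assoc, ← Complex.exp_add]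
  simp only [Complex.ofReal_zero, zero_mul, add_zero, Nat.cast_zero]
  congr 4
  push_cast
  ring

lemma sin_neg_pi_div_mul {Θ : ℝ} (hΘ₀ : 0 < Θ) (n : ℕ+) :
    Real.sin (-(Real.pi / Θ) * (n : ℝ) * Θ) = 0 := by
  have : -(Real.pi / Θ) * (n : ℝ) * Θ = -((n : ℕ) * Real.pi) := by
    field_simp
  rw [this, Real.sin_neg, Real.sin_nat_mul_pi, neg_zero]

lemma exists_harmonic_of_bdrySingDeg {Θ d : ℝ} (hΘ₀ : 0 < Θ) (hΘ : Θ < 2 * Real.pi) {φ : ℝ → ℂ}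
    (hφ : φ ∈ bdrySingDeg d) : ∃ ψ ∈ singDeg Θ d,
      (∀ z ∈ sector Θ, Laplacian.laplacian ψ z = 0) ∧ (∀ r, 0 < r → ψ (rayPoint 0 r) = φ r) ∧
      ∀ n : ℕ+, sigma Θ (-(Real.pi / Θ) * (n : ℝ)) ψ = 0 := by
  have hle := singDeg_le_singSpace Θ d
  have hneg := neg_pi_div_mul_neg hΘ₀
  let T : Submodule ℂ (ℝ → ℂ) :=
    { carrier := {φ | ∃ ψ ∈ singDeg Θ d,
        (∀ z ∈ sector Θ, Laplacian.laplacian ψ z = 0) ∧ (∀ r, 0 < r → ψ (rayPoint 0 r) = φ r) ∧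
        ∀ n : ℕ+, sigma Θ (-(Real.pi / Θ) * (n : ℝ)) ψ = 0}
      add_mem' := by
        rintro a b ⟨A, hA, hA1, hA2, hA3⟩ ⟨B, hB, hB1, hB2, hB3⟩
        refine ⟨A + B, Submodule.add_mem _ hA hB, fun z hz => ?_, fun r hr => ?_, fun n => ?_⟩
        · rw [laplacian_add_singSpace hΘ (hle hA) (hle hB) hz, hA1 z hz, hB1 z hz, add_zero]
        · rw [Pi.add_apply, Pi.add_apply, hA2 r hr, hB2 r hr]
        · rw [sigma_add hΘ₀ hΘ (hneg n) (hle hA) (hle hB), hA3, hB3, add_zero]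
      zero_mem' := ⟨0, Submodule.zero_mem _, fun z _ => laplacian_zero_apply z, fun _ _ => rfl,
        fun n => sigma_zero hΘ₀ hΘ (hneg n)⟩
      smul_mem' := by
        rintro c a ⟨A, hA, hA1, hA2, hA3⟩
        refine ⟨c • A, Submodule.smul_mem _ _ hA, fun z hz => ?_, fun r hr => ?_, fun n => ?_⟩
        · rw [laplacian_smul_singSpace hΘ _ (hle hA) hz, hA1 z hz, mul_zero]
        · rw [Pi.smul_apply, Pi.smul_apply, hA2 r hr]
        · rw [sigma_smul hΘ₀ hΘ (hneg n) _ (hle hA), hA3, mul_zero] }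
  suffices h : bdrySingDeg d ≤ T from h hφ
  refine Submodule.span_le.mpr ?_
  rintro _ ⟨Q, rfl⟩
  rw [SetLike.mem_coe]
  induction Q using Polynomial.induction_on' with
  | add A B hA hB =>
    convert T.add_mem hA hB using 1
    funext x
    simp [mul_add]
  | monomial n c =>
    obtain ⟨P, hP0, hP⟩ := exists_polynomial_im_eval hΘ₀ d n
    have hmem : (fun x : ℝ => ((x ^ d : ℝ) : ℂ) * (Real.log x : ℂ) ^ n) ∈ T := by
      refine ⟨sing Θ d 0 P, sing_mem_singDeg (by simp), fun z hz => ?_, fun r hr => ?_,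
        fun n => ?_⟩
      · rw [laplacian_sing hΘ _ _ _ hz]; simp
      · rw [sing_rayPoint_zero P hr, hP, Complex.ofReal_pow]
      · rw [sigma_sing hΘ₀ hΘ (hneg n)]
        split_ifs with h
        · rw [hP0 (by rw [h.1]; exact sin_neg_pi_div_mul hΘ₀ n), Complex.ofReal_zero]
        · rfl
    convert T.smul_mem c hmem using 1
    funext x
    simp
    ring

lemma exists_bdrySingDeg_of_singDeg {Θ d : ℝ} {φ : ℂ → ℂ} (hφ : φ ∈ singDeg Θ d) :
    ∃ t ∈ bdrySingDeg d, ∀ r, 0 < r → φ (rayPoint 0 r) = t r := by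
  obtain ⟨N, a, h⟩ := hasLogExpansion_of_mem hφ
  refine ⟨_, Submodule.subset_span ⟨∑ j ∈ Finset.range N, X ^ j * C (a j 0), rfl⟩, fun r hr => ?_⟩
  rw [rayPoint_eq_exp _ hr, h.eq _ (by simp) (by simpa using Real.two_pi_pos)]
  simp only [Real.rpow_def_of_pos hr, eval_finsetSum]
  congr 1
  · simp [mul_comm]
  · exact Finset.sum_congr rfl fun j _ => by simp; ring

/-- The sum of the spaces `𝒜_d(Ω)` with `d > -1`. -/
def regSpace (Θ : ℝ) : Submodule ℂ (ℂ → ℂ) := ⨆ d : {d : ℝ // -1 < d}, singDeg Θ d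

/-- The right-hand sides `R` for which `μ Δψ + κ ψ = R` has a solution `ψ ∈ 𝒜(Ω)` modulo terms of
degree greater than `-1`, with zero boundary values and zero coefficients `σ_d(ψ)`. -/
def solvable {Θ : ℝ} (hΘ₀ : 0 < Θ) (hΘ : Θ < 2 * Real.pi) (μ κ : ℂ) : Submodule ℂ (ℂ → ℂ) where
  carrier := {R | ∃ ψ ∈ singSpace Θ, (∀ r, 0 < r → ψ (rayPoint 0 r) = 0) ∧
    (∀ n : ℕ+, sigma Θ (-(Real.pi / Θ) * (n : ℝ)) ψ = 0) ∧
    ∃ G ∈ regSpace Θ, ∀ z ∈ sector Θ, μ * Laplacian.laplacian ψ z + κ * ψ z = R z + G z}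
  add_mem' := by
    rintro a b ⟨A, hA, hA1, hA2, G, hG, hA3⟩ ⟨B, hB, hB1, hB2, H, hH, hB3⟩
    refine ⟨A + B, Submodule.add_mem _ hA hB, fun r hr => ?_, fun n => ?_, G + H,
      Submodule.add_mem _ hG hH, fun z hz => ?_⟩
    · rw [Pi.add_apply, hA1 r hr, hB1 r hr, add_zero]
    · rw [sigma_add hΘ₀ hΘ (neg_pi_div_mul_neg hΘ₀ n) hA hB, hA2, hB2, add_zero]
    · rw [laplacian_add_singSpace hΘ hA hB hz]
      simp only [Pi.add_apply]
      linear_combination hA3 z hz + hB3 z hz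
  zero_mem' := ⟨0, Submodule.zero_mem _, fun _ _ => rfl,
    fun n => sigma_zero hΘ₀ hΘ (neg_pi_div_mul_neg hΘ₀ n), 0, Submodule.zero_mem _,
    fun z _ => by rw [laplacian_zero_apply]; simp⟩
  smul_mem' := by
    rintro c a ⟨A, hA, hA1, hA2, G, hG, hA3⟩
    refine ⟨c • A, Submodule.smul_mem _ _ hA, fun r hr => ?_, fun n => ?_, c • G,
      Submodule.smul_mem _ _ hG, fun z hz => ?_⟩
    · rw [Pi.smul_apply, hA1 r hr, smul_zero]
    · rw [sigma_smul hΘ₀ hΘ (neg_pi_div_mul_neg hΘ₀ n) _ hA, hA2, mul_zero]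
    · rw [laplacian_smul_singSpace hΘ _ hA hz]
      simp only [Pi.smul_apply, smul_eq_mul]
      linear_combination c * hA3 z hz

lemma helmholtz_sub {μ κ : ℂ} {T : ℝ} (hT : T < 2 * Real.pi) {φ ψ : ℂ → ℂ}
    (hφ : φ ∈ singSpace T) (hψ : ψ ∈ singSpace T) {z : ℂ} (hz : z ∈ sector T) :
    μ * Laplacian.laplacian (φ - ψ) z + κ * (φ - ψ) z =
      (μ * Laplacian.laplacian φ z + κ * φ z) - (μ * Laplacian.laplacian ψ z + κ * ψ z) := by
  have h := laplacian_add_singSpace hT hφ (Submodule.smul_mem _ (-1) hψ) hz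
  rw [laplacian_smul_singSpace hT _ hψ hz] at h
  have e : φ + (-1 : ℂ) • ψ = φ - ψ := by rw [neg_one_smul, sub_eq_add_neg]
  rw [← e, h]
  simp only [Pi.add_apply, Pi.smul_apply, smul_eq_mul]
  ring

lemma singDeg_le_solvable {Θ : ℝ} (hΘ₀ : 0 < Θ) (hΘ : Θ < 2 * Real.pi) {μ : ℂ} (hμ : μ ≠ 0)
    (κ : ℂ) (n : ℕ) : ∀ d : ℝ, -1 < d + 2 * n → singDeg Θ d ≤ solvable hΘ₀ hΘ μ κ := by
  induction n with
  | zero =>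
    intro d hd R hR
    refine ⟨0, Submodule.zero_mem _, fun _ _ => rfl,
      fun n => sigma_zero hΘ₀ hΘ (neg_pi_div_mul_neg hΘ₀ n), -R,
      Submodule.neg_mem _ (le_iSup (fun d : {d : ℝ // -1 < d} => singDeg Θ d)
        ⟨d, by simpa using hd⟩ hR), fun z _ => ?_⟩
    rw [laplacian_zero_apply]
    simp
  | succ n ih =>
    intro d hd R hR
    have hle := singDeg_le_singSpace Θ (d + 2)
    obtain ⟨A, hA, hA1, hA2⟩ := exists_laplacian_eq hΘ₀ hΘ (Submodule.smul_mem _ μ⁻¹ hR)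
    obtain ⟨t, ht, htA⟩ := exists_bdrySingDeg_of_singDeg hA
    obtain ⟨B, hB, hB1, hB2, hB3⟩ := exists_harmonic_of_bdrySingDeg hΘ₀ hΘ ht
    have hAB : A - B ∈ singDeg Θ (d + 2) := Submodule.sub_mem _ hA hB
    obtain ⟨E, hE, hE1, hE2, G, hG, hE3⟩ := ih (d + 2) (by push_cast at hd; linarith)
      (Submodule.smul_mem _ κ hAB)
    refine ⟨(A - B) - E, Submodule.sub_mem _ (hle hAB) hE, fun r hr => ?_, fun m => ?_, -G,
      Submodule.neg_mem _ hG, fun z hz => ?_⟩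
    · rw [Pi.sub_apply, Pi.sub_apply, htA r hr, hB2 r hr, hE1 r hr]
      simp
    · have hm := neg_pi_div_mul_neg hΘ₀ m
      rw [sigma_sub hΘ₀ hΘ hm (hle hAB) hE, sigma_sub hΘ₀ hΘ hm (hle hA) (hle hB), hA2 _ hm, hB3,
        hE2]
      simp
    · have h3 := hE3 z hz
      rw [helmholtz_sub hΘ (hle hAB) hE hz, h3,
        helmholtz_sub hΘ (hle hA) (hle hB) hz, hA1 z hz, hB1 z hz]
      simp only [Pi.sub_apply, Pi.smul_apply, smul_eq_mul, Pi.neg_apply]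
      linear_combination R z * (mul_inv_cancel₀ hμ)

/-- A singular function with given boundary values on `Γ` and given coefficients `σ_d`, which
solves the Helmholtz equation modulo terms of degree greater than `-1`. -/
lemma exists_singular_solution {Θ : ℝ} (hΘ₀ : 0 < Θ) (hΘ : Θ < 2 * Real.pi) {μ : ℂ} (hμ : μ ≠ 0)
    (κ : ℂ) {φ : ℝ → ℂ} (hφ : φ ∈ bdrySingSpace) (s : ℕ+ →₀ ℂ) :
    ∃ ψ ∈ singSpace Θ, (∀ r, 0 < r → ψ (rayPoint 0 r) = φ r) ∧
      (∀ n : ℕ+, sigma Θ (-(Real.pi / Θ) * (n : ℝ)) ψ = s n) ∧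
      ∃ G ∈ regSpace Θ, ∀ z ∈ sector Θ, μ * Laplacian.laplacian ψ z + κ * ψ z = G z := by
  classical
  have hneg := neg_pi_div_mul_neg hΘ₀
  have h1 : ∃ A ∈ singSpace Θ, (∀ z ∈ sector Θ, Laplacian.laplacian A z = 0) ∧
      (∀ r, 0 < r → A (rayPoint 0 r) = φ r) ∧
      ∀ n : ℕ+, sigma Θ (-(Real.pi / Θ) * (n : ℝ)) A = 0 := by
    induction hφ using Submodule.iSup_induction' with
    | mem d x hx =>
      obtain ⟨A, hA, h⟩ := exists_harmonic_of_bdrySingDeg hΘ₀ hΘ hx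
      exact ⟨A, singDeg_le_singSpace Θ d hA, h⟩
    | zero => exact ⟨0, Submodule.zero_mem _, fun z _ => laplacian_zero_apply z, fun _ _ => rfl,
        fun n => sigma_zero hΘ₀ hΘ (hneg n)⟩
    | add a b _ _ ha hb =>
      obtain ⟨A, hA, hA1, hA2, hA3⟩ := ha
      obtain ⟨B, hB, hB1, hB2, hB3⟩ := hb
      refine ⟨A + B, Submodule.add_mem _ hA hB, fun z hz => ?_, fun r hr => ?_, fun n => ?_⟩
      · rw [laplacian_add_singSpace hΘ hA hB hz, hA1 z hz, hB1 z hz, add_zero]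
      · rw [Pi.add_apply, Pi.add_apply, hA2 r hr, hB2 r hr]
      · rw [sigma_add hΘ₀ hΘ (hneg n) hA hB, hA3, hB3, add_zero]
  have hmem : ∀ n : ℕ+, sing Θ (-(Real.pi / Θ) * (n : ℝ)) 0 1 ∈ singSpace Θ := fun n =>
    singDeg_le_singSpace Θ _ (sing_mem_singDeg (d := -(Real.pi / Θ) * (n : ℝ)) (by simp))
  have h2 : ∃ A ∈ singSpace Θ, (∀ z ∈ sector Θ, Laplacian.laplacian A z = 0) ∧
      (∀ r, 0 < r → A (rayPoint 0 r) = 0) ∧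
      ∀ n : ℕ+, sigma Θ (-(Real.pi / Θ) * (n : ℝ)) A = s n := by
    have hm : ∀ n ∈ s.support, s n • sing Θ (-(Real.pi / Θ) * (n : ℝ)) 0 1 ∈ singSpace Θ :=
      fun n _ => Submodule.smul_mem _ _ (hmem n)
    refine ⟨∑ n ∈ s.support, s n • sing Θ (-(Real.pi / Θ) * (n : ℝ)) 0 1,
      Submodule.sum_mem _ hm, fun z hz => ?_, fun r hr => ?_, fun n => ?_⟩
    · have key : ∀ S : Finset ℕ+, Laplacian.laplacian
          (∑ n ∈ S, s n • sing Θ (-(Real.pi / Θ) * (n : ℝ)) 0 1) z = 0 := by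
        intro S
        induction S using Finset.induction_on with
        | empty => rw [Finset.sum_empty, laplacian_zero_apply]
        | insert n S hn ih =>
          rw [Finset.sum_insert hn, laplacian_add_singSpace hΘ (Submodule.smul_mem _ _ (hmem n))
            (Submodule.sum_mem _ fun m _ => Submodule.smul_mem _ _ (hmem m)) hz, ih,
            laplacian_smul_singSpace hΘ _ (hmem n) hz, laplacian_sing hΘ _ _ _ hz]
          simp
      exact key _
    · rw [Finset.sum_apply]
      refine Finset.sum_eq_zero fun n _ => ?_
      rw [Pi.smul_apply, sing_rayPoint_zero 1 hr, map_one, mul_one, ← Complex.ofReal_neg,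
        Complex.exp_ofReal_mul_I_im, Real.sin_neg, sin_neg_pi_div_mul hΘ₀]
      simp
    · rw [sigma_sum hΘ₀ hΘ (hneg n) _ _ hm, Finset.sum_eq_single n]
      · rw [sigma_smul hΘ₀ hΘ (hneg n) _ (hmem n), sigma_sing hΘ₀ hΘ (hneg n), if_pos ⟨rfl, rfl⟩]
        simp
      · intro m _ hmn
        rw [sigma_smul hΘ₀ hΘ (hneg n) _ (hmem m), sigma_sing hΘ₀ hΘ (hneg n), if_neg, mul_zero]
        rintro ⟨h, -⟩
        have := mul_left_cancel₀ (neg_ne_zero.mpr (div_pos Real.pi_pos hΘ₀).ne') h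
        exact hmn (PNat.coe_injective (Nat.cast_injective this))
      · intro hn
        rw [Finsupp.notMem_support_iff.mp hn, zero_smul, sigma_zero hΘ₀ hΘ (hneg n)]
  obtain ⟨A, hA, hA1, hA2, hA3⟩ := h1
  obtain ⟨B, hB, hB1, hB2, hB3⟩ := h2
  have hAB : A + B ∈ singSpace Θ := Submodule.add_mem _ hA hB
  have hsol : singSpace Θ ≤ solvable hΘ₀ hΘ μ κ := iSup_le fun d => by
    obtain ⟨n, hn⟩ := exists_nat_gt ((-1 - d) / 2)
    exact singDeg_le_solvable hΘ₀ hΘ hμ κ n d (by linarith)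
  obtain ⟨E, hE, hE1, hE2, G, hG, hE3⟩ := hsol (Submodule.smul_mem _ κ hAB)
  refine ⟨(A + B) - E, Submodule.sub_mem _ hAB hE, fun r hr => ?_, fun n => ?_, -G,
    Submodule.neg_mem _ hG, fun z hz => ?_⟩
  · rw [Pi.sub_apply, Pi.add_apply, hA2 r hr, hB2 r hr, hE1 r hr]
    simp
  · rw [sigma_sub hΘ₀ hΘ (hneg n) hAB hE, sigma_add hΘ₀ hΘ (hneg n) hA hB, hA3, hB3, hE2]
    simp
  · rw [helmholtz_sub hΘ hAB hE hz, hE3 z hz, laplacian_add_singSpace hΘ hA hB hz,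
      hA1 z hz, hB1 z hz]
    simp

lemma singSpace_extension {Θ : ℝ} (hΘ : Θ < 2 * Real.pi) {φ : ℂ → ℂ} (hφ : φ ∈ singSpace Θ) :
    ∃ φ' : ℂ → ℂ, (∀ z ∈ slit Θ, ContDiffAt ℝ (⊤ : ℕ∞) φ' z) ∧ EqOn φ φ' (sector Θ) := by
  induction hφ using Submodule.iSup_induction' with
  | mem d x hx =>
    obtain ⟨N, a, h⟩ := hasLogExpansion_of_mem hx
    exact ⟨fun z => logFun d N a (lg Θ z), fun z hz =>
      (contDiff_logFun d N h.smooth).contDiffAt.comp z (contDiffAt_lg hz), fun z hz => h.eqOn hΘ hz⟩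
  | zero => exact ⟨0, fun _ _ => contDiffAt_const, fun _ _ => rfl⟩
  | add a b _ _ ha hb =>
    obtain ⟨A, hA, hA'⟩ := ha
    obtain ⟨B, hB, hB'⟩ := hb
    refine ⟨A + B, fun z hz => (hA z hz).add (hB z hz), fun z hz => ?_⟩
    rw [Pi.add_apply, Pi.add_apply, hA' hz, hB' hz]

lemma regSpace_memLp {Θ : ℝ} (hΘ : Θ < 2 * Real.pi) {G : ℂ → ℂ} (hG : G ∈ regSpace Θ) {R : ℝ}
    (hR : 0 < R) : MemLp ((Metric.closedBall 0 R).indicator G) 2 (sectorMeasure Θ) := by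
  induction hG using Submodule.iSup_induction' with
  | mem d x hx =>
    obtain ⟨d, hd⟩ := d
    obtain ⟨p, hp1, hpd⟩ := exists_between hd
    obtain ⟨N, a, h⟩ := hasLogExpansion_of_mem hx
    obtain ⟨C, hC, hb⟩ := exists_logFun_bound Θ hpd (Real.log R) N fun j => (h.smooth j).continuous
    have hcont : ContinuousOn x (sector Θ) :=
      singSpace_continuousOn hΘ (singDeg_le_singSpace Θ d hx)
    refine memLp_sector_of_norm_le (p := p) (C := C) (R := R) hΘ
      ((hcont.aestronglyMeasurable (measurableSet_sector Θ)).indicator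
        Metric.isClosed_closedBall.measurableSet) hp1 hR (fun z hz hzR => ?_) fun z hz hzR => ?_
    · have hs := lg_mem_strip hΘ hz
      have hz0 := norm_pos_iff.mpr (ne_zero_of_mem_slit (sector_subset_slit hΘ hz))
      rw [indicator_of_mem (by simpa using hzR), h.eqOn hΘ hz, Real.rpow_def_of_pos hz0,
        mul_comm (Real.log _), ← lg_re Θ z]
      exact hb _ (by rw [lg_re]; exact Real.log_le_log hz0 hzR) hs.1.le hs.2.le
    · rw [indicator_of_notMem (by simpa using hzR)]
  | zero => simp
  | add a b _ _ ha hb =>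
    rw [indicator_add']
    exact ha.add hb

/-- If `μ Δψ + κ ψ` only has terms of degree greater than `-1`, then `(μ Δ + κ)(χ₀ψ)` is in
`L²(Ω)`. -/
lemma exists_memLp_residual {Θ : ℝ} (hΘ : Θ < 2 * Real.pi) {χ : ℂ → ℂ} (hχ : IsCutoff χ)
    {μ κ : ℂ} {ψ G : ℂ → ℂ} (hψ : ψ ∈ singSpace Θ) (hG : G ∈ regSpace Θ)
    (hψG : ∀ z ∈ sector Θ, μ * Laplacian.laplacian ψ z + κ * ψ z = G z) :
    ∃ h, MemLp h 2 (sectorMeasure Θ) ∧ ∀ v, IsTest Θ v →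
      ∫ z, χ z * ψ z * (μ * Laplacian.laplacian v z + κ * v z) ∂(sectorMeasure Θ) =
        ∫ z, h z * v z ∂(sectorMeasure Θ) := by
  have hχc := hχ.isSmoothCompact
  obtain ⟨ψ', hψ', heq⟩ := singSpace_extension hΘ hψ
  let U : ℂ → ℂ := fun z => χ z * ψ z
  let U' : ℂ → ℂ := fun z => χ z * ψ' z
  let H : (ℂ → ℂ) → ℂ → ℂ := fun u z => μ * Laplacian.laplacian u z + κ * u z
  have hU : ∀ z ∈ sector Θ, ContDiffAt ℝ (⊤ : ℕ∞) U z := fun z hz =>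
    hχc.1.contDiffAt.mul (singSpace_contDiffAt hΘ hψ hz)
  have hU' : ∀ z ∈ slit Θ, ContDiffAt ℝ (⊤ : ℕ∞) U' z := fun z hz =>
    hχc.1.contDiffAt.mul (hψ' z hz)
  have hUcont : ContinuousOn U (sector Θ) := fun z hz => (hU z hz).continuousAt.continuousWithinAt
  have hHcont : ContinuousOn (H U) (sector Θ) :=
    (continuousOn_const.mul (continuousOn_laplacian hU)).add (continuousOn_const.mul hUcont)
  have hH'cont : ContinuousOn (H U') (slit Θ) := by
    have h : ContinuousOn (fun z => μ * (dirDeriv 1 (dirDeriv 1 U') z +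
        dirDeriv Complex.I (dirDeriv Complex.I U') z) + κ * U' z) (slit Θ) := fun z hz =>
      ((continuousAt_const.mul
        ((contDiffAt_dirDeriv (contDiffAt_dirDeriv (hU' z hz) 1) 1).continuousAt.add
        (contDiffAt_dirDeriv (contDiffAt_dirDeriv (hU' z hz) Complex.I) Complex.I).continuousAt)).add
        (continuousAt_const.mul (hU' z hz).continuousAt)).continuousWithinAt
    refine h.congr fun z hz => ?_
    simp only [H]
    rw [laplacian_eq_dirDeriv ((hU' z hz).of_le two_le_infty)]
  have hHH' : EqOn (H U) (H U') (sector Θ) := by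
    intro z hz
    have hev : U =ᶠ[𝓝 z] U' := by
      filter_upwards [(isOpen_sector Θ).mem_nhds hz] with w hw
      simp only [U, U', heq hw]
    simp only [H]
    rw [(InnerProductSpace.laplacian_congr_nhds hev).eq_of_nhds, hev.eq_of_nhds]
  obtain ⟨ε, hε, hχ1⟩ := Metric.eventually_nhds_iff_ball.mp hχ.one_near_zero
  obtain ⟨R, hR, hχR⟩ := hχc.exists_radius
  let K : Set ℂ := Complex.exp '' (Icc (Real.log (ε / 2)) (Real.log R) ×ℂ Icc 0 Θ)
  have hK : IsCompact K := (isCompact_Icc.reProdIm isCompact_Icc).image Complex.continuous_exp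
  have hKs : K ⊆ slit Θ := by
    rintro _ ⟨ζ, hζ, rfl⟩
    exact exp_mem_slit (abs_sub_half_lt hΘ hζ.2.1 hζ.2.2)
  obtain ⟨C₀, hC₀⟩ := hK.exists_bound_of_continuousOn (hH'cont.mono hKs)
  let C := max C₀ 0
  have hC : ∀ z ∈ K, ‖H U' z‖ ≤ C := fun z hz => (hC₀ z hz).trans (le_max_left _ _)
  have hHG : ∀ z ∈ sector Θ, ‖z‖ < ε → H U z = G z := by
    intro z hz hzε
    have hev : U =ᶠ[𝓝 z] ψ := by
      filter_upwards [Metric.isOpen_ball.mem_nhds (show z ∈ Metric.ball 0 ε by simpa using hzε)]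
        with w hw
      simp only [U, hχ1 w hw, one_mul]
    simp only [H]
    rw [(InnerProductSpace.laplacian_congr_nhds hev).eq_of_nhds, hev.eq_of_nhds, hψG z hz]
  have hHR : ∀ z, R < ‖z‖ → H U z = 0 := by
    intro z hz
    have hev : U =ᶠ[𝓝 z] 0 := by
      filter_upwards [(isOpen_lt continuous_const continuous_norm).mem_nhds hz] with w hw
      simp only [U, hχR w hw, zero_mul, Pi.zero_apply]
    simp only [H]
    rw [(InnerProductSpace.laplacian_congr_nhds hev).eq_of_nhds, hev.eq_of_nhds,
      laplacian_zero_apply]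
    simp
  have hmeas : AEStronglyMeasurable (H U) (sectorMeasure Θ) :=
    hHcont.aestronglyMeasurable (measurableSet_sector Θ)
  refine ⟨H U, ?_, fun v hv => ?_⟩
  · have m1 := regSpace_memLp hΘ hG (half_pos hε)
    have m2 : MemLp ((Metric.closedBall (0 : ℂ) (ε / 2))ᶜ.indicator (H U)) 2 (sectorMeasure Θ) := by
      refine memLp_sector_of_norm_le (p := 0) (C := C) (R := R) hΘ
        (hmeas.indicator Metric.isClosed_closedBall.measurableSet.compl) (by norm_num) hR
        (fun z hz hzR => ?_) fun z hz hzR => ?_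
      · rw [Real.rpow_zero, mul_one]
        by_cases hzε : z ∈ (Metric.closedBall (0 : ℂ) (ε / 2))ᶜ
        · rw [indicator_of_mem hzε, hHH' hz]
          have hz' : ε / 2 < ‖z‖ := by simpa using hzε
          have h := lg_mem_strip hΘ hz
          refine hC z ⟨lg Θ z, ⟨?_, h.1.le, h.2.le⟩,
            exp_lg Θ (ne_zero_of_mem_slit (sector_subset_slit hΘ hz))⟩
          rw [mem_preimage, lg_re]
          exact ⟨Real.log_le_log (half_pos hε) hz'.le,
            Real.log_le_log ((half_pos hε).trans hz') hzR⟩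
        · rw [indicator_of_notMem hzε, norm_zero]
          exact le_max_right _ _
      · by_cases hzε : z ∈ (Metric.closedBall (0 : ℂ) (ε / 2))ᶜ
        · rw [indicator_of_mem hzε, hHR z hzR]
        · rw [indicator_of_notMem hzε]
    refine (m1.add m2).ae_eq ?_
    filter_upwards [ae_mem_sector Θ] with z hz
    rw [Pi.add_apply]
    by_cases hzε : z ∈ Metric.closedBall (0 : ℂ) (ε / 2)
    · rw [indicator_of_mem hzε, indicator_of_notMem (by simpa using hzε), add_zero,
        hHG z hz (lt_of_le_of_lt (by simpa using hzε) (half_lt_self hε))]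
    · rw [indicator_of_notMem hzε, indicator_of_mem hzε, zero_add]
  · have i1 := ((isTest_laplacian hv).integrable_mul hUcont).restrict (s := sector Θ)
    have i2 := (hv.integrable_mul hUcont).restrict (s := sector Θ)
    have i3 := (hv.integrable_mul (continuousOn_laplacian hU)).restrict (s := sector Θ)
    calc _ = ∫ z, (μ * (U z * Laplacian.laplacian v z) + κ * (U z * v z)) ∂(sectorMeasure Θ) :=
          integral_congr_ae (.of_forall fun z => by simp only [U]; ring)
      _ = μ * (∫ z, Laplacian.laplacian U z * v z ∂(sectorMeasure Θ)) +
          κ * ∫ z, U z * v z ∂(sectorMeasure Θ) := by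
        rw [integral_add (i1.const_mul μ) (i2.const_mul κ), integral_const_mul, integral_const_mul,
          integral_mul_laplacian_test hv hU]
      _ = ∫ z, (μ * (Laplacian.laplacian U z * v z) + κ * (U z * v z)) ∂(sectorMeasure Θ) := by
        rw [integral_add (i3.const_mul μ) (i2.const_mul κ), integral_const_mul, integral_const_mul]
      _ = _ := integral_congr_ae (.of_forall fun z => by simp only [H]; ring)

/-! ### Lifting of boundary values -/

lemma exists_tendsto_of_midpoint {E : Type*} [NormedAddCommGroup E] [InnerProductSpace ℂ E]
    [CompleteSpace E] {K : ℕ → Set E} (hne : ∀ n, (K n).Nonempty) (hanti : Antitone K)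
    (hmid : ∀ n, ∀ x ∈ K n, ∀ y ∈ K n, (2⁻¹ : ℂ) • (x + y) ∈ K n) {M : ℝ}
    (hM : ∀ x ∈ K 0, ‖x‖ ≤ M) : ∃ (y : ℕ → E) (l : E), (∀ n, y n ∈ K n) ∧
      Tendsto y atTop (𝓝 l) := by
  let d : ℕ → ℝ := fun n => sInf (norm '' K n)
  have hbdd : ∀ n, BddBelow (norm '' K n) := fun n =>
    ⟨0, by rintro _ ⟨x, -, rfl⟩; exact norm_nonneg x⟩
  have hd : ∀ n, ∀ x ∈ K n, d n ≤ ‖x‖ := fun n x hx => csInf_le (hbdd n) ⟨x, hx, rfl⟩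
  have hd0 : ∀ n, 0 ≤ d n := fun n => Real.sInf_nonneg (by rintro _ ⟨x, -, rfl⟩; exact norm_nonneg x)
  have hex : ∀ n, ∃ y ∈ K n, ‖y‖ < d n + 1 / (n + 1) := fun n => by
    obtain ⟨_, ⟨y, hy, rfl⟩, h⟩ := exists_lt_of_csInf_lt ((hne n).image norm)
      (show d n < d n + 1 / (n + 1) from lt_add_of_pos_right _ (by positivity))
    exact ⟨y, hy, h⟩
  choose y hy hyd using hex
  have hmono : Monotone d := fun m n h =>
    csInf_le_csInf (hbdd m) ((hne n).image norm) (image_mono (hanti h))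
  have hbound : BddAbove (range d) := ⟨M, by
    rintro _ ⟨n, rfl⟩
    exact (hd n _ (hy n)).trans (hM _ (hanti (Nat.zero_le n) (hy n)))⟩
  have hlim := tendsto_atTop_ciSup hmono hbound
  set D := ⨆ n, d n
  have hdD : ∀ n, d n ≤ D := le_ciSup hbound
  have key : ∀ n m, n ≤ m → ‖y n - y m‖ ^ 2 ≤ 4 * ((D + 1 / (n + 1)) ^ 2 - d n ^ 2) := by
    intro n m hnm
    have h1 := parallelogram_law_with_norm ℂ (y n) (y m)
    have h2 := hd n _ (hmid n _ (hy n) _ (hanti hnm (hy m)))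
    rw [norm_smul, norm_inv, Complex.norm_ofNat] at h2
    have h3 : (2 * d n) ^ 2 ≤ ‖y n + y m‖ ^ 2 := pow_le_pow_left₀ (by linarith [hd0 n]) (by linarith) 2
    have h4 : ‖y n‖ ^ 2 ≤ (D + 1 / (n + 1)) ^ 2 :=
      pow_le_pow_left₀ (norm_nonneg _) ((hyd n).le.trans (by linarith [hdD n])) 2
    have h5 : ‖y m‖ ^ 2 ≤ (D + 1 / (n + 1)) ^ 2 := by
      refine pow_le_pow_left₀ (norm_nonneg _) ((hyd m).le.trans (add_le_add (hdD m) ?_)) 2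
      have : (n : ℝ) ≤ m := by exact_mod_cast hnm
      gcongr
    nlinarith
  have h0 : Tendsto (fun n : ℕ => √(4 * ((D + 1 / ((n : ℝ) + 1)) ^ 2 - d n ^ 2))) atTop (𝓝 0) := by
    have h1 : Tendsto (fun n : ℕ => D + 1 / ((n : ℝ) + 1)) atTop (𝓝 (D + 0)) :=
      tendsto_const_nhds.add tendsto_one_div_add_atTop_nhds_zero_nat
    have h2 := ((((h1.pow 2).sub (hlim.pow 2)).const_mul 4).sqrt)
    simpa using h2
  have hc : CauchySeq y := by
    refine cauchySeq_of_le_tendsto_0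
      (fun n : ℕ => 2 * √(4 * ((D + 1 / ((n : ℝ) + 1)) ^ 2 - d n ^ 2)))
      (fun n m N hn hm => ?_) (by simpa only [mul_zero] using h0.const_mul 2)
    rw [two_mul]
    refine (dist_triangle_left (y n) (y m) (y N)).trans (add_le_add ?_ ?_) <;>
    · rw [dist_eq_norm]
      exact Real.le_sqrt_of_sq_le (key _ _ ‹_›)
  obtain ⟨l, hl⟩ := cauchySeq_tendsto_of_complete hc
  exact ⟨y, l, hy, hl⟩

lemma exists_H1_of_bounded {Θ : ℝ} {w : ℕ → H1 Θ} {t : ℕ → ℝ → ℂ} {g : ℝ → ℂ} {M : ℝ}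
    (hM : ∀ n, ‖w n‖ ≤ M) (h0 : ∀ n, IsTrace Θ 0 (w n) (t n)) (h1 : ∀ n, IsTrace Θ Θ (w n) 0)
    (hg : MemLp g 2 rayMeasure)
    (ht : Tendsto (fun n => eLpNorm (fun r => t n r - g r) 2 rayMeasure) atTop (𝓝 0)) :
    ∃ w : H1 Θ, IsTrace Θ 0 w g ∧ IsTrace Θ Θ w 0 := by
  let δ : ℕ → ℝ≥0∞ := fun n => ENNReal.ofReal (1 / (n + 1))
  have hδ : Tendsto δ atTop (𝓝 0) := by
    have := (ENNReal.continuous_ofReal.tendsto 0).comp tendsto_one_div_add_atTop_nhds_zero_nat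
    simpa [δ, Function.comp_def] using this
  let K : ℕ → Set (H1 Θ) := fun n => {w | ‖w‖ ≤ M ∧ IsTrace Θ Θ w 0 ∧
    ∃ t, IsTrace Θ 0 w t ∧ eLpNorm (t - g) 2 rayMeasure ≤ δ n}
  have key : ∃ (y : ℕ → H1 Θ) (l : H1 Θ), (∀ n, y n ∈ K n) ∧ Tendsto y atTop (𝓝 l) := by
    refine exists_tendsto_of_midpoint (M := M) (fun n => ?_)
      (fun m n h w hw => ?_) (fun n x hx y hy => ?_) fun x hx => hx.1
    · obtain ⟨k, hk⟩ := (ht.eventually_lt_const (show 0 < δ n from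
        ENNReal.ofReal_pos.mpr (by positivity))).exists
      exact ⟨w k, hM k, h1 k, t k, h0 k, hk.le⟩
    · obtain ⟨a, b, t, ht, htd⟩ := hw
      refine ⟨a, b, t, ht, htd.trans (ENNReal.ofReal_le_ofReal ?_)⟩
      have : (m : ℝ) ≤ n := by exact_mod_cast h
      gcongr
    · obtain ⟨a, b, t, ht, htd⟩ := hx
      obtain ⟨a', b', t', ht', htd'⟩ := hy
      refine ⟨?_, by simpa using (b.add b').smul 2⁻¹, _, (ht.add ht').smul 2⁻¹, ?_⟩
      · rw [norm_smul, norm_inv, Complex.norm_ofNat]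
        linarith [norm_add_le x y]
      · have e : (2⁻¹ : ℂ) • (t + t') - g = (2⁻¹ : ℂ) • ((t - g) + (t' - g)) := by
          funext r
          simp only [Pi.sub_apply, Pi.smul_apply, Pi.add_apply, smul_eq_mul]
          ring
        rw [e, eLpNorm_const_smul]
        refine (mul_le_mul_right ((eLpNorm_add_le (ht.1.sub hg).1 (ht'.1.sub hg).1
          (by norm_num)).trans (add_le_add htd htd')) _).trans (le_of_eq ?_)
        rw [← two_mul, ← mul_assoc]
        have : ‖(2⁻¹ : ℂ)‖ₑ * 2 = 1 := by
          rw [← ofReal_norm, norm_inv, Complex.norm_ofNat,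
            ← ENNReal.ofReal_ofNat 2, ← ENNReal.ofReal_mul (by norm_num)]
          norm_num
        rw [this, one_mul]
  obtain ⟨y, l, hy, hl⟩ := key
  choose hy1 hy2 s hs hsd using hy
  exact ⟨l, IsTrace.of_tendsto hs hl hg (tendsto_of_tendsto_of_tendsto_of_le_of_le
    tendsto_const_nhds hδ (fun _ => zero_le) hsd),
    IsTrace.of_tendsto hy2 hl MemLp.zero (by simp)⟩

/-! ### Averages of functions of one variable -/

/-- The averaging kernel. -/
def avgBump : ContDiffBump (0 : ℝ) := ⟨1 / 2, 1, by norm_num, by norm_num⟩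

/-- `ρ⁻¹ η(x/ρ)`, where `η` is a smooth function of integral `1` supported in `[-1, 1]`. -/
def kern (ρ x : ℝ) : ℂ := ((ρ⁻¹ * avgBump.normed volume (x / ρ) : ℝ) : ℂ)

/-- The average of `h` around `s` at scale `ρ`, where `q = (ρ, s)`. -/
def avg (h : ℝ → ℂ) (q : ℝ × ℝ) : ℂ := ∫ t, h t * kern q.1 (q.2 - t)

lemma avgBump_eq_zero {x : ℝ} (hx : 1 ≤ |x|) : avgBump.normed volume x = 0 := by
  by_contra h
  have : x ∈ Metric.ball (0 : ℝ) 1 := (avgBump.support_normed_eq (μ := volume)) ▸ h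
  rw [Metric.mem_ball, Real.dist_0_eq_abs] at this
  linarith

lemma kern_eq_zero {ρ x : ℝ} (hρ : 0 < ρ) (hx : ρ ≤ |x|) : kern ρ x = 0 := by
  rw [kern, avgBump_eq_zero, mul_zero, Complex.ofReal_zero]
  rwa [abs_div, abs_of_pos hρ, le_div_iff₀ hρ, one_mul]

lemma contDiffOn_kern : ContDiffOn ℝ (⊤ : ℕ∞) ↿kern (Ioi 0 ×ˢ univ) := by
  intro q hq
  have hq0 : q.1 ≠ 0 := (show 0 < q.1 from hq.1).ne'
  have h1 : ContDiffAt ℝ (⊤ : ℕ∞) (fun q : ℝ × ℝ => q.1⁻¹) q := contDiffAt_fst.inv hq0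
  have h2 : ContDiffAt ℝ (⊤ : ℕ∞) (fun q : ℝ × ℝ => avgBump.normed volume (q.2 / q.1)) q :=
    (avgBump.contDiff_normed (n := (⊤ : ℕ∞))).contDiffAt.comp q (contDiffAt_snd.div contDiffAt_fst hq0)
  exact (Complex.ofRealCLM.contDiff.contDiffAt.comp q (h1.mul h2)).contDiffWithinAt

lemma continuous_kern {ρ : ℝ} (hρ : 0 < ρ) : Continuous (kern ρ) :=
  contDiffOn_kern.continuousOn.comp_continuous (f := fun x : ℝ => (ρ, x)) (by fun_prop)
    fun _ => ⟨hρ, mem_univ _⟩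

lemma hasCompactSupport_kern {ρ : ℝ} (hρ : 0 < ρ) : HasCompactSupport (kern ρ) :=
  HasCompactSupport.intro (isCompact_Icc (a := -ρ) (b := ρ)) fun x hx => kern_eq_zero hρ (by
    by_contra h
    exact hx (abs_le.mp (not_le.mp h).le))

lemma integral_kern {ρ : ℝ} (hρ : 0 < ρ) : ∫ x, kern ρ x = 1 := by
  simp only [kern]
  rw [integral_complex_ofReal, integral_const_mul, Measure.integral_comp_div, avgBump.integral_normed,
    smul_eq_mul, mul_one, abs_of_pos hρ, inv_mul_cancel₀ hρ.ne', Complex.ofReal_one]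

lemma exists_kern_bound : ∃ C : ℝ, 0 ≤ C ∧ ∀ ρ x : ℝ, 0 < ρ →
    ‖kern ρ x‖ ≤ C * ρ⁻¹ ∧ ‖fderiv ℝ ↿kern (ρ, x)‖ ≤ C * ρ⁻¹ ^ 2 ∧
      (ρ < |x| → fderiv ℝ ↿kern (ρ, x) = 0) := by
  have hopen : IsOpen (Ioi (0 : ℝ) ×ˢ (univ : Set ℝ)) := isOpen_Ioi.prod isOpen_univ
  have hvan : ∀ ρ x : ℝ, 0 < ρ → ρ < |x| → fderiv ℝ ↿kern (ρ, x) = 0 := by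
    intro ρ x hρ hx
    have hev : ↿kern =ᶠ[𝓝 (ρ, x)] fun _ => 0 := by
      have h1 : ∀ᶠ q : ℝ × ℝ in 𝓝 (ρ, x), 0 < q.1 :=
        (isOpen_lt continuous_const continuous_fst).mem_nhds hρ
      have h2 : ∀ᶠ q : ℝ × ℝ in 𝓝 (ρ, x), q.1 < |q.2| :=
        (isOpen_lt continuous_fst continuous_snd.abs).mem_nhds hx
      filter_upwards [h1, h2] with q h1 h2 using kern_eq_zero h1 h2.le
    rw [hev.fderiv_eq, fderiv_fun_const]
    rfl
  have hc : ContinuousOn (fun x : ℝ => fderiv ℝ ↿kern (1, x)) (Icc (-1) 1) :=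
    (contDiffOn_kern.continuousOn_fderiv_of_isOpen hopen (by simp)).comp (by fun_prop)
      fun x _ => ⟨(one_pos : (0 : ℝ) < 1), mem_univ _⟩
  obtain ⟨C₁, hC₁⟩ := isCompact_Icc.exists_bound_of_continuousOn hc
  obtain ⟨C₂, hC₂⟩ := isCompact_Icc.exists_bound_of_continuousOn
    ((continuous_kern one_pos).continuousOn (s := Icc (-1) 1))
  let C := max 0 (max C₁ C₂)
  have hC0 : 0 ≤ C := le_max_left _ _
  refine ⟨C, hC0, fun ρ x hρ => ⟨?_, ?_, hvan ρ x hρ⟩⟩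
  · by_cases hx : |x / ρ| ≤ 1
    · have e : kern ρ x = (ρ⁻¹ : ℝ) * kern 1 (x / ρ) := by simp [kern]
      rw [e, norm_mul, Complex.norm_real, Real.norm_of_nonneg (inv_nonneg.mpr hρ.le), mul_comm]
      exact mul_le_mul_of_nonneg_right ((hC₂ _ (abs_le.mp hx)).trans
        ((le_max_right _ _).trans (le_max_right _ _))) (inv_nonneg.mpr hρ.le)
    · rw [kern, avgBump_eq_zero (not_le.mp hx).le, mul_zero, Complex.ofReal_zero, norm_zero]
      positivity
  · by_cases hx : |x / ρ| ≤ 1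
    · have e : (↿kern : ℝ × ℝ → ℂ) = fun q => ρ⁻¹ • (fun q => ↿kern (ρ⁻¹ • q)) q := by
        funext q
        simp only [Function.HasUncurry.uncurry, id, kern, Prod.smul_fst, Prod.smul_snd, smul_eq_mul,
          Complex.real_smul, ← Complex.ofReal_mul]
        rw [mul_div_mul_left _ _ (inv_ne_zero hρ.ne'), mul_inv, inv_inv]
        field_simp
      have hd : DifferentiableAt ℝ (fun q : ℝ × ℝ => ↿kern (ρ⁻¹ • q)) (ρ, x) := by
        have : DifferentiableAt ℝ ↿kern (ρ⁻¹ • (ρ, x)) :=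
          ((contDiffOn_kern.contDiffAt (hopen.mem_nhds (by
            refine ⟨?_, mem_univ _⟩
            simp [hρ.ne']))).differentiableAt (by simp))
        exact this.comp (ρ, x) (differentiableAt_id.const_smul ρ⁻¹)
      have e2 : fderiv ℝ ↿kern (ρ, x) = ρ⁻¹ • ρ⁻¹ • fderiv ℝ ↿kern (1, x / ρ) := by
        conv_lhs => rw [e]
        rw [fderiv_fun_const_smul hd, fderiv_comp_smul]
        simp [hρ.ne', div_eq_inv_mul]
      rw [e2, norm_smul, norm_smul, Real.norm_of_nonneg (inv_nonneg.mpr hρ.le), ← mul_assoc, ← sq,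
        mul_comm]
      exact mul_le_mul_of_nonneg_right ((hC₁ _ (abs_le.mp hx)).trans
        ((le_max_left _ _).trans (le_max_right _ _))) (by positivity)
    · rw [hvan ρ x hρ (by
        rw [abs_div, abs_of_pos hρ, not_le, lt_div_iff₀ hρ, one_mul] at hx; exact hx), norm_zero]
      positivity

lemma integrable_mul_kern {h : ℝ → ℂ} (hh : LocallyIntegrable h) {q : ℝ × ℝ} (hq : 0 < q.1) :
    Integrable fun t => h t * kern q.1 (q.2 - t) :=
  (hasCompactSupport_kern hq).convolutionExists_right (ContinuousLinearMap.mul ℝ ℂ) hh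
    (continuous_kern hq) q.2

lemma avg_sub_const {h : ℝ → ℂ} (hh : LocallyIntegrable h) (c : ℂ) {q : ℝ × ℝ} (hq : 0 < q.1) :
    avg (fun t => h t - c) q = avg h q - c := by
  have h1 : ∫ t, kern q.1 (q.2 - t) = 1 := by
    rw [integral_sub_left_eq_self (kern q.1) volume q.2, integral_kern hq]
  simp only [avg, sub_mul]
  rw [integral_sub (integrable_mul_kern hh hq)
    (integrable_mul_kern (locallyIntegrable_const c) hq), integral_const_mul, h1, mul_one]

lemma avg_support (ρ : ℝ) : ∀ p x, p ∈ Ioo 0 (ρ + 1) → x ∉ Icc (-(ρ + 1)) (ρ + 1) →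
    kern p x = 0 := fun p x hp hx => kern_eq_zero hp.1 (by
  by_contra h
  exact hx (abs_le.mp ((not_le.mp h).le.trans hp.2.le)))

lemma hasFDerivAt_avg {h : ℝ → ℂ} (hh : LocallyIntegrable h) {q : ℝ × ℝ} (hq : 0 < q.1) :
    HasFDerivAt (avg h) (∫ t, (ContinuousLinearMap.mul ℝ ℂ).precompR (ℝ × ℝ) (h t)
      (fderiv ℝ ↿kern (q.1, q.2 - t))) q :=
  hasFDerivAt_convolution_right_with_param (ContinuousLinearMap.mul ℝ ℂ) (s := Ioo 0 (q.1 + 1))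
    isOpen_Ioo isCompact_Icc (avg_support q.1) hh
    ((contDiffOn_kern.of_le (by simp)).mono (prod_mono_left Ioo_subset_Ioi_self)) q
    ⟨hq, lt_add_one _⟩

lemma contDiffAt_avg {h : ℝ → ℂ} (hh : LocallyIntegrable h) {q : ℝ × ℝ} (hq : 0 < q.1) :
    ContDiffAt ℝ (⊤ : ℕ∞) (avg h) q :=
  (contDiffOn_convolution_right_with_param (ContinuousLinearMap.mul ℝ ℂ) (s := Ioo 0 (q.1 + 1))
    isOpen_Ioo isCompact_Icc (avg_support q.1) hh
    (contDiffOn_kern.mono (prod_mono_left Ioo_subset_Ioi_self))).contDiffAt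
    ((isOpen_Ioo.prod isOpen_univ).mem_nhds ⟨⟨hq, lt_add_one _⟩, mem_univ _⟩)

lemma sq_lintegral_Icc_le {f : ℝ → ℝ≥0∞} (hf : Measurable f) (s ρ : ℝ) :
    (∫⁻ t in Icc (s - ρ) (s + ρ), f t) ^ 2 ≤
      ENNReal.ofReal (2 * ρ) * ∫⁻ t in Icc (s - ρ) (s + ρ), f t ^ 2 := by
  refine (lintegral_sq_le hf.aemeasurable).trans_eq ?_
  rw [Measure.restrict_apply_univ, Real.volume_Icc]
  ring_nf

lemma lintegral_le_setLIntegral_Icc {F : ℝ → ℝ≥0∞} {c : ℝ≥0∞} {f : ℝ → ℝ≥0∞} {s ρ : ℝ}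
    (h0 : ∀ t, ρ < |s - t| → F t = 0) (h1 : ∀ t, F t ≤ c * f t) (hf : Measurable f) :
    ∫⁻ t, F t ≤ c * ∫⁻ t in Icc (s - ρ) (s + ρ), f t := by
  rw [← lintegral_const_mul _ hf, ← lintegral_indicator measurableSet_Icc]
  refine lintegral_mono fun t => ?_
  by_cases ht : t ∈ Icc (s - ρ) (s + ρ)
  · rw [indicator_of_mem ht]; exact h1 t
  · rw [h0 t]
    · exact zero_le
    · by_contra h
      have := abs_le.mp (not_lt.mp h)
      exact ht ⟨by linarith [this.2], by linarith [this.1]⟩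

lemma ofReal_mul_two_mul_sq {C ρ : ℝ} (hC : 0 ≤ C) (hρ : 0 < ρ) (k : ℕ) :
    ENNReal.ofReal (C * ρ⁻¹ ^ (k + 1)) ^ 2 * ENNReal.ofReal (2 * ρ) =
      ENNReal.ofReal (2 * C ^ 2 * ρ⁻¹ ^ (2 * k + 1)) := by
  rw [← ENNReal.ofReal_pow (by positivity), ← ENNReal.ofReal_mul (by positivity)]
  congr 1
  have : ρ⁻¹ * ρ = 1 := inv_mul_cancel₀ hρ.ne'
  linear_combination (2 * C ^ 2 * ρ⁻¹ ^ (2 * k + 1)) * this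

lemma exists_avg_bound : ∃ C : ℝ, 0 ≤ C ∧ ∀ (h : ℝ → ℂ), Measurable h → LocallyIntegrable h →
    ∀ ρ s : ℝ, 0 < ρ →
      ‖avg h (ρ, s)‖ₑ ^ 2 ≤
        ENNReal.ofReal (C * ρ⁻¹) * ∫⁻ t in Icc (s - ρ) (s + ρ), ‖h t‖ₑ ^ 2 ∧
      ‖avg h (ρ, s) - h s‖ₑ ^ 2 ≤
        ENNReal.ofReal (C * ρ⁻¹) * ∫⁻ t in Icc (s - ρ) (s + ρ), ‖h t - h s‖ₑ ^ 2 ∧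
      ‖fderiv ℝ (avg h) (ρ, s)‖ₑ ^ 2 ≤
        ENNReal.ofReal (C * ρ⁻¹ ^ 3) * ∫⁻ t in Icc (s - ρ) (s + ρ), ‖h t - h s‖ₑ ^ 2 := by
  obtain ⟨C, hC, hk⟩ := exists_kern_bound
  have key : ∀ (h : ℝ → ℂ), Measurable h → LocallyIntegrable h → ∀ ρ s : ℝ, 0 < ρ →
      ‖avg h (ρ, s)‖ₑ ^ 2 ≤
        ENNReal.ofReal (2 * C ^ 2 * ρ⁻¹) * ∫⁻ t in Icc (s - ρ) (s + ρ), ‖h t‖ₑ ^ 2 ∧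
      ‖fderiv ℝ (avg h) (ρ, s)‖ₑ ^ 2 ≤
        ENNReal.ofReal (2 * C ^ 2 * ρ⁻¹ ^ 3) * ∫⁻ t in Icc (s - ρ) (s + ρ), ‖h t‖ₑ ^ 2 := by
    intro h hm hh ρ s hρ
    constructor
    · have h1 : ‖avg h (ρ, s)‖ₑ ≤
          ENNReal.ofReal (C * ρ⁻¹) * ∫⁻ t in Icc (s - ρ) (s + ρ), ‖h t‖ₑ := by
        refine (enorm_integral_le_lintegral_enorm _).trans
          (lintegral_le_setLIntegral_Icc (fun t ht => ?_) (fun t => ?_) hm.enorm)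
        · rw [kern_eq_zero hρ ht.le, mul_zero, enorm_zero]
        · rw [enorm_mul, mul_comm, ← ofReal_norm (kern _ _)]
          gcongr
          exact (hk ρ (s - t) hρ).1
      refine (pow_le_pow_left₀ zero_le h1 2).trans ?_
      rw [mul_pow]
      refine (mul_le_mul_right (sq_lintegral_Icc_le hm.enorm s ρ) _).trans_eq ?_
      have e := ofReal_mul_two_mul_sq hC hρ 0
      simp only [zero_add, pow_one, mul_zero] at e
      rw [← mul_assoc, e]
    · have h1 : ‖fderiv ℝ (avg h) (ρ, s)‖ₑ ≤
          ENNReal.ofReal (C * ρ⁻¹ ^ 2) * ∫⁻ t in Icc (s - ρ) (s + ρ), ‖h t‖ₑ := by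
        rw [(hasFDerivAt_avg hh (q := (ρ, s)) hρ).fderiv]
        refine (enorm_integral_le_lintegral_enorm _).trans
          (lintegral_le_setLIntegral_Icc (fun t ht => ?_) (fun t => ?_) hm.enorm)
        · rw [(hk ρ (s - t) hρ).2.2 ht, map_zero]
          exact enorm_zero (E := ℝ × ℝ →L[ℝ] ℂ)
        · have h2 : ‖(ContinuousLinearMap.mul ℝ ℂ).precompR (ℝ × ℝ) (h t)
              (fderiv ℝ ↿kern (ρ, s - t))‖ ≤ C * ρ⁻¹ ^ 2 * ‖h t‖ := by
            rw [ContinuousLinearMap.precompR_apply, ContinuousLinearMap.compL_apply, mul_comm]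
            refine (ContinuousLinearMap.opNorm_comp_le _ _).trans ?_
            gcongr
            · exact ContinuousLinearMap.opNorm_mul_apply_le ℝ ℂ (h t)
            · exact (hk ρ (s - t) hρ).2.1
          rw [← ofReal_norm, ← ofReal_norm, ← ENNReal.ofReal_mul (by positivity)]
          exact ENNReal.ofReal_le_ofReal h2
      refine (pow_le_pow_left₀ zero_le h1 2).trans ?_
      rw [mul_pow]
      refine (mul_le_mul_right (sq_lintegral_Icc_le hm.enorm s ρ) _).trans_eq ?_
      rw [← mul_assoc, ofReal_mul_two_mul_sq hC hρ 1]
  refine ⟨2 * C ^ 2, by positivity, fun h hm hh ρ s hρ => ⟨(key h hm hh ρ s hρ).1, ?_, ?_⟩⟩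
  · rw [← avg_sub_const hh (h s) (q := (ρ, s)) hρ]
    exact (key _ (hm.sub_const _) (hh.sub (locallyIntegrable_const _)) ρ s hρ).1
  · have hev : avg h =ᶠ[𝓝 (ρ, s)] fun q => avg (fun t => h t - h s) q + h s := by
      filter_upwards [(isOpen_lt continuous_const continuous_fst).mem_nhds
        (show (0 : ℝ) < ((ρ, s) : ℝ × ℝ).1 from hρ)] with q hq
      rw [avg_sub_const hh (h s) hq, sub_add_cancel]
    rw [hev.fderiv_eq, fderiv_add_const]
    exact (key _ (hm.sub_const _) (hh.sub (locallyIntegrable_const _)) ρ s hρ).2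

/-- The squared norm of `h` in `L²((1 + e^s) ds)`. -/
def weightSq (h : ℝ → ℂ) : ℝ≥0∞ := ∫⁻ s, ENNReal.ofReal (1 + Real.exp s) * ‖h s‖ₑ ^ 2

/-- The kernel `(t - s)⁻²` on `|t - s| ≤ 2`. -/
def nearKer (τ : ℝ) : ℝ≥0∞ := (Icc (-2) 2).indicator (fun τ => ENNReal.ofReal ((τ ^ 2)⁻¹)) τ

/-- A Sobolev–Slobodeckij seminorm of order `1/2`. -/
def slobSq (h : ℝ → ℂ) : ℝ≥0∞ := ∫⁻ s, ∫⁻ t, nearKer (t - s) * ‖h t - h s‖ₑ ^ 2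

lemma measurable_nearKer : Measurable nearKer :=
  Measurable.indicator (by fun_prop) measurableSet_Icc

lemma lintegral_window {F : ℝ → ℝ≥0∞} (hF : Measurable F) (ρ : ℝ) :
    ∫⁻ s, ∫⁻ t in Icc (s - ρ) (s + ρ), F t = ENNReal.ofReal (2 * ρ) * ∫⁻ t, F t := by
  have hS : MeasurableSet {p : ℝ × ℝ | p.2 ∈ Icc (p.1 - ρ) (p.1 + ρ)} := by
    have h1 : MeasurableSet {p : ℝ × ℝ | p.1 - ρ ≤ p.2} := measurableSet_le (by fun_prop) (by fun_prop)
    have h2 : MeasurableSet {p : ℝ × ℝ | p.2 ≤ p.1 + ρ} := measurableSet_le (by fun_prop) (by fun_prop)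
    exact h1.inter h2
  have hm : Measurable (Function.uncurry fun s t => (Icc (s - ρ) (s + ρ)).indicator F t) := by
    have : (Function.uncurry fun s t => (Icc (s - ρ) (s + ρ)).indicator F t) =
        {p : ℝ × ℝ | p.2 ∈ Icc (p.1 - ρ) (p.1 + ρ)}.indicator fun p => F p.2 := by
      funext p; rfl
    rw [this]
    exact (hF.comp measurable_snd).indicator hS
  simp_rw [← lintegral_indicator measurableSet_Icc]
  rw [lintegral_lintegral_swap hm.aemeasurable, ← lintegral_const_mul _ hF]
  refine lintegral_congr fun t => ?_
  have : ∀ s, (Icc (s - ρ) (s + ρ)).indicator F t =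
      (Icc (t - ρ) (t + ρ)).indicator (fun _ => F t) s := by
    intro s
    by_cases h : t ∈ Icc (s - ρ) (s + ρ)
    · rw [indicator_of_mem h, indicator_of_mem
        (show s ∈ Icc (t - ρ) (t + ρ) from ⟨by linarith [h.2], by linarith [h.1]⟩)]
    · rw [indicator_of_notMem h, indicator_of_notMem fun h' => h
        (show t ∈ Icc (s - ρ) (s + ρ) from ⟨by linarith [h'.2], by linarith [h'.1]⟩)]
  simp_rw [this]
  rw [lintegral_indicator measurableSet_Icc, setLIntegral_const, Real.volume_Icc, mul_comm]
  ring_nf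

lemma lintegral_Ioi_inv_cube {a : ℝ} (ha : 0 < a) :
    ∫⁻ ρ in Ioi a, ENNReal.ofReal (ρ⁻¹ ^ 3) ≤ ENNReal.ofReal ((a ^ 2)⁻¹) := by
  have hpos : ∀ ρ ∈ Ioi a, 0 < ρ := fun ρ hρ => ha.trans hρ
  have h1 : ∫⁻ ρ in Ioi a, ENNReal.ofReal (ρ⁻¹ ^ 3) =
      ∫⁻ ρ in Ioi a, ENNReal.ofReal (ρ ^ (-3 : ℝ)) := by
    refine setLIntegral_congr_fun measurableSet_Ioi fun ρ hρ => ?_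
    rw [Real.rpow_neg (hpos ρ hρ).le, inv_pow]
    norm_cast
  rw [h1, ← ofReal_integral_eq_lintegral_ofReal
    (integrableOn_Ioi_rpow_of_lt (by norm_num) ha) (by
      filter_upwards [ae_restrict_mem measurableSet_Ioi] with ρ hρ
      exact Real.rpow_nonneg (hpos ρ hρ).le _), integral_Ioi_rpow_of_lt (by norm_num) ha]
  refine ENNReal.ofReal_le_ofReal ?_
  have : a ^ (-3 + 1 : ℝ) = (a ^ 2)⁻¹ := by
    rw [show (-3 + 1 : ℝ) = -2 by norm_num, Real.rpow_neg ha.le]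
    norm_cast
  rw [this, show -(a ^ 2)⁻¹ / (-3 + 1) = (a ^ 2)⁻¹ / 2 by ring]
  exact half_le_self (by positivity)

/-- The kernel `C ρ⁻³` on the cone `|τ| ≤ ρ`. -/
def coneKer (C ρ τ : ℝ) : ℝ≥0∞ :=
  {p : ℝ × ℝ | |p.2| ≤ p.1}.indicator (fun p => ENNReal.ofReal (C * p.1⁻¹ ^ 3)) (ρ, τ)

lemma coneKer_of_le {C ρ τ : ℝ} (h : |τ| ≤ ρ) : coneKer C ρ τ = ENNReal.ofReal (C * ρ⁻¹ ^ 3) :=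
  indicator_of_mem (s := {p : ℝ × ℝ | |p.2| ≤ p.1}) h _

lemma coneKer_of_not_le {C ρ τ : ℝ} (h : ¬|τ| ≤ ρ) : coneKer C ρ τ = 0 :=
  indicator_of_notMem (s := {p : ℝ × ℝ | |p.2| ≤ p.1}) h _

lemma measurable_coneKer (C : ℝ) : Measurable (Function.uncurry (coneKer C)) :=
  Measurable.indicator (f := fun p : ℝ × ℝ => ENNReal.ofReal (C * p.1⁻¹ ^ 3)) (by fun_prop)
    (measurableSet_le (by fun_prop) (by fun_prop))

lemma setLIntegral_coneKer_le {C τ : ℝ} (hC : 0 ≤ C) (hτ : τ ≠ 0) :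
    ∫⁻ ρ in Ioo 0 2, coneKer C ρ τ ≤ ENNReal.ofReal C * nearKer τ := by
  have ha : 0 < |τ| := abs_pos.mpr hτ
  by_cases h2 : |τ| ≤ 2
  · rw [nearKer, indicator_of_mem (show τ ∈ Icc (-2) 2 from abs_le.mp h2), ← sq_abs]
    refine le_trans ?_ (mul_le_mul_right (lintegral_Ioi_inv_cube ha) _)
    rw [← lintegral_const_mul _ (by fun_prop), ← lintegral_indicator measurableSet_Ioi,
      ← lintegral_indicator measurableSet_Ioo]
    refine lintegral_mono_ae ?_
    have hne : ∀ᵐ ρ : ℝ, ρ ≠ |τ| := by simp [ae_iff]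
    filter_upwards [hne] with ρ hρ
    by_cases h : |τ| ≤ ρ ∧ ρ ∈ Ioo 0 2
    · rw [indicator_of_mem h.2, indicator_of_mem (show ρ ∈ Ioi |τ| from
        lt_of_le_of_ne h.1 hρ.symm), ← ENNReal.ofReal_mul hC, coneKer_of_le h.1]
    · refine le_of_eq_of_le (b := 0) ?_ zero_le
      by_cases h' : ρ ∈ Ioo 0 2
      · rw [indicator_of_mem h']
        exact coneKer_of_not_le fun hc => h ⟨hc, h'⟩
      · exact indicator_of_notMem h' _
  · have : ∫⁻ ρ in Ioo 0 2, coneKer C ρ τ = ∫⁻ ρ in Ioo (0 : ℝ) 2, 0 :=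
      setLIntegral_congr_fun measurableSet_Ioo fun ρ hρ =>
        coneKer_of_not_le fun hc => h2 (hc.trans hρ.2.le)
    rw [this, lintegral_zero]
    exact zero_le

lemma lintegral_lintegral_coneKer_le {C : ℝ} (hC : 0 ≤ C) {D : ℝ → ℝ → ℝ≥0∞}
    (hD : Measurable (Function.uncurry D)) (hD0 : ∀ s, D s s = 0) :
    ∫⁻ ρ in Ioo 0 2, ∫⁻ s, ∫⁻ t, coneKer C ρ (t - s) * D s t ≤
      ENNReal.ofReal C * ∫⁻ s, ∫⁻ t, nearKer (t - s) * D s t := by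
  have hm3 : Measurable fun p : (ℝ × ℝ) × ℝ => coneKer C p.1.1 (p.2 - p.1.2) * D p.1.2 p.2 :=
    ((measurable_coneKer C).comp
      (by fun_prop : Measurable fun p : (ℝ × ℝ) × ℝ => (p.1.1, p.2 - p.1.2))).mul
      (hD.comp (by fun_prop : Measurable fun p : (ℝ × ℝ) × ℝ => (p.1.2, p.2)))
  have hn : Measurable fun p : ℝ × ℝ => nearKer (p.2 - p.1) * D p.1 p.2 :=
    (measurable_nearKer.comp (by fun_prop)).mul hD
  rw [lintegral_lintegral_swap (f := fun ρ s => ∫⁻ t, coneKer C ρ (t - s) * D s t)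
    hm3.lintegral_prod_right'.aemeasurable, ← lintegral_const_mul _ hn.lintegral_prod_right']
  refine lintegral_mono fun s => ?_
  have hs : Measurable fun p : ℝ × ℝ => coneKer C p.1 (p.2 - s) * D s p.2 :=
    hm3.comp (by fun_prop : Measurable fun p : ℝ × ℝ => ((p.1, s), p.2))
  have hns : Measurable fun t => nearKer (t - s) * D s t :=
    hn.comp (by fun_prop : Measurable fun t : ℝ => (s, t))
  simp only
  rw [lintegral_lintegral_swap (f := fun ρ t => coneKer C ρ (t - s) * D s t) hs.aemeasurable,
    ← lintegral_const_mul _ hns]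
  refine lintegral_mono fun t => ?_
  simp only
  have hk : Measurable fun ρ => coneKer C ρ (t - s) :=
    (measurable_coneKer C).comp (by fun_prop : Measurable fun ρ : ℝ => (ρ, t - s))
  rw [lintegral_mul_const _ hk, ← mul_assoc]
  by_cases hts : t - s = 0
  · rw [sub_eq_zero.mp hts, hD0, mul_zero, mul_zero]
  · exact mul_le_mul_left (setLIntegral_coneKer_le hC hts) _

lemma measurable_enorm_sub_sq {h : ℝ → ℂ} (hm : Measurable h) :
    Measurable (Function.uncurry fun s t => ‖h t - h s‖ₑ ^ 2) :=
  ((hm.comp measurable_snd).sub (hm.comp measurable_fst)).enorm.pow_const 2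

lemma lintegral_fderiv_avg_le : ∃ C : ℝ, 0 ≤ C ∧ ∀ (h : ℝ → ℂ), Measurable h →
    LocallyIntegrable h → ∀ ε : ℝ, 0 < ε → ε ≤ 1 →
      ∫⁻ θ in Ioo 0 1, ∫⁻ s, ‖fderiv ℝ (avg h) (θ + ε, s)‖ₑ ^ 2 ≤ ENNReal.ofReal C * slobSq h := by
  obtain ⟨C, hC, hb⟩ := exists_avg_bound
  refine ⟨C, hC, fun h hm hh ε hε hε1 => ?_⟩
  let G : ℝ → ℝ≥0∞ := fun ρ => ∫⁻ s, ∫⁻ t, coneKer C ρ (t - s) * ‖h t - h s‖ₑ ^ 2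
  have hbound : ∀ ρ, 0 < ρ → ∫⁻ s, ‖fderiv ℝ (avg h) (ρ, s)‖ₑ ^ 2 ≤ G ρ := by
    intro ρ hρ
    refine lintegral_mono fun s => ((hb h hm hh ρ s hρ).2.2).trans ?_
    rw [← lintegral_const_mul _ (by fun_prop), ← lintegral_indicator measurableSet_Icc]
    refine lintegral_mono fun t => ?_
    by_cases ht : t ∈ Icc (s - ρ) (s + ρ)
    · have : |t - s| ≤ ρ := abs_le.mpr ⟨by linarith [ht.1], by linarith [ht.2]⟩
      rw [indicator_of_mem ht, coneKer_of_le this]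
    · rw [indicator_of_notMem ht]
      exact zero_le
  calc ∫⁻ θ in Ioo 0 1, ∫⁻ s, ‖fderiv ℝ (avg h) (θ + ε, s)‖ₑ ^ 2
      ≤ ∫⁻ θ in Ioo 0 1, G (θ + ε) :=
        setLIntegral_mono' measurableSet_Ioo fun θ hθ => hbound _ (add_pos hθ.1 hε)
    _ ≤ ∫⁻ θ, (Ioo 0 2).indicator G (θ + ε) := by
        rw [← lintegral_indicator measurableSet_Ioo]
        refine lintegral_mono fun θ => ?_
        by_cases hθ : θ ∈ Ioo (0 : ℝ) 1
        · rw [indicator_of_mem hθ, indicator_of_mem (show θ + ε ∈ Ioo 0 2 from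
            ⟨add_pos hθ.1 hε, by linarith [hθ.2]⟩)]
        · rw [indicator_of_notMem hθ]
          exact zero_le
    _ = ∫⁻ ρ in Ioo 0 2, G ρ := by
        rw [lintegral_add_right_eq_self (fun ρ => (Ioo 0 2).indicator G ρ) ε,
          lintegral_indicator measurableSet_Ioo]
    _ ≤ _ := lintegral_lintegral_coneKer_le hC (measurable_enorm_sub_sq hm) (by simp)

lemma one_add_exp_le {s t ρ : ℝ} (h : s ≤ t + ρ) (hρ : 0 ≤ ρ) :
    1 + Real.exp s ≤ Real.exp ρ * (1 + Real.exp t) := by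
  have h1 : Real.exp s ≤ Real.exp ρ * Real.exp t := by
    rw [← Real.exp_add]
    exact Real.exp_le_exp.mpr (by linarith)
  linarith [Real.one_le_exp hρ]

lemma setLIntegral_indicator_Iio_le (a : ℝ) (c : ℝ≥0∞) :
    ∫⁻ θ in Ioo 0 1, (Iio a).indicator (fun _ => c) θ ≤ ENNReal.ofReal a * c := by
  rw [← lintegral_indicator measurableSet_Ioo]
  calc _ ≤ ∫⁻ θ, (Ioo 0 a).indicator (fun _ => c) θ := by
        refine lintegral_mono fun θ => ?_
        by_cases h : θ ∈ Ioo (0 : ℝ) 1 ∧ θ ∈ Iio a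
        · rw [indicator_of_mem h.1, indicator_of_mem h.2,
            indicator_of_mem (show θ ∈ Ioo 0 a from ⟨h.1.1, h.2⟩)]
        · refine le_of_eq_of_le (b := 0) ?_ zero_le
          by_cases h' : θ ∈ Ioo (0 : ℝ) 1
          · rw [indicator_of_mem h', indicator_of_notMem fun hc => h ⟨h', hc⟩]
          · exact indicator_of_notMem h' _
    _ = _ := by
        rw [lintegral_indicator measurableSet_Ioo, setLIntegral_const, Real.volume_Ioo, mul_comm,
          sub_zero]

/-- The energy density of the averages of `h` on the region `θ (1 + e^s) < 1`. -/
def coneSq (h : ℝ → ℂ) (ε θ s : ℝ) : ℝ≥0∞ := {s | θ * (1 + Real.exp s) < 1}.indicator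
  (fun s => ENNReal.ofReal ((1 + Real.exp s) ^ 2) * ‖avg h (θ + ε, s)‖ₑ ^ 2) s

lemma coneSq_of_lt {h : ℝ → ℂ} {ε θ s : ℝ} (hs : θ * (1 + Real.exp s) < 1) :
    coneSq h ε θ s = ENNReal.ofReal ((1 + Real.exp s) ^ 2) * ‖avg h (θ + ε, s)‖ₑ ^ 2 :=
  indicator_of_mem (s := {s | θ * (1 + Real.exp s) < 1}) hs _

lemma lintegral_cone_avg_le : ∃ K : ℝ, 0 ≤ K ∧ ∀ (h : ℝ → ℂ), Measurable h →
    LocallyIntegrable h → ∀ ε : ℝ, 0 < ε → ε ≤ 1 →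
      ∫⁻ θ in Ioo 0 1, ∫⁻ s, coneSq h ε θ s ≤
      ENNReal.ofReal K * weightSq h := by
  obtain ⟨C, hC, hb⟩ := exists_avg_bound
  let E := Real.exp 2
  have hE : 0 < E := Real.exp_pos 2
  have hm0 : ∀ s, 0 < 1 + Real.exp s := fun s => by positivity
  refine ⟨2 * C * E ^ 3, by positivity, fun h hm hh ε hε hε1 => ?_⟩
  let F : ℝ → ℝ → ℝ≥0∞ := fun θ t => (Iio (E / (1 + Real.exp t))).indicator
    (fun _ => ENNReal.ofReal (E ^ 2 * (1 + Real.exp t) ^ 2) * ‖h t‖ₑ ^ 2) θ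
  have hF : Measurable (Function.uncurry F) := by
    have hS : MeasurableSet {p : ℝ × ℝ | p.1 < E / (1 + Real.exp p.2)} :=
      measurableSet_lt (by fun_prop) (by fun_prop)
    exact Measurable.indicator (f := fun p : ℝ × ℝ =>
      ENNReal.ofReal (E ^ 2 * (1 + Real.exp p.2) ^ 2) * ‖h p.2‖ₑ ^ 2) (by fun_prop) hS
  have hFθ : ∀ θ, Measurable (F θ) := fun θ => hF.comp (by fun_prop : Measurable fun t : ℝ => (θ, t))
  have hpt : ∀ θ ∈ Ioo (0 : ℝ) 1, ∀ s, coneSq h ε θ s ≤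
      ENNReal.ofReal (C * (θ + ε)⁻¹) * ∫⁻ t in Icc (s - (θ + ε)) (s + (θ + ε)), F θ t := by
    intro θ hθ s
    by_cases hs : θ * (1 + Real.exp s) < 1
    · rw [coneSq_of_lt hs]
      refine (mul_le_mul_right (hb h hm hh (θ + ε) s (add_pos hθ.1 hε)).1 _).trans ?_
      rw [mul_left_comm]
      refine mul_le_mul_right ?_ _
      rw [← lintegral_const_mul _ (by fun_prop)]
      refine setLIntegral_mono (hFθ θ) fun t ht => ?_
      have h1 := one_add_exp_le (s := s) (t := t) (ρ := 2) (by linarith [ht.1, hθ.2]) (by norm_num)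
      have h2 := one_add_exp_le (s := t) (t := s) (ρ := 2) (by linarith [ht.2, hθ.2]) (by norm_num)
      have h3 : θ ∈ Iio (E / (1 + Real.exp t)) := by
        rw [mem_Iio, lt_div_iff₀ (hm0 t)]
        calc θ * (1 + Real.exp t) ≤ θ * (E * (1 + Real.exp s)) :=
              mul_le_mul_of_nonneg_left h2 hθ.1.le
          _ = E * (θ * (1 + Real.exp s)) := by ring
          _ < E * 1 := mul_lt_mul_of_pos_left hs hE
          _ = E := mul_one E
      simp only [F]
      rw [indicator_of_mem h3, ← mul_pow]
      gcongr
    · exact (indicator_of_notMem (s := {s | θ * (1 + Real.exp s) < 1}) hs _).trans_le zero_le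
  have hθ2 : ∀ θ ∈ Ioo (0 : ℝ) 1, ∫⁻ s, coneSq h ε θ s ≤
      ENNReal.ofReal (2 * C) * ∫⁻ t, F θ t := by
    intro θ hθ
    have hρ : 0 < θ + ε := add_pos hθ.1 hε
    refine (lintegral_mono (hpt θ hθ)).trans ?_
    rw [lintegral_const_mul' _ _ ENNReal.ofReal_ne_top, lintegral_window (hFθ θ), ← mul_assoc,
      ← ENNReal.ofReal_mul (by positivity)]
    refine le_of_eq (congrArg (fun x => ENNReal.ofReal x * _) ?_)
    field_simp
  refine (setLIntegral_mono' measurableSet_Ioo hθ2).trans ?_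
  rw [lintegral_const_mul' _ _ ENNReal.ofReal_ne_top,
    lintegral_lintegral_swap (f := F) hF.aemeasurable, weightSq,
    ← lintegral_const_mul' _ _ ENNReal.ofReal_ne_top,
    ← lintegral_const_mul' _ _ ENNReal.ofReal_ne_top]
  refine lintegral_mono fun t => ?_
  refine (mul_le_mul_right (setLIntegral_indicator_Iio_le _ _) _).trans_eq ?_
  have := hm0 t
  rw [← mul_assoc, ← mul_assoc, ← mul_assoc, ← ENNReal.ofReal_mul (by positivity),
    ← ENNReal.ofReal_mul (by positivity), ← ENNReal.ofReal_mul (by positivity)]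
  refine congrArg (fun x => ENNReal.ofReal x * _) ?_
  field_simp

lemma tendsto_setLIntegral_Ioi {f : ℝ → ℝ≥0∞} (hf : Measurable f) (hfin : ∫⁻ t, f t ≠ ⊤) :
    Tendsto (fun n : ℕ => ∫⁻ t in Ioi (n : ℝ), f t) atTop (𝓝 0) := by
  simp_rw [← lintegral_indicator measurableSet_Ioi]
  rw [← lintegral_zero (α := ℝ) (μ := volume)]
  refine tendsto_lintegral_of_dominated_convergence f (fun n => hf.indicator measurableSet_Ioi)
    (fun n => .of_forall fun t => indicator_le_self _ _ t) hfin (.of_forall fun t => ?_)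
  obtain ⟨N, hN⟩ := exists_nat_ge t
  refine tendsto_const_nhds.congr' ?_
  filter_upwards [eventually_ge_atTop N] with n hn
  rw [indicator_of_notMem]
  exact not_lt.mpr (hN.trans (by exact_mod_cast hn))

lemma lintegral_avg_sub_le : ∃ C : ℝ, 0 ≤ C ∧ ∀ (h : ℝ → ℂ), Measurable h →
    LocallyIntegrable h → ∀ ε : ℝ, 0 < ε → ε ≤ 1 → ∀ S : ℝ,
      ∫⁻ s, ENNReal.ofReal (Real.exp s) * ‖avg h (ε, s) - h s‖ₑ ^ 2 ≤
        ENNReal.ofReal (Real.exp (S + 1) * C * ε) * slobSq h +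
          ENNReal.ofReal C * ∫⁻ t in Ioi S, ENNReal.ofReal (Real.exp t) * ‖h t‖ₑ ^ 2 := by
  obtain ⟨C, hC, hb⟩ := exists_avg_bound
  refine ⟨max C (4 * C * Real.exp 1 + 2), hC.trans (le_max_left _ _),
    fun h hm hh ε hε hε1 S => ?_⟩
  have hD := measurable_enorm_sub_sq hm
  let f : ℝ → ℝ≥0∞ := fun t => ENNReal.ofReal (Real.exp t) * ‖h t‖ₑ ^ 2
  have hf : Measurable f := by fun_prop
  rw [← lintegral_add_compl _ (measurableSet_Iic (a := S + 1)), compl_Iic]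
  refine add_le_add ?_ ?_
  · rw [slobSq, ← lintegral_const_mul' _ _ ENNReal.ofReal_ne_top]
    refine le_trans ?_ (setLIntegral_le_lintegral (Iic (S + 1)) _)
    refine setLIntegral_mono' measurableSet_Iic fun s hs => ?_
    refine (mul_le_mul_right (hb h hm hh ε s hε).2.1 _).trans ?_
    rw [← mul_assoc, ← ENNReal.ofReal_mul (by positivity),
      ← lintegral_const_mul' _ _ ENNReal.ofReal_ne_top,
      ← lintegral_const_mul' _ _ ENNReal.ofReal_ne_top, ← lintegral_indicator measurableSet_Icc]
    refine lintegral_mono fun t => ?_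
    by_cases ht : t ∈ Icc (s - ε) (s + ε)
    · rw [indicator_of_mem ht]
      by_cases hts : t - s = 0
      · simp [sub_eq_zero.mp hts]
      · have ha : |t - s| ≤ ε := abs_le.mpr ⟨by linarith [ht.1], by linarith [ht.2]⟩
        rw [nearKer, indicator_of_mem
          (show t - s ∈ Icc (-2) 2 from abs_le.mp (ha.trans (by linarith))),
          ← mul_assoc (ENNReal.ofReal _) (ENNReal.ofReal _), ← ENNReal.ofReal_mul (by positivity)]
        refine mul_le_mul_left (ENNReal.ofReal_le_ofReal ?_) _
        have h2 : 0 < (t - s) ^ 2 := by positivity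
        have h3 : ε⁻¹ ≤ ε * ((t - s) ^ 2)⁻¹ := by
          rw [← div_eq_mul_inv, le_div_iff₀ h2, ← sq_abs, inv_mul_le_iff₀ hε, ← sq]
          gcongr
        calc Real.exp s * (C * ε⁻¹)
            ≤ Real.exp (S + 1) * (max C (4 * C * Real.exp 1 + 2) * (ε * ((t - s) ^ 2)⁻¹)) := by
              gcongr
              · exact hs
              · exact le_max_left _ _
          _ = _ := by ring
    · rw [indicator_of_notMem ht]
      exact zero_le
  · have h1 : ∫⁻ s in Ioi (S + 1), ENNReal.ofReal (Real.exp s) * ‖avg h (ε, s)‖ₑ ^ 2 ≤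
        ENNReal.ofReal (2 * C * Real.exp 1) * ∫⁻ t in Ioi S, f t := by
      have h2 : ∀ s, (Ioi (S + 1)).indicator
          (fun s => ENNReal.ofReal (Real.exp s) * ‖avg h (ε, s)‖ₑ ^ 2) s ≤
          ENNReal.ofReal (C * ε⁻¹ * Real.exp 1) *
            ∫⁻ t in Icc (s - ε) (s + ε), (Ioi S).indicator f t := by
        intro s
        by_cases hs : s ∈ Ioi (S + 1)
        · rw [indicator_of_mem hs]
          refine (mul_le_mul_right (hb h hm hh ε s hε).1 _).trans ?_
          rw [← mul_assoc, ← ENNReal.ofReal_mul (by positivity),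
            ← lintegral_const_mul' _ _ ENNReal.ofReal_ne_top,
            ← lintegral_const_mul' _ _ ENNReal.ofReal_ne_top]
          refine setLIntegral_mono' measurableSet_Icc fun t ht => ?_
          have hs' : S + 1 < s := hs
          rw [indicator_of_mem (show t ∈ Ioi S from by rw [mem_Ioi]; linarith [ht.1])]
          simp only [f]
          rw [← mul_assoc (ENNReal.ofReal _) (ENNReal.ofReal _), ← ENNReal.ofReal_mul (by positivity)]
          refine mul_le_mul_left (ENNReal.ofReal_le_ofReal ?_) _
          have h3 : Real.exp s ≤ Real.exp 1 * Real.exp t := by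
            rw [← Real.exp_add]
            exact Real.exp_le_exp.mpr (by linarith [ht.1])
          calc Real.exp s * (C * ε⁻¹) ≤ Real.exp 1 * Real.exp t * (C * ε⁻¹) := by gcongr
            _ = _ := by ring
        · rw [indicator_of_notMem hs]
          exact zero_le
      rw [← lintegral_indicator measurableSet_Ioi]
      refine (lintegral_mono h2).trans ?_
      rw [lintegral_const_mul' _ _ ENNReal.ofReal_ne_top,
        lintegral_window (hf.indicator measurableSet_Ioi), ← mul_assoc,
        ← ENNReal.ofReal_mul (by positivity), lintegral_indicator measurableSet_Ioi]
      refine le_of_eq (congrArg (fun x => ENNReal.ofReal x * _) ?_)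
      field_simp
    have h4 : ∀ s, ENNReal.ofReal (Real.exp s) * ‖avg h (ε, s) - h s‖ₑ ^ 2 ≤
        2 * (ENNReal.ofReal (Real.exp s) * ‖avg h (ε, s)‖ₑ ^ 2) + 2 * f s := by
      intro s
      have h5 := enorm_add_sq_le (avg h (ε, s)) (-h s)
      rw [enorm_neg, ← sub_eq_add_neg] at h5
      refine (mul_le_mul_right h5 _).trans_eq ?_
      simp only [f]
      ring
    refine (lintegral_mono h4).trans ?_
    rw [lintegral_add_right _ (by fun_prop), lintegral_const_mul' _ _ (by simp),
      lintegral_const_mul' _ _ (by simp)]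
    have h6 : ∫⁻ s in Ioi (S + 1), f s ≤ ∫⁻ s in Ioi S, f s :=
      lintegral_mono_set (Ioi_subset_Ioi (by linarith))
    calc _ ≤ 2 * (ENNReal.ofReal (2 * C * Real.exp 1) * ∫⁻ t in Ioi S, f t) +
          2 * ∫⁻ s in Ioi S, f s := by gcongr
      _ = ENNReal.ofReal (4 * C * Real.exp 1 + 2) * ∫⁻ t in Ioi S, f t := by
        rw [← mul_assoc, ← add_mul, show (2 : ℝ≥0∞) = ENNReal.ofReal 2 by simp,
          ← ENNReal.ofReal_mul (by norm_num), ← ENNReal.ofReal_add (by positivity) (by norm_num)]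
        ring_nf
      _ ≤ _ := by
        gcongr
        exact le_max_right _ _

lemma tendsto_lintegral_avg_sub {h : ℝ → ℂ} (hm : Measurable h) (hh : LocallyIntegrable h)
    (hw : weightSq h < ⊤) (hs : slobSq h < ⊤) :
    Tendsto (fun n : ℕ => ∫⁻ s, ENNReal.ofReal (Real.exp s) *
      ‖avg h (1 / ((n : ℝ) + 1), s) - h s‖ₑ ^ 2) atTop (𝓝 0) := by
  obtain ⟨C, hC, hb⟩ := lintegral_avg_sub_le
  have hfin : ∫⁻ t, ENNReal.ofReal (Real.exp t) * ‖h t‖ₑ ^ 2 ≠ ⊤ := by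
    refine ((lintegral_mono fun t => ?_).trans_lt hw).ne
    gcongr
    linarith
  have ht := tendsto_setLIntegral_Ioi (by fun_prop) hfin
  have ht' := ENNReal.Tendsto.const_mul ht (Or.inr (ENNReal.ofReal_ne_top (r := C)))
  rw [mul_zero] at ht'
  refine ENNReal.tendsto_nhds_zero.mpr fun δ hδ => ?_
  have hδ2 : 0 < δ / 2 := ENNReal.half_pos hδ.ne'
  obtain ⟨N, hN⟩ := (ENNReal.tendsto_nhds_zero.mp ht' _ hδ2).exists
  have hl : Tendsto (fun n : ℕ => ENNReal.ofReal (Real.exp (N + 1) * C * (1 / ((n : ℝ) + 1))) *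
      slobSq h) atTop (𝓝 0) := by
    have h1 : Tendsto (fun n : ℕ => Real.exp (N + 1) * C * (1 / ((n : ℝ) + 1))) atTop (𝓝 0) := by
      simpa using tendsto_one_div_add_atTop_nhds_zero_nat.const_mul (Real.exp (N + 1) * C)
    have h2 := ENNReal.Tendsto.mul_const (ENNReal.tendsto_ofReal h1) (Or.inr hs.ne)
    simpa using h2
  filter_upwards [ENNReal.tendsto_nhds_zero.mp hl _ hδ2] with n hn
  have hpos : (0 : ℝ) < n + 1 := by positivity
  refine (hb h hm hh _ (one_div_pos.mpr hpos) (by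
    rw [div_le_one hpos]; linarith [n.cast_nonneg (α := ℝ)]) N).trans ?_
  exact (add_le_add hn hN).trans_eq (ENNReal.add_halves δ)

lemma sq_exp_sub_exp_le {s t : ℝ} (h : |t - s| ≤ 2) :
    (Real.exp s - Real.exp t) ^ 2 ≤ Real.exp 2 * (Real.exp s * Real.exp t) * (t - s) ^ 2 := by
  have key : ∀ s t : ℝ, s ≤ t → t - s ≤ 2 →
      (Real.exp t - Real.exp s) ^ 2 ≤ Real.exp 2 * (Real.exp s * Real.exp t) * (t - s) ^ 2 := by
    intro s t hst h2
    have h1 : Real.exp t - Real.exp s ≤ Real.exp t * (t - s) := by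
      have := mul_le_mul_of_nonneg_left (Real.add_one_le_exp (s - t)) (Real.exp_pos t).le
      rw [← Real.exp_add, add_sub_cancel] at this
      linarith
    have h0 : 0 ≤ Real.exp t - Real.exp s := sub_nonneg.mpr (Real.exp_le_exp.mpr hst)
    calc (Real.exp t - Real.exp s) ^ 2 ≤ (Real.exp t * (t - s)) ^ 2 := by gcongr
      _ = Real.exp t * Real.exp t * (t - s) ^ 2 := by ring
      _ ≤ Real.exp 2 * (Real.exp s * Real.exp t) * (t - s) ^ 2 := by
        rw [← mul_assoc (Real.exp 2), ← Real.exp_add 2 s]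
        gcongr
        linarith
  have h' := abs_le.mp h
  rcases le_total s t with hst | hst
  · have := key s t hst h'.2
    rwa [sub_sq_comm (Real.exp s)]
  · have := key t s hst (by linarith)
    rw [sub_sq_comm t, mul_comm (Real.exp s)]
    exact this

lemma nearKer_mul_le (h : ℝ → ℂ) (s t : ℝ) : nearKer (t - s) * ‖h t - h s‖ₑ ^ 2 ≤
    ENNReal.ofReal (Real.exp 2) * (ENNReal.ofReal (Real.exp s) * (ENNReal.ofReal (Real.exp t) *
      ENNReal.ofReal (‖h s - h t‖ ^ 2 / (Real.exp s - Real.exp t) ^ 2))) := by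
  by_cases hts : t - s = 0
  · simp [sub_eq_zero.mp hts]
  by_cases h2 : t - s ∈ Icc (-2) 2
  · rw [nearKer, indicator_of_mem h2, ← ofReal_norm, ← ENNReal.ofReal_pow (norm_nonneg _),
      ← ENNReal.ofReal_mul (by positivity), ← ENNReal.ofReal_mul (by positivity),
      ← ENNReal.ofReal_mul (by positivity), ← ENNReal.ofReal_mul (by positivity), norm_sub_rev]
    refine ENNReal.ofReal_le_ofReal ?_
    have hne : Real.exp s - Real.exp t ≠ 0 := fun hc =>
      hts (by rw [Real.exp_injective (sub_eq_zero.mp hc), sub_self])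
    have hp : 0 < (Real.exp s - Real.exp t) ^ 2 := by positivity
    have hq : 0 < (t - s) ^ 2 := by positivity
    have h3 : ((t - s) ^ 2)⁻¹ ≤
        Real.exp 2 * (Real.exp s * Real.exp t) / (Real.exp s - Real.exp t) ^ 2 := by
      rw [le_div_iff₀ hp, inv_mul_le_iff₀ hq, mul_comm]
      exact sq_exp_sub_exp_le (abs_le.mpr h2)
    calc _ ≤ Real.exp 2 * (Real.exp s * Real.exp t) / (Real.exp s - Real.exp t) ^ 2 *
          ‖h s - h t‖ ^ 2 := by gcongr
      _ = _ := by ring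
  · rw [nearKer, indicator_of_notMem h2, zero_mul]
    exact zero_le

lemma bdryParam_of_nonneg {Θ a : ℝ} (h : 0 ≤ a) : bdryParam Θ a = a := by
  simp [bdryParam, h, rayPoint]

lemma le_bdryParam_seminorm {Θ a : ℝ} (ha : 0 < a) (g : ℝ → ℂ) :
    ENNReal.ofReal (‖g a‖ ^ 2 / (4 * a)) ≤ ∫⁻ b in univ, ENNReal.ofReal
      (‖(Ioi 0).indicator g a - (Ioi 0).indicator g b‖ ^ 2 /
        ‖bdryParam Θ a - bdryParam Θ b‖ ^ 2) := by
  have h1 : ∫⁻ b in Ioo (-a) 0, ENNReal.ofReal (‖g a‖ ^ 2 / (4 * a ^ 2)) =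
      ENNReal.ofReal (‖g a‖ ^ 2 / (4 * a)) := by
    rw [setLIntegral_const, Real.volume_Ioo, ← ENNReal.ofReal_mul (by positivity)]
    congr 1
    field_simp
    ring
  rw [← h1, setLIntegral_univ]
  refine le_trans (setLIntegral_mono' measurableSet_Ioo fun b hb => ?_)
    (setLIntegral_le_lintegral (Ioo (-a) 0) _)
  have hp : ‖bdryParam Θ b‖ = -b := by
    rw [bdryParam, if_neg (not_le.mpr hb.2), rayPoint, norm_mul, Complex.norm_exp_ofReal_mul_I,
      Complex.norm_real, mul_one, Real.norm_of_nonneg (by linarith [hb.2])]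
  have ha' : ‖bdryParam Θ a‖ = a := by
    rw [bdryParam_of_nonneg ha.le, Complex.norm_real, Real.norm_of_nonneg ha.le]
  have h2 := norm_sub_norm_le (bdryParam Θ a) (bdryParam Θ b)
  have h3 := norm_sub_le (bdryParam Θ a) (bdryParam Θ b)
  rw [hp, ha'] at h2 h3
  rw [indicator_of_mem (show a ∈ Ioi 0 from ha), indicator_of_notMem (show b ∉ Ioi 0 from not_lt.mpr hb.2.le),
    sub_zero]
  have h4 : 0 < ‖bdryParam Θ a - bdryParam Θ b‖ := by linarith [hb.1]
  refine ENNReal.ofReal_le_ofReal ?_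
  gcongr
  nlinarith [hb.1]

lemma exists_log_data {Θ : ℝ} {g : ℝ → ℂ} (hg : MemH00 Θ g) : ∃ h : ℝ → ℂ, Measurable h ∧
    LocallyIntegrable h ∧ weightSq h < ⊤ ∧ slobSq h < ⊤ ∧
      ∀ᵐ r ∂rayMeasure, g r = h (Real.log r) := by
  obtain ⟨⟨hL, h1⟩, ⟨-, h2⟩⟩ := hg
  let g' := hL.1.mk g
  have hgg : g =ᵐ[rayMeasure] g' := hL.1.ae_eq_mk
  have hm' : Measurable g' := hL.1.stronglyMeasurable_mk.measurable
  let h : ℝ → ℂ := fun s => g' (Real.exp s)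
  have hm : Measurable h := hm'.comp Real.measurable_exp
  have hslob : slobSq h < ⊤ := by
    have e : ∫⁻ a in Ioi 0, ∫⁻ b in Ioi 0, ENNReal.ofReal
        (‖g a - g b‖ ^ 2 / ‖bdryParam Θ a - bdryParam Θ b‖ ^ 2) =
        ∫⁻ a in Ioi 0, ∫⁻ b in Ioi 0, ENNReal.ofReal (‖g' a - g' b‖ ^ 2 / (a - b) ^ 2) := by
      refine lintegral_congr_ae ?_
      filter_upwards [hgg, ae_restrict_mem measurableSet_Ioi] with a ha ha0
      refine lintegral_congr_ae ?_
      filter_upwards [hgg, ae_restrict_mem measurableSet_Ioi] with b hb hb0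
      rw [ha, hb, bdryParam_of_nonneg (le_of_lt ha0), bdryParam_of_nonneg (le_of_lt hb0),
        ← Complex.ofReal_sub, Complex.norm_real, Real.norm_eq_abs, sq_abs]
    rw [e, lintegral_ray] at h1
    simp_rw [lintegral_ray] at h1
    rw [slobSq]
    refine lt_of_le_of_lt ?_ (ENNReal.mul_lt_top (ENNReal.ofReal_lt_top (r := Real.exp 2)) h1)
    rw [← lintegral_const_mul' _ _ ENNReal.ofReal_ne_top]
    refine lintegral_mono fun s => ?_
    simp only
    rw [← lintegral_const_mul' _ _ ENNReal.ofReal_ne_top,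
      ← lintegral_const_mul' _ _ ENNReal.ofReal_ne_top]
    exact lintegral_mono fun t => nearKer_mul_le h s t
  have hexp : ∫⁻ s, ENNReal.ofReal (Real.exp s) * ‖h s‖ₑ ^ 2 < ⊤ := by
    rw [← lintegral_ray fun r => ‖g' r‖ₑ ^ 2]
    have := (hL.ae_eq hgg).2
    rw [eLpNorm_two_eq] at this
    by_contra hc
    rw [not_lt, top_le_iff] at hc
    simp [hc] at this
  have hone : ∫⁻ s, ‖h s‖ₑ ^ 2 < ⊤ := by
    rw [setLIntegral_univ] at h2
    have h3 : ∫⁻ a in Ioi 0, ENNReal.ofReal (‖g' a‖ ^ 2 / (4 * a)) < ⊤ := by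
      refine lt_of_le_of_lt ?_ h2
      refine le_trans ?_ (setLIntegral_le_lintegral (Ioi 0) _)
      refine lintegral_mono_ae ?_
      filter_upwards [hgg, ae_restrict_mem measurableSet_Ioi] with a ha ha0
      rw [← ha]
      exact le_bdryParam_seminorm ha0 g
    rw [lintegral_ray] at h3
    have e : ∀ s, ENNReal.ofReal (Real.exp s) *
        ENNReal.ofReal (‖g' (Real.exp s)‖ ^ 2 / (4 * Real.exp s)) =
        ENNReal.ofReal (1 / 4) * ‖h s‖ₑ ^ 2 := by
      intro s
      rw [← ofReal_norm, ← ENNReal.ofReal_pow (norm_nonneg _), ← ENNReal.ofReal_mul (by positivity),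
        ← ENNReal.ofReal_mul (by positivity)]
      congr 1
      have := Real.exp_pos s
      simp only [h]
      field_simp
    simp_rw [e] at h3
    rw [lintegral_const_mul' _ _ ENNReal.ofReal_ne_top] at h3
    exact ENNReal.lt_top_of_mul_ne_top_right h3.ne (by simp)
  refine ⟨h, hm, ?_, ?_, hslob, ?_⟩
  · have : MemLp h 2 volume := memLp_two_of_lintegral_lt_top hm.aestronglyMeasurable hone
    exact this.locallyIntegrable (by norm_num)
  · rw [weightSq]
    simp_rw [ENNReal.ofReal_add zero_le_one (Real.exp_pos _).le, add_mul]
    rw [lintegral_add_left (by fun_prop)]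
    simpa using ⟨hone, hexp⟩
  · filter_upwards [hgg, ae_restrict_mem measurableSet_Ioi] with r hr hr0
    rw [hr]
    exact congrArg g' (Real.exp_log hr0).symm

/-! ### Lifting of boundary data -/

lemma lintegral_sector_comp_lg {Θ : ℝ} (hΘ : Θ < 2 * Real.pi) {F : ℂ → ℝ≥0∞} (hF : Measurable F) :
    ∫⁻ z, F (lg Θ z) ∂(sectorMeasure Θ) = ∫⁻ θ in Ioo 0 Θ, ∫⁻ s : ℝ,
      ENNReal.ofReal (Real.exp (2 * s)) * F (s + θ * Complex.I) := by
  rw [lintegral_sector hΘ (F := fun z => F (lg Θ z)) (hF.comp (measurable_lg Θ))]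
  refine setLIntegral_congr_fun measurableSet_Ioo fun θ hθ => lintegral_congr fun s => ?_
  rw [lg_exp (by simpa using abs_sub_half_lt hΘ hθ.1.le hθ.2.le)]

lemma Lp.norm_sq_le {α : Type*} [MeasurableSpace α] {μ : Measure α} {f : Lp ℂ 2 μ} {g : α → ℂ}
    (h : f =ᵐ[μ] g) {A : ℝ≥0∞} (hA : ∫⁻ x, ‖g x‖ₑ ^ 2 ∂μ ≤ A) (hA' : A ≠ ⊤) :
    ‖f‖ ^ 2 ≤ A.toReal := by
  rw [Lp.norm_def, eLpNorm_congr_ae h, eLpNorm_two_eq, ← ENNReal.toReal_pow, ← ENNReal.rpow_natCast,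
    ← ENNReal.rpow_mul]
  norm_num
  exact ENNReal.toReal_mono hA' hA

lemma norm_dirDeriv_comp_lg_le {Θ : ℝ} {X : ℂ → ℂ} (hX : ContDiff ℝ (⊤ : ℕ∞) X) {z : ℂ}
    (hz : z ∈ slit Θ) {e : ℂ} (he : ‖e‖ = 1) :
    ‖dirDeriv e (fun z => X (lg Θ z)) z‖ ≤ ‖z‖⁻¹ * ‖fderiv ℝ X (lg Θ z)‖ := by
  rw [dirDeriv_comp_lg_eq hX hz]
  refine (ContinuousLinearMap.le_opNorm _ _).trans_eq ?_
  rw [norm_mul, norm_inv, he, mul_one, mul_comm]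

lemma exists_H1_of_strip {Θ : ℝ} (hΘ₀ : 0 < Θ) (hΘ : Θ < 2 * Real.pi) {X : ℂ → ℂ}
    (hX : ContDiff ℝ (⊤ : ℕ∞) X) {A B : ℝ≥0∞} (hA' : A ≠ ⊤) (hB' : B ≠ ⊤)
    (hA : ∫⁻ θ in Ioo 0 Θ, ∫⁻ s : ℝ, ENNReal.ofReal (1 + Real.exp (2 * s)) *
      ‖X (s + θ * Complex.I)‖ₑ ^ 2 ≤ A)
    (hB : ∫⁻ θ in Ioo 0 Θ, ∫⁻ s : ℝ, ‖fderiv ℝ X (s + θ * Complex.I)‖ₑ ^ 2 ≤ B)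
    (ht : ∀ θ, θ = 0 ∨ θ = Θ → MemLp (fun r => X (Real.log r + θ * Complex.I)) 2 rayMeasure) :
    ∃ w : H1 Θ, ‖w‖ ^ 2 ≤ A.toReal + B.toReal + B.toReal ∧
      ∀ θ, θ = 0 ∨ θ = Θ → IsTrace Θ θ w fun r => X (Real.log r + θ * Complex.I) := by
  let U : ℂ → ℂ := fun z => X (lg Θ z)
  have hXm : Measurable X := hX.continuous.measurable
  have hU : ∀ z ∈ slit Θ, ContDiffAt ℝ (⊤ : ℕ∞) U z := fun z hz =>
    hX.contDiffAt.comp z (contDiffAt_lg hz)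
  have hUm : Measurable U := hXm.comp (measurable_lg Θ)
  have i0 : ∫⁻ z, ‖U z‖ₑ ^ 2 ∂(sectorMeasure Θ) ≤ A := by
    rw [lintegral_sector_comp_lg hΘ (F := fun ζ => ‖X ζ‖ₑ ^ 2) (by fun_prop)]
    refine le_trans (lintegral_mono fun θ => lintegral_mono fun s => ?_) hA
    gcongr
    linarith
  have id : ∫⁻ z, ‖(‖z‖⁻¹ : ℂ) * U z‖ₑ ^ 2 ∂(sectorMeasure Θ) ≤ A := by
    have e : ∫⁻ z, ‖(‖z‖⁻¹ : ℂ) * U z‖ₑ ^ 2 ∂(sectorMeasure Θ) = ∫⁻ z, (fun ζ : ℂ =>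
        ENNReal.ofReal (Real.exp (-2 * ζ.re)) * ‖X ζ‖ₑ ^ 2) (lg Θ z) ∂(sectorMeasure Θ) := by
      refine setLIntegral_congr_fun (measurableSet_sector Θ) fun z hz => ?_
      have hz0 := norm_pos_iff.mpr (ne_zero_of_mem_slit (sector_subset_slit hΘ hz))
      simp only
      rw [enorm_mul, mul_pow, ← ofReal_norm, norm_inv, Complex.norm_real, norm_norm,
        ← ENNReal.ofReal_pow (by positivity), lg_re, neg_mul, Real.exp_neg, two_mul, Real.exp_add,
        Real.exp_log hz0, inv_pow, sq]
    rw [e, lintegral_sector_comp_lg hΘ (F := fun ζ : ℂ =>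
        ENNReal.ofReal (Real.exp (-2 * ζ.re)) * ‖X ζ‖ₑ ^ 2) (by fun_prop)]
    refine le_trans (lintegral_mono fun θ => lintegral_mono fun s => ?_) hA
    rw [← mul_assoc, ← ENNReal.ofReal_mul (by positivity), ← Real.exp_add]
    have : 2 * s + -2 * ((s : ℂ) + θ * Complex.I).re = 0 := by simp
    rw [this, Real.exp_zero]
    gcongr
    linarith [Real.exp_pos (2 * s)]
  have i1 : ∀ e : ℂ, ‖e‖ = 1 → ∫⁻ z, ‖dirDeriv e U z‖ₑ ^ 2 ∂(sectorMeasure Θ) ≤ B := by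
    intro e he
    have hm : Measurable fun ζ => ‖fderiv ℝ X ζ‖ₑ :=
      (hX.continuous_fderiv (by simp)).enorm.measurable
    have e : ∫⁻ z, ‖dirDeriv e U z‖ₑ ^ 2 ∂(sectorMeasure Θ) ≤ ∫⁻ z, (fun ζ : ℂ =>
        ENNReal.ofReal (Real.exp (-2 * ζ.re)) * ‖fderiv ℝ X ζ‖ₑ ^ 2) (lg Θ z)
          ∂(sectorMeasure Θ) := by
      refine setLIntegral_mono' (measurableSet_sector Θ) fun z hz => ?_
      have hzs := sector_subset_slit hΘ hz
      have hz0 := norm_pos_iff.mpr (ne_zero_of_mem_slit hzs)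
      simp only
      rw [lg_re, neg_mul, Real.exp_neg, two_mul, Real.exp_add, Real.exp_log hz0, ← ofReal_norm,
        ← ofReal_norm, ← ENNReal.ofReal_pow (norm_nonneg _), ← ENNReal.ofReal_pow (norm_nonneg _),
        ← ENNReal.ofReal_mul (by positivity)]
      refine ENNReal.ofReal_le_ofReal ?_
      rw [← sq, ← inv_pow, ← mul_pow]
      gcongr
      exact norm_dirDeriv_comp_lg_le hX hzs he
    refine e.trans ?_
    rw [lintegral_sector_comp_lg hΘ (F := fun ζ : ℂ =>
        ENNReal.ofReal (Real.exp (-2 * ζ.re)) * ‖fderiv ℝ X ζ‖ₑ ^ 2) (by fun_prop)]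
    refine le_trans (lintegral_mono fun θ => lintegral_mono fun s => ?_) hB
    rw [← mul_assoc, ← ENNReal.ofReal_mul (by positivity), ← Real.exp_add]
    have : 2 * s + -2 * ((s : ℂ) + θ * Complex.I).re = 0 := by simp
    rw [this, Real.exp_zero, ENNReal.ofReal_one, one_mul]
  have hdm : ∀ e, AEStronglyMeasurable (dirDeriv e U) (sectorMeasure Θ) := fun e =>
    ContinuousOn.aestronglyMeasurable (fun z hz => (contDiffAt_dirDeriv (hU z
      (sector_subset_slit hΘ hz)) e).continuousAt.continuousWithinAt) (measurableSet_sector Θ)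
  have hlim : ∀ θ, θ = 0 ∨ θ = Θ → (fun r => U (rayPoint θ r)) =ᵐ[rayMeasure]
      fun r => X (Real.log r + θ * Complex.I) := by
    intro θ hθ
    have hθ' : 0 ≤ θ ∧ θ ≤ Θ := by rcases hθ with rfl | rfl <;> constructor <;> linarith
    filter_upwards [ae_restrict_mem measurableSet_Ioi] with r hr
    simp only [U]
    rw [rayPoint_eq_exp θ hr, lg_exp (by simpa using abs_sub_half_lt hΘ hθ'.1 hθ'.2)]
  have hAt := hA'.lt_top
  have hBt := hB'.lt_top
  obtain ⟨w, w0, w1, w2, hw⟩ := exists_H1_of_smooth hΘ₀ hΘ hU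
    (memLp_two_of_lintegral_lt_top hUm.aestronglyMeasurable (i0.trans_lt hAt))
    (memLp_two_of_lintegral_lt_top (by
      exact ((by fun_prop : Measurable fun z : ℂ => ((‖z‖ : ℂ)⁻¹)).mul hUm).aestronglyMeasurable)
      (id.trans_lt hAt))
    (memLp_two_of_lintegral_lt_top (hdm 1) ((i1 1 (by simp)).trans_lt hBt))
    (memLp_two_of_lintegral_lt_top (hdm Complex.I) ((i1 Complex.I (by simp)).trans_lt hBt))
    fun θ hθ => (ht θ hθ).ae_eq (hlim θ hθ).symm
  refine ⟨w, ?_, fun θ hθ => (hw θ hθ).congr (hlim θ hθ)⟩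
  have e : ‖w‖ ^ 2 = ‖w.1 0‖ ^ 2 + ‖w.1 1‖ ^ 2 + ‖w.1 2‖ ^ 2 := by
    change ‖w.1‖ ^ 2 = _
    rw [PiLp.norm_sq_eq_of_L2, Fin.sum_univ_three]
  rw [e]
  exact add_le_add (add_le_add (Lp.norm_sq_le w0 i0 hA') (Lp.norm_sq_le w1 (i1 1 (by simp)) hB'))
    (Lp.norm_sq_le w2 (i1 Complex.I (by simp)) hB')

lemma exists_cutoff_profile {c : ℝ} (hc : 0 < c) : ∃ (κ : ℝ → ℝ) (C : ℝ),
    ContDiff ℝ (⊤ : ℕ∞) κ ∧ κ 0 = 1 ∧ (∀ x, ‖κ x‖ ≤ 1) ∧ (∀ x, c ≤ x → κ x = 0) ∧ 0 ≤ C ∧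
      ∀ x, ‖deriv κ x‖ ≤ C := by
  obtain ⟨C, hC, hb⟩ := exists_deriv_smoothStep_bound
  refine ⟨fun x => 1 - smoothStep (2 / c * x), 2 / c * C,
    contDiff_const.sub (contDiff_smoothStep.comp (contDiff_const.mul contDiff_id)), ?_,
    fun x => ?_, fun x hx => ?_, by positivity, fun x => ?_⟩
  · simp only
    rw [mul_zero, smoothStep_zero zero_le_one, sub_zero]
  · rw [Real.norm_eq_abs, abs_le]
    constructor <;> linarith [smoothStep_nonneg (2 / c * x), smoothStep_le_one (2 / c * x)]
  · simp only
    rw [smoothStep_one, sub_self]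
    calc (2 : ℝ) = 2 / c * c := by field_simp
      _ ≤ 2 / c * x := by gcongr
  · have h1 : HasDerivAt smoothStep (deriv smoothStep (2 / c * x)) (2 / c * x) :=
      (contDiff_smoothStep.differentiable (by simp) _).hasDerivAt
    have h2 := (h1.comp x ((hasDerivAt_id x).const_mul (2 / c))).const_sub 1
    have h3 : deriv (fun x => 1 - smoothStep (2 / c * x)) x =
        -(deriv smoothStep (2 / c * x) * (2 / c * 1)) := h2.deriv
    rw [h3, norm_neg, norm_mul, mul_one, Real.norm_of_nonneg (by positivity : 0 ≤ 2 / c), mul_comm]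
    gcongr
    exact (hb _).1

/-- A smooth positive function which is equal to `θ + ε` for `θ ≥ 0`. -/
def posShift (ε θ : ℝ) : ℝ := ε + θ * Real.smoothTransition (θ / ε + 1)

lemma contDiff_posShift (ε : ℝ) : ContDiff ℝ (⊤ : ℕ∞) (posShift ε) :=
  contDiff_const.add (contDiff_id.mul
    (Real.smoothTransition.contDiff.comp ((contDiff_id.div_const ε).add contDiff_const)))

lemma posShift_of_nonneg {ε θ : ℝ} (hε : 0 < ε) (hθ : 0 ≤ θ) : posShift ε θ = θ + ε := by
  rw [posShift, Real.smoothTransition.one_of_one_le (by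
    have : 0 ≤ θ / ε := by positivity
    linarith)]
  ring

lemma posShift_pos {ε : ℝ} (hε : 0 < ε) (θ : ℝ) : 0 < posShift ε θ := by
  rcases le_or_gt 0 θ with h | h
  · rw [posShift_of_nonneg hε h]; linarith
  rcases le_or_gt θ (-ε) with h1 | h1
  · rw [posShift, Real.smoothTransition.zero_of_nonpos, mul_zero, add_zero]
    · exact hε
    · have := (div_le_iff₀ (a := -1) (b := θ) hε).mpr (by linarith)
      linarith
  · have h2 := Real.smoothTransition.le_one (θ / ε + 1)
    have h3 := mul_le_mul_of_nonneg_left h2 (neg_nonneg.mpr h.le)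
    rw [posShift]
    linarith

/-- The lifting of `h`, in logarithmic polar coordinates. -/
def lift (κ : ℝ → ℝ) (h : ℝ → ℂ) (ε : ℝ) (ζ : ℂ) : ℂ :=
  (κ (ζ.im * (1 + Real.exp ζ.re)) : ℂ) * avg h (posShift ε ζ.im, ζ.re)

section lift

variable {κ : ℝ → ℝ} {h : ℝ → ℂ} {ε c C : ℝ}

lemma contDiff_lift (hκ : ContDiff ℝ (⊤ : ℕ∞) κ) (hh : LocallyIntegrable h) (hε : 0 < ε) :
    ContDiff ℝ (⊤ : ℕ∞) (lift κ h ε) := by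
  have h1 : ContDiff ℝ (⊤ : ℕ∞) fun ζ : ℂ => ζ.im * (1 + Real.exp ζ.re) :=
    Complex.imCLM.contDiff.mul (contDiff_const.add (Real.contDiff_exp.comp Complex.reCLM.contDiff))
  have h2 : ContDiff ℝ (⊤ : ℕ∞) fun ζ : ℂ => ((posShift ε ζ.im, ζ.re) : ℝ × ℝ) :=
    ((contDiff_posShift ε).comp Complex.imCLM.contDiff).prodMk Complex.reCLM.contDiff
  refine (Complex.ofRealCLM.contDiff.comp (hκ.comp h1)).mul (contDiff_iff_contDiffAt.mpr fun ζ => ?_)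
  exact ContDiffAt.comp (g := avg h) ζ (contDiffAt_avg hh (posShift_pos hε _)) h2.contDiffAt

lemma norm_fderiv_lift_le (hκ : ContDiff ℝ (⊤ : ℕ∞) κ) (hκ1 : ∀ x, ‖κ x‖ ≤ 1)
    (hC : ∀ x, ‖deriv κ x‖ ≤ C) (hh : LocallyIntegrable h) (hε : 0 < ε) {θ s : ℝ} (hθ : 0 < θ)
    (hs : θ * (1 + Real.exp s) < 1) :
    ‖fderiv ℝ (lift κ h ε) (s + θ * Complex.I)‖ ≤
      2 * C * ((1 + Real.exp s) * ‖avg h (θ + ε, s)‖) + ‖fderiv ℝ (avg h) (θ + ε, s)‖ := by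
  let ζ : ℂ := s + θ * Complex.I
  have hre : ζ.re = s := by simp [ζ]
  have him : ζ.im = θ := by simp [ζ]
  let L : ℂ →L[ℝ] ℝ × ℝ := Complex.imCLM.prod Complex.reCLM
  have hL : ‖L‖ ≤ 1 := ContinuousLinearMap.opNorm_le_bound _ zero_le_one fun x => by
    rw [one_mul]
    exact max_le (Complex.abs_im_le_norm x) (Complex.abs_re_le_norm x)
  have hev : lift κ h ε =ᶠ[𝓝 ζ] fun y =>
      (κ (y.im * (1 + Real.exp y.re)) : ℂ) * avg h (L y + (ε, 0)) := by
    filter_upwards [(isOpen_lt continuous_const Complex.continuous_im).mem_nhds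
      (show (0 : ℝ) < ζ.im by rw [him]; exact hθ)] with y hy
    rw [lift, posShift_of_nonneg hε (le_of_lt hy)]
    simp [L]
  have hA : HasFDerivAt (fun y => avg h (L y + (ε, 0))) ((fderiv ℝ (avg h) (θ + ε, s)).comp L) ζ := by
    have e : L ζ + (ε, 0) = (θ + ε, s) := by simp [L, hre, him]
    have h1 : HasFDerivAt (avg h) (fderiv ℝ (avg h) (θ + ε, s)) (L ζ + (ε, 0)) := by
      rw [e]
      exact ((contDiffAt_avg hh (q := (θ + ε, s)) (add_pos hθ hε)).differentiableAt
        (by simp)).hasFDerivAt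
    exact h1.comp ζ (L.hasFDerivAt.add_const _)
  have hm : HasFDerivAt (fun y : ℂ => y.im * (1 + Real.exp y.re))
      (θ • (Real.exp s • Complex.reCLM) + (1 + Real.exp s) • Complex.imCLM) ζ := by
    have h1 : HasFDerivAt (fun y : ℂ => 1 + Real.exp y.re) (Real.exp s • Complex.reCLM) ζ := by
      have := ((Complex.reCLM.hasFDerivAt (x := ζ)).exp).const_add 1
      simpa [hre] using this
    refine ((Complex.imCLM.hasFDerivAt (x := ζ)).mul h1).congr_fderiv ?_
    simp [hre, him]
  have hk : HasDerivAt κ (deriv κ (θ * (1 + Real.exp s))) (ζ.im * (1 + Real.exp ζ.re)) := by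
    rw [hre, him]
    exact (hκ.differentiable (by simp) _).hasDerivAt
  have hκm := Complex.ofRealCLM.hasFDerivAt.comp ζ (hk.comp_hasFDerivAt ζ hm)
  have hfull := (hκm.mul hA).congr_of_eventuallyEq hev
  rw [hfull.fderiv]
  refine (norm_add_le _ _).trans ?_
  rw [add_comm]
  refine add_le_add ?_ ?_
  · refine (norm_smul_le _ _).trans ?_
    have e : avg h (L ζ + (ε, 0)) = avg h (θ + ε, s) := by simp [L, hre, him]
    rw [e]
    have h2 : ‖θ • (Real.exp s • Complex.reCLM) + (1 + Real.exp s) • Complex.imCLM‖ ≤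
        2 * (1 + Real.exp s) := by
      refine (norm_add_le _ _).trans ?_
      rw [norm_smul, norm_smul, norm_smul, Complex.reCLM_norm, Complex.imCLM_norm,
        Real.norm_of_nonneg hθ.le, Real.norm_of_nonneg (Real.exp_pos s).le,
        Real.norm_of_nonneg (by positivity : 0 ≤ 1 + Real.exp s)]
      nlinarith [Real.exp_pos s]
    have h3 : ‖Complex.ofRealCLM.comp (deriv κ (θ * (1 + Real.exp s)) •
        (θ • (Real.exp s • Complex.reCLM) + (1 + Real.exp s) • Complex.imCLM))‖ ≤
        C * (2 * (1 + Real.exp s)) := by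
      refine (ContinuousLinearMap.opNorm_comp_le _ _).trans ?_
      rw [Complex.ofRealCLM_norm, one_mul, norm_smul]
      gcongr
      · exact (norm_nonneg _).trans (hC 0)
      · exact hC _
    calc _ ≤ ‖avg h (θ + ε, s)‖ * (C * (2 * (1 + Real.exp s))) := by gcongr
      _ = _ := by ring
  · refine (norm_smul_le _ _).trans ?_
    rw [← one_mul ‖fderiv ℝ (avg h) (θ + ε, s)‖]
    refine mul_le_mul ?_ ?_ (norm_nonneg _) zero_le_one
    · simpa using hκ1 _
    · exact (ContinuousLinearMap.opNorm_comp_le _ _).trans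
        (mul_le_of_le_one_right (norm_nonneg _) hL)

lemma fderiv_lift_eq_zero (hc : c < 1) (hκ0 : ∀ x, c ≤ x → κ x = 0) {θ s : ℝ}
    (hs : ¬θ * (1 + Real.exp s) < 1) : fderiv ℝ (lift κ h ε) (s + θ * Complex.I) = 0 := by
  have hcont : Continuous fun y : ℂ => y.im * (1 + Real.exp y.re) := by fun_prop
  have hev : lift κ h ε =ᶠ[𝓝 (s + θ * Complex.I)] fun _ => 0 := by
    filter_upwards [(isOpen_lt continuous_const hcont).mem_nhds
      (show c < ((s : ℂ) + θ * Complex.I).im * (1 + Real.exp ((s : ℂ) + θ * Complex.I).re) by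
        simpa using hc.trans_le (not_lt.mp hs))] with y hy
    rw [lift, hκ0 _ (le_of_lt hy), Complex.ofReal_zero, zero_mul]
  rw [hev.fderiv_eq, fderiv_fun_const]
  rfl

end lift

lemma measurable_avg {h : ℝ → ℂ} (hm : Measurable h) : Measurable (avg h) := by
  have hk : Measurable (Function.uncurry kern) := by
    have : Measurable (avgBump.normed volume) := (avgBump.continuous_normed).measurable
    unfold kern
    exact Complex.measurable_ofReal.comp (measurable_fst.inv.mul
      (this.comp (measurable_snd.div measurable_fst)))
  have h1 : Measurable fun p : (ℝ × ℝ) × ℝ => h p.2 * kern p.1.1 (p.1.2 - p.2) :=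
    (hm.comp measurable_snd).mul
      (hk.comp (by fun_prop : Measurable fun p : (ℝ × ℝ) × ℝ => (p.1.1, p.1.2 - p.2)))
  exact h1.stronglyMeasurable.integral_prod_right'.measurable

lemma setLIntegral_Ioo_le {Θ : ℝ} {F G : ℝ → ℝ≥0∞} (h0 : ∀ θ, 1 ≤ θ → F θ = 0)
    (h : ∀ θ ∈ Ioo (0 : ℝ) 1, F θ ≤ G θ) : ∫⁻ θ in Ioo 0 Θ, F θ ≤ ∫⁻ θ in Ioo 0 1, G θ := by
  rw [← lintegral_indicator measurableSet_Ioo, ← lintegral_indicator measurableSet_Ioo]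
  refine lintegral_mono fun θ => ?_
  by_cases h1 : θ ∈ Ioo 0 Θ
  · rw [indicator_of_mem h1]
    rcases lt_or_ge θ 1 with h2 | h2
    · have h3 : θ ∈ Ioo (0 : ℝ) 1 := ⟨h1.1, h2⟩
      rw [indicator_of_mem h3]
      exact h θ h3
    · rw [h0 θ h2]
      exact zero_le
  · rw [indicator_of_notMem h1]
    exact zero_le

lemma not_mul_lt_one {θ s : ℝ} (hθ : 1 ≤ θ) : ¬θ * (1 + Real.exp s) < 1 := by
  nlinarith [Real.exp_pos s]

lemma lintegral_lift_le {κ : ℝ → ℝ} {h : ℝ → ℂ} {ε c Θ : ℝ} {A : ℝ≥0∞} (hκ1 : ∀ x, ‖κ x‖ ≤ 1)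
    (hκ0 : ∀ x, c ≤ x → κ x = 0) (hc : c < 1) (hε : 0 < ε)
    (hA : ∫⁻ θ in Ioo 0 1, ∫⁻ s, coneSq h ε θ s ≤ A) :
    ∫⁻ θ in Ioo 0 Θ, ∫⁻ s : ℝ, ENNReal.ofReal (1 + Real.exp (2 * s)) *
      ‖lift κ h ε (s + θ * Complex.I)‖ₑ ^ 2 ≤ A := by
  have hz : ∀ θ s : ℝ, ¬θ * (1 + Real.exp s) < 1 → ENNReal.ofReal (1 + Real.exp (2 * s)) *
      ‖lift κ h ε (s + θ * Complex.I)‖ₑ ^ 2 = 0 := by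
    intro θ s hs
    rw [lift, hκ0]
    · simp
    · simpa using hc.le.trans (not_lt.mp hs)
  refine (setLIntegral_Ioo_le (fun θ hθ => ?_) fun θ hθ => lintegral_mono fun s => ?_).trans hA
  · simp_rw [hz θ _ (not_mul_lt_one hθ), lintegral_zero]
  · by_cases hs : θ * (1 + Real.exp s) < 1
    · rw [coneSq_of_lt hs]
      refine mul_le_mul' (ENNReal.ofReal_le_ofReal ?_) ?_
      · rw [two_mul, Real.exp_add]
        nlinarith [Real.exp_pos s]
      · have him : ((s : ℂ) + θ * Complex.I).im = θ := by simp
        have hre : ((s : ℂ) + θ * Complex.I).re = s := by simp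
        rw [lift, him, hre, posShift_of_nonneg hε hθ.1.le, enorm_mul]
        refine pow_le_pow_left₀ zero_le (mul_le_of_le_one_left zero_le ?_) 2
        rw [← ofReal_norm, Complex.norm_real]
        exact ENNReal.ofReal_le_one.mpr (hκ1 _)
    · rw [hz θ s hs]
      exact zero_le

lemma lintegral_fderiv_lift_le {κ : ℝ → ℝ} {h : ℝ → ℂ} {ε c C Θ : ℝ} {A D : ℝ≥0∞}
    (hκ : ContDiff ℝ (⊤ : ℕ∞) κ) (hκ1 : ∀ x, ‖κ x‖ ≤ 1) (hC : ∀ x, ‖deriv κ x‖ ≤ C)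
    (hκ0 : ∀ x, c ≤ x → κ x = 0) (hc : c < 1) (hm : Measurable h) (hh : LocallyIntegrable h)
    (hε : 0 < ε)
    (hA : ∫⁻ θ in Ioo 0 1, ∫⁻ s, coneSq h ε θ s ≤ A)
    (hD : ∫⁻ θ in Ioo 0 1, ∫⁻ s, ‖fderiv ℝ (avg h) (θ + ε, s)‖ₑ ^ 2 ≤ D) :
    ∫⁻ θ in Ioo 0 Θ, ∫⁻ s : ℝ, ‖fderiv ℝ (lift κ h ε) (s + θ * Complex.I)‖ₑ ^ 2 ≤
      ENNReal.ofReal (8 * C ^ 2) * A + 2 * D := by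
  have hC0 : 0 ≤ C := (norm_nonneg _).trans (hC 0)
  let P := coneSq h ε
  have hP : Measurable (Function.uncurry P) := by
    have hS : MeasurableSet {p : ℝ × ℝ | p.1 * (1 + Real.exp p.2) < 1} :=
      measurableSet_lt (by fun_prop) (by fun_prop)
    have ha : Measurable fun p : ℝ × ℝ => avg h (p.1 + ε, p.2) :=
      (measurable_avg hm).comp (by fun_prop)
    exact Measurable.indicator (f := fun p : ℝ × ℝ =>
      ENNReal.ofReal ((1 + Real.exp p.2) ^ 2) * ‖avg h (p.1 + ε, p.2)‖ₑ ^ 2) (by fun_prop) hS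
  have hpt : ∀ θ ∈ Ioo (0 : ℝ) 1, ∀ s : ℝ, ‖fderiv ℝ (lift κ h ε) (s + θ * Complex.I)‖ₑ ^ 2 ≤
      ENNReal.ofReal (8 * C ^ 2) * P θ s + 2 * ‖fderiv ℝ (avg h) (θ + ε, s)‖ₑ ^ 2 := by
    intro θ hθ s
    by_cases hs : θ * (1 + Real.exp s) < 1
    · have h1 := norm_fderiv_lift_le hκ hκ1 hC hh hε hθ.1 hs
      simp only [P]
      rw [coneSq_of_lt hs, show (2 : ℝ≥0∞) = ENNReal.ofReal 2 by simp, ← ofReal_norm, ← ofReal_norm, ← ofReal_norm,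
        ← ENNReal.ofReal_pow (norm_nonneg _), ← ENNReal.ofReal_pow (norm_nonneg _),
        ← ENNReal.ofReal_pow (norm_nonneg _), ← ENNReal.ofReal_mul (by positivity),
        ← ENNReal.ofReal_mul (by positivity), ← ENNReal.ofReal_mul (by positivity),
        ← ENNReal.ofReal_add (by positivity) (by positivity)]
      refine ENNReal.ofReal_le_ofReal ?_
      refine (pow_le_pow_left₀ (norm_nonneg _) h1 2).trans ?_
      nlinarith [sq_nonneg (2 * C * ((1 + Real.exp s) * ‖avg h (θ + ε, s)‖) -
        ‖fderiv ℝ (avg h) (θ + ε, s)‖)]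
    · rw [fderiv_lift_eq_zero hc hκ0 hs, enorm_zero]
      simp
  refine (setLIntegral_Ioo_le (fun θ hθ => ?_) fun θ hθ => lintegral_mono (hpt θ hθ)).trans ?_
  · simp_rw [fderiv_lift_eq_zero hc hκ0 (not_mul_lt_one hθ), enorm_zero]
    simp
  · have e : ∀ θ, ∫⁻ s, (ENNReal.ofReal (8 * C ^ 2) * P θ s +
        2 * ‖fderiv ℝ (avg h) (θ + ε, s)‖ₑ ^ 2) = ENNReal.ofReal (8 * C ^ 2) * (∫⁻ s, P θ s) +
        2 * ∫⁻ s, ‖fderiv ℝ (avg h) (θ + ε, s)‖ₑ ^ 2 := by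
      intro θ
      have hPθ : Measurable (P θ) := hP.comp (by fun_prop : Measurable fun s : ℝ => (θ, s))
      rw [lintegral_add_left (by fun_prop), lintegral_const_mul' _ _ ENNReal.ofReal_ne_top,
        lintegral_const_mul' _ _ (by simp)]
    simp_rw [e]
    have hP2 : Measurable fun θ => ENNReal.ofReal (8 * C ^ 2) * ∫⁻ s, P θ s :=
      hP.lintegral_prod_right'.const_mul _
    rw [lintegral_add_left hP2,
      lintegral_const_mul' _ _ ENNReal.ofReal_ne_top, lintegral_const_mul' _ _ (by simp)]
    gcongr

/-- Every function of `H^{1/2}_{00}(Γ)` is the trace on `Γ` of a function of `H¹(Ω)` whose trace on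
the other side is zero. -/
theorem exists_lift {Θ : ℝ} (hΘ₀ : 0 < Θ) (hΘ : Θ < 2 * Real.pi) {g : ℝ → ℂ} (hg : MemH00 Θ g) :
    ∃ w : H1 Θ, IsTrace Θ 0 w g ∧ IsTrace Θ Θ w 0 := by
  obtain ⟨h, hm, hh, hw, hs, hgh⟩ := exists_log_data hg
  have hgL : MemLp g 2 rayMeasure := hg.1.1
  have hc : 0 < min Θ 1 / 2 := by positivity
  have hc1 : min Θ 1 / 2 < 1 := by linarith [min_le_right Θ 1]
  have hcΘ : min Θ 1 / 2 < Θ := by linarith [min_le_left Θ 1]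
  obtain ⟨κ, C₁, hκ, hκz, hκ1, hκ0, hC₁, hκd⟩ := exists_cutoff_profile hc
  obtain ⟨K, hK, hcone⟩ := lintegral_cone_avg_le
  obtain ⟨C₂, hC₂, hder⟩ := lintegral_fderiv_avg_le
  obtain ⟨C₃, hC₃, hdiff⟩ := lintegral_avg_sub_le
  let A : ℝ≥0∞ := ENNReal.ofReal K * weightSq h
  let B : ℝ≥0∞ := ENNReal.ofReal (8 * C₁ ^ 2) * A + 2 * (ENNReal.ofReal C₂ * slobSq h)
  have hA : A ≠ ⊤ := ENNReal.mul_ne_top ENNReal.ofReal_ne_top hw.ne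
  have hB : B ≠ ⊤ := ENNReal.add_ne_top.mpr ⟨ENNReal.mul_ne_top ENNReal.ofReal_ne_top hA,
    ENNReal.mul_ne_top (by simp) (ENNReal.mul_ne_top ENNReal.ofReal_ne_top hs.ne)⟩
  have hsq : ∀ ε, eLpNorm (fun r => avg h (ε, Real.log r) - g r) 2 rayMeasure =
      (∫⁻ s, ENNReal.ofReal (Real.exp s) * ‖avg h (ε, s) - h s‖ₑ ^ 2) ^ (1 / 2 : ℝ) := by
    intro ε
    have e : (fun r => avg h (ε, Real.log r) - g r) =ᵐ[rayMeasure]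
        fun r => avg h (ε, Real.log r) - h (Real.log r) := by
      filter_upwards [hgh] with r hr
      rw [hr]
    rw [eLpNorm_congr_ae e, eLpNorm_two_eq, lintegral_ray]
    simp_rw [Real.log_exp]
  have hexp : ∫⁻ t in Ioi 0, ENNReal.ofReal (Real.exp t) * ‖h t‖ₑ ^ 2 < ⊤ := by
    refine (setLIntegral_le_lintegral _ _).trans_lt (lt_of_le_of_lt (lintegral_mono fun t => ?_) hw)
    gcongr
    linarith
  have htr : ∀ ε, 0 < ε → ε ≤ 1 → MemLp (fun r => avg h (ε, Real.log r)) 2 rayMeasure := by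
    intro ε hε hε1
    have h1 : MemLp (fun r => avg h (ε, Real.log r) - g r) 2 rayMeasure := by
      refine ⟨AEStronglyMeasurable.sub ?_ hgL.1, ?_⟩
      · exact ((measurable_avg hm).comp (by fun_prop : Measurable fun r : ℝ =>
          (ε, Real.log r))).aestronglyMeasurable
      · rw [hsq ε]
        refine ENNReal.rpow_lt_top_of_nonneg (by norm_num) (ne_of_lt ?_)
        refine (hdiff h hm hh ε hε hε1 0).trans_lt (ENNReal.add_lt_top.mpr ⟨?_, ?_⟩)
        · exact ENNReal.mul_lt_top ENNReal.ofReal_lt_top hs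
        · exact ENNReal.mul_lt_top ENNReal.ofReal_lt_top hexp
    exact (h1.add hgL).ae_eq (.of_forall fun r => by simp)
  have key : ∀ n : ℕ, ∃ w : H1 Θ, ‖w‖ ^ 2 ≤ A.toReal + B.toReal + B.toReal ∧
      IsTrace Θ 0 w (fun r => avg h (1 / ((n : ℝ) + 1), Real.log r)) ∧ IsTrace Θ Θ w 0 := by
    intro n
    have hn : (0 : ℝ) < n + 1 := by positivity
    have hε : 0 < 1 / ((n : ℝ) + 1) := one_div_pos.mpr hn
    have hε1 : 1 / ((n : ℝ) + 1) ≤ 1 := by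
      rw [div_le_one hn]; linarith [n.cast_nonneg (α := ℝ)]
    have e0 : ∀ r : ℝ, lift κ h (1 / ((n : ℝ) + 1)) (Real.log r + (0 : ℝ) * Complex.I) =
        avg h (1 / ((n : ℝ) + 1), Real.log r) := by
      intro r
      have h1 : ((Real.log r : ℂ) + (0 : ℝ) * Complex.I).im = 0 := by simp
      have h2 : ((Real.log r : ℂ) + (0 : ℝ) * Complex.I).re = Real.log r := by simp
      rw [lift, h1, h2, zero_mul, hκz, posShift_of_nonneg hε le_rfl, zero_add, Complex.ofReal_one,
        one_mul]
    have e1 : ∀ r : ℝ, lift κ h (1 / ((n : ℝ) + 1)) (Real.log r + Θ * Complex.I) = 0 := by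
      intro r
      rw [lift, hκ0, Complex.ofReal_zero, zero_mul]
      have h1 : ((Real.log r : ℂ) + Θ * Complex.I).im = Θ := by simp
      have h2 : ((Real.log r : ℂ) + Θ * Complex.I).re = Real.log r := by simp
      rw [h1, h2]
      nlinarith [Real.exp_pos (Real.log r)]
    obtain ⟨w, hw, ht⟩ := exists_H1_of_strip hΘ₀ hΘ (contDiff_lift hκ hh hε) hA hB
      (lintegral_lift_le hκ1 hκ0 hc1 hε (hcone h hm hh _ hε hε1))
      (lintegral_fderiv_lift_le hκ hκ1 hκd hκ0 hc1 hm hh hε (hcone h hm hh _ hε hε1)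
        (hder h hm hh _ hε hε1)) (by
        rintro θ (rfl | rfl)
        · simp_rw [e0]
          exact htr _ hε hε1
        · simp_rw [e1]
          exact MemLp.zero')
    refine ⟨w, hw, (ht 0 (Or.inl rfl)).congr (.of_forall fun r => ?_),
      (ht Θ (Or.inr rfl)).congr (.of_forall fun r => ?_)⟩
    · exact e0 r
    · exact e1 r
  choose w hwb h0 h1 using key
  refine exists_H1_of_bounded (M := Real.sqrt (A.toReal + B.toReal + B.toReal))
    (fun n => Real.le_sqrt_of_sq_le (hwb n)) h0 h1 hgL ?_
  have ht := (tendsto_lintegral_avg_sub hm hh hw hs).ennrpow_const (1 / 2 : ℝ)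
  rw [ENNReal.zero_rpow_of_pos (by norm_num)] at ht
  simp_rw [hsq]
  exact ht

lemma exists_H1_solution {Θ μ₀ ρ₀ : ℝ} (hΘ₀ : 0 < Θ) (hΘ : Θ < 2 * Real.pi) (hμ₀ : 0 < μ₀)
    (hρ₀ : 0 < ρ₀) {ω : ℂ} (hω : ω.im ≠ 0) (f : StrongDual ℂ (H1 Θ)) {h : ℂ → ℂ}
    (hh : MemLp h 2 (sectorMeasure Θ)) {g : ℝ → ℂ} (hg : MemH00 Θ g) :
    ∃ w : H1 Θ, IsTrace Θ 0 w g ∧ IsTrace Θ Θ w 0 ∧ ∀ (v : ℂ → ℂ) (hv : IsTest Θ v),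
      ∫ z, fnOf w z * (μ₀ * Laplacian.laplacian v z + ω ^ 2 * ρ₀ * v z) ∂(sectorMeasure Θ) =
        f (toH1 Θ v hv.1) - ∫ z, h z * v z ∂(sectorMeasure Θ) := by
  obtain ⟨l, hl0, hl1⟩ := exists_lift hΘ₀ hΘ hg
  let y : Lp ℂ 2 (sectorMeasure Θ) := star (hh.toLp h)
  let S : L2Triple Θ := diagMap Θ (ω ^ 2 * ρ₀) (-μ₀) l.1
  let i : H10 Θ →L[ℂ] H1 Θ := (H10 Θ).subtypeL.codRestrict (H1 Θ) fun v => H10_le_H1 Θ v.2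
  let F : StrongDual ℂ (H10 Θ) := f ∘L i -
    (innerSL ℂ y ∘L PiLp.proj 2 (fun _ : Fin 3 => Lp ℂ 2 (sectorMeasure Θ)) 0) ∘L (H10 Θ).subtypeL -
    innerSL ℂ (conjTriple S) ∘L (H10 Θ).subtypeL
  obtain ⟨w, hw, hF⟩ := exists_weak_solution hμ₀ hρ₀ hω F
  let w' : H1 Θ := ⟨w, H10_le_H1 Θ hw⟩
  refine ⟨l + w', ?_, ?_, fun v hv => ?_⟩
  · simpa using hl0.add (isTrace_zero_of_mem_H10 hΘ₀ hΘ (.inl rfl) w' hw)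
  · simpa using hl1.add (isTrace_zero_of_mem_H10 hΘ₀ hΘ (.inr rfl) w' hw)
  · have h1 := hF ⟨(toH1 Θ v hv.1).1, toH1_mem_H10 hv⟩
    have h2 : inner ℂ y ((toH1 Θ v hv.1).1 0) = ∫ z, h z * v z ∂(sectorMeasure Θ) := by
      rw [L2_inner_eq_integral]
      refine integral_congr_ae ?_
      filter_upwards [hh.coeFn_toLp, (toH1_coe_ae (Θ := Θ) hv.1).1] with z ha hb
      rw [ha, hb, mul_comm]
    have h3 : inner ℂ (conjTriple S) (toH1 Θ v hv.1).1 =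
        inner ℂ (conjTriple (toH1 Θ v hv.1).1) S := by
      have := inner_conjTriple_right (conjTriple S) (conjTriple (toH1 Θ v hv.1).1)
      rwa [conjTriple_conjTriple, conjTriple_conjTriple] at this
    have h4 : F ⟨(toH1 Θ v hv.1).1, toH1_mem_H10 hv⟩ = f (toH1 Θ v hv.1) -
        inner ℂ y ((toH1 Θ v hv.1).1 0) - inner ℂ (conjTriple S) (toH1 Θ v hv.1).1 := rfl
    rw [h4, h2, h3] at h1
    have h5 := integral_helmholtz_eq (μ₀ := μ₀) (ρ₀ := ρ₀) (ω := ω) (l + w') hv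
    refine h5.trans ?_
    have h6 : (l + w').1 = l.1 + w := rfl
    rw [h6, map_add, inner_add_right]
    simp only at h1
    rw [h1]
    ring

theorem exists_solution {Θ μ₀ ρ₀ : ℝ} (hΘ₀ : 0 < Θ) (hΘ : Θ < 2 * Real.pi) (hμ₀ : 0 < μ₀)
    (hρ₀ : 0 < ρ₀) {ω : ℂ} (hω : ω.im ≠ 0) {χ : ℂ → ℂ} (hχ : IsCutoff χ)
    (f : StrongDual ℂ (H1 Θ)) {g : ℝ → ℂ} (hg : g ∈ bdryDataSpace Θ χ) (s : ℕ+ →₀ ℂ) :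
    ∃ u : FunOn Θ, u ∈ farSpace Θ χ ∧ SolvesHelmholtz Θ μ₀ ρ₀ ω f u ∧
      HasBdryValue Θ χ 0 u g ∧ HasBdryValue Θ χ Θ u 0 ∧
      ∀ n : ℕ+, farSigma Θ χ (-(Real.pi / Θ) * (n : ℝ)) u = s n := by
  obtain ⟨g₀, φ, hg₀, hφ, hgφ⟩ := hg
  obtain ⟨ψ, hψ, hψφ, hσ, G, hG, hψG⟩ := exists_singular_solution hΘ₀ hΘ (μ := (μ₀ : ℂ))
    (by exact_mod_cast hμ₀.ne') (ω ^ 2 * ρ₀) hφ s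
  obtain ⟨h, hh, hres⟩ := exists_memLp_residual hΘ hχ hψ hG hψG
  obtain ⟨w, hw0, hw1, hw⟩ := exists_H1_solution hΘ₀ hΘ hμ₀ hρ₀ hω f hh hg₀
  have hcont : ContinuousOn (fun z => χ z * ψ z) (sector Θ) :=
    hχ.isSmoothCompact.continuous.continuousOn.mul (singSpace_continuousOn hΘ hψ)
  have hm : AEStronglyMeasurable (fun z => fnOf w z + χ z * ψ z) (sectorMeasure Θ) :=
    (Lp.memLp (w.1 0)).1.add (hcont.aestronglyMeasurable (measurableSet_sector Θ))
  let u : FunOn Θ := AEEqFun.mk _ hm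
  have hu : IsDecomp Θ χ u w ψ := ⟨hψ, AEEqFun.coeFn_mk _ hm⟩
  refine ⟨u, ⟨w, ψ, hu⟩, fun v hv => ?_, ⟨w, ψ, g₀, hu, hw0, ?_⟩, ⟨w, ψ, 0, hu, hw1, ?_⟩,
    fun n => ?_⟩
  · obtain ⟨i1, i2⟩ := integrable_helmholtz hΘ hχ w hψ μ₀ (ω ^ 2 * ρ₀) hv
    calc _ = ∫ z, (fnOf w z * (μ₀ * Laplacian.laplacian v z + ω ^ 2 * ρ₀ * v z) +
          χ z * ψ z * (μ₀ * Laplacian.laplacian v z + ω ^ 2 * ρ₀ * v z)) ∂(sectorMeasure Θ) := by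
          refine integral_congr_ae ?_
          filter_upwards [hu.2] with z hz
          rw [hz, add_mul]
      _ = _ := by
          rw [integral_add i1 i2, hw v hv, hres v hv, sub_add_cancel]
  · filter_upwards [hgφ, ae_restrict_mem measurableSet_Ioi] with r hr hr0
    rw [hr, hψφ r hr0]
  · filter_upwards [ae_restrict_mem measurableSet_Ioi] with r hr0
    rw [singSpace_rayPoint_top hΘ₀ hΘ hψ hr0]
    simp
  · rw [farSigma_eq hΘ₀ hΘ (neg_pi_div_mul_neg hΘ₀ n) hχ hu, hσ n]

end FarField

end

theorem mainTheorem7 (Θ : ℝ) (hΘ₀ : 0 < Θ) (hΘ : Θ < 2 * Real.pi)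
    (μ₀ ρ₀ : ℝ) (hμ₀ : 0 < μ₀) (hρ₀ : 0 < ρ₀) (ω : ℂ) (hω : ω.im ≠ 0)
    (χ : ℂ → ℂ) (hχ : FarField.IsCutoff χ)
    (f : StrongDual ℂ (FarField.H1 Θ))
    (g : ℝ → ℂ) (hg : g ∈ FarField.bdryDataSpace Θ χ)
    (s : ℕ+ →₀ ℂ) :
    ∃! u : FarField.FunOn Θ,
      u ∈ FarField.farSpace Θ χ ∧
      FarField.SolvesHelmholtz Θ μ₀ ρ₀ ω f u ∧
      FarField.HasBdryValue Θ χ 0 u g ∧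
      FarField.HasBdryValue Θ χ Θ u 0 ∧
      ∀ n : ℕ+, FarField.farSigma Θ χ (-(Real.pi / Θ) * (n : ℝ)) u = s n := by
  obtain ⟨u, hu, h1, h2, h3, h4⟩ :=
    FarField.exists_solution hΘ₀ hΘ hμ₀ hρ₀ hω hχ f hg s
  refine ⟨u, ⟨hu, h1, h2, h3, h4⟩, fun u' h' => ?_⟩
  obtain ⟨-, h1', h2', h3', h4'⟩ := h'
  exact FarField.solution_unique hΘ₀ hΘ hμ₀ hρ₀ hω hχ h1' h1 h2' h2 h3' h3
    fun n => (h4' n).trans (h4 n).symm
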